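/- Let $g\ge 1$ and $n\ge 0$ be integers and let $\Sigma$ be a surface of genus $g$ with $n$ punctures, that is, a space homeomorphic to the complement of $n$ distinct points in the closed connected orientable surface of genus $g$ (the sphere with $g$ handles). Fix a base point $x_0\in\Sigma$ and let $\rho:\pi_1(\Sigma,x_0)\to \mathrm{SL}_2(\mathbb C)$ be a homomorphism; call such a homomorphism irreducible if its image preserves no linear subspace of $\mathbb C^2$ other than $0$ and $\mathbb C^2$. Then $\rho$ is irreducible if and only if there is a one-holed torus subsurface $\Sigma'\subset\Sigma$ (a subset homeomorphic to the torus $S^1\times S^1$ minus an open disc, i.e. a compact surface of genus one with one boundary curve) such that the restriction $\rho|_{\Sigma'}:\pi_1(\Sigma')\to\mathrm{SL}_2(\mathbb C)$ is irreducible. Here $\rho|_{\Sigma'}$ is the composite $\pi_1(\Sigma',y)\to\pi_1(\Sigma,y)\cong\pi_1(\Sigma,x_0)\xrightarrow{\ \rho\ }\mathrm{SL}_2(\mathbb C)$ for a base point $y\in\Sigma'$ and a path in $\Sigma$ from $x_0$ to $y$; its irreducibility does not depend on these choices. -/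

import Mathlib

open scoped ComplexConjugate

noncomputable section

namespace SurfaceRep

/-! ### Closed surfaces of genus `g`: the sphere with `g` handles -/

/-- The centre of the first of the two unit discs to which the `i`-th handle is attached. -/
def footL {g : ℕ} (i : Fin g) : ℂ := 6 * ((i : ℕ) : ℂ)

/-- The centre of the second of the two unit discs to which the `i`-th handle is attached. -/
def footR {g : ℕ} (i : Fin g) : ℂ := 6 * ((i : ℕ) : ℂ) + 3

/-- The Riemann sphere with `2 * g` open round discs (whose closures are disjoint) removed:
the unit discs centred at `0, 3, 6, 9, …, 6 * g - 3`. -/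
def HoledSphere (g : ℕ) : Set (OnePoint ℂ) :=
  (⋃ i : Fin g, (fun z : ℂ => (z : OnePoint ℂ)) ''
    (Metric.ball (footL i) 1 ∪ Metric.ball (footR i) 1))ᶜ

/-- The two boundary circles that belong to the same handle are glued by the reflection
`footL i + u ↦ footR i - conj u` (`‖u‖ = 1`) that exchanges them. Since a reflection reverses
orientation, the quotient is orientable. -/
inductive HandleGlue (g : ℕ) : HoledSphere g → HoledSphere g → Prop
  | glue (i : Fin g) (u : ℂ) (hu : ‖u‖ = 1) (x y : HoledSphere g)
      (hx : (x : OnePoint ℂ) = ((footL i + u : ℂ) : OnePoint ℂ))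
      (hy : (y : OnePoint ℂ) = ((footR i - conj u : ℂ) : OnePoint ℂ)) : HandleGlue g x y

/-- The closed orientable surface of genus `g`, i.e. the sphere with `g` handles (with the quotient
topology; `Quot` divides by the equivalence relation generated by the gluing). -/
abbrev ClosedSurface (g : ℕ) : Type := Quot (HandleGlue g)

/-- `S` is a surface of genus `g` with `n` punctures: it is homeomorphic to the complement of some
`n` points in the closed orientable surface of genus `g`. -/
def IsSurface (g n : ℕ) (S : Type*) [TopologicalSpace S] : Prop :=
  ∃ F : Finset (ClosedSurface g), F.card = n ∧ Nonempty (S ≃ₜ {x : ClosedSurface g // x ∉ F})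

/-! ### One-holed tori -/

/-- The standard one-holed torus: the torus `S¹ × S¹` minus an open disc. (The product carries the
sup metric, so the disc removed is the open square `{(z, w) | ‖z - 1‖ < 1 ∧ ‖w - 1‖ < 1}`.) -/
def OneHoledTorus : Set (Circle × Circle) := (Metric.ball (1, 1) 1)ᶜ

/-- A subset of a space is a one-holed torus subsurface if, with the subspace topology, it is
homeomorphic to the standard one-holed torus (a compact surface of genus one with one
boundary curve). -/
def IsOneHoledTorus {S : Type*} [TopologicalSpace S] (A : Set S) : Prop :=
  Nonempty (A ≃ₜ OneHoledTorus)

/-! ### Representations -/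

/-- The standard action of `SL₂(ℂ)` on `ℂ²`, by matrix-vector multiplication. -/
def stdRep : Representation ℂ (Matrix.SpecialLinearGroup (Fin 2) ℂ) (Fin 2 → ℂ) where
  toFun A := Matrix.mulVecLin (A : Matrix (Fin 2) (Fin 2) ℂ)
  map_one' := by
    simp only [Matrix.SpecialLinearGroup.coe_one, Matrix.mulVecLin_one]
    rfl
  map_mul' A B := by
    rw [Matrix.SpecialLinearGroup.coe_mul, Matrix.mulVecLin_mul]
    rfl

/-- A homomorphism `ρ : π → SL₂(ℂ)` is irreducible if the action of `π` on `ℂ²` through `ρ`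
preserves no linear subspace other than `0` and `ℂ²`. -/
def IsIrreducible {π : Type*} [Group π] (ρ : π →* Matrix.SpecialLinearGroup (Fin 2) ℂ) : Prop :=
  Representation.IsIrreducible (stdRep.comp ρ : Representation ℂ π (Fin 2 → ℂ))

/-- The restriction of `ρ : π₁(S, x₀) → G` to a subspace `A` of `S`, with base point `y` in `A`: the
composite `π₁(A, y) → π₁(S, y) ≃ π₁(S, x₀) → G`, where the isomorphism is the change of base point
along a path `γ` from `x₀` to `y`. For path-connected `A`, another choice of `y` and `γ` only changes
it by an isomorphism of its domain and a conjugation in the image of `ρ`. -/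
def restrict {S : Type*} [TopologicalSpace S] {x₀ : S} {G : Type*} [Group G]
    (ρ : FundamentalGroup S x₀ →* G) (A : Set S) (y : A) (γ : Path x₀ (y : S)) :
    FundamentalGroup A y →* G :=
  (ρ.comp (FundamentalGroup.fundamentalGroupMulEquivOfPath γ).symm.toMonoidHom).comp
    (FundamentalGroup.map (⟨Subtype.val, continuous_subtype_val⟩ : C(A, S)) y)

end SurfaceRep

end

/-! A line preserved by `ρ` is preserved by every restriction, so the content is the converse: if
`ρ` is reducible on every one-holed torus, then `ρ` is reducible.

Reduction to a model. The orbits of homeomorphisms fixing a finite set are open in its complement,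
and the complements that occur are connected, so any finite set can be moved onto a standard one. It
suffices to treat `StdSurface`, whose holes lie along the real axis and whose punctures are the
points `punct k` on its negative part. The real axis cuts the finite part of the model into two
contractible halves. Hence the holonomy of a path is a word in the symbols `hh`, which depend only
on end points and on the half, and all computations in the fundamental group become bookkeeping of
crossings of the real axis.

Curves. The leaves `leaf k` surround the left end of the first handle together with the first `k`
punctures; the curves `handleCurve j` pass through the handles; the curves `linkCurve j` surround
two neighbouring ends of consecutive handles. A leaf followed by the alternating handle and link
curves is a chain in which consecutive curves meet once. The Dehn twists along these curves are
realized by homeomorphisms and act by the formulas in `IsTwistChain`. The curves generate the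
fundamental group (`ContainsCurves.eq_top`).

Use of the tori. A fixed one-holed torus `T` carries `leaf 0` and `handleCurve 0`
(`exists_oneHoledTorus`). Every homeomorphism `D` gives another one-holed torus `D '' T`. So for
each automorphism `φ` induced by a homeomorphism, the images under `ρ ∘ φ` of these two curves have
a common invariant line.

Algebra (`IsTwistSystem.exists_line`). Products of twists carry an edge of a chain to the next one,
so the images of any two consecutive curves share a line, after any twist. Let `U`, `V`, `W` be the
images of three consecutive curves, where `U`, `V` do not commute and preserve the line `v`. If `W`
moved `v`, the lines shared by `U⁻ᵏV` and `W` would force `U²` to be central; the same argument for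
`UV`, `V` makes `(UV)²` central, and then the eigenvalues make `V` scalar, a contradiction. So one
noncommuting edge spreads its line over the whole system. If all edges commute after all twists, the
images of all curves commute with any noncentral one among them, whose eigenline is then preserved.
In each case `ρ ∘ φ` preserves a line on generators for some automorphism `φ`, and therefore `ρ`
preserves a line. -/

open scoped ComplexConjugate

noncomputable section

namespace SurfaceRep

section Lines

/-! ### Invariant lines of elements of `SL₂(ℂ)` -/

/-- `SL₂(ℂ)`. -/
abbrev SL2 := Matrix.SpecialLinearGroup (Fin 2) ℂ

/-- The underlying matrix. -/
def mat (A : SL2) : Matrix (Fin 2) (Fin 2) ℂ := A.1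

theorem mat_mul (A B : SL2) : mat (A * B) = mat A * mat B := rfl

theorem mat_one : mat 1 = 1 := rfl

theorem mat_injective : Function.Injective mat := Subtype.val_injective

theorem det_mat (A : SL2) : (mat A).det = 1 := A.2

open Matrix in
/-- The stabilizer of the line spanned by `v`. -/
def lineStab (v : Fin 2 → ℂ) : Subgroup SL2 where
  carrier := {A | ∃ c : ℂ, (mat A) *ᵥ v = c • v}
  one_mem' := ⟨1, by simp [mat_one]⟩
  mul_mem' := by
    rintro A B ⟨a, ha⟩ ⟨b, hb⟩
    refine ⟨b * a, ?_⟩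
    rw [mat_mul, ← mulVec_mulVec, hb, mulVec_smul, ha, smul_smul]
  inv_mem' := by
    rintro A ⟨a, ha⟩
    have h1 : (mat (A⁻¹)) *ᵥ ((mat A) *ᵥ v) = v := by
      rw [mulVec_mulVec, ← mat_mul, inv_mul_cancel, mat_one, one_mulVec]
    rw [ha, mulVec_smul] at h1
    by_cases h0 : a = 0
    · rw [h0, zero_smul] at h1
      exact ⟨1, by rw [← h1]; simp⟩
    · exact ⟨a⁻¹, by rw [← h1, smul_smul, inv_mul_cancel₀ h0, one_smul, h1]⟩

/-- The determinant of the pair of vectors `v`, `w`. -/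
def cross (v w : Fin 2 → ℂ) : ℂ := v 0 * w 1 - v 1 * w 0

theorem cross_comm (v w : Fin 2 → ℂ) : cross w v = - cross v w := by unfold cross; ring

theorem eq_smul_of_cross_eq_zero {v w : Fin 2 → ℂ} (hv : v ≠ 0) (h : cross v w = 0) :
    ∃ c : ℂ, w = c • v := by
  unfold cross at h
  by_cases h0 : v 0 = 0
  · have h1 : v 1 ≠ 0 := fun h1 => hv (by ext i; fin_cases i <;> simp [h0, h1])
    have h2 : w 0 = 0 := by simpa [h0, h1] using h
    refine ⟨w 1 / v 1, ?_⟩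
    ext i; fin_cases i
    · simp [h0, h2]
    · simp; field_simp
  · refine ⟨w 0 / v 0, ?_⟩
    ext i; fin_cases i
    · simp; field_simp
    · simp; field_simp; linear_combination h

theorem mem_lineStab_of_parallel {v w : Fin 2 → ℂ} {A : SL2} (hv : v ≠ 0) (h : cross v w = 0)
    (hA : A ∈ lineStab v) : A ∈ lineStab w := by
  obtain ⟨c, rfl⟩ := eq_smul_of_cross_eq_zero hv h
  obtain ⟨a, ha⟩ := hA
  exact ⟨a, by rw [Matrix.mulVec_smul, ha, smul_comm]⟩

theorem mem_lineStab_of_parallel' {v w : Fin 2 → ℂ} {A : SL2} (hw : w ≠ 0) (h : cross v w = 0)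
    (hA : A ∈ lineStab w) : A ∈ lineStab v :=
  mem_lineStab_of_parallel hw (by rw [cross_comm, h, neg_zero]) hA

open Matrix

/-- Cramer's rule. -/
theorem eq_comb {u v : Fin 2 → ℂ} (h : cross u v ≠ 0) (w : Fin 2 → ℂ) :
    w = (cross w v / cross u v) • u + (cross u w / cross u v) • v := by
  ext i
  simp only [Pi.add_apply, Pi.smul_apply, smul_eq_mul]
  field_simp
  fin_cases i <;> simp [cross] <;> ring

/-- Two matrices that agree on two independent vectors are equal. -/
theorem eq_of_mulVec_eq {A B : Matrix (Fin 2) (Fin 2) ℂ} {u v : Fin 2 → ℂ} (h : cross u v ≠ 0)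
    (hu : A *ᵥ u = B *ᵥ u) (hv : A *ᵥ v = B *ᵥ v) : A = B := by
  apply Matrix.toLin'.injective
  ext1 i
  ext1
  simp only [LinearMap.coe_comp, Function.comp, Matrix.toLin'_apply]
  rw [eq_comb h (LinearMap.single ℂ (fun _ => ℂ) i 1)]
  simp [Matrix.mulVec_add, Matrix.mulVec_smul, hu, hv]

theorem cross_mulVec (A : SL2) (u v : Fin 2 → ℂ) : cross ((mat A) *ᵥ u) ((mat A) *ᵥ v) = cross u v := by
  have h := det_mat A
  rw [Matrix.det_fin_two] at h
  simp only [cross, Matrix.mulVec, dotProduct, Fin.sum_univ_two]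
  linear_combination (u 0 * v 1 - u 1 * v 0) * h

/-- `A` preserves the area form `cross`, which it multiplies by `a * b` on the two eigenvectors. -/
theorem eigenvalue_mul {A : SL2} {u v : Fin 2 → ℂ} {a b : ℂ} (h : cross u v ≠ 0)
    (hu : (mat A) *ᵥ u = a • u) (hv : (mat A) *ᵥ v = b • v) : a * b = 1 := by
  have := cross_mulVec A u v
  rw [hu, hv] at this
  have h2 : cross (a • u) (b • v) = a * b * cross u v := by simp [cross]; ring
  rw [h2] at this
  exact mul_right_cancel₀ h (by rw [this, one_mul])

/-- Both matrices are diagonal in the basis `u`, `v`. -/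
theorem commute_of_two_lines {A B : SL2} {u v : Fin 2 → ℂ} (h : cross u v ≠ 0)
    (hAu : A ∈ lineStab u) (hAv : A ∈ lineStab v) (hBu : B ∈ lineStab u) (hBv : B ∈ lineStab v) :
    Commute A B := by
  obtain ⟨a, ha⟩ := hAu
  obtain ⟨a', ha'⟩ := hAv
  obtain ⟨b, hb⟩ := hBu
  obtain ⟨b', hb'⟩ := hBv
  apply mat_injective
  rw [mat_mul, mat_mul]
  apply eq_of_mulVec_eq h
  · rw [← mulVec_mulVec, ← mulVec_mulVec, ha, hb, mulVec_smul, mulVec_smul, ha, hb, smul_comm]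
  · rw [← mulVec_mulVec, ← mulVec_mulVec, ha', hb', mulVec_smul, mulVec_smul, ha', hb', smul_comm]

/-- A scalar matrix commutes with everything. -/
theorem mem_center_of_eq_smul {A : SL2} {c : ℂ} (h : (mat A) = c • (1 : Matrix (Fin 2) (Fin 2) ℂ)) :
    A ∈ Subgroup.center SL2 := by
  rw [Subgroup.mem_center_iff]
  intro B
  apply mat_injective
  rw [mat_mul, mat_mul, h]
  simp

theorem eq_smul_one_of_eigen {A : SL2} {u v : Fin 2 → ℂ} {a : ℂ} (h : cross u v ≠ 0)
    (hu : (mat A) *ᵥ u = a • u) (hv : (mat A) *ᵥ v = a • v) :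
    (mat A) = a • (1 : Matrix (Fin 2) (Fin 2) ℂ) := by
  apply eq_of_mulVec_eq h
  · rw [hu, smul_mulVec, one_mulVec]
  · rw [hv, smul_mulVec, one_mulVec]

/-- The eigenvalues on any two of the lines are inverse to each other, so those on `u` and `w` both
equal the inverse of the one on `v`. Two independent eigenvectors with equal eigenvalues make the
matrix scalar. -/
theorem mem_center_of_three_lines {A : SL2} {u v w : Fin 2 → ℂ} (huv : cross u v ≠ 0)
    (huw : cross u w ≠ 0) (hvw : cross v w ≠ 0) (hu : A ∈ lineStab u) (hv : A ∈ lineStab v)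
    (hw : A ∈ lineStab w) : A ∈ Subgroup.center SL2 := by
  obtain ⟨a, ha⟩ := hu
  obtain ⟨b, hb⟩ := hv
  obtain ⟨c, hc⟩ := hw
  have h1 := eigenvalue_mul huv ha hb
  have h2 := eigenvalue_mul huw ha hc
  have h3 := eigenvalue_mul hvw hb hc
  have hne : b ≠ 0 := by rintro rfl; simp at h1
  have hac : a = c := mul_right_cancel₀ hne (by rw [h1, mul_comm, h3])
  subst hac
  exact mem_center_of_eq_smul (eq_smul_one_of_eigen huw ha hc)

theorem center_eq_smul {A : SL2} (h : A ∈ Subgroup.center SL2) :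
    ∃ c : ℂ, (mat A) = c • (1 : Matrix (Fin 2) (Fin 2) ℂ) := by
  rw [Matrix.SpecialLinearGroup.mem_center_iff] at h
  obtain ⟨r, -, hr⟩ := h
  refine ⟨r, ?_⟩
  rw [smul_one_eq_diagonal]
  exact hr.symm

theorem center_le_lineStab {A : SL2} (h : A ∈ Subgroup.center SL2) (v : Fin 2 → ℂ) :
    A ∈ lineStab v := by
  obtain ⟨c, hc⟩ := center_eq_smul h
  exact ⟨c, by rw [hc, smul_mulVec, one_mulVec]⟩

theorem exists_eigenvector (A : SL2) : ∃ v : Fin 2 → ℂ, v ≠ 0 ∧ A ∈ lineStab v := by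
  obtain ⟨c, hc⟩ := Module.End.exists_eigenvalue (Matrix.toLin' (mat A))
  obtain ⟨v, hv⟩ := hc.exists_hasEigenvector
  exact ⟨v, hv.2, c, by simpa using hv.apply_eq_smul⟩

/-- A matrix that commutes with a noncentral one preserves its eigenlines. -/
theorem mem_lineStab_of_commute {A B : SL2} (hA : A ∉ Subgroup.center SL2) (hAB : Commute A B)
    {v : Fin 2 → ℂ} (hv : v ≠ 0) (h : A ∈ lineStab v) : B ∈ lineStab v := by
  obtain ⟨a, ha⟩ := h
  have h1 : (mat A) *ᵥ ((mat B) *ᵥ v) = a • ((mat B) *ᵥ v) := by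
    rw [mulVec_mulVec, ← mat_mul, hAB.eq, mat_mul,
      ← mulVec_mulVec, ha, mulVec_smul]
  by_cases hc : cross v ((mat B) *ᵥ v) = 0
  · exact eq_smul_of_cross_eq_zero hv hc
  · exact absurd (mem_center_of_eq_smul (eq_smul_one_of_eigen hc ha h1)) hA

/-- The entries of a matrix that commutes with a noncentral `A` are a combination of `A` and `1`. -/
theorem eq_comb_of_commute {A B : SL2} (hA : A ∉ Subgroup.center SL2) (hAB : Commute A B) :
    ∃ s t : ℂ, (mat B) = s • (mat A) + t • (1 : Matrix (Fin 2) (Fin 2) ℂ) := by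
  -- If every vector were an eigenvector, the tests on `e₁`, `e₂` and `e₁ + e₂` would make `A`
  -- scalar. With `u`, `Au` a basis, the expansion of `Bu` determines `B`, because `B` commutes with
  -- `A`.
  have hex : ∃ u, cross u ((mat A) *ᵥ u) ≠ 0 := by
    by_contra! h
    have h1 := h ![1, 0]
    have h2 := h ![0, 1]
    have h3 := h ![1, 1]
    simp [cross, Matrix.mulVec, dotProduct, Fin.sum_univ_two] at h1 h2 h3
    refine hA (mem_center_of_eq_smul (c := (mat A) 0 0) ?_)
    ext i j
    fin_cases i <;> fin_cases j <;> simp [h1, h2]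
    linear_combination h3 - h1 + h2
  obtain ⟨u, hu⟩ := hex
  have hB := eq_comb hu ((mat B) *ᵥ u)
  set s := cross ((mat B) *ᵥ u) ((mat A) *ᵥ u) / cross u ((mat A) *ᵥ u)
  set t := cross u ((mat B) *ᵥ u) / cross u ((mat A) *ᵥ u)
  refine ⟨t, s, eq_of_mulVec_eq hu ?_ ?_⟩
  · rw [hB, add_mulVec, smul_mulVec, smul_mulVec, one_mulVec, add_comm]
  · rw [mulVec_mulVec, ← mat_mul, ← hAB.eq, mat_mul,
      ← mulVec_mulVec, hB, mulVec_add, mulVec_smul, mulVec_smul, add_mulVec, smul_mulVec,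
      smul_mulVec, one_mulVec, add_comm]

/-- The centralizer of a noncentral matrix lies in the span of that matrix and `1`, so it is
abelian. -/
theorem commute_of_commute {A B C : SL2} (hA : A ∉ Subgroup.center SL2) (hAB : Commute A B)
    (hAC : Commute A C) : Commute B C := by
  obtain ⟨s, t, h⟩ := eq_comb_of_commute hA hAB
  obtain ⟨s', t', h'⟩ := eq_comb_of_commute hA hAC
  apply mat_injective
  rw [mat_mul, mat_mul, h, h']
  simp only [add_mul, mul_add, smul_mul_assoc, mul_smul_comm, mul_one, one_mul]
  module

/-- A noncentral matrix with central square has eigenvalues `±i`. -/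
theorem eigenvalue_sq {A : SL2} (hA : A ∉ Subgroup.center SL2)
    (hA2 : A * A ∈ Subgroup.center SL2) {v : Fin 2 → ℂ} (hv : v ≠ 0) {a : ℂ}
    (ha : (mat A) *ᵥ v = a • v) : a * a = -1 := by
  obtain ⟨c, hc⟩ := center_eq_smul hA2
  rw [mat_mul] at hc
  have hdet := det_mat A
  rw [Matrix.det_fin_two] at hdet
  have h00 := congrFun₂ hc 0 0
  have h01 := congrFun₂ hc 0 1
  have h10 := congrFun₂ hc 1 0
  have h11 := congrFun₂ hc 1 1
  simp [Matrix.mul_apply, Fin.sum_univ_two] at h00 h01 h10 h11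
  -- In `A² = c`, the off-diagonal entries of `A` and the difference of its diagonal entries are
  -- killed by the trace. A nonzero trace would make `A` scalar. With trace zero and determinant
  -- one, `c = -1`.
  have htr : (mat A) 0 0 + (mat A) 1 1 = 0 := by
    by_contra htr
    have e01 : (mat A) 0 1 = 0 := by
      have : (mat A) 0 1 * ((mat A) 0 0 + (mat A) 1 1) = 0 := by linear_combination h01
      exact (mul_eq_zero.mp this).resolve_right htr
    have e10 : (mat A) 1 0 = 0 := by
      have : (mat A) 1 0 * ((mat A) 0 0 + (mat A) 1 1) = 0 := by linear_combination h10
      exact (mul_eq_zero.mp this).resolve_right htr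
    have e : (mat A) 0 0 = (mat A) 1 1 := by
      have : ((mat A) 0 0 - (mat A) 1 1) * ((mat A) 0 0 + (mat A) 1 1) = 0 := by linear_combination h00 - h11
      exact sub_eq_zero.mp ((mul_eq_zero.mp this).resolve_right htr)
    refine hA (mem_center_of_eq_smul (c := (mat A) 0 0) ?_)
    ext i j
    fin_cases i <;> fin_cases j <;> simp [e01, e10, e]
  have hcm : c = -1 := by linear_combination -h00 - hdet + (mat A) 0 0 * htr
  have h2 : (a * a) • v = (-1 : ℂ) • v := by
    rw [← hcm, ← smul_smul, ← ha, ← mulVec_smul, ← ha, mulVec_mulVec, hc, smul_mulVec,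
      one_mulVec]
  exact smul_left_injective _ hv h2

end Lines

section TwistChains

/-! ### Chains of curves and the twists along them -/

/-- Two matrices have a common invariant line. -/
def CommonLine (A B : SL2) : Prop := ∃ v : Fin 2 → ℂ, v ≠ 0 ∧ A ∈ lineStab v ∧ B ∈ lineStab v

variable {π : Type*} [Group π]

/-- The elements `y 0, …, y m` behave, under a group `Φ` of automorphisms, like a chain of simple
closed curves, consecutive ones meeting once, on which the Dehn twists along them act. -/
def IsTwistChain (Φ : Subgroup (MulAut π)) (m : ℕ) (y : ℕ → π) : Prop :=
  ∀ i ≤ m, ∃ D ∈ Φ, D (y i) = y i ∧ (i + 1 ≤ m → D (y (i + 1)) = (y i)⁻¹ * y (i + 1)) ∧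
    (∀ j, j + 1 = i → D (y j) = y j * y i) ∧
    (∀ j ≤ m, j + 2 ≤ i ∨ i + 2 ≤ j → D (y j) = y j)

/-- `ρ` has property `P` at the `i`-th edge of `y`, even after a twist. -/
def EdgeProp (Φ : Subgroup (MulAut π)) (P : SL2 → SL2 → Prop) (ρ : π →* SL2) (y : ℕ → π) (i : ℕ) :
    Prop :=
  ∀ φ ∈ Φ, P (ρ (φ (y i))) (ρ (φ (y (i + 1))))

theorem EdgeProp.comp {Φ : Subgroup (MulAut π)} {P : SL2 → SL2 → Prop} {ρ : π →* SL2} {y : ℕ → π}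
    {i : ℕ} (h : EdgeProp Φ P ρ y i) {φ : MulAut π} (hφ : φ ∈ Φ) :
    EdgeProp Φ P (ρ.comp φ.toMonoidHom) y i := fun ψ hψ => h (φ * ψ) (mul_mem hφ hψ)

theorem EdgeProp.self {Φ : Subgroup (MulAut π)} {P : SL2 → SL2 → Prop} {ρ : π →* SL2} {y : ℕ → π}
    {i : ℕ} (h : EdgeProp Φ P ρ y i) : P (ρ (y i)) (ρ (y (i + 1))) := h 1 (one_mem _)

theorem IsTwistChain.tail {Φ : Subgroup (MulAut π)} {m : ℕ} {y : ℕ → π}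
    (h : IsTwistChain Φ (m + 1) y) : IsTwistChain Φ m (fun i => y (i + 1)) := by
  intro i hi
  obtain ⟨D, hD, h0, h1, h2, h3⟩ := h (i + 1) (by omega)
  exact ⟨D, hD, h0, fun h => h1 (by omega), fun j hj => h2 (j + 1) (by omega),
    fun j hj hji => h3 (j + 1) (by omega) (by omega)⟩

theorem IsTwistChain.take {Φ : Subgroup (MulAut π)} {m k : ℕ} {y : ℕ → π}
    (h : IsTwistChain Φ m y) (hk : k ≤ m) : IsTwistChain Φ k y := by
  intro i hi
  obtain ⟨D, hD, h0, h1, h2, h3⟩ := h i (by omega)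
  exact ⟨D, hD, h0, fun h => h1 (by omega), h2, fun j hj hji => h3 j (by omega) hji⟩

theorem inv_apply_eq {D : MulAut π} {x z : π} (h : D z = x) : D⁻¹ x = z := by
  rw [← h]; exact D.symm_apply_apply z

/-- The reversed chain is a chain. -/
theorem IsTwistChain.reverse {Φ : Subgroup (MulAut π)} {m : ℕ} {y : ℕ → π}
    (h : IsTwistChain Φ m y) : IsTwistChain Φ m (fun i => (y (m - i))⁻¹) := by
  intro i hi
  obtain ⟨D, hD, h0, h1, h2, h3⟩ := h (m - i) (by omega)
  have h0' : D⁻¹ (y (m - i)) = y (m - i) := inv_apply_eq h0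
  -- The inverse twist sends `y (k - 1)` to `y (k - 1) * (y k)⁻¹`; after inversion this is the
  -- required form for the reversed chain. The same happens on the other side.
  refine ⟨D⁻¹, inv_mem hD, ?_, fun h => ?_, fun j hj => ?_, fun j hj hji => ?_⟩
  · simp only [map_inv, h0']
  · have := h2 (m - (i + 1)) (by omega)
    simp only [map_inv, inv_inv]
    rw [inv_apply_eq (z := y (m - (i + 1)) * (y (m - i))⁻¹)
      (by rw [map_mul, map_inv, h0, this, mul_inv_cancel_right]), mul_inv_rev, inv_inv]
  · have := h1 (by omega)
    rw [show m - i + 1 = m - j by omega] at this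
    simp only [map_inv]
    rw [inv_apply_eq (z := y (m - i) * y (m - j))
      (by rw [map_mul, h0, this, mul_inv_cancel_left]), mul_inv_rev]
  · simp only [map_inv]
    rw [inv_apply_eq (h3 (m - j) (by omega) (by omega))]

theorem EdgeProp.reverse {Φ : Subgroup (MulAut π)} {P : SL2 → SL2 → Prop}
    (hP : ∀ A B, P A B → P B⁻¹ A⁻¹) {ρ : π →* SL2} {y : ℕ → π} {m : ℕ}
    (h : ∀ i < m, EdgeProp Φ P ρ y i) :
    ∀ i < m, EdgeProp Φ P ρ (fun i => (y (m - i))⁻¹) i := by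
  intro i hi φ hφ
  have := hP _ _ (h (m - i - 1) (by omega) φ hφ)
  rw [show m - i - 1 + 1 = m - i by omega] at this
  simpa [Nat.sub_sub] using this

/-- The first edge of a chain can be moved to any other edge by a product of twists. -/
theorem IsTwistChain.edgeProp {Φ : Subgroup (MulAut π)} {P : SL2 → SL2 → Prop} {m : ℕ} {y : ℕ → π}
    (h : IsTwistChain Φ m y) {ρ : π →* SL2} (h0 : EdgeProp Φ P ρ y 0) :
    ∀ i < m, EdgeProp Φ P ρ y i := by
  intro i
  induction i with
  | zero => exact fun _ => h0
  | succ i ih =>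
    intro hi φ hφ
    obtain ⟨D₀, hD₀, a0, a1, a2, a3⟩ := h i (by omega)
    obtain ⟨D₁, hD₁, b0, b1, b2, b3⟩ := h (i + 1) (by omega)
    obtain ⟨D₂, hD₂, c0, c1, c2, c3⟩ := h (i + 1 + 1) (by omega)
    -- The product of the twists along three consecutive curves carries the first two of them to the
    -- last two. Since the property is assumed for all images of the edge under `Φ`, it passes to
    -- the next edge.
    have key : P (ρ (φ ((D₀ * D₁ * D₂) (y i)))) (ρ (φ ((D₀ * D₁ * D₂) (y (i + 1))))) :=
      ih (by omega) (φ * (D₀ * D₁ * D₂)) (mul_mem hφ (mul_mem (mul_mem hD₀ hD₁) hD₂))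
    have e1 : (D₀ * D₁ * D₂) (y i) = y (i + 1) := by
      rw [MulAut.mul_apply, MulAut.mul_apply, c3 i (by omega) (by omega), b2 i rfl, map_mul, a0,
        a1 (by omega), mul_inv_cancel_left]
    have e2 : (D₀ * D₁ * D₂) (y (i + 1)) = y (i + 1 + 1) := by
      rw [MulAut.mul_apply, MulAut.mul_apply, c2 (i + 1) rfl, map_mul, b0, b1 (by omega),
        mul_inv_cancel_left, a3 _ (by omega) (by omega)]
    rw [e1, e2] at key
    exact key

/-! ### Spreading a common line or commutation along a chain -/

section Noncommuting

variable {Φ : Subgroup (MulAut π)} {y : ℕ → π}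

theorem commute_of_mem_center {A B : SL2} (hA : A ∈ Subgroup.center SL2) : Commute A B :=
  (Subgroup.mem_center_iff.mp hA B).symm

/-- If the third matrix moves the common line of the first two, the first one has order four. -/
theorem sq_mem_center_of_not_mem (h : IsTwistChain Φ 2 y) (ρ : π →* SL2)
    (hred : EdgeProp Φ CommonLine ρ y 1)
    (hnc : ¬ Commute (ρ (y 0)) (ρ (y 1))) {v : Fin 2 → ℂ}
    (h0 : ρ (y 0) ∈ lineStab v) (h1 : ρ (y 1) ∈ lineStab v) (h2 : ρ (y 2) ∉ lineStab v) :
    ρ (y 0) * ρ (y 0) ∈ Subgroup.center SL2 := by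
  obtain ⟨D, hD, d0, d1, -, d3⟩ := h 0 (by omega)
  have d1 := d1 (by omega)
  have d3 := d3 2 le_rfl (by omega)
  simp only [zero_add] at d1
  have e1 : ∀ k : ℕ, (D ^ k) (y 1) = ((y 0) ^ k)⁻¹ * y 1 := by
    intro k
    induction k with
    | zero => simp
    | succ k ih =>
      rw [pow_succ', MulAut.mul_apply, ih, map_mul, map_inv, map_pow, d0, d1, pow_succ']
      group
  have e2 : ∀ k : ℕ, (D ^ k) (y 2) = y 2 := by
    intro k
    induction k with
    | zero => simp
    | succ k ih => rw [pow_succ', MulAut.mul_apply, ih, d3]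
  -- Write `U`, `V`, `W` for the images of `y 0`, `y 1`, `y 2`. The `k`-th power of the twist along
  -- `y 0` turns the edge `(V, W)` into `(U⁻ᵏV, W)`. Its common line `f k` is not that of `v`,
  -- because `W` moves `v`.
  have hf : ∀ k : ℕ, ∃ f : Fin 2 → ℂ, f ≠ 0 ∧ cross v f ≠ 0 ∧
      (ρ (y 0) ^ k)⁻¹ * ρ (y 1) ∈ lineStab f ∧ ρ (y 2) ∈ lineStab f := by
    intro k
    obtain ⟨f, hf, hf1, hf2⟩ := hred (D ^ k) (pow_mem hD k)
    simp only [one_add_one_eq_two] at hf2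
    rw [e1, map_mul, map_inv, map_pow] at hf1
    rw [e2] at hf2
    exact ⟨f, hf, fun hc => h2 (mem_lineStab_of_parallel' hf hc hf2), hf1, hf2⟩
  choose f hf hvf hfV hfW using hf
  -- If `f k` and `f (k + 1)` coincided, `U` and `V` would both preserve this line besides `v` and
  -- so would commute.
  have hdiff : ∀ k, cross (f k) (f (k + 1)) ≠ 0 := by
    intro k hc
    have hk := hfV k
    have hk1 := mem_lineStab_of_parallel' (hf (k + 1)) hc (hfV (k + 1))
    have hU : ρ (y 0) ∈ lineStab (f k) := by
      have := mul_mem hk (inv_mem hk1)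
      rwa [pow_succ', show (ρ (y 0) ^ k)⁻¹ * ρ (y 1) * ((ρ (y 0) * ρ (y 0) ^ k)⁻¹ * ρ (y 1))⁻¹ =
        (ρ (y 0) ^ k)⁻¹ * (ρ (y 0) * ρ (y 0) ^ k) by group, ← pow_succ', pow_succ,
        inv_mul_cancel_left] at this
    have hV : ρ (y 1) ∈ lineStab (f k) := by
      have := mul_mem (pow_mem hU k) hk
      rwa [mul_inv_cancel_left] at this
    exact hnc (commute_of_two_lines (hvf k) h0 hU h1 hV)
  -- If `f k` and `f (k + 2)` coincide, the quotient of the two twisted matrices shows that `U²`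
  -- preserves `f k`. Otherwise `W` preserves three distinct lines, hence is central and preserves
  -- `v`.
  have hsame : ∀ k, ρ (y 0) * ρ (y 0) ∈ lineStab (f k) := by
    intro k
    by_cases hc : cross (f k) (f (k + 2)) = 0
    · have hk := hfV k
      have hk1 := mem_lineStab_of_parallel' (hf (k + 2)) hc (hfV (k + 2))
      have := mul_mem hk (inv_mem hk1)
      rwa [show k + 2 = 2 + k by ring, pow_add,
        show (ρ (y 0) ^ k)⁻¹ * ρ (y 1) * ((ρ (y 0) ^ 2 * ρ (y 0) ^ k)⁻¹ * ρ (y 1))⁻¹ =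
        (ρ (y 0) ^ k)⁻¹ * (ρ (y 0) ^ 2 * ρ (y 0) ^ k) by group, ← pow_add, add_comm, pow_add,
        inv_mul_cancel_left, pow_two] at this
    · exact absurd (center_le_lineStab (mem_center_of_three_lines (hdiff k) hc (hdiff (k + 1))
        (hfW k) (hfW (k + 1)) (hfW (k + 2))) v) h2
  exact mem_center_of_three_lines (hvf 0) (hvf 1) (hdiff 0) (mul_mem h0 h0) (hsame 0) (hsame 1)

/-- In a chain of length three, the common line of two noncommuting matrices at the first edge is
preserved by the third matrix. -/
theorem mem_lineStab_of_chain_two (h : IsTwistChain Φ 2 y) (ρ : π →* SL2)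
    (hred : EdgeProp Φ CommonLine ρ y 1)
    (hnc : ¬ Commute (ρ (y 0)) (ρ (y 1))) {v : Fin 2 → ℂ} (hv : v ≠ 0)
    (h0 : ρ (y 0) ∈ lineStab v) (h1 : ρ (y 1) ∈ lineStab v) : ρ (y 2) ∈ lineStab v := by
  by_contra h2
  have hU := sq_mem_center_of_not_mem h ρ hred hnc h0 h1 h2
  -- The twist along `y 1` turns `(U, V, W)` into `(UV, V, V⁻¹W)`, to which the same lemma applies.
  -- So `(UV)²` is central as well.
  obtain ⟨D, hD, d0, d1, d2, -⟩ := h 1 (by omega)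
  have d1 := d1 (by omega)
  have d2 := d2 0 rfl
  simp only [one_add_one_eq_two] at d1
  have hUV := sq_mem_center_of_not_mem h (ρ.comp D.toMonoidHom) (hred.comp hD) (v := v)
  simp only [MonoidHom.comp_apply, MulEquiv.coe_toMonoidHom, d0, d1, d2, map_mul, map_inv] at hUV
  have hnc' : ¬ Commute (ρ (y 0) * ρ (y 1)) (ρ (y 1)) := fun hc => hnc (by
    simpa using hc.mul_left (Commute.refl (ρ (y 1))).inv_left)
  have hUV := hUV hnc' (mul_mem h0 h1) h1 fun hc => h2 (by simpa using mul_mem h1 hc)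
  obtain ⟨a, ha⟩ := h0
  obtain ⟨b, hb⟩ := h1
  have hUc : ρ (y 0) ∉ Subgroup.center SL2 := fun hc => hnc (commute_of_mem_center hc)
  have hVc : ρ (y 1) ∉ Subgroup.center SL2 := fun hc => hnc (commute_of_mem_center hc).symm
  have hUVc : ρ (y 0) * ρ (y 1) ∉ Subgroup.center SL2 := fun hc => hnc' (commute_of_mem_center hc)
  have ea := eigenvalue_sq hUc hU hv ha
  have eab := eigenvalue_sq hUVc hUV hv (a := b * a) (by
    rw [mat_mul, ← Matrix.mulVec_mulVec, hb, Matrix.mulVec_smul, ha, smul_smul])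
  -- The eigenvalues of `U` and `UV` on `v` both have square `-1`, so `b² = 1`. The line that `V`
  -- shares with `W` is a second eigenline of `V`, with eigenvalue `b⁻¹ = b`. Hence `V` is scalar,
  -- which is impossible.
  have eb : b * b = 1 := by linear_combination -eab + b * b * ea
  obtain ⟨f, hf, hf1, hf2⟩ := hred.self
  have hvf : cross v f ≠ 0 := fun hc => h2 (mem_lineStab_of_parallel' hf hc hf2)
  obtain ⟨c, hc⟩ := hf1
  have ebc := eigenvalue_mul hvf hb hc
  have hbc : c = b := by linear_combination b * ebc - c * eb
  subst hbc
  exact hVc (mem_center_of_eq_smul (eq_smul_one_of_eigen hvf hb hc))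

/-- The common line of two noncommuting matrices at the first edge is preserved along the chain. -/
theorem mem_lineStab_of_chain {v : Fin 2 → ℂ} (hv : v ≠ 0) :
    ∀ (k m : ℕ) (y : ℕ → π), IsTwistChain Φ m y → ∀ ρ : π →* SL2,
      (∀ i < m, EdgeProp Φ CommonLine ρ y i) → ¬ Commute (ρ (y 0)) (ρ (y 1)) →
      ρ (y 0) ∈ lineStab v → ρ (y 1) ∈ lineStab v → k ≤ m → ρ (y k) ∈ lineStab v := by
  intro k
  induction k with
  | zero => exact fun _ _ _ _ _ _ h0 _ _ => h0
  | succ k ih =>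
    intro m y h ρ hred hnc h0 h1 hk
    obtain rfl | hk0 := Nat.eq_zero_or_pos k
    · exact h1
    obtain ⟨m, rfl⟩ : ∃ m', m = m' + 1 := ⟨m - 1, by omega⟩
    have h2 : ∀ ρ : π →* SL2, (∀ i < m + 1, EdgeProp Φ CommonLine ρ y i) →
        ¬ Commute (ρ (y 0)) (ρ (y 1)) → ρ (y 0) ∈ lineStab v → ρ (y 1) ∈ lineStab v →
        ρ (y 2) ∈ lineStab v := fun ρ hred hnc h0 h1 =>
      mem_lineStab_of_chain_two (h.take (by omega)) ρ (hred 1 (by omega)) hnc hv h0 h1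
    obtain rfl | hk1 : k = 1 ∨ 2 ≤ k := by omega
    · exact h2 ρ hred hnc h0 h1
    -- If the next edge does not commute, the induction hypothesis applies to the chain without its
    -- first curve.
    have step1 : ∀ ρ : π →* SL2, (∀ i < m + 1, EdgeProp Φ CommonLine ρ y i) →
        ¬ Commute (ρ (y 1)) (ρ (y 2)) → ρ (y 1) ∈ lineStab v → ρ (y 2) ∈ lineStab v →
        ρ (y (k + 1)) ∈ lineStab v := fun ρ hred hnc h0 h1 =>
      ih m (fun i => y (i + 1)) h.tail ρ (fun i hi => hred (i + 1) (by omega)) hnc h0 h1 (by omega)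
    -- If `W` is noncentral but commutes with `V`, the twist along `y 0` replaces `V` by `U⁻¹V`.
    -- This does not commute with `W`: otherwise `U` and `V` would both lie in the abelian
    -- centralizer of `W`.
    have step2 : ∀ ρ : π →* SL2, (∀ i < m + 1, EdgeProp Φ CommonLine ρ y i) →
        ¬ Commute (ρ (y 0)) (ρ (y 1)) → ρ (y 0) ∈ lineStab v → ρ (y 1) ∈ lineStab v →
        ρ (y 2) ∉ Subgroup.center SL2 → ρ (y (k + 1)) ∈ lineStab v := by
      intro ρ hred hnc h0 h1 hc
      have hW := h2 ρ hred hnc h0 h1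
      by_cases hcomm : Commute (ρ (y 1)) (ρ (y 2))
      · obtain ⟨D, hD, d0, d1, -, d3⟩ := h 0 (by omega)
        have d1 : D (y 1) = (y 0)⁻¹ * y 1 := d1 (by omega)
        have := step1 (ρ.comp D.toMonoidHom) (fun i hi => (hred i hi).comp hD)
        simp only [MonoidHom.comp_apply, MulEquiv.coe_toMonoidHom, d1,
          d3 2 (by omega) (by omega), d3 (k + 1) (by omega) (by omega), map_mul, map_inv] at this
        refine this (fun hcc => ?_) (mul_mem (inv_mem h0) h1) hW
        have hU : Commute (ρ (y 0)) (ρ (y 2)) := by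
          have := (hcc.mul_left hcomm.inv_left).inv_left
          simpa using this
        exact hnc (commute_of_commute hc hU.symm hcomm.symm)
      · exact step1 ρ hred hcomm h1 hW
    -- A central `W` is replaced by the noncentral `V⁻¹W` by the twist along `y 1`.
    by_cases hc : ρ (y 2) ∈ Subgroup.center SL2
    · obtain ⟨D, hD, d0, d1, d2, d3⟩ := h 1 (by omega)
      have d1 : D (y 2) = (y 1)⁻¹ * y 2 := d1 (by omega)
      have d2 := d2 0 rfl
      have := step2 (ρ.comp D.toMonoidHom) (fun i hi => (hred i hi).comp hD)
      simp only [MonoidHom.comp_apply, MulEquiv.coe_toMonoidHom, d0, d1, d2,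
        d3 (k + 1) (by omega) (by omega), map_mul, map_inv] at this
      refine this (fun hc' => hnc ?_) (mul_mem h0 h1) h1 (fun hc' => ?_)
      · simpa using hc'.mul_left (Commute.refl (ρ (y 1))).inv_left
      · have hV : (ρ (y 1))⁻¹ ∈ Subgroup.center SL2 := (Subgroup.mul_mem_cancel_right _ hc).mp hc'
        exact hnc (commute_of_mem_center ((Subgroup.inv_mem_iff _).mp hV)).symm
    · exact step2 ρ hred hnc h0 h1 hc

/-- If all edges commute, everything in the chain commutes with a noncentral first element. -/
theorem commute_of_chain :
    ∀ (k m : ℕ) (y : ℕ → π), IsTwistChain Φ m y → ∀ ρ : π →* SL2,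
      (∀ i < m, EdgeProp Φ Commute ρ y i) → ρ (y 0) ∉ Subgroup.center SL2 → k ≤ m →
      Commute (ρ (y 0)) (ρ (y k)) := by
  intro k
  induction k with
  | zero => exact fun _ _ _ _ _ _ _ => Commute.refl _
  | succ k ih =>
    intro m y h ρ hcomm hc hk
    obtain ⟨m, rfl⟩ : ∃ m', m = m' + 1 := ⟨m - 1, by omega⟩
    have h01 : Commute (ρ (y 0)) (ρ (y 1)) := (hcomm 0 (by omega)).self
    obtain rfl | hk0 := Nat.eq_zero_or_pos k
    · exact h01
    -- If `V` is noncentral, the first and the last matrix both lie in its centralizer, the latter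
    -- by the induction hypothesis.
    have step : ∀ ρ : π →* SL2, (∀ i < m + 1, EdgeProp Φ Commute ρ y i) →
        ρ (y 1) ∉ Subgroup.center SL2 → Commute (ρ (y 0)) (ρ (y (k + 1))) := by
      intro ρ hcomm hc
      have h01 : Commute (ρ (y 0)) (ρ (y 1)) := (hcomm 0 (by omega)).self
      exact commute_of_commute hc h01.symm
        (ih m (fun i => y (i + 1)) h.tail ρ (fun i hi => hcomm (i + 1) (by omega)) hc (by omega))
    -- A central `V` becomes the noncentral `U⁻¹V` under the twist along `y 0`, which fixes `y 0`
    -- and `y (k + 1)`.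
    by_cases hc1 : ρ (y 1) ∈ Subgroup.center SL2
    · obtain ⟨D, hD, d0, d1, -, d3⟩ := h 0 (by omega)
      have d1 : D (y 1) = (y 0)⁻¹ * y 1 := d1 (by omega)
      have := step (ρ.comp D.toMonoidHom) (fun i hi => (hcomm i hi).comp hD)
      simp only [MonoidHom.comp_apply, MulEquiv.coe_toMonoidHom, d0, d1,
        d3 (k + 1) (by omega) (by omega), map_mul, map_inv] at this
      refine this fun hc' => hc ?_
      have hV : (ρ (y 0))⁻¹ ∈ Subgroup.center SL2 := (Subgroup.mul_mem_cancel_right _ hc1).mp hc'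
      exact (Subgroup.inv_mem_iff _).mp hV
    · exact step ρ hcomm hc1

end Noncommuting

end TwistChains

/-! ### Common invariant lines of a whole twist system -/

section TwistSystems

variable {π : Type*} [Group π]

theorem CommonLine.inv {A B : SL2} (h : CommonLine A B) : CommonLine B⁻¹ A⁻¹ := by
  obtain ⟨v, hv, h1, h2⟩ := h
  exact ⟨v, hv, inv_mem h2, inv_mem h1⟩

theorem mem_lineStab_conj (A B : SL2) {v : Fin 2 → ℂ} (h : B ∈ lineStab v) :
    A * B * A⁻¹ ∈ lineStab ((mat A).mulVec v) := by
  obtain ⟨b, hb⟩ := h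
  refine ⟨b, ?_⟩
  rw [Matrix.mulVec_mulVec, ← mat_mul, inv_mul_cancel_right, mat_mul, ← Matrix.mulVec_mulVec, hb,
    Matrix.mulVec_smul]

theorem mat_mulVec_ne_zero (A : SL2) {v : Fin 2 → ℂ} (hv : v ≠ 0) : (mat A).mulVec v ≠ 0 := by
  intro h
  apply hv
  have := congrArg ((mat A⁻¹).mulVec) h
  rwa [Matrix.mulVec_mulVec, ← mat_mul, inv_mul_cancel, mat_one, Matrix.one_mulVec,
    Matrix.mulVec_zero] at this

section Chain

variable {Φ : Subgroup (MulAut π)} {y : ℕ → π} {m : ℕ}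

/-- Starting from a noncommuting edge, the common line is preserved by the whole chain. -/
theorem IsTwistChain.mem_lineStab (h : IsTwistChain Φ m y) {ρ : π →* SL2}
    (hred : ∀ i < m, EdgeProp Φ CommonLine ρ y i) {v : Fin 2 → ℂ} (hv : v ≠ 0) {i : ℕ} (hi : i < m)
    (hnc : ¬ Commute (ρ (y i)) (ρ (y (i + 1)))) (h0 : ρ (y i) ∈ lineStab v)
    (h1 : ρ (y (i + 1)) ∈ lineStab v) {k : ℕ} (hk : k ≤ m) : ρ (y k) ∈ lineStab v := by
  -- Curves after the edge are reached by dropping the `i` curves before it. The curves before it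
  -- are reached by the same argument for the reversed chain.
  have fwd : ∀ (i m : ℕ) (y : ℕ → π), IsTwistChain Φ m y →
      (∀ i < m, EdgeProp Φ CommonLine ρ y i) → i < m → ¬ Commute (ρ (y i)) (ρ (y (i + 1))) →
      ρ (y i) ∈ lineStab v → ρ (y (i + 1)) ∈ lineStab v → ∀ k, i ≤ k → k ≤ m →
      ρ (y k) ∈ lineStab v := by
    intro i
    induction i with
    | zero => exact fun m y h hred _ hnc h0 h1 k _ hk =>
        mem_lineStab_of_chain hv k m y h ρ hred hnc h0 h1 hk
    | succ i ih =>
      intro m y h hred hi hnc h0 h1 k hik hk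
      obtain ⟨m, rfl⟩ : ∃ m', m = m' + 1 := ⟨m - 1, by omega⟩
      have := ih m (fun i => y (i + 1)) h.tail (fun i hi => hred (i + 1) (by omega)) (by omega)
        hnc h0 h1 (k - 1) (by omega) (by omega)
      simpa [show k - 1 + 1 = k by omega] using this
  by_cases hik : i ≤ k
  · exact fwd i m y h hred hi hnc h0 h1 k hik hk
  · have := fwd (m - (i + 1)) m _ h.reverse (EdgeProp.reverse (fun _ _ h => h.inv) hred) (by omega)
    simp only [show m - (m - (i + 1)) = i + 1 by omega,
      show m - (m - (i + 1) + 1) = i by omega, map_inv, inv_mem_iff] at this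
    have := this (fun hc => hnc (by simpa using hc.inv_inv.symm)) h1 h0 (m - k) (by omega)
      (by omega)
    rwa [show m - (m - k) = k by omega] at this

theorem IsTwistChain.commute (h : IsTwistChain Φ m y) {ρ : π →* SL2}
    (hcomm : ∀ i < m, EdgeProp Φ Commute ρ y i) {i : ℕ} (hi : i ≤ m)
    (hc : ρ (y i) ∉ Subgroup.center SL2) {k : ℕ} (hk : k ≤ m) :
    Commute (ρ (y i)) (ρ (y k)) := by
  -- Again later curves are treated by dropping the first ones, earlier curves by reversing the
  -- chain.
  have fwd : ∀ (i m : ℕ) (y : ℕ → π), IsTwistChain Φ m y →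
      (∀ i < m, EdgeProp Φ Commute ρ y i) → i ≤ m → ρ (y i) ∉ Subgroup.center SL2 →
      ∀ k, i ≤ k → k ≤ m → Commute (ρ (y i)) (ρ (y k)) := by
    intro i
    induction i with
    | zero => exact fun m y h hcomm _ hc k _ hk => commute_of_chain k m y h ρ hcomm hc hk
    | succ i ih =>
      intro m y h hcomm hi hc k hik hk
      obtain ⟨m, rfl⟩ : ∃ m', m = m' + 1 := ⟨m - 1, by omega⟩
      have := ih m (fun i => y (i + 1)) h.tail (fun i hi => hcomm (i + 1) (by omega)) (by omega)
        hc (k - 1) (by omega) (by omega)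
      simpa [show k - 1 + 1 = k by omega] using this
  by_cases hik : i ≤ k
  · exact fwd i m y h hcomm hi hc k hik hk
  · have := fwd (m - i) m _ h.reverse
      (EdgeProp.reverse (fun _ _ (h : Commute _ _) => h.inv_inv.symm) hcomm) (by omega)
    simp only [show m - (m - i) = i by omega, map_inv] at this
    have := this (fun h => hc ((Subgroup.inv_mem_iff _).mp h)) (m - k) (by omega) (by omega)
    rw [show m - (m - k) = k by omega] at this
    simpa using this.inv_inv

end Chain

/-- The sequence `a, z 0, z 1, …`. -/
def consSeq (a : π) (z : ℕ → π) : ℕ → π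
  | 0 => a
  | i + 1 => z i

/-- A system of curves that consists of a chain `z` of length `m + 1` and of further curves
`ℓ 0, …, ℓ n` that are pairwise disjoint and meet only `z 0`. -/
structure IsTwistSystem (Φ : Subgroup (MulAut π)) (n m : ℕ) (ℓ z : ℕ → π) : Prop where
  chain : ∀ k ≤ n, IsTwistChain Φ (m + 1) (consSeq (ℓ k) z)
  -- The curves `ℓ i`, `z 0`, `ℓ k` also form a chain. Both leaves are crossed by `z 0` in the same
  -- direction, so the second one has to be conjugated and inverted for the literal formulas: `(ℓ
  -- k)⁻¹ * z 0` then has the form of `z 0` times the third curve.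
  fork : ∀ i k, i < k → k ≤ n →
    IsTwistChain Φ 2 (consSeq (ℓ i) (consSeq (z 0) fun _ => ((z 0)⁻¹ * ℓ k * z 0)⁻¹))

/-- If all images of the edge `ℓ 0`, `z 0` under twists have common invariant lines, then so has
the whole system. -/
theorem IsTwistSystem.exists_line {Φ : Subgroup (MulAut π)} {n m : ℕ} {ℓ z : ℕ → π}
    (h : IsTwistSystem Φ n m ℓ z) (ρ : π →* SL2)
    (hred : ∀ φ ∈ Φ, CommonLine (ρ (φ (ℓ 0))) (ρ (φ (z 0)))) :
    ∃ φ ∈ Φ, ∃ v : Fin 2 → ℂ, v ≠ 0 ∧ (∀ k ≤ n, ρ (φ (ℓ k)) ∈ lineStab v) ∧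
      ∀ i ≤ m, ρ (φ (z i)) ∈ lineStab v := by
  have hfork0 : ∀ k, 0 < k → k ≤ n → ∀ i < 2, EdgeProp Φ CommonLine ρ
      (consSeq (ℓ 0) (consSeq (z 0) fun _ => ((z 0)⁻¹ * ℓ k * z 0)⁻¹)) i := fun k hk hkn =>
    (h.fork 0 k hk hkn).edgeProp hred
  -- The third curve of the fork is a conjugate of `(ℓ k)⁻¹` by `z 0`. A line shared with `z 0` is
  -- therefore also preserved by `ℓ k`.
  have hredk : ∀ k ≤ n, ∀ φ ∈ Φ, CommonLine (ρ (φ (ℓ k))) (ρ (φ (z 0))) := by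
    intro k hk φ hφ
    obtain rfl | hk0 := Nat.eq_zero_or_pos k
    · exact hred φ hφ
    have := hfork0 k hk0 hk 1 (by omega) φ hφ
    simp only [consSeq] at this
    obtain ⟨v, hv, h1, h2⟩ := this
    simp only [map_inv, inv_mem_iff, map_mul] at h2
    refine ⟨v, hv, ?_, h1⟩
    have := mul_mem (mul_mem h1 h2) (inv_mem h1)
    rwa [mul_assoc, mul_assoc, mul_assoc, mul_inv_cancel, mul_one, mul_inv_cancel_left] at this
  have hforkred : ∀ i k, i < k → k ≤ n → ∀ j < 2, EdgeProp Φ CommonLine ρ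
      (consSeq (ℓ i) (consSeq (z 0) fun _ => ((z 0)⁻¹ * ℓ k * z 0)⁻¹)) j := fun i k hik hk =>
    (h.fork i k hik hk).edgeProp (hredk i (by omega))
  have hchred : ∀ k ≤ n, ∀ j < m + 1, EdgeProp Φ CommonLine ρ (consSeq (ℓ k) z) j := fun k hk =>
    (h.chain k hk).edgeProp (hredk k hk)
  -- Either some edge fails to commute after some twist, and its line spreads; or all edges commute
  -- after all twists.
  by_cases hnc : ∃ k ≤ n, ∃ j < m + 1, ¬ EdgeProp Φ Commute ρ (consSeq (ℓ k) z) j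
  · obtain ⟨k, hk, j, hj, hnc⟩ := hnc
    unfold EdgeProp at hnc
    push Not at hnc
    obtain ⟨φ, hφ, hnc⟩ := hnc
    obtain ⟨v, hv, h0, h1⟩ := hchred k hk j hj φ hφ
    have hall := fun i hi => (h.chain k hk).mem_lineStab (ρ := ρ.comp φ.toMonoidHom)
      (fun i hi => (hchred k hk i hi).comp hφ) hv hj hnc h0 h1 (k := i) hi
    refine ⟨φ, hφ, v, hv, fun l hl => ?_, fun i hi => hall (i + 1) (by omega)⟩
    -- If the noncommuting edge contains `ℓ k`, the other leaves are reached through forks. An edge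
    -- inside `z` belongs to the chain of every leaf.
    obtain rfl | j := j
    · obtain rfl | hlk := eq_or_ne l k
      · exact hall 0 (by omega)
      have a0 : ρ (φ (ℓ k)) ∈ lineStab v := h0
      have a1 : ρ (φ (z 0)) ∈ lineStab v := h1
      have hnc' : ¬ Commute (ρ (φ (ℓ k))) (ρ (φ (z 0))) := hnc
      obtain hlk | hlk := lt_or_gt_of_ne hlk
      · have := (h.fork l k hlk hk).mem_lineStab (ρ := ρ.comp φ.toMonoidHom)
          (fun i hi => (hforkred l k hlk hk i hi).comp hφ) hv (i := 1) (by omega) (k := 0)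
        simp only [consSeq, MonoidHom.comp_apply, MulEquiv.coe_toMonoidHom, map_inv, map_mul,
          inv_mem_iff] at this
        refine this (fun hc => hnc' ?_) a1 (mul_mem (mul_mem (inv_mem a1) a0) a1) (by omega)
        have h3 := hc.symm.inv_left
        rw [inv_inv] at h3
        have h4 := ((Commute.refl (ρ (φ (z 0)))).mul_left h3).mul_left
          (Commute.refl (ρ (φ (z 0)))).inv_left
        rwa [mul_assoc, mul_assoc, mul_assoc, mul_inv_cancel, mul_one, mul_inv_cancel_left] at h4
      · have := (h.fork k l hlk hl).mem_lineStab (ρ := ρ.comp φ.toMonoidHom)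
          (fun i hi => (hforkred k l hlk hl i hi).comp hφ) hv (i := 0) (by omega) (k := 2)
        simp only [consSeq, MonoidHom.comp_apply, MulEquiv.coe_toMonoidHom, map_inv, map_mul,
          inv_mem_iff] at this
        have h3 := this hnc' a0 a1 (by omega)
        have := mul_mem (mul_mem a1 h3) (inv_mem a1)
        rwa [mul_assoc, mul_assoc, mul_assoc, mul_inv_cancel, mul_one, mul_inv_cancel_left] at this
    · exact (h.chain l hl).mem_lineStab (ρ := ρ.comp φ.toMonoidHom)
        (fun i hi => (hchred l hl i hi).comp hφ) hv hj hnc h0 h1 (k := 0) (by omega)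
  · push Not at hnc
    have hforkc : ∀ i k, i < k → k ≤ n → ∀ j < 2, EdgeProp Φ Commute ρ
        (consSeq (ℓ i) (consSeq (z 0) fun _ => ((z 0)⁻¹ * ℓ k * z 0)⁻¹)) j := fun i k hik hk =>
      (h.fork i k hik hk).edgeProp (hnc i (by omega) 0 (by omega))
    have hℓz : ∀ k ≤ n, Commute (ρ (ℓ k)) (ρ (z 0)) := fun k hk => (hnc k hk 0 (by omega)).self
    have hconj : ∀ k ≤ n, (ρ (z 0))⁻¹ * ρ (ℓ k) * ρ (z 0) = ρ (ℓ k) := fun k hk => by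
      rw [mul_assoc, (hℓz k hk).eq, inv_mul_cancel_left]
    -- An eigenline of a noncentral matrix that commutes with everything is preserved by everything.
    -- If no curve has a noncentral image, any line will do.
    have key : ∀ A : SL2, A ∉ Subgroup.center SL2 →
        ((∀ k ≤ n, Commute A (ρ (ℓ k))) ∧ ∀ i ≤ m, Commute A (ρ (z i))) →
        ∃ φ ∈ Φ, ∃ v : Fin 2 → ℂ, v ≠ 0 ∧ (∀ k ≤ n, ρ (φ (ℓ k)) ∈ lineStab v) ∧
          ∀ i ≤ m, ρ (φ (z i)) ∈ lineStab v := by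
      rintro A hA ⟨h1, h2⟩
      obtain ⟨v, hv, hAv⟩ := exists_eigenvector A
      exact ⟨1, one_mem _, v, hv, fun k hk => mem_lineStab_of_commute hA (h1 k hk) hv hAv,
        fun i hi => mem_lineStab_of_commute hA (h2 i hi) hv hAv⟩
    by_cases hz : ∃ i ≤ m, ρ (z i) ∉ Subgroup.center SL2
    · obtain ⟨i, hi, hz⟩ := hz
      refine key _ hz ⟨fun k hk => ?_, fun j hj => ?_⟩
      · exact (h.chain k hk).commute (hnc k hk) (i := i + 1) (by omega) hz (k := 0) (by omega)
      · exact (h.chain 0 (by omega)).commute (hnc 0 (by omega)) (i := i + 1) (by omega) hz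
          (k := j + 1) (by omega)
    push Not at hz
    by_cases hl : ∃ k ≤ n, ρ (ℓ k) ∉ Subgroup.center SL2
    · obtain ⟨k, hk, hl⟩ := hl
      refine key _ hl ⟨fun l hln => ?_, fun j hj => ?_⟩
      · obtain hlk | rfl | hlk := lt_trichotomy l k
        · have := (h.fork l k hlk hk).commute (hforkc l k hlk hk) (i := 2) (by omega) (k := 0)
          simp only [consSeq, map_inv, map_mul, hconj k hk] at this
          simpa using (this (fun h => hl ((Subgroup.inv_mem_iff _).mp h)) (by omega)).inv_left
        · exact Commute.refl _
        · have := (h.fork k l hlk hln).commute (hforkc k l hlk hln) (i := 0) (by omega) (k := 2)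
          simp only [consSeq, map_inv, map_mul, hconj l hln] at this
          simpa using (this hl (by omega)).inv_right
      · exact (h.chain k hk).commute (hnc k hk) (i := 0) (by omega) hl (k := j + 1) (by omega)
    · push Not at hl
      exact ⟨1, one_mem _, ![1, 0], fun h => by simpa using congrFun h 0,
        fun k hk => center_le_lineStab (hl k hk) _, fun i hi => center_le_lineStab (hz i hi) _⟩

end TwistSystems

/-! ### Holonomy of paths -/

section Holonomy

open CategoryTheory Topology

variable {X Y : Type*} [TopologicalSpace X] [TopologicalSpace Y] {x₀ : Y}

/-- The class of a path as an arrow of the fundamental groupoid. -/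
def pathClass {a b : Y} (p : Path a b) : FundamentalGroupoid.mk a ⟶ FundamentalGroupoid.mk b :=
  Path.Homotopic.Quotient.mk p

theorem pathClass_trans {a b c : Y} (p : Path a b) (q : Path b c) :
    pathClass (p.trans q) = pathClass p ≫ pathClass q := rfl

theorem pathClass_refl (a : Y) : pathClass (Path.refl a) = 𝟙 _ := rfl

theorem pathClass_symm {a b : Y} (p : Path a b) : pathClass p.symm = Groupoid.inv (pathClass p) :=
  rfl

/-- The element of the fundamental group that belongs to a path, when the end points of paths are
tied to the base point by the paths `τ`. The inverse makes it multiplicative for the convention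
`p * q = q.trans p` for fundamental groups. -/
def hol (τ : ∀ y : Y, Path x₀ y) {a b : Y} (p : Path a b) : FundamentalGroup Y x₀ :=
  pathClass (τ b) ≫ Groupoid.inv (pathClass p) ≫ Groupoid.inv (pathClass (τ a))

variable (τ : ∀ y : Y, Path x₀ y)

theorem hol_trans {a b c : Y} (p : Path a b) (q : Path b c) :
    hol τ (p.trans q) = hol τ p * hol τ q := by
  change _ = hol τ q ≫ hol τ p
  simp [hol, pathClass_trans]

theorem hol_refl (a : Y) : hol τ (Path.refl a) = 1 := by
  change _ = 𝟙 _
  simp [hol, pathClass_refl]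

theorem hol_symm {a b : Y} (p : Path a b) : hol τ p.symm = (hol τ p)⁻¹ := by
  rw [eq_inv_iff_mul_eq_one]
  change hol τ p ≫ hol τ p.symm = 𝟙 _
  simp [hol, pathClass_symm]

theorem hol_homotopic {a b : Y} {p q : Path a b} (h : p.Homotopic q) : hol τ p = hol τ q := by
  have : pathClass p = pathClass q := Path.Homotopic.Quotient.eq.mpr h
  rw [hol, this, hol]

theorem hol_congr {a b a' b' : Y} (p : Path a b) (q : Path a' b') (h : ∀ t, p t = q t) :
    hol τ p = hol τ q := by
  obtain rfl : a = a' := by rw [← p.source, ← q.source, h]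
  obtain rfl : b = b' := by rw [← p.target, ← q.target, h]
  rw [Path.ext (funext h)]

theorem hol_cast {a b a' b' : Y} (p : Path a b) (ha : a' = a) (hb : b' = b) :
    hol τ (p.cast ha hb) = hol τ p := hol_congr τ _ _ fun _ => rfl

theorem hol_loop (hτ : τ x₀ = Path.refl x₀) (p : Path x₀ x₀) :
    hol τ p = FundamentalGroup.fromPath (Path.Homotopic.Quotient.mk p.symm) := by
  simp only [hol, hτ, pathClass_refl]
  rw [Groupoid.inv_eq_inv (𝟙 _), IsIso.inv_id, Category.comp_id, Category.id_comp]
  rfl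

theorem exists_hol_eq (hτ : τ x₀ = Path.refl x₀) (x : FundamentalGroup Y x₀) :
    ∃ p : Path x₀ x₀, hol τ p = x := by
  obtain ⟨p, rfl⟩ := Path.Homotopic.Quotient.mk_surjective x
  exact ⟨p.symm, by rw [hol_loop τ hτ, Path.symm_symm]⟩

theorem hol_tether (hτ : τ x₀ = Path.refl x₀) (a : Y) : hol τ (τ a) = 1 := by
  change _ = 𝟙 _
  simp only [hol, hτ, pathClass_refl]
  simp

section SimplyConnected

variable [SimplyConnectedSpace X]

/-- The holonomy of a path in a simply connected space that is mapped to `Y`. -/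
def holMap (φ : C(X, Y)) (a b : X) : FundamentalGroup Y x₀ :=
  hol τ ((PathConnectedSpace.somePath a b).map φ.continuous)

/-- All paths from `a` to `b` are homotopic before they are mapped, so the chosen path may be
replaced by any other. This allows holonomies to be computed in the plane, in the halves or in a
chart. -/
theorem holMap_eq (φ : C(X, Y)) {a b : X} (p : Path a b) :
    hol τ (p.map φ.continuous) = holMap τ φ a b :=
  hol_homotopic τ ((SimplyConnectedSpace.paths_homotopic p _).map φ)

theorem hol_eq_holMap (φ : C(X, Y)) {a b : X} (p : Path a b) {c d : Y} (q : Path c d)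
    (h : ∀ t, φ (p t) = q t) : hol τ q = holMap τ φ a b := by
  rw [← holMap_eq τ φ p]
  exact hol_congr τ _ _ fun t => (h t).symm

theorem holMap_mul (φ : C(X, Y)) (a b c : X) :
    holMap τ φ a b * holMap τ φ b c = holMap τ φ a c := by
  rw [holMap, holMap, ← hol_trans, ← Path.map_trans, holMap_eq]

theorem holMap_self (φ : C(X, Y)) (a : X) : holMap τ φ a a = 1 := by
  rw [← holMap_eq τ φ (Path.refl a), ← hol_refl τ (φ a)]
  exact hol_congr τ _ _ fun t => rfl

theorem holMap_inv (φ : C(X, Y)) (a b : X) : (holMap τ φ a b)⁻¹ = holMap τ φ b a := by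
  rw [inv_eq_iff_mul_eq_one, holMap_mul, holMap_self]

theorem holMap_comp {Z : Type*} [TopologicalSpace Z] [SimplyConnectedSpace Z] (φ : C(X, Y))
    (ψ : C(Z, X)) (a b : Z) : holMap τ (φ.comp ψ) a b = holMap τ φ (ψ a) (ψ b) := by
  rw [← holMap_eq τ φ ((PathConnectedSpace.somePath a b).map ψ.continuous)]
  exact hol_congr τ _ _ fun t => rfl

/-- Two paths in (possibly different) simply connected spaces with the same image. -/
theorem holMap_congr {Z : Type*} [TopologicalSpace Z] [SimplyConnectedSpace Z] (φ : C(X, Y))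
    (ψ : C(Z, Y)) {a b : X} {c d : Z} (p : Path a b) (q : Path c d) (h : ∀ t, φ (p t) = ψ (q t)) :
    holMap τ φ a b = holMap τ ψ c d := by
  rw [← holMap_eq τ φ p, ← holMap_eq τ ψ q]
  exact hol_congr τ _ _ h

end SimplyConnected

/-- The path `t ↦ t` in `ℝ`. -/
def realPath : Path (0 : ℝ) 1 := ⟨⟨fun t => (t : ℝ), by fun_prop⟩, rfl, rfl⟩

/-- A path becomes a map from the simply connected space `ℝ`, so it can be cut at arbitrary times by
`holMap_mul`. -/
theorem hol_eq_extend {a b : Y} (p : Path a b) : hol τ p = holMap τ p.extend 0 1 :=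
  hol_eq_holMap τ _ realPath _ fun t => p.extend_extends' t

/-- The straight path in `ℝ`. -/
def segPath (s t : ℝ) : Path s t :=
  ⟨⟨fun r => (1 - r : ℝ) * s + r * t, by fun_prop⟩, by simp, by simp⟩

theorem segPath_mem {s t : ℝ} {I : Set ℝ} (hI : Convex ℝ I) (hs : s ∈ I) (ht : t ∈ I)
    (r : unitInterval) : segPath s t r ∈ I :=
  hI hs ht (sub_nonneg.mpr r.2.2) r.2.1 (by ring)

/-- A relation that holds locally along paths holds for all paths. -/
theorem hol_mem_of_local (K : Subgroup (FundamentalGroup Y x₀)) (g : Y → FundamentalGroup Y x₀)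
    (h : ∀ y, ∃ N ∈ 𝓝 y, ∀ b (p : Path y b), (∀ t, p t ∈ N) → g y * hol τ p * (g b)⁻¹ ∈ K)
    {a b : Y} (p : Path a b) : g a * hol τ p * (g b)⁻¹ ∈ K := by
  -- The condition between two times on the extended path is symmetric and transitive and holds for
  -- nearby times. By connectedness of `ℝ` it holds for `0` and `1`.
  have key := isPreconnected_univ.induction₂
    (fun s t : ℝ => g (p.extend s) * holMap τ p.extend s t * (g (p.extend t))⁻¹ ∈ K) ?_ ?_ ?_
    (Set.mem_univ 0) (Set.mem_univ 1)
  · rw [hol_eq_extend]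
    simpa using key
  · intro s _
    rw [nhdsWithin_univ]
    obtain ⟨N, hN, hNp⟩ := h (p.extend s)
    obtain ⟨ε, hε, hsub⟩ := Metric.mem_nhds_iff.mp (p.extend.continuous.continuousAt hN)
    filter_upwards [Metric.ball_mem_nhds s hε] with t ht
    rw [← holMap_eq τ p.extend (segPath s t)]
    exact hNp _ _ fun r => hsub (segPath_mem (convex_ball s ε) (Metric.mem_ball_self hε) ht r)
  · intro r s t _ _ _ h1 h2
    have := mul_mem h1 h2
    rw [← holMap_mul τ _ r s t]
    convert this using 1
    group
  · intro s t _ _ h1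
    have := inv_mem h1
    rw [← holMap_inv]
    convert this using 1
    group

/-- Local criterion for a subgroup to be the whole fundamental group. -/
theorem eq_top_of_local (hτ : τ x₀ = Path.refl x₀) (K : Subgroup (FundamentalGroup Y x₀))
    (g : Y → FundamentalGroup Y x₀) (h₀ : g x₀ ∈ K)
    (h : ∀ y, ∃ N ∈ 𝓝 y, ∀ b (p : Path y b), (∀ t, p t ∈ N) → g y * hol τ p * (g b)⁻¹ ∈ K) :
    K = ⊤ := by
  rw [eq_top_iff]
  intro x _
  obtain ⟨p, rfl⟩ := exists_hol_eq τ hτ x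
  have := hol_mem_of_local τ K g h p
  rwa [K.mul_mem_cancel_right (inv_mem h₀), K.mul_mem_cancel_left h₀] at this

/-! ### Automorphisms induced by homeomorphisms -/

/-- The automorphism `φ` of the fundamental group is induced by the homeomorphism `D`. -/
def IsInduced (φ : MulAut (FundamentalGroup Y x₀)) (D : Y ≃ₜ Y) : Prop :=
  D x₀ = x₀ ∧ ∀ p : Path x₀ x₀, φ (hol τ p) = hol τ (p.map D.continuous)

variable {τ}

theorem IsInduced.mul {φ ψ : MulAut (FundamentalGroup Y x₀)} {D E : Y ≃ₜ Y}
    (hφ : IsInduced τ φ D) (hψ : IsInduced τ ψ E) : IsInduced τ (φ * ψ) (E.trans D) := by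
  refine ⟨by simp [hφ.1, hψ.1], fun p => ?_⟩
  rw [MulAut.mul_apply, hψ.2]
  have := hφ.2 ((p.map E.continuous).cast hψ.1.symm hψ.1.symm)
  rw [hol_cast] at this
  rw [this]
  exact hol_congr τ _ _ fun t => rfl

theorem IsInduced.inv {φ : MulAut (FundamentalGroup Y x₀)} {D : Y ≃ₜ Y}
    (hφ : IsInduced τ φ D) : IsInduced τ φ⁻¹ D.symm := by
  have h0 : D.symm x₀ = x₀ := by rw [Homeomorph.symm_apply_eq, hφ.1]
  refine ⟨h0, fun p => inv_apply_eq ?_⟩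
  have := hφ.2 ((p.map D.symm.continuous).cast h0.symm h0.symm)
  rw [hol_cast] at this
  rw [this]
  exact hol_congr τ _ _ fun t => by simp

variable (τ) in
/-- The automorphisms induced by homeomorphisms that fix the base point. -/
def inducedAut : Subgroup (MulAut (FundamentalGroup Y x₀)) where
  carrier := {φ | ∃ D : Y ≃ₜ Y, IsInduced τ φ D}
  one_mem' := ⟨Homeomorph.refl Y, rfl, fun p => hol_congr τ _ _ fun _ => rfl⟩
  mul_mem' := by
    rintro φ ψ ⟨D, hD⟩ ⟨E, hE⟩
    exact ⟨_, hD.mul hE⟩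
  inv_mem' := by
    rintro φ ⟨D, hD⟩
    exact ⟨_, hD.inv⟩

theorem mapOfEq_hol (hτ : τ x₀ = Path.refl x₀) (f : C(Y, Y)) (hf : f x₀ = x₀) (p : Path x₀ x₀) :
    FundamentalGroup.mapOfEq f hf (hol τ p) = hol τ (p.map f.continuous) := by
  rw [FundamentalGroup.mapOfEq_apply, hol_congr τ (p.map f.continuous)
    ((p.map f.continuous).cast hf.symm hf.symm) (fun _ => rfl), hol_loop τ hτ, hol_loop τ hτ]
  rfl

theorem exists_isInduced (hτ : τ x₀ = Path.refl x₀) (D : Y ≃ₜ Y) (hD : D x₀ = x₀) :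
    ∃ φ : MulAut (FundamentalGroup Y x₀), IsInduced τ φ D := by
  have hD' : D.symm x₀ = x₀ := by rw [Homeomorph.symm_apply_eq, hD]
  let F := FundamentalGroup.mapOfEq (D : C(Y, Y)) hD
  let G := FundamentalGroup.mapOfEq (D.symm : C(Y, Y)) hD'
  have h1 : ∀ x, G (F x) = x := by
    intro x
    obtain ⟨p, rfl⟩ := exists_hol_eq τ hτ x
    have := mapOfEq_hol hτ (D.symm : C(Y, Y)) hD'
      ((p.map D.continuous).cast hD.symm hD.symm)
    rw [hol_cast] at this
    simp only [F, G]
    rw [mapOfEq_hol hτ]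
    refine Eq.trans this (hol_congr τ _ _ fun t => ?_)
    simp
  have h2 : ∀ x, F (G x) = x := by
    intro x
    obtain ⟨p, rfl⟩ := exists_hol_eq τ hτ x
    have := mapOfEq_hol hτ (D : C(Y, Y)) hD
      ((p.map D.symm.continuous).cast hD'.symm hD'.symm)
    rw [hol_cast] at this
    simp only [F, G]
    rw [mapOfEq_hol hτ]
    refine Eq.trans this (hol_congr τ _ _ fun t => ?_)
    simp
  exact ⟨{ F with invFun := G, left_inv := h1, right_inv := h2 }, hD, mapOfEq_hol hτ _ hD⟩

/-- The factor `μ a` is the holonomy of the image under `D` of the tether of `a`. Closing up `p` by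
the tethers of its end points reduces the formula to loops. -/
theorem IsInduced.exists_apply (hτ : τ x₀ = Path.refl x₀) {φ : MulAut (FundamentalGroup Y x₀)}
    {D : Y ≃ₜ Y} (h : IsInduced τ φ D) : ∃ μ : Y → FundamentalGroup Y x₀, μ x₀ = 1 ∧
      ∀ (a b : Y) (p : Path a b), φ (hol τ p) = μ a * hol τ (p.map D.continuous) * (μ b)⁻¹ := by
  refine ⟨fun a => hol τ ((τ a).map D.continuous), ?_, fun a b p => ?_⟩
  · simp only
    rw [hτ, ← hol_refl τ (D x₀)]
    exact hol_congr τ _ _ fun _ => rfl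
  · have := h.2 ((τ a).trans (p.trans (τ b).symm))
    rw [Path.map_trans, Path.map_trans, ← Path.map_symm] at this
    simp only [hol_trans, hol_symm, hol_tether τ hτ] at this
    rw [one_mul, inv_one, mul_one] at this
    rw [this, mul_assoc]

end Holonomy

/-! ### Homeomorphisms supported in an embedded compact set -/

section Extend

open Topology Set

variable {K Y : Type*} [TopologicalSpace K] [TopologicalSpace Y] [CompactSpace K] [T2Space Y]

/-- The range of `κ` and the complement of the open set `κ '' O` are closed and cover `Y`. On the
first set the map is `h` conjugated by the closed embedding `κ`, on the second it is the identity.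
-/
theorem exists_continuous_extension {κ : K → Y} (hκ : Continuous κ) (hinj : Function.Injective κ)
    {O : Set K} (hO : IsOpen (κ '' O)) {h : K → K} (hh : Continuous h) (hB : ∀ k ∉ O, h k = k) :
    ∃ f : Y → Y, Continuous f ∧ (∀ k, f (κ k) = κ (h k)) ∧ ∀ y ∉ κ '' O, f y = y := by
  classical
  have hce : IsClosedEmbedding κ := hκ.isClosedEmbedding hinj
  let f : Y → Y := fun y => if hy : ∃ k, κ k = y then κ (h hy.choose) else y
  have hf : ∀ k, f (κ k) = κ (h k) := by
    intro k
    have hy : ∃ k', κ k' = κ k := ⟨k, rfl⟩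
    simp only [f, dif_pos hy]
    rw [hinj hy.choose_spec]
  have hf' : ∀ y ∉ κ '' O, f y = y := by
    intro y hy
    by_cases hk : ∃ k, κ k = y
    · obtain ⟨k, rfl⟩ := hk
      rw [hf, hB k fun hk => hy ⟨k, hk, rfl⟩]
    · simp only [f, dif_neg hk]
  refine ⟨f, ?_, hf, hf'⟩
  have hcov : range κ ∪ (κ '' O)ᶜ = univ := by
    refine eq_univ_of_forall fun y => ?_
    by_cases hy : y ∈ range κ
    · exact Or.inl hy
    · exact Or.inr fun ⟨k, _, hk⟩ => hy ⟨k, hk⟩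
  rw [← continuousOn_univ, ← hcov]
  · refine ContinuousOn.union_of_isClosed ?_ ?_ hce.isClosed_range hO.isClosed_compl
    · rw [continuousOn_iff_continuous_domRestrict]
      let e := hce.isEmbedding.toHomeomorph
      have : (range κ).domRestrict f = κ ∘ h ∘ e.symm := by
        ext ⟨y, k, rfl⟩
        have : e.symm ⟨κ k, k, rfl⟩ = k := by
          rw [Homeomorph.symm_apply_eq]; rfl
        simp only [domRestrict_apply, hf, Function.comp, this]
      rw [this]
      exact hκ.comp (hh.comp e.symm.continuous)
    · exact continuousOn_id.congr fun y hy => hf' y hy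

/-- A homeomorphism of an embedded compact set that is the identity off an open part extends by the
identity. -/
theorem exists_homeomorph_extension {κ : K → Y} (hκ : Continuous κ) (hinj : Function.Injective κ)
    {O : Set K} (hO : IsOpen (κ '' O)) (h : K ≃ₜ K) (hB : ∀ k ∉ O, h k = k) :
    ∃ D : Y ≃ₜ Y, (∀ k, D (κ k) = κ (h k)) ∧ ∀ y ∉ κ '' O, D y = y := by
  have hB' : ∀ k ∉ O, h.symm k = k := fun k hk => by rw [Homeomorph.symm_apply_eq, hB k hk]
  obtain ⟨f, hfc, hf, hf'⟩ := exists_continuous_extension hκ hinj hO h.continuous hB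
  obtain ⟨e, hec, he, he'⟩ := exists_continuous_extension hκ hinj hO h.symm.continuous hB'
  refine ⟨⟨⟨f, e, fun y => ?_, fun y => ?_⟩, hfc, hec⟩, hf, hf'⟩
  · by_cases hy : y ∈ range κ
    · obtain ⟨k, rfl⟩ := hy
      rw [hf, he, h.symm_apply_apply]
    · have : y ∉ κ '' O := fun ⟨k, _, hk⟩ => hy ⟨k, hk⟩
      rw [hf' y this, he' y this]
  · by_cases hy : y ∈ range κ
    · obtain ⟨k, rfl⟩ := hy
      rw [he, hf, h.apply_symm_apply]
    · have : y ∉ κ '' O := fun ⟨k, _, hk⟩ => hy ⟨k, hk⟩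
      rw [he' y this, hf' y this]

end Extend

/-! ### Dehn twists -/

section Twist

open Topology Set

variable {Y : Type*} [TopologicalSpace Y]

/-- The standard closed annulus. -/
abbrev Annulus := UnitAddCircle × unitInterval

/-- The interior of the annulus. -/
def openAnnulus : Set Annulus := {k | 0 < (k.2 : ℝ) ∧ (k.2 : ℝ) < 1}

/-- The twist of the standard annulus. -/
def annulusTwist : Annulus ≃ₜ Annulus where
  toFun k := (k.1 + ((k.2 : ℝ) : UnitAddCircle), k.2)
  invFun k := (k.1 - ((k.2 : ℝ) : UnitAddCircle), k.2)
  left_inv k := by simp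
  right_inv k := by simp
  continuous_toFun := by
    have : Continuous fun k : Annulus => ((k.2 : ℝ) : UnitAddCircle) :=
      (AddCircle.continuous_mk' 1).comp (by fun_prop)
    fun_prop
  continuous_invFun := by
    have : Continuous fun k : Annulus => ((k.2 : ℝ) : UnitAddCircle) :=
      (AddCircle.continuous_mk' 1).comp (by fun_prop)
    fun_prop

/-- The standard twist rotates the circle at height `t` by the angle `t`, which is trivial for `t =
0` and `t = 1`. So it extends by the identity. -/
theorem exists_twist [T2Space Y] {κ : Annulus → Y} (hκ : Continuous κ) (hinj : Function.Injective κ)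
    (hO : IsOpen (κ '' openAnnulus)) :
    ∃ D : Y ≃ₜ Y, (∀ k, D (κ k) = κ (annulusTwist k)) ∧ ∀ y ∉ κ '' openAnnulus, D y = y := by
  refine exists_homeomorph_extension hκ hinj hO annulusTwist fun k hk => ?_
  obtain ⟨x, t, ht⟩ := k
  have ht' : t = 0 ∨ t = 1 := by
    simp only [openAnnulus, mem_ofPred_eq, not_and, not_lt] at hk
    rcases ht.1.eq_or_lt with h | h
    · exact Or.inl h.symm
    · exact Or.inr (le_antisymm ht.2 (hk h))
  rcases ht' with rfl | rfl
  · simp [annulusTwist]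
  · simp [annulusTwist]

theorem annulusTwist_apply (x : UnitAddCircle) (t : unitInterval) :
    annulusTwist (x, t) = (x + ((t : ℝ) : UnitAddCircle), t) := rfl

variable {x₀ : Y} (τ : ∀ y : Y, Path x₀ y)

/-- The circle `s ↦ (s, t)` on the annulus, pulled back to the line. -/
def coreMap {κ : Annulus → Y} (hκ : Continuous κ) (t : unitInterval) : C(ℝ, Y) :=
  ⟨fun s => κ ((s : UnitAddCircle), t), hκ.comp (Continuous.prodMk (AddCircle.continuous_mk' (1 : ℝ)) continuous_const)⟩

/-- The arc `t ↦ (s, t)` of the annulus. -/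
def crossMap {κ : Annulus → Y} (hκ : Continuous κ) (s : UnitAddCircle) : C(ℝ, Y) :=
  ⟨fun t => κ (s, Set.projIcc 0 1 zero_le_one t), hκ.comp (by fun_prop)⟩

/-- The effect of a twist on an arc that crosses the annulus. -/
theorem holMap_twist_crossMap {κ : Annulus → Y} (hκ : Continuous κ) (D : C(Y, Y))
    (hD : ∀ k, D (κ k) = κ (annulusTwist k)) (s : ℝ) :
    holMap τ (D.comp (crossMap hκ (s : UnitAddCircle))) 0 1 =
      holMap τ (coreMap hκ 0) s (s + 1) * holMap τ (crossMap hκ (s : UnitAddCircle)) 0 1 := by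
  -- The annulus is unrolled to the simply connected plane, with heights clamped to the unit
  -- interval. The twisted arc lifts to the diagonal from `(s, 0)` to `(s + 1, 1)`, which is
  -- homotopic to the bottom edge, a full turn, followed by a vertical edge.
  let G : C(ℝ × ℝ, Y) := ⟨fun p => κ ((p.1 : UnitAddCircle), Set.projIcc 0 1 zero_le_one p.2),
    hκ.comp (Continuous.prodMk ((AddCircle.continuous_mk' 1).comp continuous_fst) (by fun_prop))⟩
  have h1 : holMap τ (coreMap hκ 0) s (s + 1) = holMap τ G (s, 0) (s + 1, 0) := by
    refine Eq.trans ?_ (holMap_comp τ G (⟨fun s => (s, 0), by fun_prop⟩ : C(ℝ, ℝ × ℝ)) s (s + 1))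
    congr 1
    ext t
    simp only [coreMap, ContinuousMap.coe_mk, ContinuousMap.comp_apply, G]
    rw [Set.projIcc_left]
    rfl
  have h2 : holMap τ (crossMap hκ (s : UnitAddCircle)) 0 1 = holMap τ G (s + 1, 0) (s + 1, 1) := by
    refine Eq.trans ?_ (holMap_comp τ G (⟨fun t => (s + 1, t), by fun_prop⟩ : C(ℝ, ℝ × ℝ)) 0 1)
    congr 1
    ext t
    simp [crossMap, G]
  rw [h1, h2, holMap_mul]
  refine (holMap_congr τ _ _ realPath
    (⟨⟨fun t => (s + t, t), by fun_prop⟩, by simp, by simp⟩ : Path ((s, 0) : ℝ × ℝ) (s + 1, 1))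
    fun t => ?_)
  simp only [ContinuousMap.comp_apply, crossMap, ContinuousMap.coe_mk, hD, G, realPath,
    Path.coe_mk', annulusTwist_apply]
  rw [Set.projIcc_of_mem zero_le_one t.2]
  simp

end Twist

/-! ### The topology of closed surfaces -/

section ClosedSurface

open Topology Set

variable {g : ℕ}

/-- The finite part of the holed sphere. -/
def Plane (g : ℕ) : Set ℂ :=
  {z | ∀ j < g, 1 ≤ ‖z - 6 * (j : ℂ)‖ ∧ 1 ≤ ‖z - (6 * (j : ℂ) + 3)‖}

theorem coe_mem_holedSphere {z : ℂ} : (z : OnePoint ℂ) ∈ HoledSphere g ↔ z ∈ Plane g := by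
  simp only [HoledSphere, mem_compl_iff, mem_iUnion, not_exists, mem_image, mem_union,
    Metric.mem_ball, dist_eq_norm, footL, footR, Plane, not_and, OnePoint.coe_eq_coe]
  constructor
  · intro h j hj
    have := h ⟨j, hj⟩
    refine ⟨?_, ?_⟩ <;> by_contra hlt
    · exact this z (Or.inl (not_le.mp hlt)) rfl
    · exact this z (Or.inr (not_le.mp hlt)) rfl
  · rintro h i w hw rfl
    have := h i i.2
    rcases hw with hw | hw <;> linarith

theorem infty_mem_holedSphere : (OnePoint.infty : OnePoint ℂ) ∈ HoledSphere g := by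
  simp [HoledSphere]

/-- The inclusion of the finite part in the holed sphere. -/
def toHoled (z : Plane g) : HoledSphere g := ⟨((z : ℂ) : OnePoint ℂ), coe_mem_holedSphere.mpr z.2⟩

theorem continuous_toHoled : Continuous (toHoled (g := g)) :=
  Continuous.subtype_mk (OnePoint.continuous_coe.comp continuous_subtype_val) _

/-- The projection of the finite part of the holed sphere to the closed surface. -/
def pt (z : Plane g) : ClosedSurface g := Quot.mk _ (toHoled z)

theorem isClosed_holedSphere : IsClosed (HoledSphere g) := by
  rw [HoledSphere, isClosed_compl_iff]
  refine isOpen_iUnion fun i => ?_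
  exact OnePoint.isOpenEmbedding_coe.isOpenMap _ (Metric.isOpen_ball.union Metric.isOpen_ball)

instance : CompactSpace (HoledSphere g) :=
  isCompact_iff_compactSpace.mp isClosed_holedSphere.isCompact

theorem foot_cases {i j : ℕ} {u v : ℂ} (hu : ‖u‖ < 3 / 2) (hv : ‖v‖ < 3 / 2)
    (h : 6 * (i : ℂ) + u = 6 * (j : ℂ) + v) : i = j ∧ u = v := by
  have hre : 6 * (i : ℝ) + u.re = 6 * (j : ℝ) + v.re := by simpa using congrArg Complex.re h
  have h1 := abs_lt.mp ((Complex.abs_re_le_norm u).trans_lt hu)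
  have h2 := abs_lt.mp ((Complex.abs_re_le_norm v).trans_lt hv)
  have hij : i = j := by
    rcases lt_trichotomy i j with hlt | heq | hlt
    · have : (i : ℝ) + 1 ≤ j := by exact_mod_cast hlt
      linarith
    · exact heq
    · have : (j : ℝ) + 1 ≤ i := by exact_mod_cast hlt
      linarith
  subst hij
  exact ⟨rfl, add_left_cancel h⟩

/-- Left and right feet are at distance at least `3`, too far to be bridged by two vectors shorter
than `3 / 2`. -/
theorem foot_ne {i j : ℕ} {u v : ℂ} (hu : ‖u‖ < 3 / 2) (hv : ‖v‖ < 3 / 2) :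
    6 * (i : ℂ) + u ≠ 6 * (j : ℂ) + 3 - v := by
  intro h
  have hre : 6 * (i : ℝ) + u.re = 6 * (j : ℝ) + 3 - v.re := by simpa using congrArg Complex.re h
  have h1 := abs_lt.mp ((Complex.abs_re_le_norm u).trans_lt hu)
  have h2 := abs_lt.mp ((Complex.abs_re_le_norm v).trans_lt hv)
  rcases lt_or_ge j i with hlt | hle
  · have : (j : ℝ) + 1 ≤ i := by exact_mod_cast hlt
    linarith
  · have : (i : ℝ) ≤ j := by exact_mod_cast hle
    linarith

theorem HandleGlue.trans_symm {x y z : HoledSphere g} (h : HandleGlue g x y)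
    (h' : HandleGlue g z y) : x = z := by
  obtain ⟨i, u, hu, _, _, hx, hy⟩ := h
  obtain ⟨j, v, hv, _, _, hx', hy'⟩ := h'
  rw [hy] at hy'
  have := OnePoint.coe_injective hy'
  simp only [footR] at this
  have h2 : 6 * ((i : ℕ) : ℂ) + -conj u = 6 * ((j : ℕ) : ℂ) + -conj v := by
    linear_combination this
  obtain ⟨h3, h4⟩ := foot_cases (by simp only [norm_neg, RCLike.norm_conj]; linarith)
    (by simp only [norm_neg, RCLike.norm_conj]; linarith) h2
  have h5 : u = v := by simpa using congrArg conj (neg_injective h4)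
  rw [Subtype.ext_iff, hx, hx', Fin.ext h3, h5]

theorem HandleGlue.symm_trans {x y z : HoledSphere g} (h : HandleGlue g x y)
    (h' : HandleGlue g x z) : y = z := by
  obtain ⟨i, u, hu, _, _, hx, hy⟩ := h
  obtain ⟨j, v, hv, _, _, hx', hy'⟩ := h'
  rw [hx] at hx'
  obtain ⟨h3, h4⟩ := foot_cases (by linarith) (by linarith) (OnePoint.coe_injective hx')
  rw [Subtype.ext_iff, hy, hy', Fin.ext h3, h4]

theorem HandleGlue.not_trans {x y z : HoledSphere g} (h : HandleGlue g x y) :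
    ¬ HandleGlue g y z := by
  rintro ⟨j, v, hv, _, _, hx', hy'⟩
  obtain ⟨i, u, hu, _, _, hx, hy⟩ := h
  rw [hy] at hx'
  exact foot_ne (by linarith) (by rw [RCLike.norm_conj]; linarith) (OnePoint.coe_injective hx').symm

/-- The gluing is a bijection from the left circles to the right circles, which are disjoint. So
composing gluings gives nothing new, and the generated equivalence relation is the reflexive and
symmetric closure. -/
theorem mk_eq_mk {x y : HoledSphere g} : (Quot.mk (HandleGlue g) x = Quot.mk (HandleGlue g) y) ↔
    x = y ∨ HandleGlue g x y ∨ HandleGlue g y x := by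
  constructor
  · intro h
    replace h := Quot.eqvGen_exact h
    induction h with
    | rel x y h => exact Or.inr (Or.inl h)
    | refl x => exact Or.inl rfl
    | symm x y _ ih => exact ih.elim (fun h => Or.inl h.symm) fun h => Or.inr h.symm
    | trans x y z _ _ ih1 ih2 =>
      rcases ih1 with rfl | h1 | h1
      · exact ih2
      · rcases ih2 with rfl | h2 | h2
        · exact Or.inr (Or.inl h1)
        · exact absurd h2 h1.not_trans
        · exact Or.inl (h1.trans_symm h2)
      · rcases ih2 with rfl | h2 | h2
        · exact Or.inr (Or.inr h1)
        · exact Or.inl (h1.symm_trans h2)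
        · exact absurd h1 h2.not_trans
  · rintro (rfl | h | h)
    · rfl
    · exact Quot.sound h
    · exact (Quot.sound h).symm

theorem footL_add_mem {i : ℕ} {u : ℂ} (hu : 1 ≤ ‖u‖) (hu' : ‖u‖ ≤ 2) : 6 * (i : ℂ) + u ∈ Plane g := by
  intro j _
  have h1 := abs_le.mp ((Complex.abs_re_le_norm u).trans hu')
  have key : ∀ k : ℂ, 3 ≤ |(6 * (i : ℂ) - k).re| → 1 ≤ ‖6 * (i : ℂ) + u - k‖ := by
    intro k hk
    refine le_trans ?_ (Complex.abs_re_le_norm _)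
    simp only [Complex.sub_re, Complex.add_re] at hk ⊢
    rcases le_abs'.mp hk with h | h
    · exact le_abs'.mpr (Or.inl (by linarith))
    · exact le_abs'.mpr (Or.inr (by linarith))
  refine ⟨?_, key _ ?_⟩
  · rcases eq_or_ne i j with rfl | hij
    · simp [hu]
    · refine key _ ?_
      rcases lt_or_gt_of_ne hij with hlt | hlt
      · have : (i : ℝ) + 1 ≤ j := by exact_mod_cast hlt
        exact le_abs'.mpr (Or.inl (by simp; linarith))
      · have : (j : ℝ) + 1 ≤ i := by exact_mod_cast hlt
        exact le_abs'.mpr (Or.inr (by simp; linarith))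
  · rcases lt_or_ge j i with hlt | hle
    · have : (j : ℝ) + 1 ≤ i := by exact_mod_cast hlt
      exact le_abs'.mpr (Or.inr (by simp; linarith))
    · have : (i : ℝ) ≤ j := by exact_mod_cast hle
      exact le_abs'.mpr (Or.inl (by simp; linarith))

theorem footR_sub_mem {i : ℕ} {u : ℂ} (hu : 1 ≤ ‖u‖) (hu' : ‖u‖ ≤ 2) : 6 * (i : ℂ) + 3 - u ∈ Plane g := by
  intro j _
  have h1 := abs_le.mp ((Complex.abs_re_le_norm u).trans hu')
  have key : ∀ k : ℂ, 3 ≤ |(6 * (i : ℂ) + 3 - k).re| → 1 ≤ ‖6 * (i : ℂ) + 3 - u - k‖ := by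
    intro k hk
    refine le_trans ?_ (Complex.abs_re_le_norm _)
    simp only [Complex.sub_re, Complex.add_re] at hk ⊢
    rcases le_abs'.mp hk with h | h
    · exact le_abs'.mpr (Or.inl (by linarith))
    · exact le_abs'.mpr (Or.inr (by linarith))
  refine ⟨key _ ?_, ?_⟩
  · rcases lt_or_ge i j with hlt | hle
    · have : (i : ℝ) + 1 ≤ j := by exact_mod_cast hlt
      exact le_abs'.mpr (Or.inl (by simp; linarith))
    · have : (j : ℝ) ≤ i := by exact_mod_cast hle
      exact le_abs'.mpr (Or.inr (by simp; linarith))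
  · rcases eq_or_ne i j with rfl | hij
    · simp [hu]
    · refine key _ ?_
      rcases lt_or_gt_of_ne hij with hlt | hlt
      · have : (i : ℝ) + 1 ≤ j := by exact_mod_cast hlt
        exact le_abs'.mpr (Or.inl (by simp; linarith))
      · have : (j : ℝ) + 1 ≤ i := by exact_mod_cast hlt
        exact le_abs'.mpr (Or.inr (by simp; linarith))

theorem pt_glue {i : ℕ} (hi : i < g) {u : ℂ} (hu : ‖u‖ = 1) :
    pt (g := g) ⟨6 * (i : ℂ) + u, footL_add_mem (by linarith) (by linarith)⟩ =
      pt ⟨6 * (i : ℂ) + 3 - conj u,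
        footR_sub_mem (by rw [RCLike.norm_conj]; linarith) (by rw [RCLike.norm_conj]; linarith)⟩ :=
  Quot.sound (HandleGlue.glue ⟨i, hi⟩ u hu _ _ rfl rfl)

theorem pt_eq_pt {z w : Plane g} : pt z = pt w ↔ (z : ℂ) = w ∨ (∃ i < g, ∃ u : ℂ, ‖u‖ = 1 ∧
    ((z : ℂ) = 6 * (i : ℂ) + u ∧ (w : ℂ) = 6 * (i : ℂ) + 3 - conj u ∨
      (w : ℂ) = 6 * (i : ℂ) + u ∧ (z : ℂ) = 6 * (i : ℂ) + 3 - conj u)) := by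
  constructor
  · intro h
    rcases mk_eq_mk.mp h with h | ⟨i, u, hu, _, _, hx, hy⟩ | ⟨i, u, hu, _, _, hx, hy⟩
    · exact Or.inl (OnePoint.coe_injective (congrArg Subtype.val h))
    · exact Or.inr ⟨i, i.2, u, hu, Or.inl ⟨OnePoint.coe_injective hx, OnePoint.coe_injective hy⟩⟩
    · exact Or.inr ⟨i, i.2, u, hu, Or.inr ⟨OnePoint.coe_injective hx, OnePoint.coe_injective hy⟩⟩
  · rintro (h | ⟨i, hi, u, hu, ⟨hz, hw⟩ | ⟨hw, hz⟩⟩)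
    · rw [Subtype.ext h]
    · obtain ⟨z, _⟩ := z
      obtain ⟨w, _⟩ := w
      subst hz hw
      exact pt_glue hi hu
    · obtain ⟨z, _⟩ := z
      obtain ⟨w, _⟩ := w
      subst hz hw
      exact (pt_glue hi hu).symm

/-- The saturation of a closed set `C` is the union of `C` and the mirror images of its
intersections with the finitely many boundary circles, all of which are compact. -/
theorem isClosedMap_mk : IsClosedMap (Quot.mk (HandleGlue g)) := by
  intro C hC
  rw [← isQuotientMap_quot_mk.isClosed_preimage]
  let cL (i : Fin g) (u : Metric.sphere (0 : ℂ) 1) : HoledSphere g :=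
    toHoled ⟨6 * ((i : ℕ) : ℂ) + u, footL_add_mem (by simp) (by simp)⟩
  let cR (i : Fin g) (u : Metric.sphere (0 : ℂ) 1) : HoledSphere g :=
    toHoled ⟨6 * ((i : ℕ) : ℂ) + 3 - conj (u : ℂ), footR_sub_mem (by simp) (by simp)⟩
  have hcL : ∀ i, Continuous (cL i) := fun i =>
    continuous_toHoled.comp (Continuous.subtype_mk (by fun_prop) _)
  have hcR : ∀ i, Continuous (cR i) := fun i =>
    continuous_toHoled.comp (Continuous.subtype_mk
      (continuous_const.sub (Complex.continuous_conj.comp continuous_subtype_val)) _)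
  have heq : Quot.mk (HandleGlue g) ⁻¹' (Quot.mk (HandleGlue g) '' C) =
      C ∪ ((⋃ i, cL i '' (cR i ⁻¹' C)) ∪ ⋃ i, cR i '' (cL i ⁻¹' C)) := by
    ext x
    simp only [mem_preimage, mem_image, mem_union, mem_iUnion]
    constructor
    · rintro ⟨y, hy, hyx⟩
      rcases mk_eq_mk.mp hyx with rfl | ⟨i, u, hu, _, _, hx', hy'⟩ | ⟨i, u, hu, _, _, hx', hy'⟩
      · exact Or.inl hy
      · refine Or.inr (Or.inr ⟨i, ⟨u, by simpa using hu⟩, ?_, ?_⟩)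
        · convert hy; exact Subtype.ext hx'.symm
        · exact Subtype.ext hy'.symm
      · refine Or.inr (Or.inl ⟨i, ⟨u, by simpa using hu⟩, ?_, ?_⟩)
        · convert hy; exact Subtype.ext hy'.symm
        · exact Subtype.ext hx'.symm
    · rintro (hx | ⟨i, u, hu, rfl⟩ | ⟨i, u, hu, rfl⟩)
      · exact ⟨x, hx, rfl⟩
      · exact ⟨_, hu, (pt_glue i.2 (by simp)).symm⟩
      · exact ⟨_, hu, pt_glue i.2 (by simp)⟩
  rw [heq]
  refine hC.union (IsClosed.union ?_ ?_)
  · exact isClosed_iUnion_of_finite fun i =>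
      (((hC.preimage (hcR i)).isCompact).image (hcL i)).isClosed
  · exact isClosed_iUnion_of_finite fun i =>
      (((hC.preimage (hcL i)).isCompact).image (hcR i)).isClosed

/-- The fibres of the projection are disjoint compact sets, hence have disjoint neighbourhoods
upstairs. For a closed map such neighbourhoods come from neighbourhoods of the points downstairs. -/
instance : T2Space (ClosedSurface g) := by
  rw [t2Space_iff_disjoint_nhds]
  intro x y hxy
  have hsurj : Function.Surjective (Quot.mk (HandleGlue g)) := Quot.mk_surjective
  have hcl : ∀ x : ClosedSurface g, IsClosed (Quot.mk (HandleGlue g) ⁻¹' {x}) := by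
    intro x
    obtain ⟨x', rfl⟩ := hsurj x
    have := (isClosedMap_mk _ (isClosed_singleton (x := x'))).preimage
      (continuous_quot_mk (r := HandleGlue g))
    rwa [image_singleton] at this
  rw [← Filter.disjoint_comap_iff hsurj, isClosedMap_mk.comap_nhds_eq continuous_quot_mk,
    isClosedMap_mk.comap_nhds_eq continuous_quot_mk, ← separatedNhds_iff_disjoint]
  refine SeparatedNhds.of_isCompact_isCompact (hcl x).isCompact (hcl y).isCompact ?_
  exact Disjoint.preimage _ (disjoint_singleton.mpr hxy)

end ClosedSurface

/-! ### Charts of closed surfaces -/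

section Charts

open Topology Set

variable {g : ℕ}

variable (g) in
/-- The projection of the sphere to the closed surface (with a default value in the holes). -/
def sproj (x : OnePoint ℂ) : ClosedSurface g :=
  open Classical in
  if h : x ∈ HoledSphere g then Quot.mk _ ⟨x, h⟩ else Quot.mk _ ⟨OnePoint.infty, infty_mem_holedSphere⟩

variable (g) in
/-- The projection of the plane to the closed surface (with a default value in the holes). -/
def proj (z : ℂ) : ClosedSurface g := sproj g z

theorem sproj_eq {x : OnePoint ℂ} (h : x ∈ HoledSphere g) : sproj g x = Quot.mk _ ⟨x, h⟩ :=
  dif_pos h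

theorem proj_eq {z : ℂ} (h : z ∈ Plane g) : proj g z = pt ⟨z, h⟩ :=
  sproj_eq (coe_mem_holedSphere.mpr h)

theorem continuousOn_sproj : ContinuousOn (sproj g) (HoledSphere g) := by
  rw [continuousOn_iff_continuous_domRestrict]
  have : (HoledSphere g).domRestrict (sproj g) = Quot.mk _ := by
    ext x
    exact sproj_eq x.2
  rw [this]
  exact continuous_quot_mk

theorem continuousOn_proj : ContinuousOn (proj g) (Plane g) :=
  continuousOn_sproj.comp OnePoint.continuous_coe.continuousOn fun _ hz =>
    coe_mem_holedSphere.mpr hz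

theorem exists_sproj (a : ClosedSurface g) : ∃ x ∈ HoledSphere g, sproj g x = a := by
  obtain ⟨⟨x, hx⟩, rfl⟩ := Quot.mk_surjective a
  exact ⟨x, hx, sproj_eq hx⟩

theorem exists_proj (a : ClosedSurface g) : a = sproj g OnePoint.infty ∨ ∃ z ∈ Plane g, proj g z = a := by
  obtain ⟨x, hx, rfl⟩ := exists_sproj a
  induction x with
  | infty => exact Or.inl rfl
  | coe z => exact Or.inr ⟨z, coe_mem_holedSphere.mp hx, rfl⟩

theorem proj_glue {i : ℕ} (hi : i < g) {u : ℂ} (hu : ‖u‖ = 1) :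
    proj g (6 * (i : ℂ) + u) = proj g (6 * (i : ℂ) + 3 - conj u) := by
  rw [proj_eq (footL_add_mem (by linarith) (by linarith)),
    proj_eq (footR_sub_mem (by rw [RCLike.norm_conj]; linarith) (by rw [RCLike.norm_conj]; linarith)),
    pt_glue hi hu]

theorem proj_eq_proj {z w : ℂ} (hz : z ∈ Plane g) (hw : w ∈ Plane g) : proj g z = proj g w ↔
    z = w ∨ (∃ i < g, ∃ u : ℂ, ‖u‖ = 1 ∧
      (z = 6 * (i : ℂ) + u ∧ w = 6 * (i : ℂ) + 3 - conj u ∨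
        w = 6 * (i : ℂ) + u ∧ z = 6 * (i : ℂ) + 3 - conj u)) := by
  rw [proj_eq hz, proj_eq hw, pt_eq_pt]

variable (g) in
/-- The part of the plane off the closed discs to whose boundary the handles are attached. -/
def PlaneInt : Set ℂ :=
  {z | ∀ j < g, 1 < ‖z - 6 * (j : ℂ)‖ ∧ 1 < ‖z - (6 * (j : ℂ) + 3)‖}

theorem planeInt_subset : PlaneInt g ⊆ Plane g := fun _ hz j hj => ⟨(hz j hj).1.le, (hz j hj).2.le⟩

theorem isOpen_planeInt : IsOpen (PlaneInt g) := by
  have : PlaneInt g = ⋂ j ∈ Iio g, {z : ℂ | 1 < ‖z - 6 * (j : ℂ)‖ ∧ 1 < ‖z - (6 * (j : ℂ) + 3)‖} := by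
    ext z; simp [PlaneInt]
  rw [this]
  refine (finite_Iio g).isOpen_biInter fun j _ => IsOpen.and
    (isOpen_lt continuous_const (by fun_prop)) (isOpen_lt continuous_const (by fun_prop))

theorem footL_notMem_planeInt {i : ℕ} (hi : i < g) {u : ℂ} (hu : ‖u‖ = 1) :
    6 * (i : ℂ) + u ∉ PlaneInt g := by
  intro h
  have := (h i hi).1
  rw [add_sub_cancel_left] at this
  linarith

theorem footR_notMem_planeInt {i : ℕ} (hi : i < g) {u : ℂ} (hu : ‖u‖ = 1) :
    6 * (i : ℂ) + 3 - conj u ∉ PlaneInt g := by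
  intro h
  have := (h i hi).2
  rw [show 6 * (i : ℂ) + 3 - conj u - (6 * (i : ℂ) + 3) = - conj u by ring, norm_neg,
    RCLike.norm_conj] at this
  linarith

theorem sproj_eq_sproj {x y : OnePoint ℂ} (hx : x ∈ HoledSphere g) (hy : y ∈ HoledSphere g)
    (h : sproj g x = sproj g y) : x = y ∨ (∃ i < g, ∃ u : ℂ, ‖u‖ = 1 ∧
      (x = (6 * (i : ℂ) + u : ℂ) ∧ y = (6 * (i : ℂ) + 3 - conj u : ℂ) ∨
        y = (6 * (i : ℂ) + u : ℂ) ∧ x = (6 * (i : ℂ) + 3 - conj u : ℂ))) := by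
  rw [sproj_eq hx, sproj_eq hy, mk_eq_mk] at h
  rcases h with h | ⟨i, u, hu, _, _, hx, hy⟩ | ⟨i, u, hu, _, _, hx, hy⟩
  · exact Or.inl (congrArg Subtype.val h)
  · exact Or.inr ⟨i, i.2, u, hu, Or.inl ⟨hx, hy⟩⟩
  · exact Or.inr ⟨i, i.2, u, hu, Or.inr ⟨hx, hy⟩⟩

theorem proj_inj_of_int {z w : ℂ} (hz : z ∈ Plane g) (hw : w ∈ PlaneInt g)
    (h : proj g z = proj g w) : z = w := by
  rcases (proj_eq_proj hz (planeInt_subset hw)).mp h with h | ⟨i, hi, u, hu, ⟨_, h⟩ | ⟨h, _⟩⟩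
  · exact h
  · exact absurd (h ▸ hw) (footR_notMem_planeInt hi hu)
  · exact absurd (h ▸ hw) (footL_notMem_planeInt hi hu)

/-- The image of an open set that is saturated for the gluing is open. -/
theorem isOpen_sproj_image {W : Set (OnePoint ℂ)} (hW : IsOpen W)
    (hglue : ∀ i < g, ∀ u : ℂ, ‖u‖ = 1 → (((6 * (i : ℂ) + u : ℂ) : OnePoint ℂ) ∈ W ↔
      ((6 * (i : ℂ) + 3 - conj u : ℂ) : OnePoint ℂ) ∈ W)) :
    IsOpen (sproj g '' (W ∩ HoledSphere g)) := by
  rw [← isQuotientMap_quot_mk.isOpen_preimage]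
  have : Quot.mk (HandleGlue g) ⁻¹' (sproj g '' (W ∩ HoledSphere g)) = Subtype.val ⁻¹' W := by
    ext ⟨x, hx⟩
    simp only [mem_preimage, mem_image]
    constructor
    · rintro ⟨y, ⟨hyW, hy⟩, hyx⟩
      rw [← sproj_eq hx] at hyx
      rcases sproj_eq_sproj hy hx hyx with rfl | ⟨i, hi, u, hu, ⟨rfl, rfl⟩ | ⟨rfl, rfl⟩⟩
      · exact hyW
      · exact (hglue i hi u hu).mp hyW
      · exact (hglue i hi u hu).mpr hyW
    · intro h
      exact ⟨x, ⟨h, hx⟩, sproj_eq hx⟩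
  rw [this]
  exact hW.preimage continuous_subtype_val

theorem isOpen_proj_image {V : Set ℂ} (hV : IsOpen V)
    (hglue : ∀ i < g, ∀ u : ℂ, ‖u‖ = 1 → (6 * (i : ℂ) + u ∈ V ↔ 6 * (i : ℂ) + 3 - conj u ∈ V)) :
    IsOpen (proj g '' (V ∩ Plane g)) := by
  have := isOpen_sproj_image (g := g) (OnePoint.isOpenEmbedding_coe.isOpenMap V hV) (by simpa using hglue)
  convert this using 1
  ext y
  simp only [mem_image, mem_inter_iff]
  constructor
  · rintro ⟨z, ⟨hz, hz'⟩, rfl⟩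
    exact ⟨z, ⟨⟨z, hz, rfl⟩, coe_mem_holedSphere.mpr hz'⟩, rfl⟩
  · rintro ⟨_, ⟨⟨z, hz, rfl⟩, hz'⟩, rfl⟩
    exact ⟨z, ⟨hz, coe_mem_holedSphere.mp hz'⟩, rfl⟩

/-- `χ` is a chart on the ball of radius `r` about `c`. -/
structure IsChart (χ : ℂ → ClosedSurface g) (c : ℂ) (r : ℝ) : Prop where
  pos : 0 < r
  cont : ContinuousOn χ (Metric.closedBall c r)
  inj : InjOn χ (Metric.closedBall c r)
  isOpen : ∀ V ⊆ Metric.ball c r, IsOpen V → IsOpen (χ '' V)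

theorem IsChart.mono {χ : ℂ → ClosedSurface g} {c : ℂ} {r : ℝ} (h : IsChart χ c r) {s : ℝ}
    (hs : 0 < s) (hsr : s ≤ r) : IsChart χ c s :=
  ⟨hs, h.cont.mono (Metric.closedBall_subset_closedBall hsr),
    h.inj.mono (Metric.closedBall_subset_closedBall hsr),
    fun V hV => h.isOpen V (hV.trans (Metric.ball_subset_ball hsr))⟩

theorem isChart_proj {c : ℂ} {r : ℝ} (hr : 0 < r) (h : Metric.closedBall c r ⊆ PlaneInt g) :
    IsChart (proj g) c r := by
  refine ⟨hr, continuousOn_proj.mono (h.trans planeInt_subset),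
    fun z hz w hw hzw => proj_inj_of_int (planeInt_subset (h hz)) (h hw) hzw, fun V hV hVo => ?_⟩
  have hV' : V ⊆ PlaneInt g := hV.trans (Metric.ball_subset_closedBall.trans h)
  have := isOpen_proj_image (g := g) hVo fun i hi u hu =>
    ⟨fun h => absurd (hV' h) (footL_notMem_planeInt hi hu),
      fun h => absurd (hV' h) (footR_notMem_planeInt hi hu)⟩
  rwa [inter_eq_self_of_subset_left (hV'.trans planeInt_subset)] at this

/-! #### The chart at infinity -/

/-- The inversion of the sphere in the chart at infinity. -/
def sphereInv (w : ℂ) : OnePoint ℂ := open Classical in if w = 0 then OnePoint.infty else (w⁻¹ : ℂ)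

theorem sphereInv_zero : sphereInv 0 = OnePoint.infty := if_pos rfl

theorem sphereInv_of_ne {w : ℂ} (h : w ≠ 0) : sphereInv w = (w⁻¹ : ℂ) := if_neg h

theorem sphereInv_injective : Function.Injective sphereInv := by
  intro z w h
  rcases eq_or_ne z 0 with rfl | hz <;> rcases eq_or_ne w 0 with rfl | hw
  · rfl
  · rw [sphereInv_zero, sphereInv_of_ne hw] at h
    exact absurd h (OnePoint.infty_ne_coe _)
  · rw [sphereInv_zero, sphereInv_of_ne hz] at h
    exact absurd h (OnePoint.coe_ne_infty _)
  · rw [sphereInv_of_ne hz, sphereInv_of_ne hw] at h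
    exact inv_injective (OnePoint.coe_injective h)

theorem continuous_sphereInv : Continuous sphereInv := by
  rw [continuous_iff_continuousAt]
  intro w
  rcases eq_or_ne w 0 with rfl | hw
  · rw [continuousAt_iff_punctured_nhds, sphereInv_zero]
    have h1 : Filter.Tendsto (fun w : ℂ => ((w⁻¹ : ℂ) : OnePoint ℂ)) (𝓝[≠] 0)
        (𝓝 OnePoint.infty) := by
      refine OnePoint.tendsto_coe_infty.comp ?_
      rw [Filter.coclosedCompact_eq_cocompact, ← Metric.cobounded_eq_cocompact]
      exact Filter.tendsto_inv₀_nhdsNE_zero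
    refine h1.congr' ?_
    filter_upwards [self_mem_nhdsWithin] with w hw
    exact (sphereInv_of_ne hw).symm
  · have h1 : ContinuousAt (fun w : ℂ => ((w⁻¹ : ℂ) : OnePoint ℂ)) w :=
      OnePoint.continuous_coe.continuousAt.comp (continuousAt_inv₀ hw)
    refine h1.congr ?_
    filter_upwards [isOpen_ne.mem_nhds hw] with w hw
    exact (sphereInv_of_ne hw).symm

theorem isOpenMap_sphereInv : IsOpenMap sphereInv := by
  have h0 : ∀ V : Set ℂ, IsOpen V → (0 : ℂ) ∉ V → IsOpen (sphereInv '' V) := by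
    intro V hV h0
    have : sphereInv '' V = ((↑) : ℂ → OnePoint ℂ) '' ({0}ᶜ ∩ (fun w => w⁻¹) ⁻¹' V) := by
      ext x
      simp only [mem_image, mem_inter_iff, mem_preimage]
      constructor
      · rintro ⟨w, hw, rfl⟩
        have hw0 : w ≠ 0 := fun h => h0 (h ▸ hw)
        exact ⟨w⁻¹, ⟨inv_ne_zero hw0, by rwa [inv_inv]⟩, (sphereInv_of_ne hw0).symm⟩
      · rintro ⟨w, ⟨hw0, hw⟩, rfl⟩
        exact ⟨w⁻¹, hw, by rw [sphereInv_of_ne (inv_ne_zero hw0), inv_inv]⟩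
    rw [this]
    exact OnePoint.isOpenEmbedding_coe.isOpenMap _
      (continuousOn_inv₀.isOpen_inter_preimage isOpen_compl_singleton hV)
  -- About `∞`, the image of a ball is the complement of a compact disc.
  have hb : ∀ r > 0, IsOpen (sphereInv '' Metric.ball 0 r) := by
    intro r hr
    have : sphereInv '' Metric.ball 0 r =
        (((↑) : ℂ → OnePoint ℂ) '' Metric.closedBall 0 r⁻¹)ᶜ := by
      ext x
      induction x with
      | infty =>
        simp only [mem_image, mem_compl_iff, OnePoint.coe_ne_infty, and_false, exists_false,
          not_false_eq_true, iff_true]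
        exact ⟨0, by simpa using hr, sphereInv_zero⟩
      | coe z =>
        simp only [mem_image, mem_compl_iff, OnePoint.coe_eq_coe, exists_eq_right,
          mem_closedBall_zero_iff, mem_ball_zero_iff, not_le]
        constructor
        · rintro ⟨w, hw, hwz⟩
          have hw0 : w ≠ 0 := by
            rintro rfl
            rw [sphereInv_zero] at hwz
            exact OnePoint.infty_ne_coe _ hwz
          rw [sphereInv_of_ne hw0] at hwz
          rw [← OnePoint.coe_injective hwz, norm_inv]
          exact inv_strictAnti₀ (norm_pos_iff.mpr hw0) hw
        · intro hz
          have hz0 : z ≠ 0 := by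
            rintro rfl
            rw [norm_zero] at hz
            exact absurd hz (not_lt.mpr (inv_nonneg.mpr hr.le))
          refine ⟨z⁻¹, ?_, by rw [sphereInv_of_ne (inv_ne_zero hz0), inv_inv]⟩
          rw [norm_inv]
          exact inv_lt_of_inv_lt₀ hr hz
    rw [this, isOpen_compl_iff]
    exact ((isCompact_closedBall 0 r⁻¹).image OnePoint.continuous_coe).isClosed
  intro V hV
  by_cases h : (0 : ℂ) ∈ V
  · obtain ⟨r, hr, hrV⟩ := Metric.isOpen_iff.mp hV 0 h
    have : V = (V \ {0}) ∪ Metric.ball 0 r := by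
      ext z
      constructor
      · intro hz
        rcases eq_or_ne z 0 with rfl | hz0
        · exact Or.inr (Metric.mem_ball_self hr)
        · exact Or.inl ⟨hz, hz0⟩
      · rintro (hz | hz)
        exacts [hz.1, hrV hz]
    rw [this, image_union]
    exact (h0 _ (hV.sdiff isClosed_singleton) (by simp)).union (hb r hr)
  · exact h0 V hV h

theorem mem_planeInt_of_norm {z : ℂ} (hz : 6 * (g : ℝ) + 4 < ‖z‖) : z ∈ PlaneInt g := by
  intro j hj
  have hj' : (j : ℝ) ≤ g := by exact_mod_cast hj.le
  have h1 : ‖(6 * (j : ℂ))‖ = 6 * (j : ℝ) := by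
    rw [norm_mul, Complex.norm_natCast]; simp
  have h2 : ‖(6 * (j : ℂ) + 3)‖ ≤ 6 * (j : ℝ) + 3 :=
    (norm_add_le _ _).trans (by rw [h1]; simp)
  constructor
  · have := norm_sub_norm_le z (6 * (j : ℂ))
    linarith
  · have := norm_sub_norm_le z (6 * (j : ℂ) + 3)
    linarith

/-- Inverses of nonzero points of this disc have norm at least `6 * g + 5`, so they lie beyond all
holes, where nothing is glued. -/
theorem isChart_infty : IsChart (fun w => sproj g (sphereInv w)) 0 (1 / (6 * (g : ℝ) + 5)) := by
  have hpos : (0 : ℝ) < 6 * (g : ℝ) + 5 := by positivity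
  have hint : ∀ w ∈ Metric.closedBall (0 : ℂ) (1 / (6 * (g : ℝ) + 5)), w ≠ 0 →
      w⁻¹ ∈ PlaneInt g := by
    intro w hw hw0
    rw [mem_closedBall_zero_iff] at hw
    refine mem_planeInt_of_norm ?_
    rw [norm_inv]
    have := (le_inv_comm₀ hpos (norm_pos_iff.mpr hw0)).mpr (by rwa [one_div] at hw)
    linarith
  have hmem : ∀ w ∈ Metric.closedBall (0 : ℂ) (1 / (6 * (g : ℝ) + 5)),
      sphereInv w ∈ HoledSphere g := by
    intro w hw
    rcases eq_or_ne w 0 with rfl | hw0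
    · rw [sphereInv_zero]; exact infty_mem_holedSphere
    · rw [sphereInv_of_ne hw0, coe_mem_holedSphere]; exact planeInt_subset (hint w hw hw0)
  have hno : ∀ w ∈ Metric.closedBall (0 : ℂ) (1 / (6 * (g : ℝ) + 5)), ∀ z : ℂ,
      sphereInv w = z → z ∈ PlaneInt g := by
    intro w hw z hwz
    rcases eq_or_ne w 0 with rfl | hw0
    · rw [sphereInv_zero] at hwz; exact absurd hwz (OnePoint.infty_ne_coe _)
    · rw [sphereInv_of_ne hw0] at hwz
      rw [← OnePoint.coe_injective hwz]
      exact hint w hw hw0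
  refine ⟨by positivity, continuousOn_sproj.comp continuous_sphereInv.continuousOn hmem, ?_, ?_⟩
  · intro z hz w hw hzw
    rcases sproj_eq_sproj (hmem z hz) (hmem w hw) hzw with h | ⟨i, hi, u, hu, ⟨_, h⟩ | ⟨h, _⟩⟩
    · exact sphereInv_injective h
    · exact absurd (hno w hw _ h) (footR_notMem_planeInt hi hu)
    · exact absurd (hno w hw _ h) (footL_notMem_planeInt hi hu)
  · intro V hV hVo
    have hV' := hV.trans Metric.ball_subset_closedBall
    have := isOpen_sproj_image (g := g) (isOpenMap_sphereInv V hVo) fun i hi u hu =>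
      ⟨fun ⟨w, hw, h⟩ => absurd (hno w (hV' hw) _ h) (footL_notMem_planeInt hi hu),
        fun ⟨w, hw, h⟩ => absurd (hno w (hV' hw) _ h) (footR_notMem_planeInt hi hu)⟩
    rw [inter_eq_self_of_subset_left (by rintro _ ⟨w, hw, rfl⟩; exact hmem w (hV' hw)),
      image_image] at this
    exact this

/-! #### Charts at the handles -/

variable (g) in
/-- The chart about the circle along which the two ends of a handle are glued. -/
def handleChart (i : ℕ) (w : ℂ) : ClosedSurface g :=
  open Classical in
  if 0 ≤ w.re then proj g (6 * (i : ℂ) + Complex.exp w)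
  else proj g (6 * (i : ℂ) + 3 - Complex.exp (-w))

theorem handleChart_of_nonneg {i : ℕ} {w : ℂ} (h : 0 ≤ w.re) :
    handleChart g i w = proj g (6 * (i : ℂ) + Complex.exp w) := if_pos h

theorem handleChart_of_neg {i : ℕ} {w : ℂ} (h : w.re < 0) :
    handleChart g i w = proj g (6 * (i : ℂ) + 3 - Complex.exp (-w)) := if_neg (not_le.mpr h)

theorem conj_exp_of_re_eq_zero {w : ℂ} (h : w.re = 0) :
    conj (Complex.exp w) = Complex.exp (-w) := by
  rw [← Complex.exp_conj]
  congr 1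
  apply Complex.ext <;> simp [h]

theorem handleChart_of_nonpos {i : ℕ} (hi : i < g) {w : ℂ} (h : w.re ≤ 0) :
    handleChart g i w = proj g (6 * (i : ℂ) + 3 - Complex.exp (-w)) := by
  rcases h.lt_or_eq with h | h
  · exact handleChart_of_neg h
  · rw [handleChart_of_nonneg h.ge, proj_glue hi (by rw [Complex.norm_exp, h, Real.exp_zero]),
      conj_exp_of_re_eq_zero h]

theorem norm_exp_lt {w : ℂ} (h : w.re ≤ 1 / 4) : ‖Complex.exp w‖ < 3 / 2 := by
  rw [Complex.norm_exp]
  have h1 : Real.exp w.re ≤ Real.exp (1 / 4) := Real.exp_le_exp.mpr h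
  have h2 : Real.exp (1 / 4) ≤ 1 / (1 - 1 / 4) := by
    have := Real.exp_bound_div_one_sub_of_interval (x := 1 / 4) (by norm_num) (by norm_num)
    linarith
  norm_num at h2
  linarith

theorem one_le_norm_exp {w : ℂ} (h : 0 ≤ w.re) : 1 ≤ ‖Complex.exp w‖ := by
  rw [Complex.norm_exp]
  exact Real.one_le_exp h

theorem exp_injOn_ball {θ : ℝ} {z w : ℂ} (hz : ‖z - θ * Complex.I‖ ≤ 1 / 4)
    (hw : ‖w - θ * Complex.I‖ ≤ 1 / 4) (h : Complex.exp z = Complex.exp w) : z = w := by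
  rw [Complex.exp_eq_exp_iff_exists_int] at h
  obtain ⟨n, hn⟩ := h
  have h1 : ‖z - w‖ ≤ 1 / 2 := by
    have := norm_sub_le (z - θ * Complex.I) (w - θ * Complex.I)
    rw [sub_sub_sub_cancel_right] at this
    linarith
  rw [hn, add_sub_cancel_left] at h1
  have h2 : |(n : ℝ)| * (2 * Real.pi) ≤ 1 / 2 := by
    simpa [abs_of_pos Real.pi_pos] using h1
  have h3 : n = 0 := by
    by_contra hne
    have : (1 : ℝ) ≤ |(n : ℝ)| := by exact_mod_cast Int.one_le_abs hne
    nlinarith [Real.pi_gt_three]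
  rw [hn, h3]
  simp

theorem re_mem_of_ball {θ : ℝ} {w : ℂ} (hw : ‖w - θ * Complex.I‖ ≤ 1 / 4) :
    -(1 / 4) ≤ w.re ∧ w.re ≤ 1 / 4 := by
  have := abs_le.mp ((Complex.abs_re_le_norm _).trans hw)
  simpa using this

theorem footL_exp_mem {i : ℕ} {w : ℂ} (h0 : 0 ≤ w.re) (h1 : w.re ≤ 1 / 4) :
    6 * (i : ℂ) + Complex.exp w ∈ Plane g :=
  footL_add_mem (one_le_norm_exp h0) (by linarith [norm_exp_lt h1])

theorem footR_exp_mem {i : ℕ} {w : ℂ} (h0 : w.re ≤ 0) (h1 : -(1 / 4) ≤ w.re) :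
    6 * (i : ℂ) + 3 - Complex.exp (-w) ∈ Plane g :=
  footR_sub_mem (one_le_norm_exp (by simpa using h0))
    (by linarith [norm_exp_lt (w := -w) (by simp; linarith)])

/-- The coordinate is a logarithm: points with nonnegative real part go to the outside of the left
disc, the others to the outside of the right disc. On the imaginary axis the two formulas agree
through the gluing, because `conj (exp w) = exp (-w)` there. The radius `1 / 4` keeps `exp`
injective and the distances from the feet below `3 / 2`. -/
theorem isChart_handle {i : ℕ} (hi : i < g) (θ : ℝ) :
    IsChart (handleChart g i) (θ * Complex.I) (1 / 4) := by
  have hB : ∀ {w : ℂ}, w ∈ Metric.closedBall (θ * Complex.I) (1 / 4) →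
      ‖w - θ * Complex.I‖ ≤ 1 / 4 := fun hw => by rwa [← dist_eq_norm]
  have hexp : ∀ {w : ℂ}, w ∈ Metric.closedBall (θ * Complex.I) (1 / 4) →
      ‖Complex.exp w‖ < 3 / 2 := fun hw => norm_exp_lt (re_mem_of_ball (hB hw)).2
  have hexp' : ∀ {w : ℂ}, w ∈ Metric.closedBall (θ * Complex.I) (1 / 4) →
      ‖Complex.exp (-w)‖ < 3 / 2 := fun hw =>
    norm_exp_lt (by have := (re_mem_of_ball (hB hw)).1; simp; linarith)
  have hneg : ∀ {z w : ℂ}, z ∈ Metric.closedBall (θ * Complex.I) (1 / 4) →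
      w ∈ Metric.closedBall (θ * Complex.I) (1 / 4) → Complex.exp (-z) = Complex.exp (-w) →
      z = w := by
    intro z w hz hw h
    have h1 := exp_injOn_ball (hB hz) (hB hw)
    rw [Complex.exp_neg, Complex.exp_neg] at h
    exact h1 (inv_injective h)
  refine ⟨by norm_num, ?_, ?_, ?_⟩
  · have hcov : Metric.closedBall (θ * Complex.I) (1 / 4) =
        (Metric.closedBall (θ * Complex.I) (1 / 4) ∩ {w | 0 ≤ w.re}) ∪
        (Metric.closedBall (θ * Complex.I) (1 / 4) ∩ {w | w.re ≤ 0}) := by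
      rw [← inter_union_distrib_left, eq_comm, inter_eq_left]
      intro w _
      exact le_total 0 w.re
    rw [hcov]
    refine ContinuousOn.union_of_isClosed ?_ ?_
      (Metric.isClosed_closedBall.inter (isClosed_le continuous_const Complex.continuous_re))
      (Metric.isClosed_closedBall.inter (isClosed_le Complex.continuous_re continuous_const))
    · refine ContinuousOn.congr (f := fun w => proj g (6 * (i : ℂ) + Complex.exp w)) ?_
        fun w hw => handleChart_of_nonneg hw.2
      exact continuousOn_proj.comp (by fun_prop) fun w hw =>
        footL_exp_mem hw.2 (re_mem_of_ball (hB hw.1)).2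
    · refine ContinuousOn.congr (f := fun w => proj g (6 * (i : ℂ) + 3 - Complex.exp (-w))) ?_
        fun w hw => handleChart_of_nonpos hi hw.2
      exact continuousOn_proj.comp (by fun_prop) fun w hw =>
        footR_exp_mem hw.2 (re_mem_of_ball (hB hw.1)).1
  -- A point near the left foot and one near the right foot can only be identified by a gluing. This
  -- would force `‖exp (-w)‖ = 1`, against `w.re < 0`.
  · have aux : ∀ z ∈ Metric.closedBall (θ * Complex.I) (1 / 4),
        ∀ w ∈ Metric.closedBall (θ * Complex.I) (1 / 4), 0 ≤ z.re → w.re < 0 →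
        handleChart g i z ≠ handleChart g i w := by
      intro z hz w hw hz0 hw0 h
      rw [handleChart_of_nonneg hz0, handleChart_of_neg hw0, proj_eq_proj
        (footL_exp_mem hz0 (re_mem_of_ball (hB hz)).2)
        (footR_exp_mem hw0.le (re_mem_of_ball (hB hw)).1)] at h
      rcases h with h | ⟨j, hj, u, hu, ⟨h1, h2⟩ | ⟨h1, h2⟩⟩
      · exact foot_ne (hexp hz) (hexp' hw) h
      · have : 6 * (i : ℂ) + -Complex.exp (-w) = 6 * (j : ℂ) + - conj u := by
          linear_combination h2
        have := (foot_cases (by rw [norm_neg]; exact hexp' hw)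
          (by rw [norm_neg, RCLike.norm_conj]; linarith) this).2
        have h3 : ‖Complex.exp (-w)‖ = 1 := by rw [neg_injective this, RCLike.norm_conj, hu]
        rw [Complex.norm_exp, Real.exp_eq_one_iff] at h3
        simp at h3
        linarith
      · exact foot_ne (by linarith) (hexp' hw) h1.symm
    intro z hz w hw h
    rcases le_or_gt 0 z.re with hz0 | hz0 <;> rcases le_or_gt 0 w.re with hw0 | hw0
    · rw [handleChart_of_nonneg hz0, handleChart_of_nonneg hw0, proj_eq_proj
        (footL_exp_mem hz0 (re_mem_of_ball (hB hz)).2)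
        (footL_exp_mem hw0 (re_mem_of_ball (hB hw)).2)] at h
      rcases h with h | ⟨j, hj, u, hu, ⟨_, h⟩ | ⟨_, h⟩⟩
      · exact exp_injOn_ball (hB hz) (hB hw) (add_left_cancel h)
      · exact absurd h (foot_ne (hexp hw) (by rw [RCLike.norm_conj]; linarith))
      · exact absurd h (foot_ne (hexp hz) (by rw [RCLike.norm_conj]; linarith))
    · exact absurd h (aux z hz w hw hz0 hw0)
    · exact absurd h.symm (aux w hw z hz hw0 hz0)
    · rw [handleChart_of_neg hz0, handleChart_of_neg hw0, proj_eq_proj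
        (footR_exp_mem hz0.le (re_mem_of_ball (hB hz)).1)
        (footR_exp_mem hw0.le (re_mem_of_ball (hB hw)).1)] at h
      rcases h with h | ⟨j, hj, u, hu, ⟨h, _⟩ | ⟨h, _⟩⟩
      · exact hneg hz hw (sub_right_injective h)
      · exact absurd h.symm (foot_ne (by linarith) (hexp' hz))
      · exact absurd h.symm (foot_ne (by linarith) (hexp' hw))
  · intro V hV hVo
    have hV' := hV.trans Metric.ball_subset_closedBall
    -- The image of `V` is the projection of `VL ∪ VR`. This union is saturated: a point of `VL` on
    -- the left circle has a purely imaginary logarithm `w`, and its mirror image is the point of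
    -- `VR` that belongs to the same `w`, and conversely.
    let VL : Set ℂ := (fun w => 6 * (i : ℂ) + w) '' (Complex.exp '' V)
    let VR : Set ℂ := (fun w => 6 * (i : ℂ) + 3 - w) '' (Complex.exp '' ((fun w => -w) '' V))
    have hL : IsOpen VL := (Homeomorph.addLeft _).isOpenMap _ (Complex.isOpenMap_exp _ hVo)
    have hR : IsOpen VR := (Homeomorph.subLeft _).isOpenMap _
      (Complex.isOpenMap_exp _ ((Homeomorph.neg ℂ).isOpenMap _ hVo))
    have key := isOpen_proj_image (g := g) (hL.union hR) ?_
    · convert key using 1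
      ext y
      constructor
      · rintro ⟨w, hw, rfl⟩
        have hwB := re_mem_of_ball (hB (hV' hw))
        rcases le_or_gt 0 w.re with h0 | h0
        · rw [handleChart_of_nonneg h0]
          exact ⟨_, ⟨Or.inl ⟨_, ⟨w, hw, rfl⟩, rfl⟩, footL_exp_mem h0 hwB.2⟩, rfl⟩
        · rw [handleChart_of_neg h0]
          exact ⟨_, ⟨Or.inr ⟨_, ⟨_, ⟨w, hw, rfl⟩, rfl⟩, rfl⟩, footR_exp_mem h0.le hwB.1⟩, rfl⟩
      · rintro ⟨_, ⟨⟨_, ⟨w, hw, rfl⟩, rfl⟩ | ⟨_, ⟨_, ⟨w, hw, rfl⟩, rfl⟩, rfl⟩, hP⟩, rfl⟩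
        · have := (hP i hi).1
          simp only [add_sub_cancel_left, Complex.norm_exp, Real.one_le_exp_iff] at this
          exact ⟨w, hw, handleChart_of_nonneg this⟩
        · have := (hP i hi).2
          rw [show 6 * (i : ℂ) + 3 - Complex.exp (-w) - (6 * (i : ℂ) + 3) = - Complex.exp (-w) by
            ring, norm_neg, Complex.norm_exp, Real.one_le_exp_iff, Complex.neg_re] at this
          exact ⟨w, hw, handleChart_of_nonpos hi (by linarith)⟩
    · have hre : ∀ w u : ℂ, ‖u‖ = 1 → Complex.exp w = u → w.re = 0 := by
        rintro w u hu rfl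
        rwa [Complex.norm_exp, Real.exp_eq_one_iff] at hu
      intro j hj u hu
      constructor
      · rintro (⟨_, ⟨w, hw, rfl⟩, h⟩ | ⟨_, ⟨_, ⟨w, hw, rfl⟩, rfl⟩, h⟩)
        · obtain ⟨rfl, h2⟩ := foot_cases (hexp (hV' hw)) (by linarith) h
          refine Or.inr ⟨_, ⟨_, ⟨w, hw, rfl⟩, rfl⟩, ?_⟩
          simp only
          rw [← conj_exp_of_re_eq_zero (hre w u hu h2), h2]
        · exact absurd h.symm (foot_ne (by linarith) (hexp' (hV' hw)))
      · rintro (⟨_, ⟨w, hw, rfl⟩, h⟩ | ⟨_, ⟨_, ⟨w, hw, rfl⟩, rfl⟩, h⟩)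
        · exact absurd h (foot_ne (hexp (hV' hw)) (by rw [RCLike.norm_conj]; linarith))
        · have : 6 * (i : ℂ) + -Complex.exp (-w) = 6 * (j : ℂ) + - conj u := by
            linear_combination h
          obtain ⟨rfl, h2⟩ := foot_cases (by rw [norm_neg]; exact hexp' (hV' hw))
            (by rw [norm_neg, RCLike.norm_conj]; linarith) this
          have h3 := neg_injective h2
          have h4 : w.re = 0 := by
            have := hre (-w) (conj u) (by rw [RCLike.norm_conj, hu]) h3
            simpa using this
          refine Or.inl ⟨_, ⟨w, hw, rfl⟩, ?_⟩
          simp only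
          rw [← conj_exp_of_re_eq_zero h4] at h3
          rw [(starRingEnd ℂ).injective h3]

theorem exists_isChart (a : ClosedSurface g) :
    ∃ (χ : ℂ → ClosedSurface g) (c : ℂ) (r : ℝ), IsChart χ c r ∧ χ c = a := by
  rcases exists_proj a with rfl | ⟨z, hz, rfl⟩
  · exact ⟨_, _, _, isChart_infty, by simp only [sphereInv_zero]⟩
  · by_cases hint : z ∈ PlaneInt g
    · obtain ⟨r, hr, hsub⟩ := Metric.nhds_basis_closedBall.mem_iff.mp
        (isOpen_planeInt.mem_nhds hint)
      exact ⟨_, _, _, isChart_proj hr hsub, rfl⟩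
    · have hcirc : ∀ u : ℂ, ‖u‖ = 1 → ∃ θ : ℝ, Complex.exp (θ * Complex.I) = u := by
        intro u hu
        exact (Complex.norm_eq_one_iff u).mp hu
      simp only [PlaneInt, mem_ofPred_eq, not_forall] at hint
      obtain ⟨i, hi, hlt⟩ := hint
      have h := hz i hi
      rcases eq_or_lt_of_le h.1 with h1 | h1
      · obtain ⟨θ, hθ⟩ := hcirc _ h1.symm
        refine ⟨_, _, _, isChart_handle hi θ, ?_⟩
        rw [handleChart_of_nonneg (by simp), hθ, add_sub_cancel]
      · have h2 : ‖z - (6 * (i : ℂ) + 3)‖ = 1 := by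
          by_contra hne
          exact hlt ⟨h1, lt_of_le_of_ne h.2 (Ne.symm hne)⟩
        obtain ⟨θ, hθ⟩ := hcirc (-(z - (6 * (i : ℂ) + 3))) (by rw [norm_neg, h2])
        refine ⟨_, _, _, isChart_handle hi (-θ), ?_⟩
        rw [handleChart_of_nonpos hi (by simp)]
        congr 1
        rw [show -(((-θ : ℝ) : ℂ) * Complex.I) = θ * Complex.I by push_cast; ring, hθ]
        ring

end Charts

/-! ### Moving points by homeomorphisms -/

section Homogeneity

open Topology Set

/-- The disc has homeomorphisms that fix the boundary and move the centre to a given point. -/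
theorem exists_disc_homeomorph {q : ℂ} (hq : ‖q‖ < 1) :
    ∃ h : Metric.closedBall (0 : ℂ) 1 ≃ₜ Metric.closedBall (0 : ℂ) 1,
      (h ⟨0, by simp⟩ : ℂ) = q ∧
        ∀ x : Metric.closedBall (0 : ℂ) 1, 1 ≤ ‖(x : ℂ)‖ → h x = x := by
  have hmem : ∀ x : Metric.closedBall (0 : ℂ) 1,
      (x : ℂ) + ((1 - ‖(x : ℂ)‖ : ℝ) : ℂ) * q ∈ Metric.closedBall (0 : ℂ) 1 := by
    rintro ⟨x, hx⟩
    rw [mem_closedBall_zero_iff] at hx ⊢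
    refine (norm_add_le _ _).trans ?_
    rw [norm_mul, Complex.norm_real, Real.norm_of_nonneg (by linarith)]
    nlinarith [norm_nonneg q]
  -- The map `x ↦ x + (1 - ‖x‖) q` is the identity on the boundary and sends `0` to `q`. If two
  -- points had the same image, then `‖x - y‖ ≤ ‖q‖ ‖x - y‖`, which forces `x = y`.
  let f : Metric.closedBall (0 : ℂ) 1 → Metric.closedBall (0 : ℂ) 1 := fun x => ⟨_, hmem x⟩
  have hf : Continuous f := by
    refine Continuous.subtype_mk ?_ _
    have : Continuous fun x : Metric.closedBall (0 : ℂ) 1 => ((1 - ‖(x : ℂ)‖ : ℝ) : ℂ) :=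
      Complex.continuous_ofReal.comp (by fun_prop)
    fun_prop
  have hinj : Function.Injective f := by
    rintro ⟨x, hx⟩ ⟨y, hy⟩ h
    have h1 : x + ((1 - ‖x‖ : ℝ) : ℂ) * q = y + ((1 - ‖y‖ : ℝ) : ℂ) * q := congrArg Subtype.val h
    have h2 : x - y = ((‖x‖ - ‖y‖ : ℝ) : ℂ) * q := by
      push_cast at h1 ⊢
      linear_combination h1
    have h3 : ‖x - y‖ ≤ ‖x - y‖ * ‖q‖ := by
      conv_lhs => rw [h2, norm_mul, Complex.norm_real, Real.norm_eq_abs]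
      exact mul_le_mul_of_nonneg_right (abs_norm_sub_norm_le x y) (norm_nonneg q)
    have h4 : ‖x - y‖ = 0 := by nlinarith [norm_nonneg (x - y)]
    exact Subtype.ext (sub_eq_zero.mp (norm_eq_zero.mp h4))
  -- The point `y - (1 - r) q` is a preimage of `y` if its norm is `r`; the intermediate value
  -- theorem supplies such an `r`.
  have hsurj : Function.Surjective f := by
    rintro ⟨y, hy⟩
    rw [mem_closedBall_zero_iff] at hy
    have hcont : ContinuousOn (fun r : ℝ => ‖y - ((1 - r : ℝ) : ℂ) * q‖ - r) (Icc 0 1) := by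
      have : Continuous fun r : ℝ => ((1 - r : ℝ) : ℂ) :=
        Complex.continuous_ofReal.comp (by fun_prop)
      fun_prop
    obtain ⟨r, hr, hr0⟩ := intermediate_value_Icc' zero_le_one hcont
      (show (0 : ℝ) ∈ Icc _ _ from ⟨by simpa using hy, by simp⟩)
    have hr1 : ‖y - ((1 - r : ℝ) : ℂ) * q‖ = r := by simpa [sub_eq_zero] using hr0
    refine ⟨⟨y - ((1 - r : ℝ) : ℂ) * q, by rw [mem_closedBall_zero_iff, hr1]; exact hr.2⟩, ?_⟩
    refine Subtype.ext ?_
    simp only [f, hr1]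
    ring
  refine ⟨Continuous.homeoOfEquivCompactToT2 (f := Equiv.ofBijective f ⟨hinj, hsurj⟩) hf, ?_, ?_⟩
  · change (0 : ℂ) + ((1 - ‖(0 : ℂ)‖ : ℝ) : ℂ) * q = q
    simp
  · rintro ⟨x, hx⟩ h
    rw [mem_closedBall_zero_iff] at hx
    refine Subtype.ext ?_
    change x + ((1 - ‖x‖ : ℝ) : ℂ) * q = x
    rw [le_antisymm hx h]
    simp

variable {g : ℕ}

/-- A closed disc in a chart about `a`, small enough to miss `F`, supports homeomorphisms that move
its centre to any interior point. -/
theorem eventually_exists_homeomorph {F : Set (ClosedSurface g)} (hF : F.Finite)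
    {a : ClosedSurface g} (ha : a ∉ F) :
    ∀ᶠ b in 𝓝 a, ∃ D : ClosedSurface g ≃ₜ ClosedSurface g, (∀ x ∈ F, D x = x) ∧ D a = b := by
  obtain ⟨χ, c, r, hχ, rfl⟩ := exists_isChart a
  have hca : ContinuousAt χ c := hχ.cont.continuousAt (Metric.closedBall_mem_nhds c hχ.pos)
  obtain ⟨δ', hδ', hsub'⟩ := Metric.nhds_basis_closedBall.mem_iff.mp
    (hca.preimage_mem_nhds (hF.isClosed.isOpen_compl.mem_nhds ha))
  obtain ⟨δ, hδ, hδr, hsub⟩ : ∃ δ > 0, δ ≤ r ∧ Metric.closedBall c δ ⊆ χ ⁻¹' Fᶜ :=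
    ⟨min δ' r, lt_min hδ' hχ.pos, min_le_right _ _,
      (Metric.closedBall_subset_closedBall (min_le_left _ _)).trans hsub'⟩
  replace hχ := hχ.mono hδ hδr
  have hmem : ∀ x : Metric.closedBall (0 : ℂ) 1, c + δ * (x : ℂ) ∈ Metric.closedBall c δ := by
    rintro ⟨x, hx⟩
    rw [mem_closedBall_zero_iff] at hx
    simp only [Metric.mem_closedBall, dist_self_add_left, norm_mul, Complex.norm_real,
      Real.norm_of_nonneg hδ.le]
    nlinarith
  let κ : Metric.closedBall (0 : ℂ) 1 → ClosedSurface g := fun x => χ (c + δ * (x : ℂ))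
  have hκ : Continuous κ := hχ.cont.comp_continuous (by fun_prop) hmem
  have hδ0 : (δ : ℂ) ≠ 0 := by exact_mod_cast hδ.ne'
  have hinj : Function.Injective κ := by
    intro x y h
    have := hχ.inj (hmem x) (hmem y) h
    exact Subtype.ext (mul_left_cancel₀ hδ0 (add_left_cancel this))
  let O : Set (Metric.closedBall (0 : ℂ) 1) := {x | ‖(x : ℂ)‖ < 1}
  have himg : κ '' O = χ '' Metric.ball c δ := by
    ext y
    constructor
    · rintro ⟨⟨x, hx⟩, hxO, rfl⟩
      refine ⟨_, ?_, rfl⟩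
      replace hxO : ‖x‖ < 1 := hxO
      simp only [Metric.mem_ball, dist_self_add_left, norm_mul, Complex.norm_real,
        Real.norm_of_nonneg hδ.le]
      nlinarith
    · rintro ⟨z, hz, rfl⟩
      have hlt : ‖(δ : ℂ)⁻¹ * (z - c)‖ < 1 := by
        rw [norm_mul, norm_inv, Complex.norm_real, Real.norm_of_nonneg hδ.le, ← dist_eq_norm,
          inv_mul_lt_one₀ hδ]
        exact hz
      refine ⟨⟨(δ : ℂ)⁻¹ * (z - c), by rw [mem_closedBall_zero_iff]; exact hlt.le⟩, hlt, ?_⟩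
      simp only [κ]
      rw [mul_inv_cancel_left₀ hδ0, add_sub_cancel]
  have hO : IsOpen (κ '' O) := by
    rw [himg]
    exact hχ.isOpen _ subset_rfl Metric.isOpen_ball
  have hκ0 : κ ⟨0, by simp⟩ = χ c := by simp [κ]
  filter_upwards [hO.mem_nhds ⟨⟨0, by simp⟩, by simp [O], hκ0⟩]
  rintro _ ⟨q, hq, rfl⟩
  obtain ⟨h, h0, hB⟩ := exists_disc_homeomorph hq
  obtain ⟨D, hD, hD'⟩ := exists_homeomorph_extension hκ hinj hO h
    fun k hk => hB k (not_lt.mp hk)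
  refine ⟨D, fun x hx => hD' x ?_, ?_⟩
  · rintro ⟨k, -, rfl⟩
    exact hsub (hmem k) hx
  · rw [← hκ0, hD]
    exact congrArg κ (Subtype.ext h0)

/-- Being in the same orbit is an equivalence relation that holds locally, so it holds throughout
the preconnected set `Fᶜ`. -/
theorem exists_homeomorph_apply_eq {F : Set (ClosedSurface g)} (hF : F.Finite)
    (hconn : IsPreconnected Fᶜ) {a b : ClosedSurface g} (ha : a ∉ F) (hb : b ∉ F) :
    ∃ D : ClosedSurface g ≃ₜ ClosedSurface g, (∀ x ∈ F, D x = x) ∧ D a = b := by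
  refine hconn.induction₂
    (fun a b => ∃ D : ClosedSurface g ≃ₜ ClosedSurface g, (∀ x ∈ F, D x = x) ∧ D a = b)
    (fun x hx => nhdsWithin_le_nhds (eventually_exists_homeomorph hF hx)) ?_ ?_ ha hb
  · rintro x y z _ _ _ ⟨D, hD, rfl⟩ ⟨E, hE, rfl⟩
    exact ⟨D.trans E, fun x hx => by simp [hD x hx, hE x hx], rfl⟩
  · rintro x y _ _ ⟨D, hD, rfl⟩
    exact ⟨D.symm, fun x hx => by rw [Homeomorph.symm_apply_eq, hD x hx], by simp⟩

/-- A finite set can be moved to any other one, if the complements of the parts of the second one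
are connected. -/
theorem exists_homeomorph_image_eq (p : ℕ → ClosedSurface g)
    (hp : ∀ n, IsPreconnected (p '' Iio n)ᶜ) (hpinj : Function.Injective p) (n : ℕ)
    (F : Finset (ClosedSurface g)) (hF : F.card = n) :
    ∃ D : ClosedSurface g ≃ₜ ClosedSurface g, D '' (F : Set (ClosedSurface g)) = p '' Iio n := by
  classical
  induction n generalizing F with
  | zero =>
    rw [Finset.card_eq_zero] at hF
    exact ⟨Homeomorph.refl _, by simp [hF]⟩
  | succ n ih =>
    obtain ⟨a, G, haG, rfl, hG⟩ := Finset.card_eq_succ.mp hF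
    obtain ⟨D, hD⟩ := ih G hG
    have hpn : p n ∉ p '' Iio n := by
      rintro ⟨k, hk, hkn⟩
      exact (ne_of_lt hk) (hpinj hkn)
    have hDa : D a ∉ p '' Iio n := by
      rw [← hD]
      rintro ⟨b, hb, hab⟩
      exact haG (D.injective hab ▸ hb)
    -- The second homeomorphism moves the new point while it fixes the points that are already in
    -- place.
    obtain ⟨E, hE, hEa⟩ := exists_homeomorph_apply_eq ((finite_Iio n).image p) (hp n) hDa hpn
    refine ⟨D.trans E, ?_⟩
    have : (D.trans E) '' (G : Set (ClosedSurface g)) = p '' Iio n := by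
      rw [show ⇑(D.trans E) = E ∘ D from rfl, image_comp, hD]
      exact EqOn.image_eq_self hE
    rw [Finset.coe_insert, image_insert_eq, this, Homeomorph.trans_apply, hEa, ← image_insert_eq,
      show Iio (n + 1) = insert n (Iio n) by ext k; simp only [mem_Iio, mem_insert_iff]; omega]

end Homogeneity

/-! ### Half planes with bumps -/

section UpClosed

open Topology Set

/-- Subsets of the closed upper half plane that are closed under upward translation and contain a
half plane. -/
structure UpClosed (A : Set ℂ) : Prop where
  im_nonneg : ∀ z ∈ A, 0 ≤ z.im
  add_mem : ∀ z ∈ A, ∀ s : ℝ, 0 ≤ s → z + s * Complex.I ∈ A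
  mem_of_le : ∀ z : ℂ, 3 ≤ z.im → z ∈ A

/-- Pushing up by `3` moves the set into a convex half plane that it contains, where a straight-line
homotopy contracts it to `3i`. -/
theorem UpClosed.contractibleSpace {A : Set ℂ} (h : UpClosed A) : ContractibleSpace A := by
  rw [contractible_iff_id_nullhomotopic]
  have h3 : ∀ z ∈ A, z + ((3 : ℝ) : ℂ) * Complex.I ∈ A := fun z hz => h.add_mem z hz 3 (by norm_num)
  let f : C(A, A) := ⟨fun z => ⟨(z : ℂ) + ((3 : ℝ) : ℂ) * Complex.I, h3 z z.2⟩, by fun_prop⟩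
  let c : A := ⟨((3 : ℝ) : ℂ) * Complex.I, h.mem_of_le _ (by simp)⟩
  have H1 : (ContinuousMap.id A).Homotopic f := by
    refine ⟨⟨⟨fun p => ⟨(p.2 : ℂ) + (((p.1 : ℝ) * 3 : ℝ) : ℂ) * Complex.I,
      h.add_mem _ p.2.2 _ (mul_nonneg p.1.2.1 (by norm_num))⟩, ?_⟩, ?_, ?_⟩⟩
    · refine Continuous.subtype_mk ?_ _
      have : Continuous fun p : unitInterval × A => (((p.1 : ℝ) * 3 : ℝ) : ℂ) :=
        Complex.continuous_ofReal.comp (by fun_prop)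
      fun_prop
    · intro z; exact Subtype.ext (by simp)
    · intro z; exact Subtype.ext (by simp [f])
  have H2 : f.Homotopic (ContinuousMap.const A c) := by
    refine ⟨⟨⟨fun p => ⟨((1 - (p.1 : ℝ) : ℝ) : ℂ) * (p.2 : ℂ) + ((3 : ℝ) : ℂ) * Complex.I,
      h.mem_of_le _ ?_⟩, ?_⟩, ?_, ?_⟩⟩
    · simp only [Complex.add_im, Complex.im_ofReal_mul, Complex.I_im]
      nlinarith [h.im_nonneg _ p.2.2, p.1.2.2]
    · refine Continuous.subtype_mk ?_ _
      have : Continuous fun p : unitInterval × A => ((1 - (p.1 : ℝ) : ℝ) : ℂ) :=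
        Complex.continuous_ofReal.comp (by fun_prop)
      fun_prop
    · intro z; exact Subtype.ext (by simp [f])
    · intro z; exact Subtype.ext (by simp [c])
  exact ⟨c, H1.trans H2⟩

theorem norm_le_norm_add_mul_I {w : ℂ} (hw : 0 ≤ w.im) {s : ℝ} (hs : 0 ≤ s) :
    ‖w‖ ≤ ‖w + s * Complex.I‖ := by
  rw [Complex.norm_def, Complex.norm_def]
  refine Real.sqrt_le_sqrt ?_
  simp only [Complex.normSq_apply, Complex.add_re, Complex.add_im, Complex.re_ofReal_mul,
    Complex.im_ofReal_mul, Complex.I_re, Complex.I_im]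
  nlinarith

theorem norm_sub_le_norm_add_mul_I_sub {z c : ℂ} (hc : c.im = 0) (hz : 0 ≤ z.im) {s : ℝ}
    (hs : 0 ≤ s) : ‖z - c‖ ≤ ‖z + s * Complex.I - c‖ := by
  rw [add_sub_right_comm]
  exact norm_le_norm_add_mul_I (by simp [hc, hz]) hs

theorem UpClosed.inter {A B : Set ℂ} (hA : UpClosed A) (hB : UpClosed B) : UpClosed (A ∩ B) :=
  ⟨fun z hz => hA.1 z hz.1, fun z hz s hs => ⟨hA.2 z hz.1 s hs, hB.2 z hz.2 s hs⟩,
    fun z hz => ⟨hA.3 z hz, hB.3 z hz⟩⟩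

theorem UpClosed.isPathConnected {A : Set ℂ} (h : UpClosed A) : IsPathConnected A := by
  have := h.contractibleSpace
  rw [isPathConnected_iff_pathConnectedSpace]
  infer_instance

end UpClosed

/-! ### The standard punctured surface -/

section Standard

open Topology Set

/-- An increasing sequence of radii between `1` and `3 / 2`. -/
def rad (j : ℕ) : ℝ := 1 + (1 - 1 / ((j : ℝ) + 1)) / 2

theorem rad_strictMono : StrictMono rad := by
  intro i j hij
  have h1 : (0 : ℝ) < (i : ℝ) + 1 := by positivity
  have h2 : (i : ℝ) + 1 < (j : ℝ) + 1 := by exact_mod_cast Nat.succ_lt_succ hij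
  have := one_div_lt_one_div_of_lt h1 h2
  simp only [rad]
  linarith

theorem rad_zero : rad 0 = 1 := by simp [rad]

theorem one_lt_rad {j : ℕ} (hj : 0 < j) : 1 < rad j := rad_zero ▸ rad_strictMono hj

theorem one_le_rad (j : ℕ) : 1 ≤ rad j := rad_zero ▸ rad_strictMono.monotone (Nat.zero_le j)

theorem rad_lt (j : ℕ) : rad j < 3 / 2 := by
  have : (0 : ℝ) < 1 / ((j : ℝ) + 1) := by positivity
  simp only [rad]
  linarith

/-- The punctures lie on the negative real axis. -/
def punct (k : ℕ) : ℂ := ((-rad (4 * k + 3) : ℝ) : ℂ)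

variable (g n : ℕ)

theorem mem_planeInt_of_real {x : ℝ} (h1 : 1 < |x|) (h2 : x < 2) : (x : ℂ) ∈ PlaneInt g := by
  intro j _
  have hj : (0 : ℝ) ≤ j := Nat.cast_nonneg j
  have e1 : ‖(x : ℂ) - 6 * (j : ℂ)‖ = |x - 6 * j| := by
    rw [← Real.norm_eq_abs, ← Complex.norm_real]; push_cast; rfl
  have e2 : ‖(x : ℂ) - (6 * (j : ℂ) + 3)‖ = |x - (6 * j + 3)| := by
    rw [← Real.norm_eq_abs, ← Complex.norm_real]; push_cast; rfl
  rw [e1, e2]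
  constructor
  · rcases Nat.eq_zero_or_pos j with rfl | hj
    · simpa using h1
    · have : (1 : ℝ) ≤ j := by exact_mod_cast hj
      rw [lt_abs]; right; linarith
  · rw [lt_abs]; right; linarith

theorem punct_mem_planeInt (k : ℕ) : punct k ∈ PlaneInt g := by
  refine mem_planeInt_of_real g ?_ ?_
  · rw [abs_neg, lt_abs]; exact Or.inl (one_lt_rad (by omega))
  · linarith [one_le_rad (4 * k + 3)]

/-- The punctures of the standard punctured surface. -/
def surfPunct (k : ℕ) : ClosedSurface g := proj g (punct k)

theorem surfPunct_injective : Function.Injective (surfPunct g) := by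
  intro k l h
  have h1 : punct k = punct l :=
    proj_inj_of_int (planeInt_subset (punct_mem_planeInt g k)) (punct_mem_planeInt g l) h
  have h2 := neg_injective (Complex.ofReal_injective h1)
  have := rad_strictMono.injective h2
  omega

/-- The standard surface of genus `g` with `n` punctures. -/
abbrev StdSurface : Type := {x : ClosedSurface g // x ∉ surfPunct g '' Iio n}

/-- The finite part of the holed sphere without the punctures. -/
def Omega : Set ℂ := Plane g ∩ {z | ∀ k < n, z ≠ punct k}

variable {g n}

theorem proj_notMem_punct {z : ℂ} (hz : z ∈ Omega g n) : proj g z ∉ surfPunct g '' Iio n := by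
  rintro ⟨k, hk, h⟩
  exact hz.2 k hk (proj_inj_of_int hz.1 (punct_mem_planeInt g k) h.symm)

theorem mem_omega_of_proj {z : ℂ} (hz : z ∈ Plane g) (h : proj g z ∉ surfPunct g '' Iio n) :
    z ∈ Omega g n :=
  ⟨hz, fun k hk h' => h ⟨k, hk, by rw [h', surfPunct]⟩⟩

/-- The point of the standard surface over a point of the plane. -/
def stdPt (z : Omega g n) : StdSurface g n := ⟨proj g z, proj_notMem_punct z.2⟩

theorem continuous_stdPt : Continuous (stdPt (g := g) (n := n)) :=
  Continuous.subtype_mk (continuousOn_proj.comp_continuous continuous_subtype_val fun z => z.2.1) _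

variable (g n) in
/-- The upper half of `Omega`. -/
def Half : Set ℂ := Omega g n ∩ {z | 0 ≤ z.im}

/-- A point of the closed upper half plane recedes from every real point when it moves up, and all
holes and punctures have real centres. -/
theorem upClosed_half : UpClosed (Half g n) := by
  refine ⟨fun z hz => hz.2, fun z hz s hs => ⟨⟨fun j hj => ⟨?_, ?_⟩, fun k hk h => ?_⟩, ?_⟩,
    fun z hz => ⟨⟨fun j _ => ⟨?_, ?_⟩, fun k hk h => ?_⟩, ?_⟩⟩
  · exact (hz.1.1 j hj).1.trans (norm_sub_le_norm_add_mul_I_sub (by simp) hz.2 hs)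
  · exact (hz.1.1 j hj).2.trans (norm_sub_le_norm_add_mul_I_sub (by simp) hz.2 hs)
  · have him : z.im + s = 0 := by simpa [punct] using congrArg Complex.im h
    have : 0 ≤ z.im := hz.2
    obtain rfl : s = 0 := by linarith
    exact hz.1.2 k hk (by simpa using h)
  · have : 0 ≤ z.im := hz.2
    simpa using add_nonneg this hs
  · refine le_trans ?_ (Complex.abs_im_le_norm _)
    rw [le_abs]; left; simp; linarith
  · refine le_trans ?_ (Complex.abs_im_le_norm _)
    rw [le_abs]; left; simp; linarith
  · have : z.im = 0 := by simpa [punct] using congrArg Complex.im h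
    linarith
  · exact le_trans (by norm_num) hz

/-- Because of this, holonomies within one half depend only on the end points. -/
instance : ContractibleSpace (Half g n) := upClosed_half.contractibleSpace

/-- The identity or the conjugation. -/
def flip (s : Bool) (z : ℂ) : ℂ := bif s then conj z else z

@[simp] theorem flip_false (z : ℂ) : flip false z = z := rfl

@[simp] theorem flip_true (z : ℂ) : flip true z = conj z := rfl

theorem flip_flip (s : Bool) (z : ℂ) : flip s (flip s z) = z := by cases s <;> simp

theorem continuous_flip (s : Bool) : Continuous (flip s) := by
  cases s
  · exact continuous_id
  · exact Complex.continuous_conj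

theorem flip_ofReal (s : Bool) (x : ℝ) : flip s x = x := by cases s <;> simp

theorem norm_flip (s : Bool) (z : ℂ) : ‖flip s z‖ = ‖z‖ := by cases s <;> simp

theorem flip_re (s : Bool) (z : ℂ) : (flip s z).re = z.re := by cases s <;> simp

theorem flip_add (s : Bool) (z w : ℂ) : flip s (z + w) = flip s z + flip s w := by cases s <;> simp

theorem flip_sub (s : Bool) (z w : ℂ) : flip s (z - w) = flip s z - flip s w := by cases s <;> simp

theorem flip_mem_omega (s : Bool) {z : ℂ} : flip s z ∈ Omega g n ↔ z ∈ Omega g n := by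
  have key : ∀ z ∈ Omega g n, flip s z ∈ Omega g n := by
    intro z hz
    have h6 : ∀ j : ℕ, flip s (6 * (j : ℂ)) = 6 * (j : ℂ) := fun j => by
      have := flip_ofReal s (6 * j); push_cast at this; exact this
    have h63 : ∀ j : ℕ, flip s (6 * (j : ℂ) + 3) = 6 * (j : ℂ) + 3 := fun j => by
      have := flip_ofReal s (6 * j + 3); push_cast at this; exact this
    refine ⟨fun j hj => ?_, fun k hk h => hz.2 k hk ?_⟩
    · rw [← h63 j, ← h6 j, ← flip_sub, ← flip_sub, norm_flip, norm_flip]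
      rw [h6]
      exact hz.1 j hj
    · rw [← flip_flip s z, h, punct, flip_ofReal]
  exact ⟨fun h => flip_flip s z ▸ key _ h, key z⟩

/-- The two halves of the standard surface. -/
def halfMap (s : Bool) : C(Half g n, StdSurface g n) :=
  ⟨fun z => stdPt ⟨flip s z, (flip_mem_omega s).mpr z.2.1⟩,
    continuous_stdPt.comp (Continuous.subtype_mk ((continuous_flip s).comp continuous_subtype_val) _)⟩

theorem halfMap_coe (s : Bool) (z : Half g n) : (halfMap s z : ClosedSurface g) = proj g (flip s z) :=
  rfl

theorem exists_half {z : ℂ} (hz : z ∈ Omega g n) : ∃ s, ∃ w ∈ Half g n, z = flip s w := by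
  rcases le_total 0 z.im with h | h
  · exact ⟨false, z, ⟨hz, h⟩, rfl⟩
  · exact ⟨true, conj z, ⟨(flip_mem_omega true).mpr hz, by simpa using h⟩, by simp⟩

theorem real_mem_half {x : ℝ} (h1 : 1 ≤ |x|) (h2 : x ≤ 2) (h3 : ∀ k < n, x ≠ -rad (4 * k + 3)) :
    (x : ℂ) ∈ Half g n := by
  refine ⟨⟨fun j _ => ?_, fun k hk h => h3 k hk (Complex.ofReal_injective h)⟩, by simp⟩
  have hj : (0 : ℝ) ≤ j := Nat.cast_nonneg j
  have e1 : ‖(x : ℂ) - 6 * (j : ℂ)‖ = |x - 6 * j| := by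
    rw [← Real.norm_eq_abs, ← Complex.norm_real]; push_cast; rfl
  have e2 : ‖(x : ℂ) - (6 * (j : ℂ) + 3)‖ = |x - (6 * j + 3)| := by
    rw [← Real.norm_eq_abs, ← Complex.norm_real]; push_cast; rfl
  rw [e1, e2]
  constructor
  · rcases Nat.eq_zero_or_pos j with rfl | hj
    · simpa using h1
    · have : (1 : ℝ) ≤ j := by exact_mod_cast hj
      rw [le_abs]; right; linarith
  · rw [le_abs]; right; linarith

theorem pos_real_mem_half {x : ℝ} (h1 : 1 ≤ x) (h2 : x ≤ 2) : (x : ℂ) ∈ Half g n :=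
  real_mem_half (by rwa [abs_of_nonneg (by linarith)]) h2 fun k _ h => by
    linarith [one_le_rad (4 * k + 3)]

theorem I_mem_half : Complex.I ∈ Half g n := by
  have hle : ∀ x : ℝ, 1 ≤ ‖Complex.I - x‖ := fun x => by
    refine le_trans ?_ (Complex.abs_im_le_norm _)
    simp
  refine ⟨⟨fun j _ => ⟨?_, ?_⟩, fun k hk h => ?_⟩, by simp⟩
  · have := hle (6 * j); push_cast at this; exact this
  · have := hle (6 * j + 3); push_cast at this; exact this
  · simpa [punct] using congrArg Complex.im h

theorem isPathConnected_compl_punct : IsPathConnected (surfPunct g '' Iio n)ᶜ := by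
  have hhalf : ∀ s, IsPathConnected (Subtype.val '' (range (halfMap (g := g) (n := n) s))) :=
    fun s => (isPathConnected_range (halfMap s).continuous).image continuous_subtype_val
  have hsub : ∀ s, Subtype.val '' (range (halfMap (g := g) (n := n) s)) ⊆
      (surfPunct g '' Iio n)ᶜ := by
    rintro s _ ⟨x, -, rfl⟩
    exact x.2
  have hjoin : ∀ z ∈ Omega g n, JoinedIn (surfPunct g '' Iio n)ᶜ (proj g ((2 : ℝ) : ℂ)) (proj g z) := by
    intro z hz
    obtain ⟨s, w, hw, rfl⟩ := exists_half hz
    refine ((hhalf s).joinedIn _ ⟨_, ⟨⟨((2 : ℝ) : ℂ), pos_real_mem_half (by norm_num) le_rfl⟩, rfl⟩, ?_⟩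
      _ ⟨_, ⟨⟨w, hw⟩, rfl⟩, rfl⟩).mono (hsub s)
    rw [halfMap_coe, flip_ofReal]
  have h2 : ((2 : ℝ) : ℂ) ∈ Omega g n := (pos_real_mem_half (by norm_num) le_rfl).1
  refine ⟨proj g ((2 : ℝ) : ℂ), proj_notMem_punct h2, fun {y} hy => ?_⟩
  rcases exists_proj y with rfl | ⟨z, hz, rfl⟩
  -- The point at infinity is joined to a finite point inside the disc of the chart at infinity.
  -- This disc contains no puncture, since the punctures have norm below `3 / 2` and the finite
  -- points of the disc have norm at least `5`.
  · have hch := isChart_infty (g := g)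
    set ρ := 1 / (6 * (g : ℝ) + 5) with hρ
    have hmemP : ∀ w ∈ Metric.closedBall (0 : ℂ) ρ, sproj g (sphereInv w) ∈ (surfPunct g '' Iio n)ᶜ := by
      rintro w hw ⟨k, hk, h⟩
      have hwm : sphereInv w ∈ HoledSphere g := by
        rcases eq_or_ne w 0 with rfl | hw0
        · rw [sphereInv_zero]; exact infty_mem_holedSphere
        · rw [sphereInv_of_ne hw0, coe_mem_holedSphere]
          refine planeInt_subset (mem_planeInt_of_norm ?_)
          rw [mem_closedBall_zero_iff, hρ, one_div] at hw
          rw [norm_inv]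
          have := (le_inv_comm₀ (by positivity) (norm_pos_iff.mpr hw0)).mpr hw
          linarith
      rcases sproj_eq_sproj (coe_mem_holedSphere.mpr (planeInt_subset (punct_mem_planeInt g k))) hwm h
        with h | ⟨i, hi, u, hu, ⟨h, -⟩ | ⟨-, h⟩⟩
      · rcases eq_or_ne w 0 with rfl | hw0
        · rw [sphereInv_zero] at h; exact OnePoint.coe_ne_infty _ h
        · rw [sphereInv_of_ne hw0] at h
          have h := OnePoint.coe_injective h
          have h1 : ‖w⁻¹‖ < 3 / 2 := by
            rw [← h, punct, Complex.norm_real, norm_neg, Real.norm_of_nonneg (by linarith [one_le_rad (4 * k + 3)])]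
            exact rad_lt _
          rw [mem_closedBall_zero_iff] at hw
          rw [norm_inv, inv_lt_comm₀ (norm_pos_iff.mpr hw0) (by norm_num)] at h1
          have : ρ ≤ 1 / 5 := one_div_le_one_div_of_le (by norm_num) (by linarith [Nat.cast_nonneg (α := ℝ) g])
          norm_num at h1
          linarith
      · have := punct_mem_planeInt g k
        rw [OnePoint.coe_injective h] at this
        exact footL_notMem_planeInt hi hu this
      · have := punct_mem_planeInt g k
        rw [OnePoint.coe_injective h] at this
        exact footR_notMem_planeInt hi hu this
    have hball : IsPathConnected (Metric.closedBall (0 : ℂ) ρ) :=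
      (convex_closedBall _ _).isPathConnected ⟨0, Metric.mem_closedBall_self hch.pos.le⟩
    have hρC : (ρ : ℂ) ≠ 0 := by exact_mod_cast hch.pos.ne'
    have hρm : (ρ : ℂ) ∈ Metric.closedBall (0 : ℂ) ρ := by
      rw [mem_closedBall_zero_iff, Complex.norm_real, Real.norm_of_nonneg hch.pos.le]
    have hj : JoinedIn (surfPunct g '' Iio n)ᶜ (sproj g (sphereInv ρ)) (sproj g (sphereInv 0)) :=
      ((hball.image' hch.cont).joinedIn _ ⟨ρ, hρm, rfl⟩ _
        ⟨0, Metric.mem_closedBall_self hch.pos.le, rfl⟩).mono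
        (by rintro _ ⟨w, hw, rfl⟩; exact hmemP w hw)
    rw [sphereInv_of_ne hρC, sphereInv_zero] at hj
    refine (hjoin _ (mem_omega_of_proj ?_ (hj.source_mem))).trans hj
    refine planeInt_subset (mem_planeInt_of_norm ?_)
    rw [norm_inv, Complex.norm_real, Real.norm_of_nonneg hch.pos.le, hρ, one_div, inv_inv]
    linarith
  · exact hjoin z (mem_omega_of_proj hz hy)

instance : PathConnectedSpace (StdSurface g n) :=
  isPathConnected_iff_pathConnectedSpace.mp isPathConnected_compl_punct

/-- Every surface of genus `g` with `n` punctures is homeomorphic to the standard one. -/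
theorem IsSurface.nonempty_homeomorph {S : Type*} [TopologicalSpace S] (h : IsSurface g n S) :
    Nonempty (S ≃ₜ StdSurface g n) := by
  obtain ⟨F, hF, ⟨e⟩⟩ := h
  obtain ⟨D, hD⟩ := exists_homeomorph_image_eq (surfPunct g)
    (fun n => isPathConnected_compl_punct.isConnected.isPreconnected) (surfPunct_injective g) n F hF
  refine ⟨e.trans (D.subtype fun x => ?_)⟩
  rw [not_iff_not, ← hD, D.injective.mem_set_image, Finset.mem_coe]

end Standard

/-! ### Dehn twists acting on holonomies -/

section TwistAction

open Topology Set

variable {Y : Type*} [TopologicalSpace Y] [T2Space Y] {x₀ : Y} {τ : ∀ y : Y, Path x₀ y}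

/-- The automorphism that belongs to a Dehn twist, up to the factors `μ` of the end points. -/
theorem exists_twist_action (hτ : τ x₀ = Path.refl x₀) {κ : Annulus → Y} (hκ : Continuous κ)
    (hinj : Function.Injective κ) (hO : IsOpen (κ '' openAnnulus)) (hx₀ : x₀ ∉ κ '' openAnnulus) :
    ∃ φ ∈ inducedAut τ, ∃ μ : Y → FundamentalGroup Y x₀, μ x₀ = 1 ∧
      (∀ (a b : Y) (p : Path a b), (∀ t, p t ∉ κ '' openAnnulus) →
        φ (hol τ p) = μ a * hol τ p * (μ b)⁻¹) ∧
      ∀ s : ℝ, φ (holMap τ (crossMap hκ (s : UnitAddCircle)) 0 1) =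
        μ (κ (s, 0)) * (holMap τ (coreMap hκ 0) s (s + 1) *
          holMap τ (crossMap hκ (s : UnitAddCircle)) 0 1) * (μ (κ (s, 1)))⁻¹ := by
  obtain ⟨D, hD, hD'⟩ := exists_twist hκ hinj hO
  obtain ⟨φ, hφ⟩ := exists_isInduced hτ D (hD' _ hx₀)
  obtain ⟨μ, hμ, hact⟩ := hφ.exists_apply hτ
  refine ⟨φ, ⟨D, hφ⟩, μ, hμ, fun a b p hp => ?_, fun s => ?_⟩
  · rw [hact, hol_congr τ (p.map D.continuous) p fun t => hD' _ (hp t)]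
  · rw [← holMap_twist_crossMap τ hκ (D : C(Y, Y)) hD s, ← holMap_eq τ _ realPath, hact,
      ← holMap_eq τ _ realPath]
    simp only [crossMap, ContinuousMap.coe_mk, Set.projIcc_left, Set.projIcc_right]
    rfl

end TwistAction

/-! ### Holonomies in the two halves of the standard surface -/

section Halves

open Topology Set

variable {g n : ℕ}

variable (g n) in
/-- The base point of the standard surface. -/
def stdBase : StdSurface g n := stdPt ⟨Complex.I, I_mem_half.1⟩

/-- The point of the standard surface over a point of the plane (with a default value). -/
def stdP (z : ℂ) : StdSurface g n :=
  open Classical in if h : z ∈ Omega g n then stdPt ⟨z, h⟩ else stdBase g n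

theorem stdP_eq {z : ℂ} (h : z ∈ Omega g n) : stdP z = stdPt ⟨z, h⟩ := dif_pos h

theorem stdP_coe {z : ℂ} (h : z ∈ Omega g n) : (stdP z : StdSurface g n).1 = proj g z := by
  rw [stdP_eq h]; rfl

theorem stdP_I : (stdP Complex.I : StdSurface g n) = stdBase g n := stdP_eq _

theorem stdP_congr {z w : ℂ} (hz : z ∈ Omega g n) (hw : w ∈ Omega g n) (h : proj g z = proj g w) :
    (stdP z : StdSurface g n) = stdP w := by
  apply Subtype.ext
  rw [stdP_coe hz, stdP_coe hw, h]

theorem continuousOn_stdP : ContinuousOn (stdP (g := g) (n := n)) (Omega g n) := by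
  rw [continuousOn_iff_continuous_domRestrict]
  have : (Omega g n).domRestrict (stdP (g := g) (n := n)) = stdPt := by
    ext x
    exact congrArg _ (stdP_eq x.2)
  rw [this]
  exact continuous_stdPt

theorem half_subset {z : ℂ} (hz : z ∈ Half g n) (s : Bool) : flip s z ∈ Omega g n :=
  (flip_mem_omega s).mpr hz.1

theorem halfMap_eq_stdP (s : Bool) (z : Half g n) : halfMap s z = stdP (flip s z) :=
  (stdP_eq (half_subset z.2 s)).symm

theorem exists_stdTether : ∃ τ : ∀ y : StdSurface g n, Path (stdBase g n) y,
    τ (stdBase g n) = Path.refl _ := by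
  classical
  refine ⟨fun y => if h : y = stdBase g n then (Path.refl _).cast rfl h else
    PathConnectedSpace.somePath _ _, ?_⟩
  simp

variable (τ : ∀ y : StdSurface g n, Path (stdBase g n) y)

/-- The holonomy of paths in the upper (`s = false`) or lower (`s = true`) half of the surface; for
the lower half, the end points are replaced by their conjugates. -/
def hh (s : Bool) (a b : ℂ) : FundamentalGroup (StdSurface g n) (stdBase g n) :=
  open Classical in
  if h : a ∈ Half g n ∧ b ∈ Half g n then holMap τ (halfMap s) ⟨a, h.1⟩ ⟨b, h.2⟩ else 1

theorem hh_eq (s : Bool) {a b : ℂ} (ha : a ∈ Half g n) (hb : b ∈ Half g n) :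
    hh τ s a b = holMap τ (halfMap s) ⟨a, ha⟩ ⟨b, hb⟩ := dif_pos ⟨ha, hb⟩

theorem hh_mul (s : Bool) {a b c : ℂ} (ha : a ∈ Half g n) (hb : b ∈ Half g n) (hc : c ∈ Half g n) :
    hh τ s a b * hh τ s b c = hh τ s a c := by
  rw [hh_eq τ s ha hb, hh_eq τ s hb hc, hh_eq τ s ha hc, holMap_mul]

theorem hh_self (s : Bool) (a : ℂ) : hh τ s a a = 1 := by
  by_cases ha : a ∈ Half g n
  · rw [hh_eq τ s ha ha, holMap_self]
  · exact dif_neg fun h => ha h.1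

theorem hh_inv (s : Bool) (a b : ℂ) : (hh τ s a b)⁻¹ = hh τ s b a := by
  by_cases h : a ∈ Half g n ∧ b ∈ Half g n
  · rw [hh_eq τ s h.1 h.2, hh_eq τ s h.2 h.1, holMap_inv]
  · rw [hh, dif_neg h, hh, dif_neg fun h' => h h'.symm, inv_one]

/-- The path in a set that a continuous function on an interval describes. -/
def arcPath {A : Set ℂ} {f : ℝ → ℂ} {s t : ℝ} (hst : s ≤ t) (hf : ContinuousOn f (Icc s t))
    (hA : ∀ r ∈ Icc s t, f r ∈ A) :
    Path (⟨f s, hA s (left_mem_Icc.mpr hst)⟩ : A) ⟨f t, hA t (right_mem_Icc.mpr hst)⟩ where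
  toFun r := ⟨f (segPath s t r), hA _ (segPath_mem (convex_Icc s t) (left_mem_Icc.mpr hst)
    (right_mem_Icc.mpr hst) r)⟩
  continuous_toFun := Continuous.subtype_mk (hf.comp_continuous (segPath s t).continuous
    fun r => segPath_mem (convex_Icc s t) (left_mem_Icc.mpr hst) (right_mem_Icc.mpr hst) r) _
  source' := by simp
  target' := by simp

theorem holMap_eq_hh (σ : Bool) (ψ : C(ℝ, StdSurface g n)) {f : ℝ → ℂ} {s t : ℝ} (hst : s ≤ t)
    (hf : ContinuousOn f (Icc s t)) (hA : ∀ r ∈ Icc s t, f r ∈ Half g n)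
    (h : ∀ r ∈ Icc s t, ψ r = stdP (flip σ (f r))) : holMap τ ψ s t = hh τ σ (f s) (f t) := by
  rw [hh_eq τ σ (hA s (left_mem_Icc.mpr hst)) (hA t (right_mem_Icc.mpr hst))]
  refine holMap_congr τ _ _ (segPath s t) (arcPath hst hf hA) fun r => ?_
  rw [halfMap_eq_stdP]
  exact h _ (segPath_mem (convex_Icc s t) (left_mem_Icc.mpr hst) (right_mem_Icc.mpr hst) r)

theorem hh_congr (σ σ' : Bool) {f f' : ℝ → ℂ} {s t : ℝ} (hst : s ≤ t)
    (hf : ContinuousOn f (Icc s t)) (hA : ∀ r ∈ Icc s t, f r ∈ Half g n)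
    (hf' : ContinuousOn f' (Icc s t)) (hA' : ∀ r ∈ Icc s t, f' r ∈ Half g n)
    (h : ∀ r ∈ Icc s t, proj g (flip σ (f r)) = proj g (flip σ' (f' r))) :
    hh τ σ (f s) (f t) = hh τ σ' (f' s) (f' t) := by
  rw [hh_eq τ σ (hA s (left_mem_Icc.mpr hst)) (hA t (right_mem_Icc.mpr hst)),
    hh_eq τ σ' (hA' s (left_mem_Icc.mpr hst)) (hA' t (right_mem_Icc.mpr hst))]
  refine holMap_congr τ _ _ (arcPath hst hf hA) (arcPath hst hf' hA') fun r => ?_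
  have hr := segPath_mem (convex_Icc s t) (left_mem_Icc.mpr hst) (right_mem_Icc.mpr hst) r
  rw [halfMap_eq_stdP, halfMap_eq_stdP]
  exact stdP_congr (half_subset (hA _ hr) σ) (half_subset (hA' _ hr) σ') (h _ hr)

/-- On a real interval in the surface, both halves agree. -/
theorem hh_real (σ σ' : Bool) {x y : ℝ} (h : ∀ r ∈ uIcc x y, (r : ℂ) ∈ Half g n) :
    hh τ σ x y = hh τ σ' x y := by
  have key : ∀ x y : ℝ, x ≤ y → (∀ r ∈ Icc x y, (r : ℂ) ∈ Half g n) →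
      hh τ σ x y = hh τ σ' x y := fun x y hxy h =>
    hh_congr τ σ σ' hxy Complex.continuous_ofReal.continuousOn h
      Complex.continuous_ofReal.continuousOn h fun r _ => by rw [flip_ofReal, flip_ofReal]
  rcases le_total x y with hxy | hxy
  · exact key x y hxy (by rwa [uIcc_of_le hxy] at h)
  · rw [← hh_inv, ← hh_inv τ σ', key y x hxy (by rwa [uIcc_of_ge hxy] at h)]

theorem notMem_punct_of_notMem_planeInt {z : ℂ} (hz : z ∈ Plane g) (h : z ∉ PlaneInt g) :
    z ∈ Omega g n := ⟨hz, fun k _ hk => h (hk ▸ punct_mem_planeInt g k)⟩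

theorem footL_mem_half {j : ℕ} (hj : j < g) {u : ℂ} (hu : ‖u‖ = 1) (him : 0 ≤ u.im) :
    6 * (j : ℂ) + u ∈ Half g n :=
  ⟨notMem_punct_of_notMem_planeInt (footL_add_mem hu.ge (by linarith))
    (footL_notMem_planeInt hj hu), by simpa using him⟩

theorem footR_mem_half {j : ℕ} (hj : j < g) {u : ℂ} (hu : ‖u‖ = 1) (him : 0 ≤ u.im) :
    6 * (j : ℂ) + 3 - conj u ∈ Half g n :=
  ⟨notMem_punct_of_notMem_planeInt (footR_sub_mem (by rw [RCLike.norm_conj, hu])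
    (by rw [RCLike.norm_conj]; linarith)) (footR_notMem_planeInt hj hu), by simpa using him⟩

theorem flip_six (s : Bool) (j : ℕ) : flip s (6 * (j : ℂ)) = 6 * (j : ℂ) := by
  have := flip_ofReal s (6 * j); push_cast at this; exact this

theorem flip_three (s : Bool) : flip s 3 = 3 := by
  have := flip_ofReal s 3; push_cast at this; exact this

theorem proj_flip_glue (s : Bool) {j : ℕ} (hj : j < g) {u : ℂ} (hu : ‖u‖ = 1) :
    proj g (flip s (6 * (j : ℂ) + u)) = proj g (flip s (6 * (j : ℂ) + 3 - conj u)) := by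
  rw [flip_add, flip_sub, flip_add, flip_six, flip_three, proj_glue hj (by rwa [norm_flip])]
  cases s <;> rfl

/-- The arcs on both ends of a handle agree. -/
theorem hh_glue (s : Bool) {j : ℕ} (hj : j < g) {u v : ℂ} (hu : ‖u‖ = 1) (hv : ‖v‖ = 1)
    (hu' : 0 ≤ u.im) (hv' : 0 ≤ v.im) :
    hh τ s (6 * (j : ℂ) + u) (6 * (j : ℂ) + v) =
      hh τ s (6 * (j : ℂ) + 3 - conj u) (6 * (j : ℂ) + 3 - conj v) := by
  have key : ∀ α β : ℝ, α ≤ β → 0 ≤ α → β ≤ Real.pi →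
      hh τ s (6 * (j : ℂ) + Complex.exp (α * Complex.I)) (6 * (j : ℂ) + Complex.exp (β * Complex.I)) =
      hh τ s (6 * (j : ℂ) + 3 - conj (Complex.exp (α * Complex.I)))
        (6 * (j : ℂ) + 3 - conj (Complex.exp (β * Complex.I))) := by
    intro α β hαβ hα hβ
    have h1 : ∀ r : ℝ, ‖Complex.exp (r * Complex.I)‖ = 1 := Complex.norm_exp_ofReal_mul_I
    have h2 : ∀ r ∈ Icc α β, 0 ≤ (Complex.exp (r * Complex.I)).im := fun r hr => by
      rw [Complex.exp_ofReal_mul_I_im]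
      exact Real.sin_nonneg_of_nonneg_of_le_pi (hα.trans hr.1) (hr.2.trans hβ)
    have hc : Continuous fun r : ℝ => Complex.exp (r * Complex.I) := by fun_prop
    exact hh_congr τ s s (f := fun r => 6 * (j : ℂ) + Complex.exp (r * Complex.I))
      (f' := fun r => 6 * (j : ℂ) + 3 - conj (Complex.exp (r * Complex.I))) hαβ
      (by fun_prop) (fun r hr => footL_mem_half hj (h1 r) (h2 r hr))
      (continuous_const.sub (Complex.continuous_conj.comp hc)).continuousOn
      (fun r hr => footR_mem_half hj (h1 r) (h2 r hr)) fun r hr => proj_flip_glue s hj (h1 r)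
  have hex : ∀ u : ℂ, ‖u‖ = 1 → 0 ≤ u.im → ∃ α : ℝ, 0 ≤ α ∧ α ≤ Real.pi ∧
      u = Complex.exp (α * Complex.I) := by
    intro u hu hu'
    refine ⟨u.arg, Complex.arg_nonneg_iff.mpr hu', Complex.arg_le_pi u, ?_⟩
    have := Complex.norm_mul_exp_arg_mul_I u
    rw [hu, Complex.ofReal_one, one_mul] at this
    exact this.symm
  obtain ⟨α, hα0, hα, rfl⟩ := hex u hu hu'
  obtain ⟨β, hβ0, hβ, rfl⟩ := hex v hv hv'
  rcases le_total α β with h | h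
  · exact key α β h hα0 hβ
  · rw [← hh_inv, ← hh_inv τ s (6 * (j : ℂ) + 3 - conj (Complex.exp (β * Complex.I))),
      key β α h hβ0 hα]

/-- The effect of `φ` on holonomies of paths that it fixes. -/
theorem apply_hh {φ : MulAut (FundamentalGroup (StdSurface g n) (stdBase g n))}
    {μ : StdSurface g n → FundamentalGroup (StdSurface g n) (stdBase g n)} {O : Set (StdSurface g n)}
    (h : ∀ (a b : StdSurface g n) (p : Path a b), (∀ t, p t ∉ O) →
      φ (hol τ p) = μ a * hol τ p * (μ b)⁻¹) (s : Bool) {A : Set ℂ} (hA : A ⊆ Half g n)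
    (hAO : ∀ z ∈ A, stdP (flip s z) ∉ O) {a b : ℂ} (hab : JoinedIn A a b) :
    φ (hh τ s a b) = μ (stdP (flip s a)) * hh τ s a b * (μ (stdP (flip s b)))⁻¹ := by
  obtain ⟨p, hp⟩ := hab
  have ha : a ∈ A := by simpa using hp 0
  have hb : b ∈ A := by simpa using hp 1
  let q : Path (⟨a, hA ha⟩ : Half g n) ⟨b, hA hb⟩ :=
    ⟨⟨fun t => ⟨p t, hA (hp t)⟩, by fun_prop⟩, by simp, by simp⟩
  have := h _ _ (q.map (halfMap s).continuous) fun t => by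
    rw [Path.map_coe, Function.comp, halfMap_eq_stdP]
    exact hAO _ (hp t)
  rw [holMap_eq, ← hh_eq, halfMap_eq_stdP, halfMap_eq_stdP] at this
  exact this

end Halves

/-! ### Twists along round annuli -/

section Round

open Topology Set

variable {g n : ℕ}

/-- The standard parametrization of the unit circle. -/
def cis (x : UnitAddCircle) : ℂ := AddCircle.toCircle x

theorem continuous_cis : Continuous cis :=
  continuous_subtype_val.comp AddCircle.continuous_toCircle

theorem norm_cis (x : UnitAddCircle) : ‖cis x‖ = 1 := Circle.norm_coe _

theorem cis_coe (s : ℝ) : cis (s : UnitAddCircle) = Complex.exp (((2 * Real.pi * s : ℝ) : ℂ) * Complex.I) := by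
  rw [cis, AddCircle.toCircle_apply_mk, Circle.coe_exp, div_one]

theorem cis_injective : Function.Injective cis :=
  Subtype.val_injective.comp (AddCircle.injective_toCircle one_ne_zero)

theorem exists_cis {u : ℂ} (hu : ‖u‖ = 1) : ∃ x, cis x = u := by
  obtain ⟨θ, rfl⟩ := (Complex.norm_eq_one_iff u).mp hu
  refine ⟨((θ / (2 * Real.pi) : ℝ) : UnitAddCircle), ?_⟩
  rw [cis_coe, mul_div_cancel₀ _ (by positivity)]

theorem stdP_inj_of_int {z w : ℂ} (hz : z ∈ Omega g n) (hw : w ∈ Omega g n) (hwi : w ∈ PlaneInt g)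
    (h : (stdP z : StdSurface g n) = stdP w) : z = w := by
  have := congrArg Subtype.val h
  rw [stdP_coe hz, stdP_coe hw] at this
  exact proj_inj_of_int hz.1 hwi this

variable (τ : ∀ y : StdSurface g n, Path (stdBase g n) y)

/-- The arc across the annulus is taken on the real axis to the left of `c`. The outer circle based
at its outer end then runs through the lower half to `c + r₂` and back through the upper half, which
makes its holonomy a product of two symbols `hh`. Paths in a half that avoid the open annulus are
only changed by the factors at their ends. -/
theorem exists_round_twist (hτ : τ (stdBase g n) = Path.refl _) {c r₁ r₂ : ℝ} (h₁ : 0 < r₁)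
    (h₁₂ : r₁ < r₂) (hint : ∀ z : ℂ, r₁ ≤ ‖z - c‖ → ‖z - c‖ ≤ r₂ → z ∈ PlaneInt g)
    (hann : ∀ z : ℂ, r₁ ≤ ‖z - c‖ → ‖z - c‖ ≤ r₂ → z ∈ Omega g n)
    (hI : ‖Complex.I - c‖ ≤ r₁ ∨ r₂ ≤ ‖Complex.I - c‖) :
    ∃ φ ∈ inducedAut τ, ∃ μ : StdSurface g n → FundamentalGroup (StdSurface g n) (stdBase g n),
      μ (stdBase g n) = 1 ∧
      (∀ (s : Bool) (A : Set ℂ), A ⊆ Half g n → (∀ z ∈ A, ‖z - c‖ ≤ r₁ ∨ r₂ ≤ ‖z - c‖) →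
        ∀ a b : ℂ, JoinedIn A a b →
          φ (hh τ s a b) = μ (stdP (flip s a)) * hh τ s a b * (μ (stdP (flip s b)))⁻¹) ∧
      φ (hh τ false ((c - r₂ : ℝ) : ℂ) ((c - r₁ : ℝ) : ℂ)) = μ (stdP ((c - r₂ : ℝ) : ℂ)) *
        (hh τ true ((c - r₂ : ℝ) : ℂ) ((c + r₂ : ℝ) : ℂ) *
          hh τ false ((c + r₂ : ℝ) : ℂ) ((c - r₂ : ℝ) : ℂ) *
          hh τ false ((c - r₂ : ℝ) : ℂ) ((c - r₁ : ℝ) : ℂ)) * (μ (stdP ((c - r₁ : ℝ) : ℂ)))⁻¹ := by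
  -- The parameter `t` runs from the outer circle to the inner one, so the boundary circle at `t =
  -- 0`, whose holonomy the twist inserts, is the outer circle.
  let ρ : unitInterval → ℝ := fun t => r₂ + (r₁ - r₂) * t
  have hρ : ∀ t, r₁ ≤ ρ t ∧ ρ t ≤ r₂ := fun t =>
    ⟨by simp only [ρ]; nlinarith [t.2.1, t.2.2], by simp only [ρ]; nlinarith [t.2.1, t.2.2]⟩
  let Z : Annulus → ℂ := fun k => c + (ρ k.2 : ℂ) * cis k.1
  have hZc : Continuous Z := by
    have h1 : Continuous fun k : Annulus => (ρ k.2 : ℂ) := Complex.continuous_ofReal.comp (by fun_prop)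
    have h2 : Continuous fun k : Annulus => cis k.1 := continuous_cis.comp continuous_fst
    fun_prop
  have hZn : ∀ k, ‖Z k - c‖ = ρ k.2 := fun k => by
    simp only [Z, add_sub_cancel_left, norm_mul, norm_cis, mul_one, Complex.norm_real]
    exact Real.norm_of_nonneg (h₁.le.trans (hρ _).1)
  have hZi : ∀ k, Z k ∈ PlaneInt g := fun k =>
    hint _ ((hZn k).symm ▸ (hρ k.2).1) ((hZn k).symm ▸ (hρ k.2).2)
  have hZo : ∀ k, Z k ∈ Omega g n := fun k =>
    hann _ ((hZn k).symm ▸ (hρ k.2).1) ((hZn k).symm ▸ (hρ k.2).2)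
  let κ : Annulus → StdSurface g n := fun k => stdP (Z k)
  have hκ : Continuous κ := continuousOn_stdP.comp_continuous hZc hZo
  have hinj : Function.Injective κ := by
    intro k l h
    have h1 : Z k = Z l := stdP_inj_of_int (hZo k) (hZo l) (hZi l) h
    have h2 : ρ k.2 = ρ l.2 := by rw [← hZn, ← hZn, h1]
    have h3 : (k.2 : ℝ) = l.2 := by
      have : (r₁ - r₂) * (k.2 : ℝ) = (r₁ - r₂) * l.2 := add_left_cancel h2
      exact mul_left_cancel₀ (by linarith) this
    have h4 : cis k.1 = cis l.1 := by
      have h5 : (ρ k.2 : ℂ) * cis k.1 = (ρ k.2 : ℂ) * cis l.1 := by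
        have := add_left_cancel h1
        rwa [← h2] at this
      exact mul_left_cancel₀ (by exact_mod_cast (h₁.trans_le (hρ _).1).ne') h5
    exact Prod.ext (cis_injective h4) (Subtype.ext h3)
  have himg : κ '' openAnnulus = {y | ∃ z : ℂ, (r₁ < ‖z - c‖ ∧ ‖z - c‖ < r₂) ∧ y.1 = proj g z} := by
    ext y
    constructor
    · rintro ⟨k, hk, rfl⟩
      refine ⟨Z k, ?_, stdP_coe (hZo k)⟩
      rw [hZn]
      simp only [ρ]
      constructor <;> nlinarith [hk.1, hk.2]
    · rintro ⟨z, ⟨hz1, hz2⟩, hy⟩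
      have hz0 : ‖z - c‖ ≠ 0 := (h₁.trans hz1).ne'
      obtain ⟨x, hx⟩ := exists_cis (u := (z - c) / (‖z - c‖ : ℂ)) (by
        rw [norm_div, Complex.norm_real, norm_norm, div_self hz0])
      have ht : 0 < (r₂ - ‖z - c‖) / (r₂ - r₁) ∧ (r₂ - ‖z - c‖) / (r₂ - r₁) < 1 :=
        ⟨div_pos (by linarith) (by linarith), (div_lt_one (by linarith)).mpr (by linarith)⟩
      refine ⟨(x, ⟨(r₂ - ‖z - c‖) / (r₂ - r₁), ht.1.le, ht.2.le⟩), ht, ?_⟩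
      have hρz : r₂ + (r₁ - r₂) * ((r₂ - ‖z - c‖) / (r₂ - r₁)) = ‖z - c‖ := by
        have : r₂ - r₁ ≠ 0 := by linarith
        field_simp
        ring
      have hZz : Z (x, ⟨(r₂ - ‖z - c‖) / (r₂ - r₁), ht.1.le, ht.2.le⟩) = z := by
        simp only [Z, ρ, hx, hρz]
        rw [mul_div_cancel₀ _ (by exact_mod_cast hz0), add_sub_cancel]
      apply Subtype.ext
      rw [hy]
      exact (stdP_coe (hZo _)).trans (congrArg (proj g) hZz)
  have hO : IsOpen (κ '' openAnnulus) := by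
    rw [himg]
    have hV : IsOpen {z : ℂ | r₁ < ‖z - c‖ ∧ ‖z - c‖ < r₂} :=
      IsOpen.and (isOpen_lt continuous_const (by fun_prop)) (isOpen_lt (by fun_prop) continuous_const)
    have hVi : ∀ z ∈ {z : ℂ | r₁ < ‖z - c‖ ∧ ‖z - c‖ < r₂}, z ∈ PlaneInt g :=
      fun z hz => hint z hz.1.le hz.2.le
    have := (isOpen_proj_image (g := g) hV fun i hi u hu =>
      ⟨fun h => absurd (hVi _ h) (footL_notMem_planeInt hi hu),
        fun h => absurd (hVi _ h) (footR_notMem_planeInt hi hu)⟩).preimage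
        (continuous_subtype_val (p := fun x => x ∉ surfPunct g '' Iio n))
    convert this using 1
    ext y
    constructor
    · rintro ⟨z, hz, hy⟩
      exact ⟨z, ⟨hz, planeInt_subset (hVi z hz)⟩, hy.symm⟩
    · rintro ⟨z, hz, hy⟩
      exact ⟨z, hz.1, hy.symm⟩
  have hout : ∀ z ∈ Omega g n, (‖z - c‖ ≤ r₁ ∨ r₂ ≤ ‖z - c‖) → stdP z ∉ κ '' openAnnulus := by
    rintro z hz hzc ⟨k, hk, h⟩
    have h1 : z = Z k := stdP_inj_of_int hz (hZo k) (hZi k) h.symm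
    have h2 := hZn k
    rw [← h1] at h2
    simp only [ρ] at h2
    rcases hzc with h | h <;> nlinarith [hk.1, hk.2]
  have hx₀ : stdBase g n ∉ κ '' openAnnulus := by
    rw [← stdP_I]
    exact hout _ I_mem_half.1 hI
  obtain ⟨φ, hφ, μ, hμ, hfix, hcross⟩ := exists_twist_action (τ := τ) hτ hκ hinj hO hx₀
  refine ⟨φ, hφ, μ, hμ, fun s A hA hAc a b hab => apply_hh τ hfix s hA (fun z hz =>
    hout _ (half_subset (hA hz) s) ?_) hab, ?_⟩
  · rw [← flip_ofReal s c, ← flip_sub, norm_flip]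
    exact hAc z hz
  have hcis : cis ((1 / 2 : ℝ) : UnitAddCircle) = -1 := by
    rw [cis_coe, show 2 * Real.pi * (1 / 2) = Real.pi by ring, Complex.exp_pi_mul_I]
  have hmem : ∀ z : ℂ, 0 ≤ z.im → r₁ ≤ ‖z - c‖ → ‖z - c‖ ≤ r₂ → z ∈ Half g n :=
    fun z h0 h1 h2 => ⟨hann z h1 h2, h0⟩
  have e1 : holMap τ (crossMap hκ ((1 / 2 : ℝ) : UnitAddCircle)) 0 1 =
      hh τ false ((c - r₂ : ℝ) : ℂ) ((c - r₁ : ℝ) : ℂ) := by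
    have := holMap_eq_hh τ false (crossMap hκ ((1 / 2 : ℝ) : UnitAddCircle))
      (f := fun t => ((c - (r₂ + (r₁ - r₂) * t) : ℝ) : ℂ)) zero_le_one
      (Complex.continuous_ofReal.comp (by fun_prop)).continuousOn (fun r hr => hmem _ (by simp)
        ?_ ?_) fun r hr => ?_
    · simpa using this
    · rw [← Complex.ofReal_sub, Complex.norm_real, Real.norm_eq_abs, abs_sub_comm, le_abs]
      left; nlinarith [hr.1, hr.2]
    · rw [← Complex.ofReal_sub, Complex.norm_real, Real.norm_eq_abs, abs_sub_comm, abs_le]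
      constructor <;> nlinarith [hr.1, hr.2]
    · simp only [crossMap, ContinuousMap.coe_mk, κ, Z, hcis, flip_false, ρ]
      rw [Set.projIcc_of_mem zero_le_one hr]
      push_cast
      ring_nf
  have hcore : ∀ s : ℝ, coreMap hκ 0 s = stdP (c + r₂ * Complex.exp (((2 * Real.pi * s : ℝ) : ℂ) * Complex.I)) := by
    intro s
    simp [coreMap, κ, Z, ρ, cis_coe]
  have hexp : ∀ θ : ℝ, ‖(c : ℂ) + r₂ * Complex.exp (θ * Complex.I) - c‖ = r₂ := fun θ => by
    rw [add_sub_cancel_left, norm_mul, Complex.norm_exp_ofReal_mul_I, mul_one, Complex.norm_real,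
      Real.norm_of_nonneg (h₁.trans h₁₂).le]
  have him : ∀ θ : ℝ, ((c : ℂ) + r₂ * Complex.exp (θ * Complex.I)).im = r₂ * Real.sin θ := fun θ => by
    simp [Complex.exp_ofReal_mul_I_im]
  have hr₂ : 0 < r₂ := h₁.trans h₁₂
  have hcE : Continuous fun r : ℝ => Complex.exp (((2 * Real.pi * r : ℝ) : ℂ) * Complex.I) := by
    have : Continuous fun r : ℝ => ((2 * Real.pi * r : ℝ) : ℂ) :=
      Complex.continuous_ofReal.comp (by fun_prop)
    fun_prop
  have hcE' : Continuous fun r : ℝ => Complex.exp (((-(2 * Real.pi * r) : ℝ) : ℂ) * Complex.I) := by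
    have : Continuous fun r : ℝ => ((-(2 * Real.pi * r) : ℝ) : ℂ) :=
      Complex.continuous_ofReal.comp (by fun_prop)
    fun_prop
  have hsin : ∀ r ∈ Icc (1 : ℝ) (3 / 2), 0 ≤ Real.sin (2 * Real.pi * r) := fun r hr => by
    rw [← Real.sin_sub_two_pi]
    exact Real.sin_nonneg_of_nonneg_of_le_pi (by nlinarith [Real.pi_pos, hr.1])
      (by nlinarith [Real.pi_pos, hr.2])
  have hsin' : ∀ r ∈ Icc (1 / 2 : ℝ) 1, 0 ≤ Real.sin (-(2 * Real.pi * r)) := fun r hr => by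
    rw [← Real.sin_add_two_pi]
    exact Real.sin_nonneg_of_nonneg_of_le_pi (by nlinarith [Real.pi_pos, hr.2])
      (by nlinarith [Real.pi_pos, hr.1])
  have v0 : Complex.exp (((2 * Real.pi * (3 / 2) : ℝ) : ℂ) * Complex.I) = -1 := by
    rw [show (2 * Real.pi * (3 / 2) : ℝ) = Real.pi + 2 * Real.pi by ring, Complex.ofReal_add,
      add_mul, Complex.exp_add, Complex.exp_pi_mul_I]
    push_cast
    rw [Complex.exp_two_pi_mul_I, mul_one]
  have v1 : Complex.exp (((2 * Real.pi * 1 : ℝ) : ℂ) * Complex.I) = 1 := by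
    push_cast
    rw [mul_one, Complex.exp_two_pi_mul_I]
  have v2 : Complex.exp (((-(2 * Real.pi * (1 / 2)) : ℝ) : ℂ) * Complex.I) = -1 := by
    rw [show (2 * Real.pi * (1 / 2) : ℝ) = Real.pi by ring]
    push_cast
    rw [neg_mul, Complex.exp_neg, Complex.exp_pi_mul_I]
    norm_num
  have v3 : Complex.exp (((-(2 * Real.pi * 1) : ℝ) : ℂ) * Complex.I) = 1 := by
    push_cast
    rw [mul_one, neg_mul, Complex.exp_neg, Complex.exp_two_pi_mul_I, inv_one]
  have e2 : holMap τ (coreMap hκ 0) 1 (3 / 2) =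
      hh τ false ((c + r₂ : ℝ) : ℂ) ((c - r₂ : ℝ) : ℂ) := by
    have := holMap_eq_hh τ false (coreMap hκ 0)
      (f := fun r => (c : ℂ) + r₂ * Complex.exp (((2 * Real.pi * r : ℝ) : ℂ) * Complex.I))
      (s := 1) (t := 3 / 2) (by norm_num) (by fun_prop) (fun r hr => hmem _
        (by rw [him]; exact mul_nonneg hr₂.le (hsin r hr)) (by rw [hexp]; exact h₁₂.le)
        (by rw [hexp])) fun r _ => hcore r
    rw [this, v0, v1]
    congr 1 <;> push_cast <;> ring
  have e3 : holMap τ (coreMap hκ 0) (1 / 2) 1 =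
      hh τ true ((c - r₂ : ℝ) : ℂ) ((c + r₂ : ℝ) : ℂ) := by
    have := holMap_eq_hh τ true (coreMap hκ 0)
      (f := fun r => (c : ℂ) + r₂ * Complex.exp (((-(2 * Real.pi * r) : ℝ) : ℂ) * Complex.I))
      (s := 1 / 2) (t := 1) (by norm_num) (by fun_prop) (fun r hr => hmem _
        (by rw [him]; exact mul_nonneg hr₂.le (hsin' r hr)) (by rw [hexp]; exact h₁₂.le)
        (by rw [hexp])) fun r _ => ?_
    · rw [this, v2, v3]
      congr 1 <;> push_cast <;> ring
    · rw [hcore, flip_true, map_add, map_mul, Complex.conj_ofReal, Complex.conj_ofReal,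
        ← Complex.exp_conj, map_mul, Complex.conj_ofReal, Complex.conj_I]
      push_cast
      ring_nf
  -- Half a turn, `s = 1 / 2`, is the direction of `-1`. The full turn from there is cut at `s = 1`,
  -- where it passes from the lower to the upper half.
  have key := hcross (1 / 2)
  rw [e1, show (1 / 2 : ℝ) + 1 = 3 / 2 by norm_num, ← holMap_mul τ _ (1 / 2) 1 (3 / 2), e2, e3] at key
  have hk0 : κ (((1 / 2 : ℝ) : UnitAddCircle), 0) = stdP ((c - r₂ : ℝ) : ℂ) := by
    simp only [κ, Z, hcis, ρ]
    congr 1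
    push_cast
    simp
    ring
  have hk1 : κ (((1 / 2 : ℝ) : UnitAddCircle), 1) = stdP ((c - r₁ : ℝ) : ℂ) := by
    simp only [κ, Z, hcis, ρ]
    congr 1
    push_cast
    simp
    ring
  rw [hk0, hk1] at key
  exact key

end Round

/-! ### Twists along the handles -/

section Ribbon

open Topology Set

variable {g n : ℕ}

/-- The points of the open ribbon that passes through the `j`-th handle. -/
def Ribbon (j : ℕ) : Set ℂ := {z | (6 * (j : ℝ) < z.re ∧ z.re < 6 * (j : ℝ) + 3) ∧ |z.im| < 1 / 2}

theorem isOpen_ribbon (j : ℕ) : IsOpen (Ribbon j) :=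
  IsOpen.and (IsOpen.and (isOpen_lt continuous_const Complex.continuous_re)
    (isOpen_lt Complex.continuous_re continuous_const))
    (isOpen_lt (Complex.continuous_im.abs) continuous_const)

theorem ribbon_glue (j i : ℕ) {u : ℂ} (hu : ‖u‖ = 1) :
    6 * (i : ℂ) + u ∈ Ribbon j ↔ 6 * (i : ℂ) + 3 - conj u ∈ Ribbon j := by
  have h1 := abs_le.mp ((Complex.abs_re_le_norm u).trans hu.le)
  simp only [Ribbon, mem_ofPred_eq, Complex.add_re, Complex.add_im, Complex.sub_re, Complex.sub_im,
    Complex.conj_re, Complex.conj_im, Complex.mul_re, Complex.mul_im, Complex.natCast_re,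
    Complex.natCast_im, Complex.re_ofNat, Complex.im_ofNat, mul_zero, zero_mul, sub_zero, add_zero,
    zero_add, sub_neg_eq_add]
  refine and_congr_left fun _ => ?_
  rcases lt_trichotomy i j with h | rfl | h
  · have : (i : ℝ) + 1 ≤ j := by exact_mod_cast h
    constructor <;> rintro ⟨h2, h3⟩ <;> linarith
  · constructor <;> rintro ⟨h2, h3⟩ <;> constructor <;> linarith
  · have : (j : ℝ) + 1 ≤ i := by exact_mod_cast h
    constructor <;> rintro ⟨h2, h3⟩ <;> linarith

theorem mem_ribbon_of_proj {j : ℕ} {z w : ℂ} (hz : z ∈ Plane g) (hw : w ∈ Plane g)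
    (h : proj g z = proj g w) (hwr : w ∈ Ribbon j) : z ∈ Ribbon j := by
  rcases (proj_eq_proj hz hw).mp h with rfl | ⟨i, _, u, hu, ⟨rfl, rfl⟩ | ⟨rfl, rfl⟩⟩
  · exact hwr
  · exact (ribbon_glue j i hu).mpr hwr
  · exact (ribbon_glue j i hu).mp hwr

/-- Points between the two ends of a handle. -/
theorem mem_omega_between {j : ℕ} {z : ℂ} (h0 : 6 * (j : ℝ) ≤ z.re) (h1 : z.re ≤ 6 * (j : ℝ) + 3)
    (h2 : 1 ≤ (z.re - 6 * j) ^ 2 + z.im ^ 2) (h3 : 1 ≤ (6 * (j : ℝ) + 3 - z.re) ^ 2 + z.im ^ 2) :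
    z ∈ Omega g n := by
  have hfar : ∀ c : ℝ, 1 ≤ (z.re - c) ^ 2 + z.im ^ 2 → 1 ≤ ‖z - (c : ℂ)‖ := by
    intro c hc
    rw [Complex.norm_def, Real.one_le_sqrt, Complex.normSq_apply]
    simp only [Complex.sub_re, Complex.sub_im, Complex.ofReal_re, Complex.ofReal_im]
    nlinarith
  refine ⟨fun i _ => ?_, fun k _ h => ?_⟩
  · have k1 := hfar (6 * i)
    have k2 := hfar (6 * i + 3)
    push_cast at k1 k2
    rcases lt_trichotomy i j with h | rfl | h
    · have : (i : ℝ) + 1 ≤ j := by exact_mod_cast h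
      exact ⟨k1 (by nlinarith), k2 (by nlinarith)⟩
    · exact ⟨k1 h2, k2 (by nlinarith)⟩
    · have : (j : ℝ) + 1 ≤ i := by exact_mod_cast h
      exact ⟨k1 (by nlinarith), k2 (by nlinarith)⟩
  · have h4 : z.re = -rad (4 * k + 3) := by rw [h, punct, Complex.ofReal_re]
    have : (0 : ℝ) ≤ j := Nat.cast_nonneg j
    linarith [one_le_rad (4 * k + 3)]

theorem joinedTops_mem {j : ℕ} : 6 * (j : ℂ) + 3 - conj Complex.I = 6 * (j : ℂ) + 3 + Complex.I := by
  simp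

theorem topL_mem_half {j : ℕ} (hj : j < g) : 6 * (j : ℂ) + Complex.I ∈ Half g n :=
  footL_mem_half hj (by simp) (by simp)

theorem topR_mem_half {j : ℕ} (hj : j < g) : 6 * (j : ℂ) + 3 + Complex.I ∈ Half g n := by
  rw [← joinedTops_mem]
  exact footR_mem_half hj (by simp) (by simp)

variable (τ : ∀ y : StdSurface g n, Path (stdBase g n) y)

/-- The strip of height one between the two ends of the handle closes up to an annulus by the
gluing. The arc across it goes down through the middle of the strip. The core leaves the middle to
the left, enters the left end of the handle, comes out of the right end and returns; it is recorded
by the tops of the two ends. -/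
theorem exists_ribbon_twist (hτ : τ (stdBase g n) = Path.refl _) {j : ℕ} (hj : j < g) :
    ∃ φ ∈ inducedAut τ, ∃ μ : StdSurface g n → FundamentalGroup (StdSurface g n) (stdBase g n),
      μ (stdBase g n) = 1 ∧
      (∀ (s : Bool) (A : Set ℂ), A ⊆ Half g n → (∀ z ∈ A, z ∉ Ribbon j) →
        ∀ a b : ℂ, JoinedIn A a b →
          φ (hh τ s a b) = μ (stdP (flip s a)) * hh τ s a b * (μ (stdP (flip s b)))⁻¹) ∧
      φ (hh τ false (6 * j + 3 / 2 + Complex.I / 2) (6 * j + 3 / 2) *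
          hh τ true (6 * j + 3 / 2) (6 * j + 3 / 2 + Complex.I / 2)) =
        μ (stdP (flip false (6 * j + 3 / 2 + Complex.I / 2))) *
        (hh τ false (6 * j + 3 / 2 + Complex.I / 2) (6 * j + Complex.I) *
          hh τ false (6 * j + 3 + Complex.I) (6 * j + 3 / 2 + Complex.I / 2) *
          (hh τ false (6 * j + 3 / 2 + Complex.I / 2) (6 * j + 3 / 2) *
          hh τ true (6 * j + 3 / 2) (6 * j + 3 / 2 + Complex.I / 2))) *
        (μ (stdP (flip true (6 * j + 3 / 2 + Complex.I / 2))))⁻¹ := by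
  let y : unitInterval → ℝ := fun t => 1 / 2 - t
  have hy : ∀ t, |y t| ≤ 1 / 2 := fun t => by
    rw [abs_le]; simp only [y]; constructor <;> linarith [t.2.1, t.2.2]
  let w : ℝ → ℝ := fun y => Real.sqrt (1 - y ^ 2)
  have hw : ∀ y, |y| ≤ 1 / 2 → 1 / 2 ≤ w y ∧ w y ≤ 1 ∧ w y ^ 2 + y ^ 2 = 1 := by
    intro y hy
    have hy2 : y ^ 2 ≤ 1 / 4 := by
      have := sq_le_sq' (abs_le.mp hy).1 (abs_le.mp hy).2
      linarith
    have h0 : 0 ≤ 1 - y ^ 2 := by linarith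
    refine ⟨Real.le_sqrt_of_sq_le (by linarith), ?_, ?_⟩
    · exact Real.sqrt_le_one.mpr (by nlinarith [sq_nonneg y])
    · simp only [w]; rw [Real.sq_sqrt h0]; ring
  -- On the line of height `y`, the unit circle about a foot lies at horizontal distance `w y`. The
  -- parameter `s` moves linearly from the right circle (`s = 0`) to the left circle (`s = 1`), and
  -- these two ends are glued.
  let F : ℝ → ℝ → ℂ := fun s y => ⟨6 * j + 3 * (1 - s) + (2 * s - 1) * w y, y⟩
  have hFre : ∀ s y, (F s y).re = 6 * j + 3 * (1 - s) + (2 * s - 1) * w y := fun _ _ => rfl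
  have hFim : ∀ s y, (F s y).im = y := fun _ _ => rfl
  have hFeq : ∀ s y, F s y = ((6 * j + 3 * (1 - s) + (2 * s - 1) * w y : ℝ) : ℂ) + y * Complex.I :=
    fun s y => Complex.mk_eq_add_mul_I _ _
  have hwc : Continuous w := Real.continuous_sqrt.comp (by fun_prop)
  have hFc : Continuous fun p : ℝ × ℝ => F p.1 p.2 := by
    simp only [hFeq]
    refine Continuous.add (Complex.continuous_ofReal.comp ?_) (by fun_prop)
    have : Continuous fun p : ℝ × ℝ => w p.2 := hwc.comp continuous_snd
    fun_prop
  have hFb : ∀ s ∈ Icc (0 : ℝ) 1, ∀ y, |y| ≤ 1 / 2 →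
      6 * j + w y ≤ (F s y).re ∧ (F s y).re ≤ 6 * j + 3 - w y := by
    intro s hs y hy
    obtain ⟨h1, h2, h3⟩ := hw y hy
    rw [hFre]
    constructor <;> nlinarith [hs.1, hs.2]
  have hFo : ∀ s ∈ Icc (0 : ℝ) 1, ∀ y, |y| ≤ 1 / 2 → F s y ∈ Omega g n := by
    intro s hs y hy
    obtain ⟨h1, h2, h3⟩ := hw y hy
    obtain ⟨h4, h5⟩ := hFb s hs y hy
    refine mem_omega_between (j := j) (by linarith) (by linarith) ?_ ?_
    · rw [hFim]; nlinarith
    · rw [hFim]; nlinarith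
  have hproj : ∀ s : ℝ, ((projIcc 0 1 zero_le_one s : unitInterval) : ℝ) ∈ Icc (0 : ℝ) 1 :=
    fun s => (projIcc 0 1 zero_le_one s).2
  have hyc : Continuous y := by fun_prop
  have hf2 : Continuous fun p : ℝ × unitInterval =>
      (stdP (F ((projIcc 0 1 zero_le_one p.1 : unitInterval) : ℝ) (y p.2)) : StdSurface g n) :=
    continuousOn_stdP.comp_continuous (hFc.comp (Continuous.prodMk
      (continuous_subtype_val.comp ((continuous_projIcc (h := zero_le_one)).comp continuous_fst))
      (hyc.comp continuous_snd))) fun p => hFo _ (hproj _) _ (hy _)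
  let f2 : C(ℝ × unitInterval, StdSurface g n) := ⟨_, hf2⟩
  let f : ℝ → C(unitInterval, StdSurface g n) := f2.curry
  have hf : ∀ s ∈ Icc (0 : ℝ) 1, ∀ t, f s t = stdP (F s (y t)) := by
    intro s hs t
    simp only [f, f2, ContinuousMap.curry_apply, ContinuousMap.coe_mk]
    rw [projIcc_of_mem zero_le_one hs]
  have hF0 : ∀ y, |y| ≤ 1 / 2 → F 1 y = 6 * j + (⟨w y, y⟩ : ℂ) := fun y hy =>
    Complex.ext (by simp [hFre]; ring) (by simp [hFim])
  have hF1 : ∀ y, |y| ≤ 1 / 2 → F 0 y = 6 * j + 3 - conj (⟨w y, y⟩ : ℂ) := fun y hy =>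
    Complex.ext (by simp [hFre]; ring) (by simp [hFim])
  have hwn : ∀ y, |y| ≤ 1 / 2 → ‖(⟨w y, y⟩ : ℂ)‖ = 1 := fun y hy => by
    rw [Complex.norm_def, Complex.normSq_mk, Real.sqrt_eq_one, ← (hw y hy).2.2]; ring
  have hf01 : f 0 = f (0 + 1) := by
    ext1 t
    rw [hf 0 (by simp), hf (0 + 1) (by simp), zero_add]
    refine stdP_congr (hFo 0 (by simp) _ (hy t)) (hFo 1 (by simp) _ (hy t)) ?_
    rw [hF0 _ (hy t), hF1 _ (hy t), proj_glue hj (hwn _ (hy t))]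
  have hfc : Continuous f := f2.curry.continuous
  let G : UnitAddCircle → C(unitInterval, StdSurface g n) := AddCircle.liftIco 1 0 f
  have hG : Continuous G := AddCircle.liftIco_continuous hf01 hfc.continuousOn
  have hGf : ∀ s ∈ Icc (0 : ℝ) 1, G (s : UnitAddCircle) = f s := by
    intro s hs
    rcases hs.2.lt_or_eq with h | rfl
    · exact AddCircle.liftIco_coe_apply ⟨hs.1, by simpa using h⟩
    · have h1 : ((1 : ℝ) : UnitAddCircle) = ((0 : ℝ) : UnitAddCircle) := by
        rw [AddCircle.coe_period, AddCircle.coe_zero]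
      rw [h1, show f 1 = f 0 by rw [hf01, zero_add]]
      exact AddCircle.liftIco_coe_apply ⟨le_rfl, by simp⟩
  let κ : Annulus → StdSurface g n := fun k => G k.1 k.2
  have hκ : Continuous κ := (hG.comp continuous_fst).eval continuous_snd
  have hκs : ∀ s ∈ Icc (0 : ℝ) 1, ∀ t, κ ((s : UnitAddCircle), t) = stdP (F s (y t)) := by
    intro s hs t
    simp only [κ]
    rw [hGf s hs, hf s hs]
  have hrep : ∀ k : Annulus, ∃ s ∈ Ico (0 : ℝ) 1, k.1 = (s : UnitAddCircle) := by
    intro k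
    obtain ⟨s, hs, h⟩ := AddCircle.eq_coe_Ico k.1
    exact ⟨s, hs, h.symm⟩
  -- Every nontrivial identification involves a point on a left circle. For `s < 1` there is none,
  -- so injectivity reduces to that of `F`.
  have hnotL : ∀ s ∈ Ico (0 : ℝ) 1, ∀ y, |y| ≤ 1 / 2 → ∀ i : ℕ, ∀ u : ℂ, ‖u‖ = 1 →
      F s y ≠ 6 * (i : ℂ) + u := by
    intro s hs y hy i u hu h
    obtain ⟨h1, h2, h3⟩ := hw y hy
    have h4 := hFb s ⟨hs.1, hs.2.le⟩ y hy
    have hre : (F s y).re = 6 * i + u.re := by rw [h]; simp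
    have him : y = u.im := by rw [← hFim s y, h]; simp
    have h5 : u.re ^ 2 + u.im ^ 2 = 1 := by
      have := Complex.sq_norm u
      rw [hu, Complex.normSq_apply] at this
      linarith
    have h6 := abs_le.mp ((Complex.abs_re_le_norm u).trans hu.le)
    rcases lt_trichotomy i j with hlt | rfl | hlt
    · have : (i : ℝ) + 1 ≤ j := by exact_mod_cast hlt
      linarith
    · have h7 : w y < u.re := by
        have : w y < (F s y).re - 6 * i := by rw [hFre]; nlinarith [hs.2]
        linarith
      have h8 : y ^ 2 = u.im ^ 2 := by rw [him]
      nlinarith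
    · have : (j : ℝ) + 1 ≤ i := by exact_mod_cast hlt
      linarith
  have hinj : Function.Injective κ := by
    rintro ⟨x, t⟩ ⟨x', t'⟩ h
    obtain ⟨s, hs, rfl⟩ := hrep (x, t)
    obtain ⟨s', hs', rfl⟩ := hrep (x', t')
    rw [hκs s ⟨hs.1, hs.2.le⟩, hκs s' ⟨hs'.1, hs'.2.le⟩] at h
    have h := congrArg Subtype.val h
    have ho := hFo s ⟨hs.1, hs.2.le⟩ _ (hy t)
    have ho' := hFo s' ⟨hs'.1, hs'.2.le⟩ _ (hy t')
    rw [stdP_coe ho, stdP_coe ho', proj_eq_proj ho.1 ho'.1] at h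
    rcases h with h | ⟨i, _, u, hu, ⟨h, _⟩ | ⟨h, _⟩⟩
    · have him := congrArg Complex.im h
      have hre := congrArg Complex.re h
      rw [hFim, hFim] at him
      rw [hFre, hFre, him] at hre
      obtain ⟨h1, h2, h3⟩ := hw _ (hy t')
      have hss : s = s' := by
        have : (s - s') * (2 * w (y t') - 3) = 0 := by linear_combination hre
        rcases mul_eq_zero.mp this with h | h <;> linarith
      have htt : t = t' := Subtype.ext (by simp only [y] at him; linarith)
      rw [hss, htt]
    · exact absurd h (hnotL s hs _ (hy t) i u hu)
    · exact absurd h (hnotL s' hs' _ (hy t') i u hu)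
  have himg : κ '' openAnnulus =
      Subtype.val ⁻¹' (proj g '' (Ribbon j ∩ Plane g)) := by
    ext p
    constructor
    · rintro ⟨⟨x, t⟩, ht, rfl⟩
      obtain ⟨s, hs, rfl⟩ := hrep (x, t)
      have hs' : s ∈ Icc (0 : ℝ) 1 := ⟨hs.1, hs.2.le⟩
      obtain ⟨h1, h2, h3⟩ := hw _ (hy t)
      obtain ⟨h4, h5⟩ := hFb s hs' _ (hy t)
      refine ⟨F s (y t), ⟨⟨⟨by linarith, by linarith⟩, ?_⟩, (hFo s hs' _ (hy t)).1⟩, ?_⟩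
      · rw [hFim, abs_lt]; simp only [y]; constructor <;> linarith [ht.1, ht.2]
      · rw [hκs s hs', stdP_coe (hFo s hs' _ (hy t))]
    · rintro ⟨z, ⟨⟨⟨h1, h2⟩, h3⟩, hz⟩, hzp⟩
      obtain ⟨h4, h5, h6⟩ := hw z.im h3.le
      have hz' := hz j hj
      have hsq : ∀ c : ℝ, 1 ≤ ‖z - (c : ℂ)‖ → 1 ≤ (z.re - c) ^ 2 + z.im ^ 2 := by
        intro c hc
        have := Complex.sq_norm (z - (c : ℂ))
        rw [Complex.normSq_apply] at this
        simp only [Complex.sub_re, Complex.sub_im, Complex.ofReal_re, Complex.ofReal_im] at this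
        nlinarith
      have hl := hsq (6 * j) (by push_cast; exact hz'.1)
      have hr := hsq (6 * j + 3) (by push_cast; exact hz'.2)
      have hl' : w z.im ≤ z.re - 6 * j := by nlinarith
      have hr' : w z.im ≤ 6 * j + 3 - z.re := by nlinarith
      have hpos : 0 < 3 - 2 * w z.im := by linarith
      set s := (3 - w z.im - (z.re - 6 * j)) / (3 - 2 * w z.im) with hs
      have hs01 : s ∈ Icc (0 : ℝ) 1 :=
        ⟨div_nonneg (by linarith) hpos.le, (div_le_one hpos).mpr (by linarith)⟩
      have hsm : s * (3 - 2 * w z.im) = 3 - w z.im - (z.re - 6 * j) := div_mul_cancel₀ _ hpos.ne'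
      have ht := abs_lt.mp h3
      have ht0 : 0 < 1 / 2 - z.im := by linarith
      have ht1 : 1 / 2 - z.im < 1 := by linarith
      refine ⟨((s : UnitAddCircle), ⟨1 / 2 - z.im, ht0.le, ht1.le⟩), ⟨ht0, ht1⟩, ?_⟩
      apply Subtype.ext
      rw [hκs s hs01, stdP_coe (hFo s hs01 _ (hy _)), ← hzp]
      congr 1
      refine Complex.ext ?_ ?_
      · rw [hFre]
        simp only [y, sub_sub_cancel]
        linarith
      · simp [hFim, y]
  have hO : IsOpen (κ '' openAnnulus) := by
    rw [himg]
    exact (isOpen_proj_image (isOpen_ribbon j) fun i _ u hu => ribbon_glue j i hu).preimage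
      continuous_subtype_val
  have hout : ∀ z ∈ Omega g n, z ∉ Ribbon j → stdP z ∉ κ '' openAnnulus := by
    intro z hz hzr h
    rw [himg] at h
    obtain ⟨z', ⟨hz', hz'P⟩, h⟩ := h
    rw [stdP_coe hz] at h
    exact hzr (mem_ribbon_of_proj hz.1 hz'P h.symm hz')
  have hx₀ : stdBase g n ∉ κ '' openAnnulus := by
    rw [← stdP_I]
    refine hout _ I_mem_half.1 fun h => ?_
    have := h.2
    norm_num at this
  obtain ⟨φ, hφ, μ, hμ, hfix, hcross⟩ := exists_twist_action (τ := τ) hτ hκ hinj hO hx₀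
  refine ⟨φ, hφ, μ, hμ, fun s A hA hAc a b hab => apply_hh τ hfix s hA (fun z hz =>
    hout _ (half_subset (hA hz) s) fun h => hAc z hz ?_) hab, ?_⟩
  · cases s
    · exact h
    · simpa [Ribbon] using h
  have hy0 : y 0 = 1 / 2 := by simp [y]
  have hy1 : y 1 = -(1 / 2) := by simp [y]; norm_num
  have hhalf : |(1 / 2 : ℝ)| ≤ 1 / 2 := by norm_num [abs_le]
  have hm : ∀ y, F (1 / 2) y = 6 * j + 3 / 2 + y * Complex.I := fun y =>
    Complex.ext (by simp [hFre]; ring) (by simp [hFim])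
  have hI2 : (6 * j + 3 / 2 + Complex.I / 2 : ℂ) = F (1 / 2) (1 / 2) := by
    rw [hm]; push_cast; ring
  have hm0 : (6 * j + 3 / 2 : ℂ) = F (1 / 2) 0 := by rw [hm]; simp
  have hmid : (1 / 2 : ℝ) ∈ Icc (0 : ℝ) 1 := by norm_num
  have hFh : ∀ s ∈ Icc (0 : ℝ) 1, ∀ y, |y| ≤ 1 / 2 → 0 ≤ y → F s y ∈ Half g n :=
    fun s hs y hy h0 => ⟨hFo s hs y hy, h0⟩
  have hFcs : ∀ y, Continuous fun s => F s y := fun y =>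
    hFc.comp (Continuous.prodMk continuous_id continuous_const)
  have hFcy : ∀ s, Continuous fun y => F s y := fun s =>
    hFc.comp (Continuous.prodMk continuous_const continuous_id)
  have c1 : holMap τ (crossMap hκ ((1 / 2 : ℝ) : UnitAddCircle)) 0 (1 / 2) =
      hh τ false (6 * j + 3 / 2 + Complex.I / 2) (6 * j + 3 / 2) := by
    have := holMap_eq_hh τ false (crossMap hκ ((1 / 2 : ℝ) : UnitAddCircle))
      (f := fun t => F (1 / 2) (1 / 2 - t)) (s := 0) (t := 1 / 2) (by norm_num)
      ((hFcy _).comp (by fun_prop)).continuousOn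
      (fun r hr => hFh _ hmid _ (by rw [abs_le]; constructor <;> linarith [hr.1, hr.2])
        (by linarith [hr.2])) fun r hr => ?_
    · rw [this, hI2, hm0, sub_zero, sub_self]
    · simp only [crossMap, ContinuousMap.coe_mk, flip_false]
      rw [hκs _ hmid, Set.projIcc_of_mem zero_le_one ⟨hr.1, by linarith [hr.2]⟩]
  have c2 : holMap τ (crossMap hκ ((1 / 2 : ℝ) : UnitAddCircle)) (1 / 2) 1 =
      hh τ true (6 * j + 3 / 2) (6 * j + 3 / 2 + Complex.I / 2) := by
    have := holMap_eq_hh τ true (crossMap hκ ((1 / 2 : ℝ) : UnitAddCircle))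
      (f := fun t => F (1 / 2) (t - 1 / 2)) (s := 1 / 2) (t := 1) (by norm_num)
      ((hFcy _).comp (by fun_prop)).continuousOn
      (fun r hr => hFh _ hmid _ (by rw [abs_le]; constructor <;> linarith [hr.1, hr.2])
        (by linarith [hr.1])) fun r hr => ?_
    · rw [this, hI2, hm0, sub_self]
      norm_num
    · simp only [crossMap, ContinuousMap.coe_mk, flip_true]
      rw [hκs _ hmid, Set.projIcc_of_mem zero_le_one ⟨by linarith [hr.1], hr.2⟩]
      congr 1
      refine Complex.ext ?_ ?_
      · rw [Complex.conj_re, hFre, hFre]; ring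
      · rw [Complex.conj_im, hFim, hFim]; simp only [y]; ring
  set u : ℂ := ⟨w (1 / 2), 1 / 2⟩ with hu
  have hun : ‖u‖ = 1 := hwn _ hhalf
  have c3 : holMap τ (coreMap hκ 0) (1 / 2) 1 =
      hh τ false (6 * j + 3 / 2 + Complex.I / 2) (6 * j + u) := by
    have := holMap_eq_hh τ false (coreMap hκ 0)
      (f := fun s => F s (1 / 2)) (s := 1 / 2) (t := 1) (by norm_num) (hFcs _).continuousOn
      (fun r hr => hFh _ ⟨by linarith [hr.1], hr.2⟩ _ hhalf (by norm_num)) fun r hr => ?_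
    · rw [this, hI2, hF0 _ hhalf]
    · simp only [coreMap, ContinuousMap.coe_mk, flip_false]
      rw [hκs _ ⟨by linarith [hr.1], hr.2⟩, hy0]
  have c4 : holMap τ (coreMap hκ 0) 1 (3 / 2) =
      hh τ false (6 * j + 3 - conj u) (6 * j + 3 / 2 + Complex.I / 2) := by
    have := holMap_eq_hh τ false (coreMap hκ 0)
      (f := fun s => F (s - 1) (1 / 2)) (s := 1) (t := 3 / 2) (by norm_num)
      ((hFcs _).comp (by fun_prop)).continuousOn
      (fun r hr => hFh _ ⟨by linarith [hr.1], by linarith [hr.2]⟩ _ hhalf (by norm_num))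
      fun r hr => ?_
    · rw [this, hI2, sub_self, hF1 _ hhalf, show (3 / 2 : ℝ) - 1 = 1 / 2 by norm_num]
    · simp only [coreMap, ContinuousMap.coe_mk, flip_false]
      have hr1 : (r : UnitAddCircle) = ((r - 1 : ℝ) : UnitAddCircle) := by
        rw [AddCircle.coe_sub, AddCircle.coe_period, sub_zero]
      rw [hr1, hκs _ ⟨by linarith [hr.1], by linarith [hr.2]⟩, hy0]
  have hmh : (6 * j + 3 / 2 + Complex.I / 2 : ℂ) ∈ Half g n := by
    rw [hI2]; exact hFh _ hmid _ hhalf (by norm_num)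
  have huim : 0 ≤ u.im := by rw [hu]; norm_num
  -- The core passes the handle at height `1 / 2`. Both ends of the handle see the same arc from
  -- there to the top, so the passage may be moved to the tops.
  have c5 : hh τ false (6 * j + 3 / 2 + Complex.I / 2) (6 * j + u) *
      hh τ false (6 * j + 3 - conj u) (6 * j + 3 / 2 + Complex.I / 2) =
      hh τ false (6 * j + 3 / 2 + Complex.I / 2) (6 * j + Complex.I) *
      hh τ false (6 * j + 3 + Complex.I) (6 * j + 3 / 2 + Complex.I / 2) := by
    have h1 := footL_mem_half (n := n) hj hun huim
    have h2 := footR_mem_half (n := n) hj hun huim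
    have h3 := hh_glue τ false hj (v := Complex.I) hun (by simp) huim (by simp)
    rw [joinedTops_mem] at h3
    rw [← hh_mul τ false hmh h1 (topL_mem_half hj), h3,
      ← hh_mul τ false h2 (topR_mem_half hj) hmh]
    group
  have key := hcross (1 / 2)
  rw [show (1 / 2 : ℝ) + 1 = 3 / 2 by norm_num, ← holMap_mul τ (coreMap hκ 0) (1 / 2) 1 (3 / 2),
    ← holMap_mul τ (crossMap hκ _) 0 (1 / 2) 1, c1, c2, c3, c4, c5] at key
  rw [key, hκs _ hmid, hκs _ hmid, hy0, hy1]
  congr 3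
  · rw [flip_false, hI2]
  · rw [flip_true, hI2]
    congr 1
    refine Complex.ext ?_ ?_
    · rw [Complex.conj_re, hFre, hFre]; simp only [w]; norm_num
    · rw [Complex.conj_im, hFim, hFim]

end Ribbon

/-! ### Curves on the standard surface -/

section Curves

open Topology Set

variable {g n : ℕ}

/-- The top of the left end of a handle. -/
def topL (j : ℕ) : ℂ := 6 * j + Complex.I

/-- The top of the right end of a handle. -/
def topR (j : ℕ) : ℂ := 6 * j + 3 + Complex.I

/-- The point in the middle between the two ends of a handle. -/
def mid (j : ℕ) : ℂ := ((6 * j + 3 / 2 : ℝ) : ℂ)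

/-- The point where the `k`-th leaf meets the negative real axis. -/
def leafPt (k : ℕ) : ℂ := ((-rad (4 * k + 2) : ℝ) : ℂ)

theorem topL_zero : topL 0 = Complex.I := by simp [topL]

theorem flip_mid (s : Bool) (j : ℕ) : flip s (mid j) = mid j := flip_ofReal s _

theorem flip_leafPt (s : Bool) (k : ℕ) : flip s (leafPt k) = leafPt k := flip_ofReal s _

theorem topL_mem {j : ℕ} (hj : j < g) : topL j ∈ Half g n := topL_mem_half hj

theorem topR_mem {j : ℕ} (hj : j < g) : topR j ∈ Half g n := topR_mem_half hj

theorem between_mem (j : ℕ) {x : ℝ} (h1 : 6 * j + 1 ≤ x) (h2 : x ≤ 6 * j + 2) :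
    (x : ℂ) ∈ Half g n := by
  refine ⟨mem_omega_between (j := j) ?_ ?_ ?_ ?_, by simp⟩ <;>
    simp only [Complex.ofReal_re, Complex.ofReal_im] <;> nlinarith

theorem mid_mem (j : ℕ) : mid j ∈ Half g n := between_mem j (by linarith) (by linarith)

theorem neg_rad_mem {j : ℕ} (h : ∀ k, j ≠ 4 * k + 3) : ((-rad j : ℝ) : ℂ) ∈ Half g n := by
  refine real_mem_half ?_ (by linarith [one_le_rad j]) fun k _ h' => ?_
  · rw [abs_neg, le_abs]; exact Or.inl (one_le_rad j)
  · exact h k (rad_strictMono.injective (neg_injective h'))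

theorem leafPt_mem (k : ℕ) : leafPt k ∈ Half g n := neg_rad_mem fun l => by omega

theorem pos_rad_mem (j : ℕ) : (rad j : ℂ) ∈ Half g n :=
  pos_real_mem_half (one_le_rad j) (by linarith [rad_lt j])

theorem proj_topL {j : ℕ} (hj : j < g) : proj g (topL j) = proj g (topR j) := by
  rw [topL, topR, proj_glue hj (by simp), joinedTops_mem]

theorem stdP_topL {j : ℕ} (hj : j < g) : (stdP (topL j) : StdSurface g n) = stdP (topR j) :=
  stdP_congr (topL_mem hj).1 (topR_mem hj).1 (proj_topL hj)

variable (τ : ∀ y : StdSurface g n, Path (stdBase g n) y)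

/-- The holonomy of the loop at `z` that passes the real axis downwards in `x`, upwards in `y`. -/
def lasso (z x y : ℂ) : FundamentalGroup (StdSurface g n) (stdBase g n) :=
  hh τ false z x * hh τ true x y * hh τ false y z

/-- A crossing point can be moved wherever the upper and the lower holonomy agree, in particular
along a real interval contained in the surface. -/
theorem lasso_congr {z x y x' y' : ℂ} (hz : z ∈ Half g n) (hx : x ∈ Half g n) (hy : y ∈ Half g n)
    (hx' : x' ∈ Half g n) (hy' : y' ∈ Half g n) (h1 : hh τ false x x' = hh τ true x x')
    (h2 : hh τ false y y' = hh τ true y y') : lasso τ z x y = lasso τ z x' y' := by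
  rw [lasso, lasso, ← hh_mul τ true hx hx' hy, ← hh_mul τ true hx' hy' hy, ← h1,
    ← hh_inv τ true y y', ← h2, hh_inv, ← mul_assoc, ← mul_assoc, hh_mul τ false hz hx hx',
    mul_assoc _ (hh τ false y' y), hh_mul τ false hy' hy hz]

theorem lasso_mul (z : ℂ) {x y w : ℂ} (hx : x ∈ Half g n) (hy : y ∈ Half g n)
    (hw : w ∈ Half g n) : lasso τ z x y * lasso τ z y w = lasso τ z x w := by
  simp only [lasso]
  rw [← hh_mul τ true hx hy hw, ← hh_inv τ false z y]
  group

theorem lasso_inv (z x y : ℂ) : (lasso τ z x y)⁻¹ = lasso τ z y x := by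
  simp only [lasso, mul_inv_rev, hh_inv, mul_assoc]

theorem lasso_conj {z w x y : ℂ} (hz : z ∈ Half g n) (hw : w ∈ Half g n) (hx : x ∈ Half g n)
    (hy : y ∈ Half g n) :
    hh τ false w z * lasso τ z x y * (hh τ false w z)⁻¹ = lasso τ w x y := by
  rw [lasso, lasso, ← hh_mul τ false hw hz hx, ← hh_mul τ false hy hz hw, hh_inv]
  group

/-- The path from the base point to the left top of the `j`-th handle that passes all handles. -/
def tail : ℕ → FundamentalGroup (StdSurface g n) (stdBase g n)
  | 0 => 1
  | j + 1 => tail j * hh τ false (topR j) (topL (j + 1))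

/-- The curve through the `j`-th handle. -/
def handleCurve (j : ℕ) : FundamentalGroup (StdSurface g n) (stdBase g n) :=
  tail τ j * hh τ false (topL j) (topR j) * (tail τ j)⁻¹

/-- The curve around the right end of the `j`-th handle and the left end of the next one. -/
def linkCurve (j : ℕ) : FundamentalGroup (StdSurface g n) (stdBase g n) :=
  tail τ j * lasso τ (topR j) (mid j) (mid (j + 1)) * (tail τ j)⁻¹

/-- The `k`-th curve around the left end of the first handle. -/
def leaf (k : ℕ) : FundamentalGroup (StdSurface g n) (stdBase g n) :=
  lasso τ Complex.I (leafPt k) (mid 0)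

/-- The automorphism `φ` is local up to the factors `M`, at least on the tails. -/
structure IsLocal (φ : MulAut (FundamentalGroup (StdSurface g n) (stdBase g n)))
    (M : ℂ → FundamentalGroup (StdSurface g n) (stdBase g n)) : Prop where
  base : M Complex.I = 1
  glue : ∀ j < g, M (topL j) = M (topR j)
  link : ∀ j, j + 1 < g → φ (hh τ false (topR j) (topL (j + 1))) =
    M (topR j) * hh τ false (topR j) (topL (j + 1)) * (M (topL (j + 1)))⁻¹

variable {τ} {φ : MulAut (FundamentalGroup (StdSurface g n) (stdBase g n))}
  {M : ℂ → FundamentalGroup (StdSurface g n) (stdBase g n)}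

/-- The factors at the tops telescope, as the two tops of a handle are the same point of the surface
and the base point has factor `1`. -/
theorem IsLocal.apply_tail (h : IsLocal τ φ M) {j : ℕ} (hj : j < g) :
    φ (tail τ j) = tail τ j * (M (topL j))⁻¹ := by
  induction j with
  | zero => rw [tail, map_one, topL_zero, h.base, inv_one, one_mul]
  | succ j ih =>
    rw [tail, map_mul, ih (by omega), h.link j hj, h.glue j (by omega)]
    group

theorem IsLocal.apply_conj (h : IsLocal τ φ M) {j : ℕ} (hj : j < g)
    {x y : FundamentalGroup (StdSurface g n) (stdBase g n)}
    (hxy : φ x = M (topL j) * y * (M (topL j))⁻¹) :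
    φ (tail τ j * x * (tail τ j)⁻¹) = tail τ j * y * (tail τ j)⁻¹ := by
  rw [map_mul, map_mul, map_inv, h.apply_tail hj, hxy]
  group

theorem IsLocal.apply_handleCurve (h : IsLocal τ φ M) {j : ℕ} (hj : j < g)
    (hE : φ (hh τ false (topL j) (topR j)) =
      M (topL j) * hh τ false (topL j) (topR j) * (M (topR j))⁻¹) :
    φ (handleCurve τ j) = handleCurve τ j :=
  h.apply_conj hj (by rw [hE, h.glue j hj])

theorem apply_lasso {z x y : ℂ} (h1 : φ (hh τ false z x) = M z * hh τ false z x * (M x)⁻¹)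
    (h2 : φ (hh τ true x y) = M x * hh τ true x y * (M y)⁻¹)
    (h3 : φ (hh τ false y z) = M y * hh τ false y z * (M z)⁻¹) :
    φ (lasso τ z x y) = M z * lasso τ z x y * (M z)⁻¹ := by
  rw [lasso, map_mul, map_mul, h1, h2, h3]
  group

theorem IsLocal.apply_linkCurve (h : IsLocal τ φ M) {j : ℕ} (hj : j < g)
    (hC : φ (lasso τ (topR j) (mid j) (mid (j + 1))) =
      M (topR j) * lasso τ (topR j) (mid j) (mid (j + 1)) * (M (topR j))⁻¹) :
    φ (linkCurve τ j) = linkCurve τ j :=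
  h.apply_conj hj (by rw [hC, h.glue j hj])

theorem handleCurve_zero : handleCurve τ 0 = hh τ false Complex.I (topR 0) := by
  rw [handleCurve, tail, topL_zero]; group

end Curves

/-! ### The action of the twists on the curves -/

section Action

open Topology Set

variable {g n : ℕ} (τ : ∀ y : StdSurface g n, Path (stdBase g n) y)

/-- Removing such a disc with real centre keeps the half `UpClosed`, hence path connected. So any
two points outside the annulus can be joined outside it within a half. -/
theorem upClosed_compl_disc {c r : ℝ} (hr : r ≤ 3) :
    UpClosed ({z : ℂ | 0 ≤ z.im} ∩ {z | r ≤ ‖z - c‖}) := by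
  refine ⟨fun z hz => hz.1, fun z hz s hs => ⟨?_, ?_⟩, fun z hz => ⟨?_, ?_⟩⟩
  · have : 0 ≤ z.im := hz.1
    simpa using add_nonneg this hs
  · exact le_trans hz.2 (norm_sub_le_norm_add_mul_I_sub (by simp) hz.1 hs)
  · exact le_trans (by norm_num) hz
  · refine le_trans ?_ (Complex.abs_im_le_norm _)
    rw [le_abs]; left; simp; linarith

/-- Twists along round annuli, acting on holonomies. -/
theorem exists_round_action (hτ : τ (stdBase g n) = Path.refl _) {c r₁ r₂ : ℝ} (h₁ : 0 < r₁)
    (h₁₂ : r₁ < r₂) (h₂ : r₂ ≤ 3)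
    (hint : ∀ z : ℂ, r₁ ≤ ‖z - c‖ → ‖z - c‖ ≤ r₂ → z ∈ PlaneInt g)
    (hann : ∀ z : ℂ, r₁ ≤ ‖z - c‖ → ‖z - c‖ ≤ r₂ → z ∈ Omega g n)
    (hI : ‖Complex.I - c‖ ≤ r₁ ∨ r₂ ≤ ‖Complex.I - c‖) :
    ∃ φ ∈ inducedAut τ, ∃ M : ℂ → FundamentalGroup (StdSurface g n) (stdBase g n),
      M Complex.I = 1 ∧ (∀ j < g, M (topL j) = M (topR j)) ∧
      (∀ (s : Bool) (a b : ℂ), a ∈ Half g n → b ∈ Half g n → r₂ ≤ ‖a - c‖ → r₂ ≤ ‖b - c‖ →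
        φ (hh τ s a b) = M (flip s a) * hh τ s a b * (M (flip s b))⁻¹) ∧
      (∀ (s : Bool) (a b : ℂ), JoinedIn (Half g n ∩ {z | ‖z - c‖ ≤ r₁}) a b →
        φ (hh τ s a b) = M (flip s a) * hh τ s a b * (M (flip s b))⁻¹) ∧
      ∀ a b : ℂ, a ∈ Half g n → r₂ ≤ ‖a - c‖ →
        JoinedIn (Half g n ∩ {z | ‖z - c‖ ≤ r₁}) ((c - r₁ : ℝ) : ℂ) b →
        φ (hh τ false a b) = M a *
          (hh τ false a b * lasso τ b ((c - r₂ : ℝ) : ℂ) ((c + r₂ : ℝ) : ℂ)) * (M b)⁻¹ := by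
  obtain ⟨φ, hφ, μ, hμ, hfix, hcross⟩ := exists_round_twist τ hτ h₁ h₁₂ hint hann hI
  have hout : ∀ (s : Bool) (a b : ℂ), a ∈ Half g n → b ∈ Half g n → r₂ ≤ ‖a - c‖ →
      r₂ ≤ ‖b - c‖ → φ (hh τ s a b) =
        μ (stdP (flip s a)) * hh τ s a b * (μ (stdP (flip s b)))⁻¹ := by
    intro s a b ha hb hac hbc
    have hup := (upClosed_half (g := g) (n := n)).inter (upClosed_compl_disc (c := c) h₂)
    exact hfix s _ inter_subset_left (fun z hz => Or.inr hz.2.2) a b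
      (hup.isPathConnected.joinedIn a ⟨ha, ha.2, hac⟩ b ⟨hb, hb.2, hbc⟩)
  have hin : ∀ (s : Bool) (a b : ℂ), JoinedIn (Half g n ∩ {z | ‖z - c‖ ≤ r₁}) a b →
      φ (hh τ s a b) = μ (stdP (flip s a)) * hh τ s a b * (μ (stdP (flip s b)))⁻¹ :=
    fun s a b hab => hfix s _ inter_subset_left (fun z hz => Or.inl hz.2) a b hab
  have hr₂ := h₁.trans h₁₂
  have hreal : ∀ x : ℝ, r₁ ≤ |x - c| → |x - c| ≤ r₂ → (x : ℂ) ∈ Half g n := fun x h1 h2 =>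
    ⟨hann x (by rwa [← Complex.ofReal_sub, Complex.norm_real])
      (by rwa [← Complex.ofReal_sub, Complex.norm_real]), by simp⟩
  have n1 : |c - r₂ - c| = r₂ := by rw [abs_sub_comm, abs_of_pos] <;> linarith
  have n2 : |c + r₂ - c| = r₂ := by rw [abs_of_pos] <;> linarith
  have n3 : |c - r₁ - c| = r₁ := by rw [abs_sub_comm, abs_of_pos] <;> linarith
  have m1 := hreal (c - r₂) (by linarith) (by linarith)
  have m2 := hreal (c + r₂) (by linarith) (by linarith)
  have m3 := hreal (c - r₁) (by linarith) (by linarith)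
  refine ⟨φ, hφ, fun z => μ (stdP z), (congrArg μ stdP_I).trans hμ,
    fun j hj => congrArg μ (stdP_topL hj),
    hout, hin, fun a b ha hac hab => ?_⟩
  have hb : b ∈ Half g n := hab.target_mem.1
  have h1 := hout false a _ ha m1 hac (by rw [← Complex.ofReal_sub, Complex.norm_real]; exact n1.ge)
  have h2 := hin false _ _ hab
  rw [flip_false, flip_false] at h1 h2
  -- The path is rerouted through the arc on the real axis to the left of `c`, the only piece that
  -- meets the open annulus.
  have hsplit : hh τ false a b = hh τ false a ((c - r₂ : ℝ) : ℂ) *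
      hh τ false ((c - r₂ : ℝ) : ℂ) ((c - r₁ : ℝ) : ℂ) * hh τ false ((c - r₁ : ℝ) : ℂ) b := by
    rw [hh_mul τ false ha m1 m3, hh_mul τ false ha m3 hb]
  have hb1 : hh τ false b ((c - r₂ : ℝ) : ℂ) = (hh τ false ((c - r₁ : ℝ) : ℂ) b)⁻¹ *
      (hh τ false ((c - r₂ : ℝ) : ℂ) ((c - r₁ : ℝ) : ℂ))⁻¹ := by
    rw [hh_inv, hh_inv, hh_mul τ false hb m3 m1]
  have hb2 : hh τ false ((c + r₂ : ℝ) : ℂ) b = hh τ false ((c + r₂ : ℝ) : ℂ) ((c - r₂ : ℝ) : ℂ) *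
      hh τ false ((c - r₂ : ℝ) : ℂ) ((c - r₁ : ℝ) : ℂ) * hh τ false ((c - r₁ : ℝ) : ℂ) b := by
    rw [hh_mul τ false m2 m1 m3, hh_mul τ false m2 m3 hb]
  rw [lasso, hsplit, map_mul, map_mul, h1, h2, hcross, hb1, hb2]
  group

/-- A quarter turn from `i` whose radius grows from `1` to `r` stays outside the unit disc. Before
its end its imaginary part is positive, so it avoids the punctures. -/
theorem joinedIn_spiral {r : ℝ} (h1 : 1 ≤ r) (h2 : r < 3 / 2) :
    JoinedIn (Half g n ∩ {z | ‖z - ((0 : ℝ) : ℂ)‖ ≤ r}) Complex.I (r : ℂ) ∧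
    (((-r : ℝ) : ℂ) ∈ Half g n →
      JoinedIn (Half g n ∩ {z | ‖z - ((0 : ℝ) : ℂ)‖ ≤ r}) Complex.I ((-r : ℝ) : ℂ)) := by
  have key : ∀ ε : ℝ, (ε = 1 ∨ ε = -1) → (((ε * r : ℝ) : ℂ) ∈ Half g n) →
      JoinedIn (Half g n ∩ {z | ‖z - ((0 : ℝ) : ℂ)‖ ≤ r}) Complex.I ((ε * r : ℝ) : ℂ) := by
    intro ε hε hmem
    let R : unitInterval → ℝ := fun t => 1 + t * (r - 1)
    have hR : ∀ t, 1 ≤ R t ∧ R t ≤ r := fun t =>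
      ⟨by simp only [R]; nlinarith [t.2.1, t.2.2], by simp only [R]; nlinarith [t.2.1, t.2.2]⟩
    let α : unitInterval → ℝ := fun t => Real.pi / 2 - ε * t * (Real.pi / 2)
    let f : unitInterval → ℂ := fun t => (R t : ℂ) * Complex.exp (α t * Complex.I)
    have hfc : Continuous f := by
      have c1 : Continuous fun t => (R t : ℂ) := Complex.continuous_ofReal.comp (by fun_prop)
      have c2 : Continuous fun t => (α t : ℂ) := Complex.continuous_ofReal.comp (by fun_prop)
      fun_prop
    have hfn : ∀ t, ‖f t‖ = R t := fun t => by
      rw [norm_mul, Complex.norm_exp_ofReal_mul_I, mul_one, Complex.norm_real,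
        Real.norm_of_nonneg (by linarith [(hR t).1])]
    have hf0 : f 0 = Complex.I := by
      simp only [f, R, α]
      simp only [Set.Icc.coe_zero]
      rw [zero_mul, add_zero, mul_zero, zero_mul, sub_zero]
      push_cast
      rw [Complex.exp_pi_div_two_mul_I, one_mul]
    have hf1 : f 1 = ((ε * r : ℝ) : ℂ) := by
      have : Complex.exp (α 1 * Complex.I) = ε := by
        rcases hε with rfl | rfl
        · simp [α]
        · have : α 1 = Real.pi := by simp [α]
          rw [this, Complex.exp_pi_mul_I]; simp
      simp only [f, this, R]
      push_cast
      simp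
      ring
    have him : ∀ t : unitInterval, (t : ℝ) < 1 → 0 < (f t).im := by
      intro t ht
      have h0 : (f t).im = R t * Real.sin (α t) := by
        simp only [f]
        rw [Complex.im_ofReal_mul, Complex.exp_ofReal_mul_I_im]
      rw [h0]
      refine mul_pos (by linarith [(hR t).1]) ?_
      have := t.2.1
      rcases hε with rfl | rfl <;>
        exact Real.sin_pos_of_pos_of_lt_pi (by simp only [α]; nlinarith [Real.pi_pos])
          (by simp only [α]; nlinarith [Real.pi_pos])
    refine ⟨⟨⟨f, hfc⟩, hf0, hf1⟩, fun t => ?_⟩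
    change f t ∈ _
    rcases t.2.2.lt_or_eq with ht | ht
    · refine ⟨⟨⟨fun j _ => ?_, fun k _ h => ?_⟩, (him t ht).le⟩, ?_⟩
      · have hj : (0 : ℝ) ≤ j := Nat.cast_nonneg j
        have e1 : ‖(6 * (j : ℂ))‖ = 6 * j := by simp
        have e2 : ‖(6 * (j : ℂ) + 3)‖ = 6 * j + 3 := by
          have : (6 * (j : ℂ) + 3) = ((6 * j + 3 : ℝ) : ℂ) := by push_cast; ring
          rw [this, Complex.norm_real, Real.norm_of_nonneg (by positivity)]
        constructor
        · rcases Nat.eq_zero_or_pos j with rfl | hj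
          · simpa [hfn] using (hR t).1
          · have : (1 : ℝ) ≤ j := by exact_mod_cast hj
            have := norm_sub_norm_le (6 * (j : ℂ)) (f t)
            rw [norm_sub_rev, e1, hfn] at this
            linarith [(hR t).2]
        · have := norm_sub_norm_le (6 * (j : ℂ) + 3) (f t)
          rw [norm_sub_rev, e2, hfn] at this
          linarith [(hR t).2]
      · have := him t ht
        rw [h, punct, Complex.ofReal_im] at this
        exact lt_irrefl _ this
      · simpa [hfn] using (hR t).2
    · have : t = 1 := Subtype.ext ht
      rw [this, hf1]
      refine ⟨hmem, ?_⟩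
      have : |ε| = 1 := by rcases hε with rfl | rfl <;> simp
      simp only [mem_ofPred_eq, Complex.ofReal_zero, sub_zero, Complex.norm_real, Real.norm_eq_abs,
        abs_mul, this, one_mul]
      rw [abs_of_pos (by linarith)]
  refine ⟨?_, fun h => ?_⟩
  · have := key 1 (Or.inl rfl) (by rw [one_mul]; exact pos_real_mem_half h1 (by linarith))
    rwa [one_mul] at this
  · have := key (-1) (Or.inr rfl) (by rwa [neg_one_mul])
    rwa [neg_one_mul] at this

end Action

/-! ### Twists along link curves -/

section Twists

open Topology Set

variable {g n : ℕ} (τ : ∀ y : StdSurface g n, Path (stdBase g n) y)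

/-- A twist fixes its own core: with `L` the lasso, the arc into the annulus contributes `L` and the
arc out of it `L⁻¹`, so up to the end factors the image is `L⁻¹ * L * L`. -/
theorem apply_lasso_of_cross {φ : MulAut (FundamentalGroup (StdSurface g n) (stdBase g n))}
    {M : ℂ → FundamentalGroup (StdSurface g n) (stdBase g n)} {z x y : ℂ}
    (h1 : φ (hh τ false x z) = M x * (hh τ false x z * lasso τ z x y) * (M z)⁻¹)
    (h2 : φ (hh τ true x y) = M x * hh τ true x y * (M y)⁻¹)
    (h3 : φ (hh τ false y z) = M y * (hh τ false y z * lasso τ z x y) * (M z)⁻¹) :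
    φ (lasso τ z x y) = M z * lasso τ z x y * (M z)⁻¹ := by
  have h4 : φ (hh τ false z x) = M z * ((lasso τ z x y)⁻¹ * hh τ false z x) * (M x)⁻¹ := by
    rw [← hh_inv, map_inv, h1]
    group
  conv_lhs => rw [lasso, map_mul, map_mul, h4, h2, h3]
  have : hh τ false z x * hh τ true x y * hh τ false y z = lasso τ z x y := rfl
  calc _ = M z * (lasso τ z x y)⁻¹ * (hh τ false z x * hh τ true x y * hh τ false y z) *
        lasso τ z x y * (M z)⁻¹ := by group
    _ = _ := by rw [this]; group

theorem re_dist_le {z : ℂ} {x c r : ℝ} (h : r ≤ |x - c|) (hz : z.re = x) : r ≤ ‖z - c‖ := by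
  refine h.trans (le_trans (le_of_eq ?_) (Complex.abs_re_le_norm _))
  rw [Complex.sub_re, Complex.ofReal_re, hz]

theorem topL_re (j : ℕ) : (topL j).re = 6 * j := by simp [topL]

theorem topR_re (j : ℕ) : (topR j).re = 6 * j + 3 := by simp [topR]

theorem topL_im (j : ℕ) : (topL j).im = 1 := by simp [topL]

theorem topR_im (j : ℕ) : (topR j).im = 1 := by simp [topR]

/-- These are paths inside the disc bounded by the annulus of the link: along the real axis to the
right foot and up a quarter of its circle, then horizontally from the top of one foot to the top of
the next. -/
theorem joinedIn_link {j : ℕ} (hj : j + 1 < g) :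
    JoinedIn (Half g n ∩ {z | ‖z - ((6 * j + 9 / 2 : ℝ) : ℂ)‖ ≤ 27 / 10})
      (((6 * j + 9 / 2 - 27 / 10 : ℝ)) : ℂ) (topR j) ∧
    JoinedIn (Half g n ∩ {z | ‖z - ((6 * j + 9 / 2 : ℝ) : ℂ)‖ ≤ 27 / 10})
      (topR j) (topL (j + 1)) := by
  have hre : ∀ k : ℂ, k.im = 0 → ∀ z : ℂ, 1 ≤ |z.im| → 1 ≤ ‖z - k‖ := fun k hk z hz =>
    le_trans (by simpa [hk] using hz) (Complex.abs_im_le_norm (z - k))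
  have himH : ∀ z : ℂ, 1 ≤ z.im → z ∈ Half g n := by
    intro z hz
    have hz' : 1 ≤ |z.im| := hz.trans (le_abs_self _)
    refine ⟨⟨fun i _ => ⟨hre _ (by simp) z hz', hre _ (by simp) z hz'⟩, fun k _ h => ?_⟩, ?_⟩
    · rw [h, punct, Complex.ofReal_im] at hz
      norm_num at hz
    · exact le_trans zero_le_one hz
  have hnorm : ∀ z : ℂ, (z.re - (6 * j + 9 / 2)) ^ 2 + z.im ^ 2 ≤ (27 / 10) ^ 2 →
      ‖z - ((6 * j + 9 / 2 : ℝ) : ℂ)‖ ≤ 27 / 10 := by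
    intro z hz
    rw [Complex.norm_def]
    refine Real.sqrt_le_iff.mpr ⟨by norm_num, ?_⟩
    rw [Complex.normSq_apply]
    simp only [Complex.sub_re, Complex.sub_im, Complex.ofReal_re, Complex.ofReal_im]
    nlinarith
  have seg : ∀ a b : ℂ, (∀ t ∈ Icc (0 : ℝ) 1, a + t * (b - a) ∈
      Half g n ∩ {z | ‖z - ((6 * j + 9 / 2 : ℝ) : ℂ)‖ ≤ 27 / 10}) →
      JoinedIn (Half g n ∩ {z | ‖z - ((6 * j + 9 / 2 : ℝ) : ℂ)‖ ≤ 27 / 10}) a b := by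
    intro a b h
    refine ⟨⟨⟨fun t => a + ((t : ℝ) : ℂ) * (b - a), by fun_prop⟩, by simp, by simp⟩, fun t => ?_⟩
    exact h t t.2
  constructor
  · have hv : JoinedIn (Half g n ∩ {z | ‖z - ((6 * j + 9 / 2 : ℝ) : ℂ)‖ ≤ 27 / 10})
        (((6 * j + 9 / 2 - 27 / 10 : ℝ)) : ℂ) (((6 * j + 2 : ℝ) : ℂ)) := by
      refine seg _ _ fun t ht => ?_
      have : (((6 * j + 9 / 2 - 27 / 10 : ℝ)) : ℂ) + t * ((((6 * j + 2 : ℝ) : ℂ)) -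
          (((6 * j + 9 / 2 - 27 / 10 : ℝ)) : ℂ)) = ((6 * j + 9 / 5 + t * (1 / 5) : ℝ) : ℂ) := by
        push_cast; ring
      rw [this]
      refine ⟨between_mem j (by linarith [ht.1]) (by linarith [ht.2]), hnorm _ ?_⟩
      simp only [Complex.ofReal_re, Complex.ofReal_im]
      nlinarith [ht.1, ht.2]
    refine hv.trans ?_
    refine ⟨⟨⟨fun t => 6 * j + 3 - conj (Complex.exp (((t : ℝ) * (Real.pi / 2) : ℝ) * Complex.I)),
      ?_⟩, ?_, ?_⟩, fun t => ?_⟩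
    · have c1 : Continuous fun t : unitInterval => (((t : ℝ) * (Real.pi / 2) : ℝ) : ℂ) :=
        Complex.continuous_ofReal.comp (by fun_prop)
      exact continuous_const.sub (Complex.continuous_conj.comp (by fun_prop))
    · simp; ring
    · simp only [Set.Icc.coe_one, one_mul]
      push_cast
      rw [Complex.exp_pi_div_two_mul_I, joinedTops_mem, topR]
    · change 6 * (j : ℂ) + 3 - conj (Complex.exp (((t : ℝ) * (Real.pi / 2) : ℝ) * Complex.I)) ∈ _
      have hu := Complex.norm_exp_ofReal_mul_I ((t : ℝ) * (Real.pi / 2))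
      have hs : 0 ≤ Real.sin ((t : ℝ) * (Real.pi / 2)) :=
        Real.sin_nonneg_of_nonneg_of_le_pi (by nlinarith [t.2.1, Real.pi_pos])
          (by nlinarith [t.2.2, Real.pi_pos])
      refine ⟨footR_mem_half (by omega) hu (by rw [Complex.exp_ofReal_mul_I_im]; exact hs), ?_⟩
      have : ‖(6 * (j : ℂ) + 3 - conj (Complex.exp (((t : ℝ) * (Real.pi / 2) : ℝ) * Complex.I))) -
          ((6 * j + 9 / 2 : ℝ) : ℂ)‖ ≤ ‖(-(3 / 2) : ℂ)‖ +
          ‖conj (Complex.exp (((t : ℝ) * (Real.pi / 2) : ℝ) * Complex.I))‖ := by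
        refine le_trans (le_of_eq ?_) (norm_sub_le _ _)
        push_cast
        ring_nf
      rw [RCLike.norm_conj, hu] at this
      norm_num at this
      simp only [mem_ofPred_eq]
      push_cast at this ⊢
      linarith
  · refine seg _ _ fun t ht => ⟨himH _ ?_, hnorm _ ?_⟩
    · simp [topL, topR]
    · simp only [Complex.add_re, Complex.add_im, Complex.re_ofReal_mul, Complex.im_ofReal_mul,
        Complex.sub_re, Complex.sub_im, topL_re, topR_re, topL_im, topR_im]
      push_cast
      nlinarith [ht.1, ht.2]

/-- The twist along a link curve. -/
theorem exists_link_twist (hτ : τ (stdBase g n) = Path.refl _) {j : ℕ} (hj : j + 1 < g) :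
    ∃ φ ∈ inducedAut τ, (∀ i < g, i ≠ j → i ≠ j + 1 → φ (handleCurve τ i) = handleCurve τ i) ∧
      φ (handleCurve τ j) = handleCurve τ j * linkCurve τ j ∧
      φ (handleCurve τ (j + 1)) = (linkCurve τ j)⁻¹ * handleCurve τ (j + 1) ∧
      (∀ i, i + 1 < g → φ (linkCurve τ i) = linkCurve τ i) ∧
      ∀ k, φ (leaf τ k) = leaf τ k := by
  set c : ℝ := 6 * j + 9 / 2 with hc
  -- The annulus has centre midway between two neighbouring feet. These two are at distance `3 / 2`
  -- from the centre and all other feet at distance at least `9 / 2`, so the radii `2.7` and `2.8`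
  -- keep clear of all unit discs.
  have hfar : ∀ z : ℂ, 27 / 10 ≤ ‖z - c‖ → ‖z - c‖ ≤ 28 / 10 → ∀ x : ℝ,
      (|c - x| ≤ 3 / 2 ∨ 9 / 2 ≤ |c - x|) → 1 < ‖z - x‖ := by
    intro z h1 h2 x hx
    have e1 : ‖(c : ℂ) - x‖ = |c - x| := by rw [← Complex.ofReal_sub, Complex.norm_real]; rfl
    have h3 := norm_sub_le_norm_sub_add_norm_sub z (x : ℂ) (c : ℂ)
    have h4 := norm_sub_le_norm_sub_add_norm_sub (c : ℂ) z (x : ℂ)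
    rw [norm_sub_rev (x : ℂ) c, e1] at h3
    rw [e1, norm_sub_rev (c : ℂ) z] at h4
    rcases hx with hx | hx <;> linarith
  have hj0 : (0 : ℝ) ≤ j := Nat.cast_nonneg j
  have hint : ∀ z : ℂ, 27 / 10 ≤ ‖z - c‖ → ‖z - c‖ ≤ 28 / 10 → z ∈ PlaneInt g := by
    intro z h1 h2 i _
    have k1 := hfar z h1 h2 (6 * i)
    have k2 := hfar z h1 h2 (6 * i + 3)
    push_cast at k1 k2
    rcases lt_trichotomy i j with h | rfl | h
    · have : (i : ℝ) + 1 ≤ j := by exact_mod_cast h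
      exact ⟨k1 (Or.inr (le_abs.mpr (Or.inl (by rw [hc]; linarith)))),
        k2 (Or.inr (le_abs.mpr (Or.inl (by rw [hc]; linarith))))⟩
    · exact ⟨k1 (Or.inr (le_abs.mpr (Or.inl (by rw [hc]; linarith)))),
        k2 (Or.inl (abs_le.mpr ⟨by rw [hc]; linarith, by rw [hc]; linarith⟩))⟩
    · rcases (Nat.succ_le_of_lt h).eq_or_lt with rfl | h
      · push_cast at k1 k2 ⊢
        exact ⟨k1 (Or.inl (abs_le.mpr ⟨by rw [hc]; linarith, by rw [hc]; linarith⟩)),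
          k2 (Or.inr (le_abs.mpr (Or.inr (by rw [hc]; linarith))))⟩
      · have : (j : ℝ) + 1 + 1 ≤ i := by exact_mod_cast h
        exact ⟨k1 (Or.inr (le_abs.mpr (Or.inr (by rw [hc]; linarith)))),
          k2 (Or.inr (le_abs.mpr (Or.inr (by rw [hc]; linarith))))⟩
  have hann : ∀ z : ℂ, 27 / 10 ≤ ‖z - c‖ → ‖z - c‖ ≤ 28 / 10 → z ∈ Omega g n := by
    refine fun z h1 h2 => ⟨planeInt_subset (hint z h1 h2), fun k _ h => ?_⟩
    have h3 := (abs_le.mp ((Complex.abs_re_le_norm _).trans h2)).1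
    rw [h, punct, Complex.sub_re, Complex.ofReal_re, Complex.ofReal_re, hc] at h3
    linarith [one_le_rad (4 * k + 3)]
  obtain ⟨φ, hφ, M, hMI, hMg, hout, hin, hcr⟩ := exists_round_action τ hτ (c := c) (r₁ := 27 / 10)
    (r₂ := 28 / 10) (by norm_num) (by norm_num) (by norm_num) hint hann
    (Or.inr (re_dist_le (x := 0) (le_abs.mpr (Or.inr (by rw [hc]; linarith))) (by simp)))
  obtain ⟨J1, J2⟩ := joinedIn_link (n := n) hj
  have oL : ∀ i, i ≠ j + 1 → 28 / 10 ≤ ‖topL i - c‖ := by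
    intro i hi
    refine re_dist_le ?_ (topL_re i)
    rcases lt_or_gt_of_ne hi with h | h
    · have : (i : ℝ) ≤ j := by exact_mod_cast Nat.lt_succ_iff.mp h
      exact le_abs.mpr (Or.inr (by rw [hc]; linarith))
    · have : (j : ℝ) + 1 + 1 ≤ i := by exact_mod_cast h
      exact le_abs.mpr (Or.inl (by rw [hc]; linarith))
  have oR : ∀ i, i ≠ j → 28 / 10 ≤ ‖topR i - c‖ := by
    intro i hi
    refine re_dist_le ?_ (topR_re i)
    rcases lt_or_gt_of_ne hi with h | h
    · have : (i : ℝ) + 1 ≤ j := by exact_mod_cast h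
      exact le_abs.mpr (Or.inr (by rw [hc]; linarith))
    · have : (j : ℝ) + 1 ≤ i := by exact_mod_cast h
      exact le_abs.mpr (Or.inl (by rw [hc]; linarith))
  have oM : ∀ i, 28 / 10 ≤ ‖mid i - c‖ := by
    intro i
    refine re_dist_le ?_ (Complex.ofReal_re _)
    rcases lt_or_ge j i with h | h
    · have : (j : ℝ) + 1 ≤ i := by exact_mod_cast h
      exact le_abs.mpr (Or.inl (by rw [hc]; linarith))
    · have : (i : ℝ) ≤ j := by exact_mod_cast h
      exact le_abs.mpr (Or.inr (by rw [hc]; linarith))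
  have oN : ∀ k, 28 / 10 ≤ ‖leafPt k - c‖ := fun k =>
    re_dist_le (le_abs.mpr (Or.inr (by rw [hc]; linarith [one_le_rad (4 * k + 2)])))
      (Complex.ofReal_re _)
  have oI : 28 / 10 ≤ ‖Complex.I - c‖ := by rw [← topL_zero]; exact oL 0 (by omega)
  have hloc : IsLocal τ φ M := by
    refine ⟨hMI, hMg, fun i hi => ?_⟩
    rcases eq_or_ne i j with rfl | hij
    · exact hin false _ _ J2
    · exact hout false _ _ (topR_mem (by omega)) (topL_mem hi) (oR i hij) (oL _ (by omega))
  -- The outer circle meets the real axis between the two ends of the `j`-th handle and between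
  -- those of the next one, so its crossing points can be slid to the two midpoints.
  have hlasso : lasso τ (topR j) ((c - 28 / 10 : ℝ) : ℂ) ((c + 28 / 10 : ℝ) : ℂ) =
      lasso τ (topR j) (mid j) (mid (j + 1)) := by
    refine lasso_congr τ (topR_mem (by omega)) (between_mem j (by rw [hc]; linarith)
      (by rw [hc]; linarith)) (between_mem (j + 1) (by rw [hc]; push_cast; linarith)
      (by rw [hc]; push_cast; linarith)) (mid_mem j) (mid_mem (j + 1)) ?_ ?_
    · refine hh_real τ _ _ fun r hr => ?_
      rw [uIcc_comm, uIcc_of_le (by rw [hc]; linarith)] at hr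
      exact between_mem j (by linarith [hr.1]) (by have := hr.2; rw [hc] at this; linarith)
    · refine hh_real τ _ _ fun r hr => ?_
      rw [uIcc_of_le (by rw [hc]; push_cast; linarith)] at hr
      obtain ⟨hr1, hr2⟩ := hr
      rw [hc] at hr1
      push_cast at hr2
      exact between_mem (j + 1) (by push_cast; linarith) (by push_cast; linarith)
  have hcrR : ∀ a, a ∈ Half g n → 28 / 10 ≤ ‖a - c‖ → φ (hh τ false a (topR j)) = M a *
      (hh τ false a (topR j) * lasso τ (topR j) (mid j) (mid (j + 1))) * (M (topR j))⁻¹ :=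
    fun a ha hac => by rw [← hlasso]; exact hcr a _ ha hac J1
  have hC : φ (lasso τ (topR j) (mid j) (mid (j + 1))) = M (topR j) *
      lasso τ (topR j) (mid j) (mid (j + 1)) * (M (topR j))⁻¹ := by
    refine apply_lasso_of_cross τ (hcrR _ (mid_mem j) (oM j)) ?_ (hcrR _ (mid_mem _) (oM _))
    have := hout true _ _ (mid_mem j) (mid_mem (j + 1)) (oM _) (oM _)
    rwa [flip_mid, flip_mid] at this
  refine ⟨φ, hφ, fun i hi h1 h2 => ?_, ?_, ?_, fun i hi => ?_, fun k => ?_⟩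
  · exact hloc.apply_handleCurve hi (hout false _ _ (topL_mem hi) (topR_mem hi) (oL i h2) (oR i h1))
  · have := hloc.apply_conj (j := j) (by omega) (x := hh τ false (topL j) (topR j))
      (y := hh τ false (topL j) (topR j) * lasso τ (topR j) (mid j) (mid (j + 1)))
      (by rw [hcrR _ (topL_mem (by omega)) (oL j (by omega)), hMg j (by omega)])
    rw [handleCurve, this, linkCurve]
    group
  -- The left top of the next handle lies inside the annulus. The path is routed through `topR j`:
  -- first inside the disc, then outwards, which is the inverse of a crossing already computed.
  · have hx : φ (hh τ false (topL (j + 1)) (topR (j + 1))) = M (topL (j + 1)) *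
        ((hh τ false (topR j) (topL (j + 1)))⁻¹ *
          (lasso τ (topR j) (mid j) (mid (j + 1)))⁻¹ * hh τ false (topR j) (topL (j + 1)) *
          hh τ false (topL (j + 1)) (topR (j + 1))) * (M (topL (j + 1)))⁻¹ := by
      have h1 := hcrR _ (topR_mem hj) (oR (j + 1) (by omega))
      have h2 := hin false _ _ J2
      rw [flip_false, flip_false] at h2
      have e1 : hh τ false (topL (j + 1)) (topR (j + 1)) =
          (hh τ false (topR j) (topL (j + 1)))⁻¹ * (hh τ false (topR (j + 1)) (topR j))⁻¹ := by
        rw [hh_inv, hh_inv, hh_mul τ false (topL_mem hj) (topR_mem (by omega)) (topR_mem hj)]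
      rw [e1, map_mul, map_inv, map_inv, h1, h2, ← hMg (j + 1) hj]
      group
    have := hloc.apply_conj hj hx
    rw [handleCurve, this, linkCurve, tail]
    group
  · rcases eq_or_ne i j with rfl | hij
    · exact hloc.apply_linkCurve (by omega) hC
    · refine hloc.apply_linkCurve (by omega) (apply_lasso ?_ ?_ ?_)
      · exact hout false _ _ (topR_mem (by omega)) (mid_mem i) (oR i hij) (oM _)
      · have := hout true _ _ (mid_mem i) (mid_mem (i + 1)) (oM _) (oM _)
        rwa [flip_mid, flip_mid] at this
      · exact hout false _ _ (mid_mem _) (topR_mem (by omega)) (oM _) (oR i hij)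
  · have : φ (lasso τ Complex.I (leafPt k) (mid 0)) =
        M Complex.I * lasso τ Complex.I (leafPt k) (mid 0) * (M Complex.I)⁻¹ := by
      refine apply_lasso ?_ ?_ ?_
      · exact hout false _ _ I_mem_half (leafPt_mem k) oI (oN k)
      · have := hout true _ _ (leafPt_mem (g := g) (n := n) k) (mid_mem 0) (oN k) (oM _)
        rwa [flip_mid, flip_leafPt] at this
      · exact hout false _ _ (mid_mem _) I_mem_half (oM _) oI
    rw [leaf, this, hMI]
    group

end Twists

/-! ### Twists along leaves and handles, and the resulting twist system -/

section MoreTwists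

open Topology Set

variable {g n : ℕ} (τ : ∀ y : StdSurface g n, Path (stdBase g n) y)

/-- Conjugation by the first handle curve moves the starting point of the lasso from `i` through the
handle to the top of the right end. The lasso from there avoids the annuli of the leaves with index
at most `k`. -/
theorem leaf_eq (hg : 0 < g) (k : ℕ) :
    (handleCurve τ 0)⁻¹ * leaf τ k * handleCurve τ 0 = lasso τ (topR 0) (leafPt k) (mid 0) := by
  rw [handleCurve_zero, hh_inv, leaf, ← lasso_conj τ I_mem_half (topR_mem hg) (leafPt_mem k)
    (mid_mem 0), hh_inv]

theorem mid_zero : mid 0 = ((3 / 2 : ℝ) : ℂ) := by simp [mid]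

/-- The twist along a leaf. -/
theorem exists_leaf_twist (hτ : τ (stdBase g n) = Path.refl _) (hg : 0 < g) (k : ℕ) :
    ∃ φ ∈ inducedAut τ, φ (handleCurve τ 0) = (leaf τ k)⁻¹ * handleCurve τ 0 ∧
      (∀ i < g, 0 < i → φ (handleCurve τ i) = handleCurve τ i) ∧
      (∀ i, i + 1 < g → φ (linkCurve τ i) = linkCurve τ i) ∧
      φ (leaf τ k) = leaf τ k ∧ (∀ i < k, φ (leaf τ i) = leaf τ i) ∧
      ∀ i, k ≤ i → φ ((handleCurve τ 0)⁻¹ * leaf τ i * handleCurve τ 0) =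
        (handleCurve τ 0)⁻¹ * leaf τ i * handleCurve τ 0 := by
  -- The radii are interleaved: the annulus of the `k`-th leaf has radii number `4k + 1` and `4k +
  -- 2`, the leaf crosses the negative axis on its outer circle, and the next puncture sits at
  -- radius number `4k + 3`. So no annulus contains a puncture, and annuli of different leaves are
  -- disjoint.
  set r₁ := rad (4 * k + 1) with hr₁
  set r₂ := rad (4 * k + 2) with hr₂
  have h1 : 1 < r₁ := one_lt_rad (by omega)
  have h12 : r₁ < r₂ := rad_strictMono (by omega)
  have h2 : r₂ < 3 / 2 := rad_lt _
  have hint : ∀ z : ℂ, r₁ ≤ ‖z - ((0 : ℝ) : ℂ)‖ → ‖z - ((0 : ℝ) : ℂ)‖ ≤ r₂ → z ∈ PlaneInt g := by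
    intro z hz1 hz2 i _
    rw [Complex.ofReal_zero, sub_zero] at hz1 hz2
    have hi : (0 : ℝ) ≤ i := Nat.cast_nonneg i
    have e1 : ‖(6 * (i : ℂ))‖ = 6 * i := by simp
    have e2 : ‖(6 * (i : ℂ) + 3)‖ = 6 * i + 3 := by
      have : (6 * (i : ℂ) + 3) = ((6 * i + 3 : ℝ) : ℂ) := by push_cast; ring
      rw [this, Complex.norm_real, Real.norm_of_nonneg (by positivity)]
    constructor
    · rcases Nat.eq_zero_or_pos i with rfl | hi
      · simp; linarith
      · have : (1 : ℝ) ≤ i := by exact_mod_cast hi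
        have := norm_sub_norm_le (6 * (i : ℂ)) z
        rw [norm_sub_rev, e1] at this
        linarith
    · have := norm_sub_norm_le (6 * (i : ℂ) + 3) z
      rw [norm_sub_rev, e2] at this
      linarith
  have hann : ∀ z : ℂ, r₁ ≤ ‖z - ((0 : ℝ) : ℂ)‖ → ‖z - ((0 : ℝ) : ℂ)‖ ≤ r₂ → z ∈ Omega g n := by
    refine fun z hz1 hz2 => ⟨planeInt_subset (hint z hz1 hz2), fun l _ h => ?_⟩
    rw [Complex.ofReal_zero, sub_zero, h, punct, Complex.norm_real, norm_neg,
      Real.norm_of_nonneg (by linarith [one_le_rad (4 * l + 3)])] at hz1 hz2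
    have := rad_strictMono.le_iff_le.mp hz1
    have := rad_strictMono.le_iff_le.mp hz2
    omega
  obtain ⟨φ, hφ, M, hMI, hMg, hout, hin, hcr⟩ := exists_round_action τ hτ (c := 0) (r₁ := r₁)
    (r₂ := r₂) (by linarith) h12 (by linarith) hint hann (Or.inl (by simp [h1.le]))
  have hnL : ∀ i, 0 < i → r₂ ≤ ‖topL i - ((0 : ℝ) : ℂ)‖ := fun i hi => by
    have : (1 : ℝ) ≤ i := by exact_mod_cast hi
    exact re_dist_le (le_abs.mpr (Or.inl (by linarith))) (topL_re i)
  have hnR : ∀ i, r₂ ≤ ‖topR i - ((0 : ℝ) : ℂ)‖ := fun i => by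
    have : (0 : ℝ) ≤ i := Nat.cast_nonneg i
    exact re_dist_le (le_abs.mpr (Or.inl (by linarith))) (topR_re i)
  have hnM : ∀ i, r₂ ≤ ‖mid i - ((0 : ℝ) : ℂ)‖ := fun i => by
    have : (0 : ℝ) ≤ i := Nat.cast_nonneg i
    exact re_dist_le (le_abs.mpr (Or.inl (by linarith))) (Complex.ofReal_re _)
  have hnN : ∀ i, k ≤ i → r₂ ≤ ‖leafPt i - ((0 : ℝ) : ℂ)‖ := fun i hi => by
    refine re_dist_le (le_abs.mpr (Or.inr ?_)) (Complex.ofReal_re _)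
    have : r₂ ≤ rad (4 * i + 2) := rad_strictMono.monotone (by omega)
    linarith
  have hloc : IsLocal τ φ M := ⟨hMI, hMg, fun i hi =>
    hout false _ _ (topR_mem (by omega)) (topL_mem hi) (hnR i) (hnL _ (by omega))⟩
  have hMR : M (topR 0) = 1 := by rw [← hMg 0 hg, topL_zero, hMI]
  have hr₁m : ((0 - r₁ : ℝ) : ℂ) ∈ Half g n := by
    rw [zero_sub, hr₁]
    exact neg_rad_mem fun l => by omega
  have J : JoinedIn (Half g n ∩ {z | ‖z - ((0 : ℝ) : ℂ)‖ ≤ r₁}) ((0 - r₁ : ℝ) : ℂ) Complex.I := by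
    rw [zero_sub] at hr₁m ⊢
    exact ((joinedIn_spiral h1.le (by linarith)).2 hr₁m).symm
  have hlasso : lasso τ Complex.I ((0 - r₂ : ℝ) : ℂ) ((0 + r₂ : ℝ) : ℂ) = leaf τ k := by
    have e : ((0 - r₂ : ℝ) : ℂ) = leafPt k := by rw [zero_sub, leafPt]
    have e' : ((0 + r₂ : ℝ) : ℂ) ∈ Half g n := pos_real_mem_half (by linarith) (by linarith)
    rw [e, leaf]
    refine lasso_congr τ I_mem_half (leafPt_mem k) e' (leafPt_mem k) (mid_mem 0)
      (by rw [hh_self, hh_self]) ?_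
    rw [mid_zero]
    refine hh_real τ _ _ fun r hr => ?_
    rw [uIcc_of_le (by linarith)] at hr
    exact pos_real_mem_half (by linarith [hr.1]) (by linarith [hr.2])
  have hcrI : ∀ a, a ∈ Half g n → r₂ ≤ ‖a - ((0 : ℝ) : ℂ)‖ → φ (hh τ false a Complex.I) = M a *
      (hh τ false a Complex.I * leaf τ k) * (M Complex.I)⁻¹ :=
    fun a ha hac => by rw [← hlasso]; exact hcr a _ ha hac J
  have hE : φ (handleCurve τ 0) = (leaf τ k)⁻¹ * handleCurve τ 0 := by
    rw [handleCurve_zero, ← hh_inv, map_inv, hcrI _ (topR_mem hg) (hnR 0), hMR, hMI]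
    group
  refine ⟨φ, hφ, hE, fun i hi h0 => ?_, fun i hi => ?_, ?_, fun i hi => ?_, fun i hi => ?_⟩
  · exact hloc.apply_handleCurve hi (hout false _ _ (topL_mem hi) (topR_mem hi) (hnL i h0) (hnR i))
  · refine hloc.apply_linkCurve (by omega) (apply_lasso ?_ ?_ ?_)
    · exact hout false _ _ (topR_mem (by omega)) (mid_mem i) (hnR i) (hnM i)
    · have := hout true _ _ (mid_mem i) (mid_mem (i + 1)) (hnM _) (hnM _)
      rwa [flip_mid, flip_mid] at this
    · exact hout false _ _ (mid_mem _) (topR_mem (by omega)) (hnM _) (hnR i)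
  · have := apply_lasso_of_cross τ (φ := φ) (M := M) (z := Complex.I) (x := leafPt k) (y := mid 0)
      (hcrI _ (leafPt_mem k) (hnN k le_rfl)) ?_ (hcrI _ (mid_mem 0) (hnM 0))
    · rw [leaf, this, hMI]
      group
    · have := hout true _ _ (leafPt_mem k) (mid_mem 0) (hnN k le_rfl) (hnM 0)
      rwa [flip_mid, flip_leafPt] at this
  -- A leaf with smaller index fits inside the inner circle, once its crossing point is slid from
  -- `mid 0` to its own radius on the positive axis.
  · have hri : rad (4 * i + 2) ≤ r₁ := rad_strictMono.monotone (by omega)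
    have e : leaf τ i = lasso τ Complex.I (leafPt i) ((rad (4 * i + 2) : ℝ) : ℂ) := by
      refine lasso_congr τ I_mem_half (leafPt_mem i) (mid_mem 0) (leafPt_mem i) (pos_rad_mem _)
        (by rw [hh_self, hh_self]) ?_
      rw [mid_zero]
      refine hh_real τ _ _ fun r hr => ?_
      rw [uIcc_comm, uIcc_of_le (rad_lt _).le] at hr
      exact pos_real_mem_half (by linarith [hr.1, one_le_rad (4 * i + 2)]) (by linarith [hr.2])
    obtain ⟨J1, J2⟩ := joinedIn_spiral (g := g) (n := n) (one_le_rad (4 * i + 2)) (rad_lt _)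
    have hsub : Half g n ∩ {z | ‖z - ((0 : ℝ) : ℂ)‖ ≤ rad (4 * i + 2)} ⊆
        Half g n ∩ {z | ‖z - ((0 : ℝ) : ℂ)‖ ≤ r₁} :=
      inter_subset_inter_right _ fun z hz => le_trans hz hri
    replace J1 := J1.mono hsub
    replace J2 := (J2 (leafPt_mem i)).mono hsub
    have := apply_lasso (φ := φ) (M := M) (τ := τ) (z := Complex.I) (x := leafPt i)
      (y := ((rad (4 * i + 2) : ℝ) : ℂ)) (hin false _ _ J2) ?_ (hin false _ _ J1.symm)
    · rw [e, this, hMI]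
      group
    · have := hin true _ _ (J2.symm.trans J1)
      rw [flip_ofReal, flip_ofReal] at this
      exact this
  -- Seen from the right end of the handle, leaves with index at least `k` stay outside the open
  -- annulus; the `k`-th one crosses the real axis on its outer circle.
  · rw [leaf_eq τ hg]
    have := apply_lasso (φ := φ) (M := M) (τ := τ) (z := topR 0) (x := leafPt i) (y := mid 0)
      (hout false _ _ (topR_mem hg) (leafPt_mem i) (hnR 0) (hnN i hi)) ?_
      (hout false _ _ (mid_mem 0) (topR_mem hg) (hnM 0) (hnR 0))
    · rw [this, hMR]
      group
    · have := hout true _ _ (leafPt_mem i) (mid_mem 0) (hnN i hi) (hnM 0)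
      rwa [flip_mid, flip_leafPt] at this

theorem upClosed_compl_ribbon (j : ℕ) : UpClosed ({z : ℂ | 0 ≤ z.im} ∩ (Ribbon j)ᶜ) := by
  refine ⟨fun z hz => hz.1, fun z hz s hs => ⟨?_, fun h => hz.2 ?_⟩, fun z hz => ⟨?_, fun h => ?_⟩⟩
  · have : 0 ≤ z.im := hz.1
    simpa using add_nonneg this hs
  · have h0 : 0 ≤ z.im := hz.1
    obtain ⟨h1, h2⟩ := h
    simp only [Complex.add_re, Complex.add_im, Complex.re_ofReal_mul, Complex.im_ofReal_mul,
      Complex.I_re, Complex.I_im, mul_zero, add_zero, mul_one] at h1 h2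
    refine ⟨h1, ?_⟩
    rw [abs_of_nonneg (by linarith)] at h2
    rw [abs_of_nonneg h0]
    linarith
  · exact le_trans (by norm_num) hz
  · have := (abs_lt.mp h.2).2
    linarith

/-- The twist along a handle. -/
theorem exists_handle_twist (hτ : τ (stdBase g n) = Path.refl _) {j : ℕ} (hj : j < g) :
    ∃ φ ∈ inducedAut τ, (∀ i < g, φ (handleCurve τ i) = handleCurve τ i) ∧
      (j + 1 < g → φ (linkCurve τ j) = (handleCurve τ j)⁻¹ * linkCurve τ j) ∧
      (∀ i, i + 1 = j → φ (linkCurve τ i) = linkCurve τ i * handleCurve τ j) ∧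
      (∀ i, i + 1 < g → i ≠ j → i + 1 ≠ j → φ (linkCurve τ i) = linkCurve τ i) ∧
      (j = 0 → ∀ k, φ (leaf τ k) = leaf τ k * handleCurve τ 0) ∧
      (0 < j → ∀ k, φ (leaf τ k) = leaf τ k) := by
  obtain ⟨φ, hφ, μ, hμ, hfix, hcross⟩ := exists_ribbon_twist τ hτ hj
  -- The point `q` lies on the upper edge of the ribbon, where the arc across it begins.
  set q : ℂ := 6 * j + 3 / 2 + Complex.I / 2 with hq
  have hmid : (6 * j + 3 / 2 : ℂ) = mid j := by rw [mid]; push_cast; ring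
  rw [hmid] at hcross
  set M : ℂ → FundamentalGroup (StdSurface g n) (stdBase g n) := fun z => μ (stdP z) with hM
  have hout : ∀ (s : Bool) (a b : ℂ), a ∈ Half g n → b ∈ Half g n → a ∉ Ribbon j → b ∉ Ribbon j →
      φ (hh τ s a b) = M (flip s a) * hh τ s a b * (M (flip s b))⁻¹ := by
    intro s a b ha hb hac hbc
    have hup := (upClosed_half (g := g) (n := n)).inter (upClosed_compl_ribbon j)
    exact hfix s _ inter_subset_left (fun z hz => hz.2.2) a b
      (hup.isPathConnected.joinedIn a ⟨ha, ha.2, hac⟩ b ⟨hb, hb.2, hbc⟩)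
  have oIm : ∀ z : ℂ, 1 / 2 ≤ z.im → z ∉ Ribbon j := fun z hz h => by
    have := (abs_lt.mp h.2).2
    linarith
  have oL : ∀ i, topL i ∉ Ribbon j := fun i => oIm _ (by rw [topL_im]; norm_num)
  have oR : ∀ i, topR i ∉ Ribbon j := fun i => oIm _ (by rw [topR_im]; norm_num)
  have oI : Complex.I ∉ Ribbon j := by rw [← topL_zero]; exact oL 0
  have hqim : q.im = 1 / 2 := by rw [hq]; simp
  have oq : q ∉ Ribbon j := oIm _ hqim.ge
  have oM : ∀ i, i ≠ j → mid i ∉ Ribbon j := by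
    rintro i hij ⟨⟨h1, h2⟩, -⟩
    rw [mid, Complex.ofReal_re] at h1 h2
    rcases lt_or_gt_of_ne hij with h | h
    · have : (i : ℝ) + 1 ≤ j := by exact_mod_cast h
      linarith
    · have : (j : ℝ) + 1 ≤ i := by exact_mod_cast h
      linarith
  have oN : ∀ k, leafPt k ∉ Ribbon j := by
    rintro k ⟨⟨h1, -⟩, -⟩
    rw [leafPt, Complex.ofReal_re] at h1
    have : (0 : ℝ) ≤ j := Nat.cast_nonneg j
    linarith [one_le_rad (4 * k + 2)]
  have hMI : M Complex.I = 1 := (congrArg μ stdP_I).trans hμ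
  have hMg : ∀ i < g, M (topL i) = M (topR i) := fun i hi => congrArg μ (stdP_topL hi)
  have hloc : IsLocal τ φ M := ⟨hMI, hMg, fun i hi =>
    hout false _ _ (topR_mem (by omega)) (topL_mem hi) (oR i) (oL _)⟩
  have hqm : q ∈ Half g n := by
    refine ⟨mem_omega_between (j := j) ?_ ?_ ?_ ?_, by rw [mem_ofPred_eq, hqim]; norm_num⟩
    all_goals
      have hre : q.re = 6 * j + 3 / 2 := by rw [hq]; simp
      rw [hre]
    · linarith
    · linarith
    · nlinarith [sq_nonneg q.im]
    · nlinarith [sq_nonneg q.im]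
  have hLm := topL_mem (n := n) hj
  have hRm := topR_mem (n := n) hj
  -- A path from `a` down through `mid j` to `b` in the lower half crosses the ribbon once. After
  -- rerouting through `q`, the twist inserts a passage through the handle, here based at `a`.
  have hcr : ∀ a b, a ∈ Half g n → b ∈ Half g n → a ∉ Ribbon j → b ∉ Ribbon j →
      φ (hh τ false a (mid j) * hh τ true (mid j) b) = M a * (hh τ false a (topL j) *
        hh τ false (topR j) a * (hh τ false a (mid j) * hh τ true (mid j) b)) *
        (M (flip true b))⁻¹ := by
    intro a b ha hb hac hbc
    have h1 := hout false a q ha hqm hac oq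
    have h2 := hout true q b hqm hb oq hbc
    have e1 : hh τ false a (mid j) * hh τ true (mid j) b = hh τ false a q *
        (hh τ false q (mid j) * hh τ true (mid j) q) * hh τ true q b := by
      rw [← hh_mul τ false ha hqm (mid_mem j), ← hh_mul τ true (mid_mem j) hqm hb]
      group
    have e2 : hh τ false q (topL j) = (hh τ false a q)⁻¹ * hh τ false a (topL j) := by
      rw [hh_inv, hh_mul τ false hqm ha hLm]
    have e3 : hh τ false (topR j) q = hh τ false (topR j) a * hh τ false a q := by
      rw [hh_mul τ false hRm ha hqm]
    have h3 : φ (hh τ false q (mid j) * hh τ true (mid j) q) = M (flip false q) *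
        (hh τ false q (topL j) * hh τ false (topR j) q *
          (hh τ false q (mid j) * hh τ true (mid j) q)) * (M (flip true q))⁻¹ := hcross
    rw [e1, map_mul, map_mul, h1, h2, h3, e2, e3]
    simp only [flip_false]
    group
  refine ⟨φ, hφ, fun i hi => ?_, fun h => ?_, fun i hi => ?_, fun i hi h1 h2 => ?_, ?_, ?_⟩
  · exact hloc.apply_handleCurve hi (hout false _ _ (topL_mem hi) (topR_mem hi) (oL i) (oR i))
  · have h1 := hcr (topR j) (mid (j + 1)) hRm (mid_mem _) (oR j) (oM _ (by omega))
    have h2 := hout false _ _ (mid_mem (j + 1)) hRm (oM _ (by omega)) (oR j)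
    rw [flip_false, flip_false] at h2
    rw [flip_mid, hh_self, mul_one] at h1
    have := hloc.apply_conj hj (x := lasso τ (topR j) (mid j) (mid (j + 1)))
      (y := (hh τ false (topL j) (topR j))⁻¹ * lasso τ (topR j) (mid j) (mid (j + 1))) (by
        rw [lasso, map_mul, h1, h2, hMg j hj, hh_inv]
        group)
    rw [linkCurve, this, handleCurve]
    group
  · subst hi
    have hRm' := topR_mem (n := n) (show i < g by omega)
    have h1 := hcr (topR i) (mid i) hRm' (mid_mem i) (oR i) (oM i (by omega))
    have h2 := hout false _ _ hRm' (mid_mem i) (oR i) (oM i (by omega))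
    rw [flip_false, flip_false] at h2
    rw [flip_mid] at h1
    -- This link curve crosses the ribbon upwards at `mid (i + 1)`; that part is written as the
    -- inverse of a downward crossing.
    have e1 : lasso τ (topR i) (mid i) (mid (i + 1)) = hh τ false (topR i) (mid i) *
        (hh τ false (topR i) (mid (i + 1)) * hh τ true (mid (i + 1)) (mid i))⁻¹ := by
      rw [lasso, mul_inv_rev, hh_inv, hh_inv, mul_assoc]
    have e2 : hh τ false (topR (i + 1)) (topR i) = (hh τ false (topL (i + 1)) (topR (i + 1)))⁻¹ *
        (hh τ false (topR i) (topL (i + 1)))⁻¹ := by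
      rw [hh_inv, hh_inv, hh_mul τ false hRm hLm hRm']
    have := hloc.apply_conj (j := i) (by omega) (x := lasso τ (topR i) (mid i) (mid (i + 1)))
      (y := lasso τ (topR i) (mid i) (mid (i + 1)) * (hh τ false (topR i) (topL (i + 1)) *
        hh τ false (topL (i + 1)) (topR (i + 1)) * (hh τ false (topR i) (topL (i + 1)))⁻¹)) (by
        rw [e1, map_mul, map_inv, h1, h2, hMg i (by omega), e2]
        group)
    rw [linkCurve, this, handleCurve, tail]
    group
  · refine hloc.apply_linkCurve (by omega) (apply_lasso ?_ ?_ ?_)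
    · exact hout false _ _ (topR_mem (by omega)) (mid_mem i) (oR i) (oM i h1)
    · have := hout true _ _ (mid_mem i) (mid_mem (i + 1)) (oM _ h1) (oM _ h2)
      rwa [flip_mid, flip_mid] at this
    · exact hout false _ _ (mid_mem _) (topR_mem (by omega)) (oM _ h2) (oR i)
  · rintro rfl k
    have h1 := hcr Complex.I (leafPt k) I_mem_half (leafPt_mem k) oI (oN k)
    have h2 := hout false _ _ (I_mem_half (g := g) (n := n)) (leafPt_mem k) oI (oN k)
    rw [flip_false, flip_false] at h2
    rw [flip_leafPt, topL_zero, hh_self, one_mul] at h1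
    have e1 : leaf τ k = hh τ false Complex.I (leafPt k) *
        (hh τ false Complex.I (mid 0) * hh τ true (mid 0) (leafPt k))⁻¹ := by
      rw [leaf, lasso, mul_inv_rev, hh_inv, hh_inv, mul_assoc]
    rw [handleCurve_zero, e1, map_mul, map_inv, h1, h2, hMI, ← hh_inv τ false Complex.I (topR 0)]
    group
  · intro h0 k
    have : φ (lasso τ Complex.I (leafPt k) (mid 0)) =
        M Complex.I * lasso τ Complex.I (leafPt k) (mid 0) * (M Complex.I)⁻¹ := by
      refine apply_lasso ?_ ?_ ?_
      · exact hout false _ _ I_mem_half (leafPt_mem k) oI (oN k)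
      · have := hout true _ _ (leafPt_mem k) (mid_mem 0) (oN k) (oM 0 (by omega))
        rwa [flip_mid, flip_leafPt] at this
      · exact hout false _ _ (mid_mem _) I_mem_half (oM 0 (by omega)) oI
    rw [leaf, this, hMI]
    group

/-- The chain of curves that alternates between handles and links. -/
def chainCurve (i : ℕ) : FundamentalGroup (StdSurface g n) (stdBase g n) :=
  if i % 2 = 0 then handleCurve τ (i / 2) else linkCurve τ (i / 2)

theorem chainCurve_even (j : ℕ) : chainCurve τ (2 * j) = handleCurve τ j := by
  rw [chainCurve, if_pos (by omega), Nat.mul_div_cancel_left _ (by norm_num)]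

theorem chainCurve_odd (j : ℕ) : chainCurve τ (2 * j + 1) = linkCurve τ j := by
  rw [chainCurve, if_neg (by omega), show (2 * j + 1) / 2 = j by omega]

/-- In the order leaf, handle, link, handle, and so on, only neighbours meet. The twist along each
curve is one of the three computed above, and only the formulas for the two neighbours are
nontrivial. -/
theorem isTwistChain_leaf (hτ : τ (stdBase g n) = Path.refl _) (hg : 0 < g) (k : ℕ) :
    IsTwistChain (inducedAut τ) (2 * g - 2 + 1) (consSeq (leaf τ k) (chainCurve τ)) := by
  have hfixed : ∀ (P : ℕ → Prop) (φ : MulAut (FundamentalGroup (StdSurface g n) (stdBase g n))),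
      (∀ j, j < g → P (2 * j) → φ (handleCurve τ j) = handleCurve τ j) →
      (∀ j, j + 1 < g → P (2 * j + 1) → φ (linkCurve τ j) = linkCurve τ j) →
      ∀ i, i ≤ 2 * g - 2 → P i → φ (chainCurve τ i) = chainCurve τ i := by
    intro P φ h1 h2 i hi hP
    obtain ⟨j, rfl | rfl⟩ := Nat.even_or_odd' i
    · rw [chainCurve_even]; exact h1 j (by omega) hP
    · rw [chainCurve_odd]; exact h2 j (by omega) hP
  intro i hi
  rcases i with _ | i
  · obtain ⟨φ, hφ, h0, hh, hl, hk, -, -⟩ := exists_leaf_twist τ hτ hg k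
    refine ⟨φ, hφ, hk, fun _ => ?_, fun j hj => by omega, fun j hj hj2 => ?_⟩
    · change φ (chainCurve τ (2 * 0)) = _ * chainCurve τ (2 * 0)
      rw [chainCurve_even]
      exact h0
    · obtain ⟨j, rfl⟩ : ∃ j', j = j' + 1 := ⟨j - 1, by omega⟩
      exact hfixed (fun i => 0 < i) φ (fun j hj h => hh j hj (by omega)) (fun j hj _ => hl j hj) j
        (by omega) (by omega)
  · obtain ⟨j, rfl | rfl⟩ := Nat.even_or_odd' i
    · obtain ⟨φ, hφ, hh, hlj, hlj', hl, hk0, hk⟩ := exists_handle_twist τ hτ (j := j) (by omega)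
      refine ⟨φ, hφ, ?_, fun h => ?_, fun i hi' => ?_, fun i hi' h => ?_⟩
      · change φ (chainCurve τ (2 * j)) = chainCurve τ (2 * j)
        rw [chainCurve_even]
        exact hh j (by omega)
      · change φ (chainCurve τ (2 * j + 1)) = (chainCurve τ (2 * j))⁻¹ * chainCurve τ (2 * j + 1)
        rw [chainCurve_even, chainCurve_odd]
        exact hlj (by omega)
      · obtain rfl : i = 2 * j := by omega
        change _ = _ * chainCurve τ (2 * j)
        rcases j with _ | j
        · rw [chainCurve_even]
          exact hk0 rfl k
        · change φ (chainCurve τ (2 * j + 1)) = chainCurve τ (2 * j + 1) * _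
          rw [chainCurve_even, chainCurve_odd]
          exact hlj' j rfl
      · rcases i with _ | i
        · exact hk (by omega) k
        · exact hfixed (fun i => i + 2 ≤ 2 * j ∨ 2 * j + 2 ≤ i) φ (fun j hj h => hh j hj)
            (fun l hlg h => hl l hlg (by omega) (by omega)) i (by omega) (by omega)
    · obtain ⟨φ, hφ, hh, hj, hj1, hl, hk⟩ := exists_link_twist τ hτ (j := j) (by omega)
      refine ⟨φ, hφ, ?_, fun h => ?_, fun i hi' => ?_, fun i hi' h => ?_⟩
      · change φ (chainCurve τ (2 * j + 1)) = chainCurve τ (2 * j + 1)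
        rw [chainCurve_odd]
        exact hl j (by omega)
      · change φ (chainCurve τ (2 * (j + 1))) =
          (chainCurve τ (2 * j + 1))⁻¹ * chainCurve τ (2 * (j + 1))
        rw [chainCurve_even, chainCurve_odd]
        exact hj1
      · obtain rfl : i = 2 * j + 1 := by omega
        change φ (chainCurve τ (2 * j)) = chainCurve τ (2 * j) * chainCurve τ (2 * j + 1)
        rw [chainCurve_even, chainCurve_odd]
        exact hj
      · rcases i with _ | i
        · exact hk k
        · exact hfixed (fun i => i + 2 ≤ 2 * j + 1 ∨ 2 * j + 1 + 2 ≤ i) φ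
            (fun l hlg h => hh l hlg (by omega) (by omega)) (fun l hlg h => hl l hlg) i
            (by omega) (by omega)

/-- The two leaves are disjoint and each is crossed once by the first handle curve. The condition `i
< k` matters: the twist along the smaller leaf fixes the conjugate of the larger one, while the
twist along the larger leaf fixes the smaller one itself. -/
theorem isTwistChain_fork (hτ : τ (stdBase g n) = Path.refl _) (hg : 0 < g) {i k : ℕ}
    (hik : i < k) : IsTwistChain (inducedAut τ) 2 (consSeq (leaf τ i) (consSeq (chainCurve τ 0)
      fun _ => ((chainCurve τ 0)⁻¹ * leaf τ k * chainCurve τ 0)⁻¹)) := by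
  have e0 : chainCurve τ 0 = handleCurve τ 0 := chainCurve_even τ 0
  rw [e0]
  obtain ⟨φ, hφ, hE, -, -, hi, -, hi'⟩ := exists_leaf_twist τ hτ hg i
  obtain ⟨ψ, hψ, hE2, -, -, hk, hk', hk''⟩ := exists_leaf_twist τ hτ hg k
  obtain ⟨χ, hχ, hh, -, -, -, hl, -⟩ := exists_handle_twist τ hτ hg
  intro l hl2
  rcases l with _ | _ | _ | l
  · refine ⟨φ, hφ, hi, fun _ => hE, fun j hj => by omega, fun j hj h => ?_⟩
    obtain rfl : j = 2 := by omega
    change φ (_⁻¹) = _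
    rw [map_inv, hi' k hik.le]
    rfl
  · refine ⟨χ, hχ, hh 0 hg, fun _ => ?_, fun j hj => ?_, fun j hj h => by omega⟩
    · change χ (((handleCurve τ 0)⁻¹ * leaf τ k * handleCurve τ 0)⁻¹) = (handleCurve τ 0)⁻¹ *
        ((handleCurve τ 0)⁻¹ * leaf τ k * handleCurve τ 0)⁻¹
      rw [map_inv, map_mul, map_mul, map_inv, hh 0 hg, hl rfl k]
      group
    · obtain rfl : j = 0 := by omega
      exact hl rfl i
  · refine ⟨ψ, hψ, ?_, fun h => by omega, fun j hj => ?_, fun j hj h => ?_⟩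
    · change ψ (_⁻¹) = _
      rw [map_inv, hk'' k le_rfl]
      rfl
    · obtain rfl : j = 1 := by omega
      change ψ (handleCurve τ 0) = handleCurve τ 0 *
        ((handleCurve τ 0)⁻¹ * leaf τ k * handleCurve τ 0)⁻¹
      rw [hE2]
      group
    · obtain rfl : j = 0 := by omega
      exact hk' i hik
  · omega

theorem isTwistSystem (hτ : τ (stdBase g n) = Path.refl _) (hg : 0 < g) :
    IsTwistSystem (inducedAut τ) n (2 * g - 2) (leaf τ) (chainCurve τ) :=
  ⟨fun k _ => isTwistChain_leaf τ hτ hg k, fun _ _ hik _ => isTwistChain_fork τ hτ hg hik⟩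

end MoreTwists

/-! ### Generators of the fundamental group: weights of points -/

section Weights

open Topology Set

variable {g n : ℕ} (τ : ∀ y : StdSurface g n, Path (stdBase g n) y)

theorem real_mem_half_iff {x : ℝ} : (x : ℂ) ∈ Half g n ↔
    (∀ j < g, 1 ≤ |x - 6 * j| ∧ 1 ≤ |x - (6 * j + 3)|) ∧ ∀ k < n, x ≠ -rad (4 * k + 3) := by
  have e1 : ∀ j : ℕ, ‖(x : ℂ) - 6 * (j : ℂ)‖ = |x - 6 * j| := fun j => by
    rw [← Real.norm_eq_abs, ← Complex.norm_real]; push_cast; rfl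
  have e2 : ∀ j : ℕ, ‖(x : ℂ) - (6 * (j : ℂ) + 3)‖ = |x - (6 * j + 3)| := fun j => by
    rw [← Real.norm_eq_abs, ← Complex.norm_real]; push_cast; rfl
  constructor
  · rintro ⟨⟨h1, h2⟩, -⟩
    exact ⟨fun j hj => by rw [← e1, ← e2]; exact h1 j hj,
      fun k hk h => h2 k hk (by rw [h, punct])⟩
  · rintro ⟨h1, h2⟩
    exact ⟨⟨fun j hj => by rw [e1, e2]; exact h1 j hj,
      fun k hk h => h2 k hk (Complex.ofReal_injective h)⟩, by simp⟩

/-- The holonomy from the base point to a point in a half of the surface. -/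
def weight (s : Bool) (z : ℂ) : FundamentalGroup (StdSurface g n) (stdBase g n) :=
  bif s then hh τ false Complex.I (mid 0) * hh τ true (mid 0) z else hh τ false Complex.I z

theorem weight_mul (s : Bool) {a b : ℂ} (ha : a ∈ Half g n) (hb : b ∈ Half g n) :
    weight τ s a * hh τ s a b = weight τ s b := by
  cases s
  · exact hh_mul τ false I_mem_half ha hb
  · simp only [weight, cond_true]
    rw [mul_assoc, hh_mul τ true (mid_mem 0) ha hb]

/-- A real point of the surface lies in both halves; its two weights differ by a lasso, so they
agree modulo a subgroup exactly when this lasso belongs to it. -/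
theorem weight_lasso (x : ℂ) :
    weight τ false x * (weight τ true x)⁻¹ = lasso τ Complex.I x (mid 0) := by
  simp only [weight, cond_true, cond_false, lasso, mul_inv_rev, hh_inv, mul_assoc]

/-- The part of a tail that is left after the direct path is removed. -/
def loopTail (j : ℕ) : FundamentalGroup (StdSurface g n) (stdBase g n) :=
  tail τ j * hh τ false (topL j) Complex.I

/-- A subgroup that contains the curves of the twist system. -/
structure ContainsCurves (K : Subgroup (FundamentalGroup (StdSurface g n) (stdBase g n))) :
    Prop where
  leaf_mem : ∀ k ≤ n, leaf τ k ∈ K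
  handle_mem : ∀ j < g, handleCurve τ j ∈ K
  link_mem : ∀ j, j + 1 < g → linkCurve τ j ∈ K

variable {τ} {K : Subgroup (FundamentalGroup (StdSurface g n) (stdBase g n))}

theorem loopTail_succ {j : ℕ} (hj : j + 1 < g) : loopTail τ (j + 1) =
    loopTail τ j * (hh τ false Complex.I (topL j) * hh τ false (topR j) Complex.I) := by
  rw [loopTail, tail, loopTail, mul_assoc (tail τ j), hh_mul τ false (topR_mem (by omega))
    (topL_mem hj) I_mem_half, ← hh_inv τ false Complex.I (topL j)]
  group

/-- The tail through all previous handles differs from the direct path by a product of direct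
passages through these handles. Conjugating a handle curve by it gives the next passage, so both
facts follow by a joint induction. -/
theorem ContainsCurves.loopTail_mem (h : ContainsCurves τ K) {j : ℕ} (hj : j < g) :
    loopTail τ j ∈ K ∧ hh τ false Complex.I (topL j) * hh τ false (topR j) Complex.I ∈ K := by
  have step : ∀ j < g, loopTail τ j ∈ K →
      hh τ false Complex.I (topL j) * hh τ false (topR j) Complex.I ∈ K := by
    intro j hj hT
    have := mul_mem (mul_mem (inv_mem hT) (inv_mem (h.handle_mem j hj))) hT
    convert this using 1
    rw [loopTail, handleCurve, ← hh_inv τ false Complex.I (topL j),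
      ← hh_mul τ false (topL_mem hj) I_mem_half (topR_mem hj), ← hh_inv τ false (topR j),
      ← hh_inv τ false Complex.I (topL j)]
    group
  have hT : ∀ j < g, loopTail τ j ∈ K := by
    intro j
    induction j with
    | zero =>
      intro _
      rw [loopTail, tail, topL_zero, hh_self, mul_one]
      exact one_mem K
    | succ j ih =>
      intro hj
      rw [loopTail_succ hj]
      exact mul_mem (ih (by omega)) (step j (by omega) (ih (by omega)))
  exact ⟨hT j hj, step j hj (hT j hj)⟩

/-- The jump of the weight across a handle is constant along a semicircle, since both ends of the
handle see the same arc. -/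
theorem weight_glue_mul (s : Bool) {j : ℕ} (hj : j < g) {u v : ℂ} (hu : ‖u‖ = 1) (hv : ‖v‖ = 1)
    (hu' : 0 ≤ u.im) (hv' : 0 ≤ v.im) :
    weight τ s (6 * (j : ℂ) + u) * (weight τ s (6 * (j : ℂ) + 3 - conj u))⁻¹ =
      weight τ s (6 * (j : ℂ) + v) * (weight τ s (6 * (j : ℂ) + 3 - conj v))⁻¹ := by
  rw [← weight_mul τ s (footL_mem_half hj hu hu') (footL_mem_half hj hv hv'),
    ← weight_mul τ s (footR_mem_half hj hu hu') (footR_mem_half hj hv hv'),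
    hh_glue τ s hj hu hv hu' hv']
  group

theorem ContainsCurves.weight_glue_false (h : ContainsCurves τ K) {j : ℕ} (hj : j < g) {u : ℂ}
    (hu : ‖u‖ = 1) (hu' : 0 ≤ u.im) :
    weight τ false (6 * (j : ℂ) + u) * (weight τ false (6 * (j : ℂ) + 3 - conj u))⁻¹ ∈ K := by
  rw [weight_glue_mul false hj hu (v := Complex.I) (by simp) hu' (by simp), joinedTops_mem]
  simp only [weight, cond_false, hh_inv]
  exact (h.loopTail_mem hj).2

theorem lasso_real {x y : ℝ} (hxy : ∀ r ∈ uIcc x y, (r : ℂ) ∈ Half g n)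
    (h : lasso τ Complex.I x (mid 0) ∈ K) : lasso τ Complex.I y (mid 0) ∈ K := by
  rwa [lasso_congr τ I_mem_half (hxy y right_mem_uIcc) (mid_mem 0) (hxy x left_mem_uIcc) (mid_mem 0)
    (hh_real τ false true (by rwa [uIcc_comm])) (by rw [hh_self, hh_self])]

/-- A link curve with its tail removed is the lasso from one midpoint to the next; these lassos
compose. -/
theorem ContainsCurves.lasso_mid (h : ContainsCurves τ K) {j : ℕ} (hj : j < g) :
    lasso τ Complex.I (mid j) (mid 0) ∈ K := by
  induction j with
  | zero =>
    rw [lasso, hh_self, mul_one, hh_mul τ false I_mem_half (mid_mem 0) I_mem_half, hh_self]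
    exact one_mem K
  | succ j ih =>
    obtain ⟨h1, h2⟩ := h.loopTail_mem (j := j) (by omega)
    have hc := mul_mem h1 h2
    have key : lasso τ Complex.I (mid j) (mid (j + 1)) ∈ K := by
      have := mul_mem (mul_mem (inv_mem hc) (h.link_mem j hj)) hc
      convert this using 1
      rw [loopTail, linkCurve, ← lasso_conj τ I_mem_half (topR_mem (show j < g by omega)) (mid_mem j)
        (mid_mem (j + 1)), ← hh_inv τ false Complex.I (topL j)]
      group
    rw [← lasso_mul τ _ (mid_mem (j + 1)) (mid_mem j) (mid_mem 0), ← lasso_inv τ _ (mid j)]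
    exact mul_mem (inv_mem key) (ih (by omega))

/-- For the lower half the jump is evaluated at `u = 1`, where the circles meet the real axis next
to the midpoint. There the two weights of each end differ by elements of `K`, and the jump for the
upper half is known. -/
theorem ContainsCurves.weight_glue (h : ContainsCurves τ K) (s : Bool) {j : ℕ} (hj : j < g) {u : ℂ}
    (hu : ‖u‖ = 1) (hu' : 0 ≤ u.im) :
    weight τ s (6 * (j : ℂ) + u) * (weight τ s (6 * (j : ℂ) + 3 - conj u))⁻¹ ∈ K := by
  cases s
  · exact h.weight_glue_false hj hu hu'
  rw [weight_glue_mul true hj hu (v := 1) (by simp) hu' (by simp)]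
  have h0 := h.weight_glue_false hj (u := 1) (by simp) (by simp)
  have h1 : lasso τ Complex.I ((6 * j + 1 : ℝ) : ℂ) (mid 0) ∈ K := by
    refine lasso_real (fun r hr => ?_) (h.lasso_mid hj)
    rw [uIcc_comm, uIcc_of_le (by linarith)] at hr
    exact between_mem j hr.1 (by linarith [hr.2])
  have h2 : lasso τ Complex.I ((6 * j + 2 : ℝ) : ℂ) (mid 0) ∈ K := by
    refine lasso_real (fun r hr => ?_) (h.lasso_mid hj)
    rw [uIcc_of_le (by linarith)] at hr
    exact between_mem j (by linarith [hr.1]) hr.2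
  have e1 : ((6 * j + 1 : ℝ) : ℂ) = 6 * (j : ℂ) + 1 := by push_cast; ring
  have e2 : ((6 * j + 2 : ℝ) : ℂ) = 6 * (j : ℂ) + 3 - conj 1 := by push_cast; rw [map_one]; ring
  rw [← weight_lasso, e1] at h1
  rw [← weight_lasso, e2] at h2
  have := mul_mem (mul_mem (inv_mem h1) h0) h2
  convert this using 1
  group

/-- The gluing at `u = -1` identifies the point to the left of the `j`-th handle with the point to
its right, so membership propagates from left to right. It starts with the innermost leaf. -/
theorem ContainsCurves.lasso_right (h : ContainsCurves τ K) {j : ℕ} (hj : j < g) :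
    lasso τ Complex.I ((6 * j + 4 : ℝ) : ℂ) (mid 0) ∈ K := by
  have step : ∀ j < g, lasso τ Complex.I ((6 * j - 1 : ℝ) : ℂ) (mid 0) ∈ K →
      lasso τ Complex.I ((6 * j + 4 : ℝ) : ℂ) (mid 0) ∈ K := by
    intro j hj hA
    have h0 := h.weight_glue false hj (u := -1) (by simp) (by simp)
    have h1 := h.weight_glue true hj (u := -1) (by simp) (by simp)
    have e1 : ((6 * j - 1 : ℝ) : ℂ) = 6 * (j : ℂ) + -1 := by push_cast; ring
    have e2 : ((6 * j + 4 : ℝ) : ℂ) = 6 * (j : ℂ) + 3 - conj (-1) := by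
      push_cast; rw [map_neg, map_one]; ring
    rw [← weight_lasso, e1] at hA
    rw [← weight_lasso, e2]
    have := mul_mem (mul_mem (inv_mem h0) hA) h1
    convert this using 1
    group
  induction j with
  | zero =>
    refine step 0 hj (lasso_real (fun r hr => ?_) (h.leaf_mem 0 (Nat.zero_le n)))
    have h2 := one_le_rad (4 * 0 + 2)
    rw [uIcc_of_le (by push_cast; linarith)] at hr
    push_cast at hr
    refine real_mem_half ?_ (by linarith [hr.2]) fun k _ hk => ?_
    · rw [le_abs]; right; linarith [hr.2]
    · have := rad_strictMono (show 4 * 0 + 2 < 4 * k + 3 by omega)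
      linarith [hr.1]
  | succ j ih =>
    refine step (j + 1) hj (lasso_real (fun r hr => ?_) (ih (by omega)))
    push_cast at hr
    rw [uIcc_of_le (by linarith)] at hr
    have hj0 : (0 : ℝ) ≤ j := Nat.cast_nonneg j
    refine real_mem_half_iff.mpr ⟨fun i _ => ?_, fun k _ hk => ?_⟩
    · rcases Nat.lt_or_ge j i with hi | hi
      · have : (j : ℝ) + 1 ≤ i := by exact_mod_cast hi
        constructor <;> rw [le_abs] <;> right <;> linarith [hr.2]
      · have : (i : ℝ) ≤ j := by exact_mod_cast hi
        constructor <;> rw [le_abs] <;> left <;> linarith [hr.1]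
    · linarith [one_le_rad (4 * k + 3), hr.1]

/-- Lassos with crossing points in the same real interval of the surface are equal. Each interval
contains a point that is already settled: on a leaf, midway between the ends of a handle, or to the
right of a handle. -/
theorem ContainsCurves.lasso_mem (h : ContainsCurves τ K) (hg : 0 < g) {x : ℝ}
    (hx : (x : ℂ) ∈ Half g n) : lasso τ Complex.I x (mid 0) ∈ K := by
  obtain ⟨h1, h2⟩ := real_mem_half_iff.mp hx
  rcases le_or_gt x (-1) with hx1 | hx1
  -- The number `k` counts the punctures between `x` and the first foot. The point `leafPt k` then
  -- lies in the same interval as `x`; the case `k = n` is the interval beyond all punctures.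
  · have hex : ∃ k, n ≤ k ∨ -x < rad (4 * k + 3) := ⟨n, Or.inl le_rfl⟩
    classical
    set k := Nat.find hex with hk
    have hk1 := Nat.find_spec hex
    rw [← hk] at hk1
    have hk2 : ∀ l < k, l < n ∧ rad (4 * l + 3) ≤ -x := fun l hl => by
      simpa using Nat.find_min hex hl
    have hkn : k ≤ n := Nat.find_le (Or.inl le_rfl)
    refine lasso_real (fun r hr => ?_) (h.leaf_mem k hkn)
    have hr' : (r ≤ -1) := by
      rcases le_total (-rad (4 * k + 2)) x with hle | hle
      · rw [uIcc_of_le hle] at hr; linarith [hr.2]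
      · rw [uIcc_of_ge hle] at hr; linarith [hr.2, one_le_rad (4 * k + 2)]
    refine real_mem_half (by rw [le_abs]; right; linarith) (by linarith) fun l hl he => ?_
    rcases Nat.lt_or_ge l k with hlk | hlk
    · have a1 := (hk2 l hlk).2.lt_of_ne fun e => h2 l hl (by linarith)
      have a2 := rad_strictMono (show 4 * l + 3 < 4 * k + 2 by omega)
      rcases le_total (-rad (4 * k + 2)) x with hle | hle
      · rw [uIcc_of_le hle] at hr; linarith [hr.2]
      · rw [uIcc_of_ge hle] at hr; linarith [hr.2]
    · have a1 := hk1.resolve_left (by omega)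
      have a2 := rad_strictMono.monotone (show 4 * k + 3 ≤ 4 * l + 3 by omega)
      have a3 := rad_strictMono (show 4 * k + 2 < 4 * l + 3 by omega)
      rcases le_total (-rad (4 * k + 2)) x with hle | hle
      · rw [uIcc_of_le hle] at hr; linarith [hr.1]
      · rw [uIcc_of_ge hle] at hr; linarith [hr.1]
  · have hx0 : 1 ≤ x := by
      have := (h1 0 hg).1
      rw [le_abs] at this
      push_cast at this
      rcases this with h | h <;> linarith
    -- The handle at or before `x`, capped at the last one, beyond which the real axis has no
    -- further holes.
    obtain ⟨j, hj, hj1, hj2⟩ : ∃ j < g, 6 * (j : ℝ) ≤ x ∧ (j + 1 < g → x < 6 * (j : ℝ) + 6) := by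
      have hf1 := Nat.floor_le (show 0 ≤ x / 6 by linarith)
      have hf2 := Nat.lt_floor_add_one (x / 6)
      rcases Nat.lt_or_ge (⌊x / 6⌋₊) g with hlt | hge
      · exact ⟨_, hlt, by linarith, fun _ => by linarith⟩
      · refine ⟨g - 1, by omega, ?_, fun h => by omega⟩
        have : ((g - 1 : ℕ) : ℝ) ≤ (⌊x / 6⌋₊ : ℝ) := by exact_mod_cast (by omega)
        linarith
    have hjl : 6 * (j : ℝ) + 1 ≤ x := by
      have := (h1 j hj).1
      rw [le_abs] at this
      rcases this with h | h <;> linarith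
    have hjr := (h1 j hj).2
    rw [le_abs] at hjr
    rcases hjr with hjr | hjr
    · have hx5 : j + 1 < g → x ≤ 6 * j + 5 := fun hlt => by
        have := (h1 (j + 1) hlt).1
        rw [le_abs] at this
        push_cast at this
        rcases this with h | h <;> linarith [hj2 hlt]
      refine lasso_real (fun r hr => ?_) (h.lasso_right hj)
      rw [uIcc_of_le (by linarith)] at hr
      have hj0 : (0 : ℝ) ≤ j := Nat.cast_nonneg j
      refine real_mem_half_iff.mpr ⟨fun i hi => ?_, fun k _ hk => ?_⟩
      · rcases Nat.lt_or_ge j i with hij | hij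
        · have : (j : ℝ) + 1 ≤ i := by exact_mod_cast hij
          have := hx5 (by omega)
          constructor <;> rw [le_abs] <;> right <;> linarith [hr.2]
        · have : (i : ℝ) ≤ j := by exact_mod_cast hij
          constructor <;> rw [le_abs] <;> left <;> linarith [hr.1]
      · linarith [one_le_rad (4 * k + 3), hr.1]
    · refine lasso_real (fun r hr => ?_) (h.lasso_mid hj)
      have : r ∈ Icc (6 * (j : ℝ) + 1) (6 * j + 2) :=
        (uIcc_subset_Icc (by constructor <;> linarith) ⟨hjl, by linarith⟩) hr
      exact between_mem j this.1 this.2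

/-- Up to elements of a subgroup that contains the curves, the weight depends only on the point of
the surface. -/
theorem ContainsCurves.weight_congr (h : ContainsCurves τ K) (hg : 0 < g) {s s' : Bool} {z w : ℂ}
    (hz : z ∈ Half g n) (hw : w ∈ Half g n) (hzw : proj g (flip s z) = proj g (flip s' w)) :
    weight τ s z * (weight τ s' w)⁻¹ ∈ K := by
  have hreal : ∀ (s s' : Bool) (z : ℂ), z ∈ Half g n → z.im = 0 →
      weight τ s z * (weight τ s' z)⁻¹ ∈ K := by
    intro s s' z hz h0
    obtain ⟨x, rfl⟩ : ∃ x : ℝ, z = x := ⟨z.re, by apply Complex.ext <;> simp [h0]⟩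
    have := h.lasso_mem hg hz
    rw [← weight_lasso] at this
    cases s <;> cases s'
    · rw [mul_inv_cancel]; exact one_mem K
    · exact this
    · have := inv_mem this
      rwa [mul_inv_rev, inv_inv] at this
    · rw [mul_inv_cancel]; exact one_mem K
  have hglue : ∀ (s s' : Bool) (z w : ℂ), z ∈ Half g n → w ∈ Half g n → ∀ i < g, ∀ u : ℂ, ‖u‖ = 1 →
      flip s z = 6 * (i : ℂ) + u → flip s' w = 6 * (i : ℂ) + 3 - conj u →
      weight τ s z * (weight τ s' w)⁻¹ ∈ K := by
    intro s s' z w hz hw i hi u hu ez ew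
    have ez' : z = 6 * (i : ℂ) + flip s u := by
      rw [← flip_flip s z, ez, flip_add, flip_six]
    have ew' : w = 6 * (i : ℂ) + 3 - conj (flip s' u) := by
      rw [← flip_flip s' w, ew, flip_sub, flip_add, flip_six, flip_three]
      cases s' <;> rfl
    have hz0 : 0 ≤ (flip s u).im := by
      have : 0 ≤ z.im := hz.2
      rw [ez'] at this; simpa using this
    have hw0 : 0 ≤ (flip s' u).im := by
      have : 0 ≤ w.im := hw.2
      rw [ew'] at this; simpa using this
    have hg1 := h.weight_glue s hi (u := flip s u) (by rwa [norm_flip]) hz0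
    rw [← ez'] at hg1
    by_cases hs : s = s'
    · rw [← hs] at ew' ⊢
      rwa [← ew'] at hg1
    · have hu0 : u.im = 0 := by
        cases s <;> cases s' <;> simp at hs hz0 hw0 <;> linarith
      have hfl : ∀ t, flip t u = u := fun t => by
        cases t
        · rfl
        · exact Complex.conj_eq_iff_im.mpr hu0
      rw [hfl] at hg1 ew'
      rw [← ew'] at hg1
      have := mul_mem hg1 (hreal s s' w hw (by rw [ew']; simp [hu0]))
      convert this using 1
      group
  rcases (proj_eq_proj (half_subset hz s).1 (half_subset hw s').1).mp hzw with
    e | ⟨i, hi, u, hu, ⟨e1, e2⟩ | ⟨e1, e2⟩⟩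
  · by_cases hs : s = s'
    · subst hs
      have : z = w := by rw [← flip_flip s z, e, flip_flip]
      rw [this, mul_inv_cancel]
      exact one_mem K
    · have hzi : 0 ≤ z.im := hz.2
      have hwi : 0 ≤ w.im := hw.2
      have h1 := congrArg Complex.im e
      have h2 := congrArg Complex.re e
      rw [flip_re, flip_re] at h2
      have h0 : z.im = 0 ∧ w.im = 0 := by
        cases s <;> cases s' <;> simp at hs h1 <;> constructor <;> linarith
      have : z = w := Complex.ext h2 (by rw [h0.1, h0.2])
      rw [← this]
      exact hreal s s' z hz h0.1
  · exact hglue s s' z w hz hw i hi u hu e1 e2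
  · have := inv_mem (hglue s' s w z hw hz i hi u hu e1 e2)
    rwa [mul_inv_rev, inv_inv] at this

end Weights

/-! ### Generators of the fundamental group: the local condition -/

section Generators

open Topology Set

variable {g n : ℕ} {τ : ∀ y : StdSurface g n, Path (stdBase g n) y}
  {K : Subgroup (FundamentalGroup (StdSurface g n) (stdBase g n))}

theorem sproj_infty_ne {z : ℂ} (hz : z ∈ Plane g) : proj g z ≠ sproj g OnePoint.infty := by
  intro h
  rcases sproj_eq_sproj (coe_mem_holedSphere.mpr hz) infty_mem_holedSphere h with
    h | ⟨_, _, _, _, ⟨_, h⟩ | ⟨h, _⟩⟩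
  · exact OnePoint.coe_ne_infty _ h
  · exact OnePoint.infty_ne_coe _ h
  · exact OnePoint.infty_ne_coe _ h

theorem sproj_infty_notMem : sproj g OnePoint.infty ∉ surfPunct g '' Iio n := by
  rintro ⟨k, -, h⟩
  exact sproj_infty_ne (planeInt_subset (punct_mem_planeInt g k)) h

/-- The function `γ` extends the weights, up to elements of `K`. -/
def ExtendsWeight (τ : ∀ y : StdSurface g n, Path (stdBase g n) y)
    (K : Subgroup (FundamentalGroup (StdSurface g n) (stdBase g n)))
    (γ : StdSurface g n → FundamentalGroup (StdSurface g n) (stdBase g n)) : Prop :=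
  ∀ (s : Bool), ∀ z ∈ Half g n, γ (stdP (flip s z)) * (weight τ s z)⁻¹ ∈ K

/-- By `weight_congr` any representative of a point may be used. The point at infinity is in neither
half, so its value is free. -/
theorem ContainsCurves.exists_extendsWeight (h : ContainsCurves τ K) (hg : 0 < g)
    (x : FundamentalGroup (StdSurface g n) (stdBase g n)) :
    ∃ γ, ExtendsWeight τ K γ ∧ ∀ y : StdSurface g n, y.1 = sproj g OnePoint.infty → γ y = x := by
  classical
  have hex : ∀ y : StdSurface g n, ∃ v, (∀ s, ∀ z ∈ Half g n, stdP (flip s z) = y →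
      v * (weight τ s z)⁻¹ ∈ K) ∧ (y.1 = sproj g OnePoint.infty → v = x) := by
    intro y
    by_cases hy : ∃ s, ∃ z ∈ Half g n, stdP (flip s z) = y
    · obtain ⟨s, z, hz, rfl⟩ := hy
      refine ⟨weight τ s z, fun s' w hw e => h.weight_congr hg hz hw ?_, fun e => ?_⟩
      · have := congrArg Subtype.val e
        rw [stdP_coe (half_subset hz s), stdP_coe (half_subset hw s')] at this
        exact this.symm
      · rw [stdP_coe (half_subset hz s)] at e
        exact absurd e (sproj_infty_ne (half_subset hz s).1)
    · exact ⟨x, fun s z hz e => absurd ⟨s, z, hz, e⟩ hy, fun _ => rfl⟩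
  choose γ hγ using hex
  exact ⟨γ, fun s z hz => (hγ _).1 s z hz rfl, fun y => (hγ y).2⟩

/-- A path whose lift stays on one side of the real axis runs in one half, where weights are
multiplicative. -/
theorem ExtendsWeight.mem_of_path {γ : StdSurface g n → FundamentalGroup (StdSurface g n) (stdBase g n)}
    (h : ExtendsWeight τ K γ) {a b : StdSurface g n} (p : Path a b) {f : unitInterval → ℂ}
    (hf : Continuous f) (hfP : ∀ t, f t ∈ Plane g) (hp : ∀ t, (p t).1 = proj g (f t))
    (him : (∀ t, 0 ≤ (f t).im) ∨ ∀ t, (f t).im ≤ 0) : γ a * hol τ p * (γ b)⁻¹ ∈ K := by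
  obtain ⟨s, hs⟩ : ∃ s, ∀ t, 0 ≤ (flip s (f t)).im := by
    rcases him with h | h
    · exact ⟨false, h⟩
    · exact ⟨true, fun t => by simpa using h t⟩
  have hO : ∀ t, f t ∈ Omega g n := fun t => mem_omega_of_proj (hfP t) (hp t ▸ (p t).2)
  have hH : ∀ t, flip s (f t) ∈ Half g n := fun t => ⟨(flip_mem_omega s).mpr (hO t), hs t⟩
  let q : Path (⟨flip s (f 0), hH 0⟩ : Half g n) ⟨flip s (f 1), hH 1⟩ :=
    ⟨⟨fun t => ⟨flip s (f t), hH t⟩, Continuous.subtype_mk ((continuous_flip s).comp hf) _⟩, rfl, rfl⟩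
  have hpt : ∀ t, p t = stdP (flip s (flip s (f t))) := fun t => by
    rw [flip_flip]
    exact Subtype.ext ((hp t).trans (stdP_coe (hO t)).symm)
  have h1 : hol τ p = hh τ s (flip s (f 0)) (flip s (f 1)) := by
    rw [hh_eq τ s (hH 0) (hH 1)]
    refine hol_eq_holMap τ _ q _ fun t => ?_
    rw [hpt, halfMap_eq_stdP]
    rfl
  have ha : a = stdP (flip s (flip s (f 0))) := by rw [← hpt, p.source]
  have hb : b = stdP (flip s (flip s (f 1))) := by rw [← hpt, p.target]
  have k1 := h s _ (hH 0)
  have k2 := h s _ (hH 1)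
  rw [← ha] at k1
  rw [← hb] at k2
  have := mul_mem k1 (inv_mem k2)
  rw [← weight_mul τ s (hH 0) (hH 1), ← h1] at this
  convert this using 1
  group

/-- A chart that avoids the punctures. -/
structure IsPunctChart (n : ℕ) (χ : ℂ → ClosedSurface g) (c : ℂ) (r : ℝ) : Prop where
  isChart : IsChart χ c r
  notMem : ∀ w ∈ Metric.closedBall c r, χ w ∉ surfPunct g '' Iio n

theorem IsChart.exists_isPunctChart {χ : ℂ → ClosedSurface g} {c : ℂ} {r : ℝ} (h : IsChart χ c r)
    (hc : χ c ∉ surfPunct g '' Iio n) : ∃ ε > 0, ∀ δ > 0, δ ≤ ε → δ ≤ r ∧ IsPunctChart n χ c δ := by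
  have hopen : IsOpen (surfPunct g '' Iio n)ᶜ := (((finite_Iio n).image _).isClosed).isOpen_compl
  have hca : ContinuousAt χ c := h.cont.continuousAt (Metric.closedBall_mem_nhds c h.pos)
  obtain ⟨ε, hε, hsub⟩ := Metric.nhds_basis_closedBall.mem_iff.mp
    (hca.preimage_mem_nhds (hopen.mem_nhds hc))
  refine ⟨min ε r, lt_min hε h.pos, fun δ hδ hδε => ⟨hδε.trans (min_le_right _ _),
    h.mono hδ (hδε.trans (min_le_right _ _)), fun w hw => ?_⟩⟩
  exact hsub (Metric.closedBall_subset_closedBall (hδε.trans (min_le_left _ _)) hw)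

variable {χ : ℂ → ClosedSurface g} {c : ℂ} {r : ℝ}

/-- A chart as a map to the punctured surface. -/
def IsPunctChart.map (h : IsPunctChart n χ c r) : C(Metric.closedBall c r, StdSurface g n) :=
  ⟨fun w => ⟨χ w, h.notMem w w.2⟩, Continuous.subtype_mk
    (h.isChart.cont.comp_continuous continuous_subtype_val fun w => w.2) _⟩

theorem IsPunctChart.contractibleSpace (h : IsPunctChart n χ c r) :
    ContractibleSpace (Metric.closedBall c r) :=
  (convex_closedBall c r).contractibleSpace ⟨c, Metric.mem_closedBall_self h.isChart.pos.le⟩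

/-- The centre of a closed ball. -/
def IsPunctChart.centre (h : IsPunctChart n χ c r) : Metric.closedBall c r :=
  ⟨c, Metric.mem_closedBall_self h.isChart.pos.le⟩

/-- The straight path in a ball. -/
def ballPath (a b : Metric.closedBall c r) : Path a b where
  toFun t := ⟨(1 - t : ℝ) • (a : ℂ) + (t : ℝ) • (b : ℂ), convex_closedBall c r a.2 b.2
    (sub_nonneg.mpr t.2.2) t.2.1 (by ring)⟩
  continuous_toFun := Continuous.subtype_mk (by fun_prop) _
  source' := Subtype.ext (by simp)
  target' := Subtype.ext (by simp)

theorem ballPath_coe (a b : Metric.closedBall c r) (t : unitInterval) :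
    (ballPath a b t : ℂ) = (1 - t : ℝ) • (a : ℂ) + (t : ℝ) • (b : ℂ) := rfl

theorem ballPath_re (a b : Metric.closedBall c r) (t : unitInterval) :
    (ballPath a b t : ℂ).re = (1 - t) * (a : ℂ).re + t * (b : ℂ).re := by
  simp [ballPath_coe]

theorem ballPath_im (a b : Metric.closedBall c r) (t : unitInterval) :
    (ballPath a b t : ℂ).im = (1 - t) * (a : ℂ).im + t * (b : ℂ).im := by
  simp [ballPath_coe]

theorem continuous_ballPath (a b : Metric.closedBall c r) :
    Continuous fun t => (ballPath a b t : ℂ) :=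
  continuous_subtype_val.comp (ballPath a b).continuous

/-- The local condition in a chart. -/
theorem IsPunctChart.exists_nhds (h : IsPunctChart n χ c r)
    {γ : StdSurface g n → FundamentalGroup (StdSurface g n) (stdBase g n)}
    (hγ : ∀ b, γ (h.map h.centre) * hol τ ((ballPath h.centre b).map h.map.continuous) *
      (γ (h.map b))⁻¹ ∈ K) {y : StdSurface g n} (hy : y.1 = χ c) :
    ∃ N ∈ 𝓝 y, ∀ b (p : Path y b), (∀ t, p t ∈ N) → γ y * hol τ p * (γ b)⁻¹ ∈ K := by
  have hcs := h.contractibleSpace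
  have hyc : y = h.map h.centre := Subtype.ext hy
  have hopen := h.isChart.isOpen _ subset_rfl Metric.isOpen_ball
  refine ⟨Subtype.val ⁻¹' (χ '' Metric.ball c r), continuous_subtype_val.continuousAt.preimage_mem_nhds
    (hopen.mem_nhds ⟨c, Metric.mem_ball_self h.isChart.pos, hy.symm⟩), fun b p hp => ?_⟩
  have hinj : Function.Injective h.map := fun z w hzw =>
    Subtype.ext (h.isChart.inj z.2 w.2 (congrArg Subtype.val hzw))
  have hce : IsClosedEmbedding h.map := h.map.continuous.isClosedEmbedding hinj
  have hmem : ∀ t, ∃ w, h.map w = p t := fun t => by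
    obtain ⟨w, hw, e⟩ := hp t
    exact ⟨⟨w, Metric.ball_subset_closedBall hw⟩, Subtype.ext e⟩
  choose l hl using hmem
  have hlc : Continuous l := by
    rw [hce.isInducing.continuous_iff]
    have : h.map ∘ l = p := funext hl
    rw [this]
    exact p.continuous
  have h0 : l 0 = h.centre := hinj (by rw [hl, p.source, hyc])
  let q : Path h.centre (l 1) := ⟨⟨l, hlc⟩, h0, rfl⟩
  have hb : h.map (l 1) = b := by rw [hl, p.target]
  have := hγ (l 1)
  rw [holMap_eq τ h.map, ← hol_eq_holMap τ h.map q p hl, hb, ← hyc] at this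
  exact this

theorem ExtendsWeight.mem_of_chart
    {γ : StdSurface g n → FundamentalGroup (StdSurface g n) (stdBase g n)}
    (hγ : ExtendsWeight τ K γ) (h : IsPunctChart n χ c r) (a b : Metric.closedBall c r)
    {f : unitInterval → ℂ} (hf : Continuous f) (hfP : ∀ t, f t ∈ Plane g)
    (hp : ∀ t, χ (ballPath a b t) = proj g (f t))
    (him : (∀ t, 0 ≤ (f t).im) ∨ ∀ t, (f t).im ≤ 0) :
    γ (h.map a) * hol τ ((ballPath a b).map h.map.continuous) * (γ (h.map b))⁻¹ ∈ K :=
  hγ.mem_of_path _ hf hfP hp him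

/-- In a handle chart the side of the real axis is the sign of a sine. Short segments starting at
`θ` keep this sign; at a zero of the sine they move off in one direction only. -/
theorem exists_sin_sign (θ : ℝ) : ∃ δ > 0, ∀ θ', |θ' - θ| ≤ δ →
    (∀ t : unitInterval, 0 ≤ Real.sin ((1 - t) * θ + t * θ')) ∨
      ∀ t : unitInterval, Real.sin ((1 - t) * θ + t * θ') ≤ 0 := by
  have habs : ∀ (θ' : ℝ) (t : unitInterval), |(1 - t) * θ + t * θ' - θ| ≤ |θ' - θ| := by
    intro θ' t
    rw [show (1 - (t : ℝ)) * θ + t * θ' - θ = t * (θ' - θ) by ring, abs_mul, abs_of_nonneg t.2.1]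
    exact mul_le_of_le_one_left (abs_nonneg _) t.2.2
  rcases lt_trichotomy (Real.sin θ) 0 with h | h | h
  · obtain ⟨ε, hε, hsub⟩ := Metric.nhds_basis_closedBall.mem_iff.mp
      (Real.continuous_sin.continuousAt.preimage_mem_nhds (Iio_mem_nhds h))
    exact ⟨ε, hε, fun θ' hθ' => Or.inr fun t => le_of_lt (hsub ((habs θ' t).trans hθ'))⟩
  · refine ⟨1, one_pos, fun θ' hθ' => ?_⟩
    obtain ⟨h1, h2⟩ := abs_le.mp hθ'
    have hs : ∀ t : unitInterval, Real.sin ((1 - t) * θ + t * θ') =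
        Real.cos θ * Real.sin (t * (θ' - θ)) := fun t => by
      rw [show (1 - (t : ℝ)) * θ + t * θ' = θ + t * (θ' - θ) by ring, Real.sin_add, h]
      ring
    have hsgn : (∀ t : unitInterval, 0 ≤ Real.sin (t * (θ' - θ))) ∨
        ∀ t : unitInterval, Real.sin (t * (θ' - θ)) ≤ 0 := by
      rcases le_total 0 (θ' - θ) with h0 | h0
      · exact Or.inl fun t => Real.sin_nonneg_of_nonneg_of_le_pi (mul_nonneg t.2.1 h0)
          (by nlinarith [t.2.1, t.2.2, Real.pi_gt_three])
      · exact Or.inr fun t => Real.sin_nonpos_of_nonpos_of_neg_pi_le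
          (mul_nonpos_of_nonneg_of_nonpos t.2.1 h0) (by nlinarith [t.2.1, t.2.2, Real.pi_gt_three])
    simp only [hs]
    rcases le_total 0 (Real.cos θ) with hc | hc <;> rcases hsgn with h | h
    · exact Or.inl fun t => mul_nonneg hc (h t)
    · exact Or.inr fun t => mul_nonpos_of_nonneg_of_nonpos hc (h t)
    · exact Or.inr fun t => mul_nonpos_of_nonpos_of_nonneg hc (h t)
    · exact Or.inl fun t => mul_nonneg_of_nonpos_of_nonpos hc (h t)
  · obtain ⟨ε, hε, hsub⟩ := Metric.nhds_basis_closedBall.mem_iff.mp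
      (Real.continuous_sin.continuousAt.preimage_mem_nhds (Ioi_mem_nhds h))
    exact ⟨ε, hε, fun θ' hθ' => Or.inl fun t => le_of_lt (hsub ((habs θ' t).trans hθ'))⟩

/-- A segment that starts on the real axis stays on one side of it; about other points the disc is
taken so small that it does not cross the axis. -/
theorem ExtendsWeight.exists_nhds_of_int
    {γ : StdSurface g n → FundamentalGroup (StdSurface g n) (stdBase g n)}
    (hγ : ExtendsWeight τ K γ) {z : ℂ} (hz : z ∈ PlaneInt g) {y : StdSurface g n}
    (hy : y.1 = proj g z) :
    ∃ N ∈ 𝓝 y, ∀ b (p : Path y b), (∀ t, p t ∈ N) → γ y * hol τ p * (γ b)⁻¹ ∈ K := by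
  obtain ⟨r, hr, hsub⟩ := Metric.nhds_basis_closedBall.mem_iff.mp (isOpen_planeInt.mem_nhds hz)
  obtain ⟨ε, hε, hch⟩ := (isChart_proj hr hsub).exists_isPunctChart (n := n) (hy ▸ y.2)
  have key : ∀ δ > 0, δ ≤ ε → (∀ b ∈ Metric.closedBall z δ, (0 ≤ z.im ∧ 0 ≤ b.im) ∨
      (z.im ≤ 0 ∧ b.im ≤ 0)) →
      ∃ N ∈ 𝓝 y, ∀ b (p : Path y b), (∀ t, p t ∈ N) → γ y * hol τ p * (γ b)⁻¹ ∈ K := by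
    intro δ hδ hδε hsign
    obtain ⟨hδr, hc⟩ := hch δ hδ hδε
    refine hc.exists_nhds (fun b => hγ.mem_of_chart hc _ b (continuous_ballPath _ _) (fun t => ?_)
      (fun t => rfl) ?_) hy
    · exact planeInt_subset (hsub (Metric.closedBall_subset_closedBall hδr (ballPath _ b t).2))
    · simp only [ballPath_im]
      refine (hsign b b.2).imp (fun h t => ?_) fun h t => ?_
      · exact add_nonneg (mul_nonneg (sub_nonneg.mpr t.2.2) h.1) (mul_nonneg t.2.1 h.2)
      · exact add_nonpos (mul_nonpos_of_nonneg_of_nonpos (sub_nonneg.mpr t.2.2) h.1)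
          (mul_nonpos_of_nonneg_of_nonpos t.2.1 h.2)
  by_cases h0 : z.im = 0
  · refine key ε hε le_rfl fun b _ => ?_
    rw [h0]
    simpa using le_total 0 b.im
  · refine key (min ε |z.im|) (lt_min hε (abs_pos.mpr h0)) (min_le_left _ _) fun b hb => ?_
    rw [Metric.mem_closedBall, dist_eq_norm] at hb
    have h1 := abs_le.mp (((Complex.abs_im_le_norm _).trans hb).trans (min_le_right _ _))
    rw [Complex.sub_im] at h1
    rcases le_total 0 z.im with h2 | h2
    · rw [abs_of_nonneg h2] at h1
      exact Or.inl ⟨h2, by linarith [h1.1]⟩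
    · rw [abs_of_nonpos h2] at h1
      exact Or.inr ⟨h2, by linarith [h1.2]⟩

theorem ExtendsWeight.exists_nhds_of_handle
    {γ : StdSurface g n → FundamentalGroup (StdSurface g n) (stdBase g n)}
    (hγ : ExtendsWeight τ K γ) {i : ℕ} (hi : i < g) (θ : ℝ) {y : StdSurface g n}
    (hy : y.1 = handleChart g i (θ * Complex.I)) :
    ∃ N ∈ 𝓝 y, ∀ b (p : Path y b), (∀ t, p t ∈ N) → γ y * hol τ p * (γ b)⁻¹ ∈ K := by
  obtain ⟨ε, hε, hch⟩ := (isChart_handle hi θ).exists_isPunctChart (n := n) (hy ▸ y.2)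
  obtain ⟨δ, hδ, hsin⟩ := exists_sin_sign θ
  obtain ⟨hr, hc⟩ := hch (min ε δ) (lt_min hε hδ) (min_le_left _ _)
  refine hc.exists_nhds (fun b => ?_) hy
  have hB : ∀ w : Metric.closedBall (θ * Complex.I) (min ε δ),
      -(1 / 4) ≤ (w : ℂ).re ∧ (w : ℂ).re ≤ 1 / 4 := fun w =>
    re_mem_of_ball (by rw [← dist_eq_norm]; exact w.2.trans hr)
  have hre : ∀ t, (ballPath hc.centre b t : ℂ).re = t * (b : ℂ).re := fun t => by
    rw [ballPath_re]
    simp [IsPunctChart.centre]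
  have him : ∀ t, (ballPath hc.centre b t : ℂ).im = (1 - t) * θ + t * (b : ℂ).im := fun t => by
    rw [ballPath_im]
    simp [IsPunctChart.centre]
  have hs := hsin (b : ℂ).im (by
    have := (Complex.abs_im_le_norm _).trans ((dist_eq_norm (b : ℂ) _).ge.trans b.2)
    simpa using this.trans (min_le_right _ _))
  have hcont := continuous_ballPath hc.centre b
  rcases le_total 0 (b : ℂ).re with h0 | h0
  · have hre' : ∀ t, 0 ≤ (ballPath hc.centre b t : ℂ).re := fun t => by
      rw [hre]; exact mul_nonneg t.2.1 h0
    refine hγ.mem_of_chart hc _ b (f := fun t => 6 * (i : ℂ) + Complex.exp (ballPath hc.centre b t))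
      (by fun_prop) (fun t => footL_exp_mem (hre' t) (hB _).2)
      (fun t => handleChart_of_nonneg (hre' t)) ?_
    refine hs.imp (fun h t => ?_) fun h t => ?_
    all_goals
      have := h t
      rw [← him] at this
      simp only [Complex.add_im, Complex.exp_im]
      simp
    · exact mul_nonneg (Real.exp_pos _).le this
    · exact mul_nonpos_of_nonneg_of_nonpos (Real.exp_pos _).le this
  · have hre' : ∀ t, (ballPath hc.centre b t : ℂ).re ≤ 0 := fun t => by
      rw [hre]; exact mul_nonpos_of_nonneg_of_nonpos t.2.1 h0
    refine hγ.mem_of_chart hc _ b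
      (f := fun t => 6 * (i : ℂ) + 3 - Complex.exp (-(ballPath hc.centre b t : ℂ)))
      (by fun_prop) (fun t => footR_exp_mem (hre' t) (hB _).1)
      (fun t => handleChart_of_nonpos hi (hre' t)) ?_
    refine hs.imp (fun h t => ?_) fun h t => ?_
    all_goals
      have := h t
      rw [← him] at this
      simp only [Complex.sub_im, Complex.add_im, Complex.exp_im]
      simp
    · exact mul_nonneg (Real.exp_pos _).le this
    · exact mul_nonpos_of_nonneg_of_nonpos (Real.exp_pos _).le this

/-- Inversion exchanges the two sides of the real axis, so a segment on one side that avoids `0`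
runs in one half. -/
theorem ExtendsWeight.mem_of_infty
    {γ : StdSurface g n → FundamentalGroup (StdSurface g n) (stdBase g n)}
    (hγ : ExtendsWeight τ K γ) {r : ℝ} (hr : r ≤ 1 / (6 * (g : ℝ) + 5))
    (h : IsPunctChart n (fun w => sproj g (sphereInv w)) 0 r) (a b : Metric.closedBall (0 : ℂ) r)
    (h0 : ∀ t, (ballPath a b t : ℂ) ≠ 0)
    (him : (0 ≤ (a : ℂ).im ∧ 0 ≤ (b : ℂ).im) ∨ ((a : ℂ).im ≤ 0 ∧ (b : ℂ).im ≤ 0)) :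
    γ (h.map a) * hol τ ((ballPath a b).map h.map.continuous) * (γ (h.map b))⁻¹ ∈ K := by
  have hpos : (0 : ℝ) < 6 * (g : ℝ) + 5 := by positivity
  refine hγ.mem_of_chart h a b (f := fun t => (ballPath a b t : ℂ)⁻¹)
    ((continuous_ballPath a b).inv₀ h0) (fun t => planeInt_subset (mem_planeInt_of_norm ?_))
    (fun t => by rw [sphereInv_of_ne (h0 t)]; rfl) ?_
  · have hw := (ballPath a b t).2
    rw [mem_closedBall_zero_iff] at hw
    rw [norm_inv]
    have := (le_inv_comm₀ hpos (norm_pos_iff.mpr (h0 t))).mpr (by rw [← one_div]; exact hw.trans hr)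
    linarith
  · rw [or_comm]
    refine him.imp (fun h t => ?_) fun h t => ?_
    all_goals
      rw [Complex.inv_im, ballPath_im]
    · refine div_nonpos_of_nonpos_of_nonneg (neg_nonpos.mpr ?_) (Complex.normSq_nonneg _)
      exact add_nonneg (mul_nonneg (sub_nonneg.mpr t.2.2) h.1) (mul_nonneg t.2.1 h.2)
    · refine div_nonneg (neg_nonneg.mpr ?_) (Complex.normSq_nonneg _)
      exact add_nonpos (mul_nonpos_of_nonneg_of_nonpos (sub_nonneg.mpr t.2.2) h.1)
        (mul_nonpos_of_nonneg_of_nonpos t.2.1 h.2)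

theorem exists_half_of_proj {y : StdSurface g n} {z : ℂ} (hz : z ∈ Plane g) (hy : y.1 = proj g z) :
    ∃ s, ∃ w ∈ Half g n, stdP (flip s w) = y := by
  have hO := mem_omega_of_proj (n := n) hz (hy ▸ y.2)
  obtain ⟨s, w, hw, rfl⟩ := exists_half hO
  exact ⟨s, w, hw, Subtype.ext ((stdP_coe hO).trans hy.symm)⟩

/-- The curves of the twist system generate the fundamental group. -/
theorem ContainsCurves.eq_top (hτ : τ (stdBase g n) = Path.refl _) (hg : 0 < g)
    (h : ContainsCurves τ K) : K = ⊤ := by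
  obtain ⟨ε, hε, hch⟩ := (isChart_infty (g := g)).exists_isPunctChart (n := n)
    (by simp only [sphereInv_zero]; exact sproj_infty_notMem)
  obtain ⟨hεr, hc⟩ := hch ε hε le_rfl
  have hcs := hc.contractibleSpace
  let w₀ : Metric.closedBall (0 : ℂ) ε := ⟨-(ε * Complex.I), by simp [abs_of_pos hε]⟩
  let w₁ : Metric.closedBall (0 : ℂ) ε := ⟨ε, by simp [abs_of_pos hε]⟩
  -- The function `γ₀` only serves to prescribe the value of `γ` at infinity, by transport from
  -- `w₀`. At `w₀` itself the two functions agree modulo `K`.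
  obtain ⟨γ₀, hγ₀, -⟩ := h.exists_extendsWeight hg 1
  obtain ⟨γ, hγ, hγi⟩ := h.exists_extendsWeight hg (γ₀ (hc.map w₀) * holMap τ hc.map w₀ hc.centre)
  refine eq_top_of_local τ hτ K γ ?_ fun y => ?_
  · have := hγ false _ I_mem_half
    rwa [flip_false, stdP_I, weight, cond_false, hh_self, inv_one, mul_one] at this
  have hzero : (hc.map hc.centre).1 = sproj g OnePoint.infty := by rw [← sphereInv_zero]; rfl
  have hne : ∀ b : Metric.closedBall (0 : ℂ) ε, (b : ℂ) ≠ 0 →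
      ∃ s, ∃ w ∈ Half g n, stdP (flip s w) = hc.map b := by
    intro b hb
    have hpos : (0 : ℝ) < 6 * (g : ℝ) + 5 := by positivity
    refine exists_half_of_proj (z := (b : ℂ)⁻¹) (planeInt_subset (mem_planeInt_of_norm ?_)) ?_
    · have hw := b.2
      rw [mem_closedBall_zero_iff] at hw
      rw [norm_inv]
      have := (le_inv_comm₀ hpos (norm_pos_iff.mpr hb)).mpr (by rw [← one_div]; exact hw.trans hεr)
      linarith
    · change sproj g (sphereInv b) = _
      rw [sphereInv_of_ne hb]
      rfl
  have hw₀ : γ₀ (hc.map w₀) * (γ (hc.map w₀))⁻¹ ∈ K := by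
    obtain ⟨s, w, hw, e⟩ := hne w₀ (by simp [w₀, hε.ne'])
    rw [← e]
    have := mul_mem (hγ₀ s w hw) (inv_mem (hγ s w hw))
    rwa [mul_inv_rev, inv_inv, mul_assoc, inv_mul_cancel_left] at this
  rcases exists_proj y.1 with hy | ⟨z, hz, hy⟩
  · refine hc.exists_nhds (fun b => ?_) (hy.trans (by simp only [sphereInv_zero]))
    rw [holMap_eq τ hc.map]
    by_cases hb : (b : ℂ) = 0
    · have : b = hc.centre := Subtype.ext hb
      rw [this, holMap_self, mul_one, mul_inv_cancel]
      exact one_mem K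
    rw [hγi _ hzero, mul_assoc (γ₀ _), holMap_mul]
    -- From `w₀` on the negative imaginary axis, points with nonpositive imaginary part are reached
    -- along a segment. The others are reached by a detour through the real point `w₁`, which avoids
    -- the centre.
    have key : γ (hc.map w₀) * holMap τ hc.map w₀ b * (γ (hc.map b))⁻¹ ∈ K := by
      rcases le_or_gt (b : ℂ).im 0 with hi | hi
      · have := hγ.mem_of_infty hεr hc w₀ b (fun t ht => ?_) (Or.inr ⟨by simp [w₀, hε.le], hi⟩)
        · rwa [holMap_eq τ hc.map] at this
        · have him := congrArg Complex.im ht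
          rw [ballPath_im, Complex.zero_im] at him
          have e0 : (w₀ : ℂ).im = -ε := by simp [w₀]
          rw [e0] at him
          have ht1 : (t : ℝ) = 1 := by
            by_contra hne
            have : (t : ℝ) < 1 := t.2.2.lt_of_ne hne
            nlinarith [t.2.1]
          rw [ballPath_coe, ht1] at ht
          simp at ht
          exact hb ht
      · have h1 := hγ.mem_of_infty hεr hc w₀ w₁ (fun t ht => ?_)
          (Or.inr ⟨by simp [w₀, hε.le], by simp [w₁]⟩)
        · have h2 := hγ.mem_of_infty hεr hc w₁ b (fun t ht => ?_) (Or.inl ⟨by simp [w₁], hi.le⟩)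
          · rw [holMap_eq τ hc.map] at h1 h2
            have := mul_mem h1 h2
            rw [← holMap_mul τ hc.map w₀ w₁ b]
            convert this using 1
            group
          · have him := congrArg Complex.im ht
            have hre := congrArg Complex.re ht
            have e0 : (w₁ : ℂ).im = 0 := by simp [w₁]
            have e1 : (w₁ : ℂ).re = ε := by simp [w₁]
            rw [ballPath_im, Complex.zero_im, e0] at him
            rw [ballPath_re, Complex.zero_re, e1] at hre
            have ht0 : (t : ℝ) = 0 := by
              have : (t : ℝ) * (b : ℂ).im = 0 := by linarith
              exact (mul_eq_zero.mp this).resolve_right hi.ne'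
            rw [ht0] at hre
            linarith
        · have him := congrArg Complex.im ht
          have hre := congrArg Complex.re ht
          rw [ballPath_im, Complex.zero_im] at him
          rw [ballPath_re, Complex.zero_re] at hre
          simp only [w₀, w₁] at him hre
          simp at him hre
          rcases hre with hre | hre
          · rw [hre] at him; simp at him; exact hε.ne' him
          · exact hε.ne' hre
    have := mul_mem hw₀ key
    convert this using 1
    group
  · by_cases hint : z ∈ PlaneInt g
    · exact hγ.exists_nhds_of_int hint hy.symm
    · simp only [PlaneInt, mem_ofPred_eq, not_forall] at hint
      obtain ⟨i, hi, hlt⟩ := hint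
      have h1 := hz i hi
      rcases eq_or_lt_of_le h1.1 with h2 | h2
      · obtain ⟨θ, hθ⟩ := (Complex.norm_eq_one_iff _).mp h2.symm
        refine hγ.exists_nhds_of_handle hi θ ?_
        rw [handleChart_of_nonneg (by simp), hθ, add_sub_cancel, hy]
      · have h3 : ‖z - (6 * (i : ℂ) + 3)‖ = 1 := by
          by_contra hne
          exact hlt ⟨h2, lt_of_le_of_ne h1.2 (Ne.symm hne)⟩
        obtain ⟨θ, hθ⟩ := (Complex.norm_eq_one_iff (-(z - (6 * (i : ℂ) + 3)))).mp (by rw [norm_neg, h3])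
        refine hγ.exists_nhds_of_handle hi (-θ) ?_
        rw [handleChart_of_nonpos hi (by simp),
          show -(((-θ : ℝ) : ℂ) * Complex.I) = θ * Complex.I by push_cast; ring, hθ, ← hy]
        congr 1
        ring

end Generators

/-! ### A one-holed torus in the standard surface -/

section Torus

open Topology Set

variable {g n : ℕ}

/-- Around the first handle only its own two discs have to be avoided. The punctures have radius
greater than `5 / 4 = rad 1`, so they do not meet the part to the left. -/
theorem mem_omega_near {z : ℂ} (h1 : -(5 / 4) ≤ z.re) (h2 : z.re ≤ 17 / 4)
    (h3 : 1 ≤ z.re ^ 2 + z.im ^ 2) (h4 : 1 ≤ (3 - z.re) ^ 2 + z.im ^ 2)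
    (h5 : 0 < z.re ∨ z.re ^ 2 + z.im ^ 2 ≤ (5 / 4) ^ 2) : z ∈ Omega g n := by
  have hfar : ∀ c : ℝ, 1 ≤ (z.re - c) ^ 2 + z.im ^ 2 → 1 ≤ ‖z - (c : ℂ)‖ := by
    intro c h
    rw [Complex.norm_def, Real.one_le_sqrt, Complex.normSq_apply]
    simp only [Complex.sub_re, Complex.ofReal_re, Complex.sub_im, Complex.ofReal_im, sub_zero]
    nlinarith
  refine ⟨fun j _ => ?_, fun k _ h => ?_⟩
  · have e1 := hfar (6 * j)
    have e2 := hfar (6 * j + 3)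
    push_cast at e1 e2
    rcases Nat.eq_zero_or_pos j with rfl | hj
    · refine ⟨e1 (by push_cast; nlinarith), e2 (by push_cast; nlinarith)⟩
    · have hj' : (1 : ℝ) ≤ j := by exact_mod_cast hj
      exact ⟨e1 (by nlinarith [sq_nonneg z.im]), e2 (by nlinarith [sq_nonneg z.im])⟩
  · have hre : z.re = -rad (4 * k + 3) := by rw [h, punct, Complex.ofReal_re]
    have him : z.im = 0 := by rw [h, punct, Complex.ofReal_im]
    have hr : 5 / 4 < rad (4 * k + 3) := by
      have : rad 1 = 5 / 4 := by norm_num [rad]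
      rw [← this]
      exact rad_strictMono (by omega)
    rcases h5 with h5 | h5
    · linarith
    · rw [hre, him] at h5
      nlinarith

/-- A Möbius transformation that is an involution of the unit circle. -/
def mob (w : ℂ) : ℂ := (1 - 2 * w) / (2 - w)

theorem two_sub_ne {w : ℂ} (hw : ‖w‖ = 1) : 2 - w ≠ 0 := by
  intro h
  rw [← sub_eq_zero.mp h] at hw
  norm_num at hw

theorem mob_re_im {w : ℂ} (hw : ‖w‖ = 1) : (mob w).re = (4 - 5 * w.re) / (5 - 4 * w.re) ∧
    (mob w).im = -(3 * w.im) / (5 - 4 * w.re) := by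
  have h1 : w.re * w.re + w.im * w.im = 1 := by
    rw [← Complex.normSq_apply, Complex.normSq_eq_norm_sq, hw, one_pow]
  have h2 : Complex.normSq (2 - w) = 5 - 4 * w.re := by
    rw [Complex.normSq_apply]
    simp
    linarith
  have h3 : 5 - 4 * w.re ≠ 0 := h2 ▸ (Complex.normSq_pos.mpr (two_sub_ne hw)).ne'
  constructor
  · rw [mob, Complex.div_re, h2]
    field_simp
    simp
    linarith
  · rw [mob, Complex.div_im, h2]
    field_simp
    simp
    linarith

theorem five_sub_pos {w : ℂ} (hw : ‖w‖ = 1) : 0 < 5 - 4 * w.re := by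
  have := (abs_le.mp ((Complex.abs_re_le_norm w).trans hw.le)).2
  linarith

theorem norm_mob {w : ℂ} (hw : ‖w‖ = 1) : ‖mob w‖ = 1 := by
  have h1 : w.re * w.re + w.im * w.im = 1 := by
    rw [← Complex.normSq_apply, Complex.normSq_eq_norm_sq, hw, one_pow]
  have h3 := (five_sub_pos hw).ne'
  rw [Complex.norm_def, Complex.normSq_apply, (mob_re_im hw).1, (mob_re_im hw).2, Real.sqrt_eq_one]
  field_simp
  linear_combination 9 * h1

theorem mob_mob {w : ℂ} (hw : ‖w‖ = 1) : mob (mob w) = w := by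
  have h1 := two_sub_ne hw
  have h2 := two_sub_ne (norm_mob hw)
  have h3 : mob w * (2 - w) = 1 - 2 * w := div_mul_cancel₀ _ h1
  rw [mob, div_eq_iff h2]
  linear_combination -h3

/-- In the standard torus the arc `re > 1 / 2` is removed over `|t| < 1`, whereas the band in the
plane consists of the points of the circle with `re ≥ 1 / 2`. The involution `mob` carries the
remaining arc into this one. -/
theorem half_le_mob_re {w : ℂ} (hw : ‖w‖ = 1) (h : w.re ≤ 1 / 2) : 1 / 2 ≤ (mob w).re := by
  rw [(mob_re_im hw).1, le_div_iff₀ (five_sub_pos hw)]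
  linarith

theorem mob_neg_one : mob (-1) = 1 := by norm_num [mob]

/-- The position along the band. -/
def bandPos (t : ℝ) : ℝ := max 0 (min 1 ((t + 1) / 2))

/-- The radius. -/
def bandRad (t : ℝ) : ℝ := 1 + min 1 ((3 - |t|) / 2) / 4

/-- The torus with a hole, in the plane. -/
def torusPt (t : ℝ) (u : ℂ) : ℂ :=
  ((3 * bandPos t + bandRad t * (1 - 2 * bandPos t) * u.re : ℝ) : ℂ) +
    ((bandRad t * u.im : ℝ) : ℂ) * Complex.I

theorem torusPt_re (t : ℝ) (u : ℂ) :
    (torusPt t u).re = 3 * bandPos t + bandRad t * (1 - 2 * bandPos t) * u.re := by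
  simp only [torusPt, Complex.add_re, Complex.ofReal_re, Complex.re_ofReal_mul, Complex.I_re,
    mul_zero, add_zero]

theorem torusPt_im (t : ℝ) (u : ℂ) : (torusPt t u).im = bandRad t * u.im := by
  simp only [torusPt, Complex.add_im, Complex.ofReal_im, Complex.im_ofReal_mul, Complex.I_im,
    mul_one, zero_add]

theorem continuous_torusPt : Continuous fun p : ℝ × ℂ => torusPt p.1 p.2 := by
  have h1 : Continuous bandPos := by unfold bandPos; fun_prop
  have h2 : Continuous bandRad := by unfold bandRad; fun_prop
  have h1' := h1.comp (continuous_fst (X := ℝ) (Y := ℂ))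
  have h2' := h2.comp (continuous_fst (X := ℝ) (Y := ℂ))
  have h3 := Complex.continuous_re.comp (continuous_snd (X := ℝ) (Y := ℂ))
  have h4 := Complex.continuous_im.comp (continuous_snd (X := ℝ) (Y := ℂ))
  exact (Complex.continuous_ofReal.comp ((continuous_const.mul h1').add
    ((h2'.mul (continuous_const.sub (continuous_const.mul h1'))).mul h3))).add
    ((Complex.continuous_ofReal.comp (h2'.mul h4)).mul continuous_const)

theorem band_left {t : ℝ} (h : t ≤ -1) :
    bandPos t = 0 ∧ bandRad t = 1 + min 1 ((3 + t) / 2) / 4 := by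
  refine ⟨max_eq_left ((min_le_right _ _).trans (by linarith)), ?_⟩
  rw [bandRad, abs_of_nonpos (by linarith), sub_neg_eq_add]

theorem band_right {t : ℝ} (h : 1 ≤ t) :
    bandPos t = 1 ∧ bandRad t = 1 + min 1 ((3 - t) / 2) / 4 := by
  refine ⟨?_, ?_⟩
  · rw [bandPos, min_eq_left (by linarith), max_eq_right zero_le_one]
  · rw [bandRad, abs_of_nonneg (by linarith)]

theorem band_mid {t : ℝ} (h1 : -1 ≤ t) (h2 : t ≤ 1) :
    bandPos t = (t + 1) / 2 ∧ bandRad t = 5 / 4 := by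
  refine ⟨?_, ?_⟩
  · rw [bandPos, min_eq_right (by linarith), max_eq_right (by linarith)]
  · have : |t| ≤ 1 := abs_le.mpr ⟨h1, h2⟩
    rw [bandRad, min_eq_left (by linarith)]
    norm_num

theorem bandRad_mem {t : ℝ} (h1 : -3 ≤ t) (h2 : t ≤ 3) : 1 ≤ bandRad t ∧ bandRad t ≤ 5 / 4 := by
  have : |t| ≤ 3 := abs_le.mpr ⟨h1, h2⟩
  have h3 : 0 ≤ min 1 ((3 - |t|) / 2) := le_min zero_le_one (by linarith)
  have h4 := min_le_left 1 ((3 - |t|) / 2)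
  constructor <;> rw [bandRad] <;> linarith

/-- The parameters of the torus with a hole. -/
def TorusParam : Set (ℝ × Circle) :=
  {p | (-3 ≤ p.1 ∧ p.1 ≤ 3) ∧ (1 ≤ |p.1| ∨ (p.2 : ℂ).re ≤ 1 / 2)}

/-- The three zones of the torus with a hole. -/
theorem torusPt_zones {t : ℝ} {u : ℂ} (h1 : -3 ≤ t) (h2 : t ≤ 3) (hu : ‖u‖ = 1)
    (h : 1 ≤ |t| ∨ 1 / 2 ≤ u.re) :
    (t ≤ -1 ∧ (torusPt t u).re ^ 2 + (torusPt t u).im ^ 2 = bandRad t ^ 2 ∧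
      (torusPt t u).re = bandRad t * u.re ∧ (torusPt t u).re ≤ 5 / 4 ∧ -(5 / 4) ≤ (torusPt t u).re) ∨
    (1 ≤ t ∧ (3 - (torusPt t u).re) ^ 2 + (torusPt t u).im ^ 2 = bandRad t ^ 2 ∧
      (torusPt t u).re = 3 - bandRad t * u.re ∧ 7 / 4 ≤ (torusPt t u).re ∧
      (torusPt t u).re ≤ 17 / 4) ∨
    ((-1 < t ∧ t < 1) ∧ (5 / 4) ^ 2 < (torusPt t u).re ^ 2 + (torusPt t u).im ^ 2 ∧
      (5 / 4) ^ 2 < (3 - (torusPt t u).re) ^ 2 + (torusPt t u).im ^ 2 ∧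
      0 < (torusPt t u).re ∧ (torusPt t u).re < 3 ∧ 1 / 2 ≤ u.re) := by
  have hn : u.re ^ 2 + u.im ^ 2 = 1 := by
    rw [sq, sq, ← Complex.normSq_apply, Complex.normSq_eq_norm_sq, hu, one_pow]
  have hre := abs_le.mp ((Complex.abs_re_le_norm u).trans hu.le)
  obtain ⟨r1, r2⟩ := bandRad_mem h1 h2
  rcases le_or_gt t (-1) with ht | ht
  · left
    have e : (torusPt t u).re = bandRad t * u.re := by
      rw [torusPt_re, (band_left ht).1]; ring
    refine ⟨ht, ?_, e, ?_, ?_⟩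
    · rw [e, torusPt_im]; linear_combination bandRad t ^ 2 * hn
    · rw [e]; nlinarith
    · rw [e]; nlinarith
  rcases le_or_gt 1 t with ht' | ht'
  · right; left
    have e : (torusPt t u).re = 3 - bandRad t * u.re := by
      rw [torusPt_re, (band_right ht').1]; ring
    refine ⟨ht', ?_, e, ?_, ?_⟩
    · rw [e, torusPt_im]; linear_combination bandRad t ^ 2 * hn
    · rw [e]; nlinarith
    · rw [e]; nlinarith
  right; right
  have hu2 : 1 / 2 ≤ u.re := h.resolve_left (not_le.mpr (abs_lt.mpr ⟨ht, ht'⟩))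
  obtain ⟨b1, b2⟩ := band_mid ht.le ht'.le
  have e : (torusPt t u).re = 5 / 4 * u.re + (t + 1) / 2 * (3 - 5 / 2 * u.re) := by
    rw [torusPt_re, b1, b2]; ring
  have e' : (torusPt t u).im = 5 / 4 * u.im := by rw [torusPt_im, b2]
  have l1 : 5 / 4 * u.re < (torusPt t u).re := by
    rw [e]
    have : 0 < (t + 1) / 2 * (3 - 5 / 2 * u.re) := mul_pos (by linarith) (by linarith)
    linarith
  have l2 : 5 / 4 * u.re < 3 - (torusPt t u).re := by
    rw [e]
    have : 0 < (1 - (t + 1) / 2) * (3 - 5 / 2 * u.re) := mul_pos (by linarith) (by linarith)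
    linarith
  refine ⟨⟨ht, ht'⟩, ?_, ?_, by linarith, by linarith, hu2⟩ <;> rw [e'] <;> nlinarith

theorem torusPt_mem {t : ℝ} {u : ℂ} (h1 : -3 ≤ t) (h2 : t ≤ 3) (hu : ‖u‖ = 1)
    (h : 1 ≤ |t| ∨ 1 / 2 ≤ u.re) : torusPt t u ∈ Omega g n := by
  obtain ⟨r1, r2⟩ := bandRad_mem h1 h2
  rcases torusPt_zones h1 h2 hu h with ⟨-, e, -, h3, h4⟩ | ⟨-, e, -, h3, h4⟩ | ⟨-, e, e', h3, h4, -⟩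
  · exact mem_omega_near h4 (by linarith) (by nlinarith) (by nlinarith [sq_nonneg (torusPt t u).im])
      (Or.inr (by nlinarith))
  · exact mem_omega_near (by linarith) h4 (by nlinarith [sq_nonneg (torusPt t u).im])
      (by nlinarith) (Or.inl (by linarith))
  · exact mem_omega_near (by linarith) (by linarith) (by linarith) (by linarith) (Or.inl h3)

/-- The zones are disjoint: the collars lie within `5 / 4` of `0` and of `3`, and the open band lies
farther from both. In a collar the distance from the foot determines `t` and then `u`. In the band
the height determines `u`, as `u.re` is positive, and the position along the horizontal segment then
determines `t`. -/
theorem torusPt_injective {t t' : ℝ} {u u' : ℂ} (h1 : -3 ≤ t) (h2 : t ≤ 3) (hu : ‖u‖ = 1)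
    (h : 1 ≤ |t| ∨ 1 / 2 ≤ u.re) (h1' : -3 ≤ t') (h2' : t' ≤ 3) (hu' : ‖u'‖ = 1)
    (h' : 1 ≤ |t'| ∨ 1 / 2 ≤ u'.re) (he : torusPt t u = torusPt t' u') : t = t' ∧ u = u' := by
  obtain ⟨r1, r2⟩ := bandRad_mem h1 h2
  obtain ⟨r1', r2'⟩ := bandRad_mem h1' h2'
  have him : bandRad t * u.im = bandRad t' * u'.im := by rw [← torusPt_im, he, torusPt_im]
  have hz := torusPt_zones h1 h2 hu h
  have hz' := torusPt_zones h1' h2' hu' h'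
  rw [he] at hz
  have hfin : bandRad t = bandRad t' → u.re = u'.re → u = u' := fun hr hre => by
    refine Complex.ext hre ?_
    rw [hr] at him
    exact mul_left_cancel₀ (by linarith) him
  have hmul : bandRad t = bandRad t' → bandRad t * u.re = bandRad t' * u'.re → u = u' :=
    fun hr hre => hfin hr (by rw [hr] at hre; exact mul_left_cancel₀ (by linarith) hre)
  have hsq : bandRad t ^ 2 = bandRad t' ^ 2 → bandRad t = bandRad t' := fun h =>
    (pow_left_inj₀ (by linarith) (by linarith) two_ne_zero).mp h
  rcases hz with ⟨a, e, f, c, d⟩ | ⟨a, e, f, c, d⟩ | ⟨a, e, e2, c, d, b⟩ <;>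
    rcases hz' with ⟨a', e', f', c', d'⟩ | ⟨a', e', f', c', d'⟩ | ⟨a', e', e2', c', d', b'⟩
  · have hr := hsq (by rw [← e, ← e'])
    refine ⟨?_, hmul hr (by rw [← f, ← f'])⟩
    rw [(band_left a).2, (band_left a').2, min_eq_right (by linarith), min_eq_right (by linarith)] at hr
    linarith
  · linarith
  · nlinarith
  · linarith
  · have hr := hsq (by rw [← e, ← e'])
    refine ⟨?_, hmul hr (by linarith)⟩
    rw [(band_right a).2, (band_right a').2, min_eq_right (by linarith),
      min_eq_right (by linarith)] at hr
    linarith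
  · nlinarith
  · nlinarith
  · nlinarith
  · obtain ⟨b1, b2⟩ := band_mid a.1.le a.2.le
    obtain ⟨b1', b2'⟩ := band_mid a'.1.le a'.2.le
    have hn : u.re ^ 2 + u.im ^ 2 = 1 := by
      rw [sq, sq, ← Complex.normSq_apply, Complex.normSq_eq_norm_sq, hu, one_pow]
    have hn' : u'.re ^ 2 + u'.im ^ 2 = 1 := by
      rw [sq, sq, ← Complex.normSq_apply, Complex.normSq_eq_norm_sq, hu', one_pow]
    have hi : u.im = u'.im := by rw [b2, b2'] at him; linarith
    have hr : u.re = u'.re := by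
      rw [hi] at hn
      exact (pow_left_inj₀ (by linarith) (by linarith) two_ne_zero).mp (by linarith)
    refine ⟨?_, Complex.ext hr hi⟩
    have hx : (torusPt t u).re = (torusPt t' u').re := by rw [he]
    rw [torusPt_re, torusPt_re, b1, b2, b1', b2', hr] at hx
    have hle := (abs_le.mp ((Complex.abs_re_le_norm u').trans hu'.le)).2
    have : (t - t') * (3 - 5 / 2 * u'.re) = 0 := by linarith
    rcases mul_eq_zero.mp this with h0 | h0 <;> linarith

theorem torusPt_neg_three (u : ℂ) : torusPt (-3) u = u := by
  obtain ⟨e1, e2⟩ := band_left (t := -3) (by norm_num)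
  norm_num at e2
  apply Complex.ext
  · rw [torusPt_re, e1, e2]; ring
  · rw [torusPt_im, e2]; ring

theorem torusPt_three (u : ℂ) : torusPt 3 u = 3 - conj u := by
  obtain ⟨e1, e2⟩ := band_right (t := 3) (by norm_num)
  norm_num at e2
  apply Complex.ext
  · rw [torusPt_re, e1, e2]; simp; ring
  · rw [torusPt_im, e2]; simp

/-- Only the first handle is near. Its circles are the curves `t = -3` and `t = 3`, and the same `u`
on both is exactly the gluing. -/
theorem torusPt_glue {t t' : ℝ} {u u' v : ℂ} {i : ℕ} (h1 : -3 ≤ t) (h2 : t ≤ 3) (hu : ‖u‖ = 1)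
    (h : 1 ≤ |t| ∨ 1 / 2 ≤ u.re) (h1' : -3 ≤ t') (h2' : t' ≤ 3) (hu' : ‖u'‖ = 1)
    (h' : 1 ≤ |t'| ∨ 1 / 2 ≤ u'.re) (hv : ‖v‖ = 1) (e : torusPt t u = 6 * (i : ℂ) + v)
    (e' : torusPt t' u' = 6 * (i : ℂ) + 3 - conj v) : t = -3 ∧ t' = 3 ∧ u = u' := by
  have hle := abs_le.mp ((Complex.abs_re_le_norm v).trans hv.le)
  have hi : i = 0 := by
    by_contra hi
    have hi1 : (1 : ℝ) ≤ i := by exact_mod_cast Nat.one_le_iff_ne_zero.mpr hi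
    have hre : (torusPt t u).re = 6 * i + v.re := by rw [e]; simp
    rcases torusPt_zones h1 h2 hu h with ⟨-, -, -, c, d⟩ | ⟨-, -, -, c, d⟩ | ⟨-, -, -, c, d, -⟩ <;>
      linarith
  subst hi
  rw [Nat.cast_zero, mul_zero, zero_add, ← torusPt_neg_three v] at e
  rw [Nat.cast_zero, mul_zero, zero_add, ← torusPt_three v] at e'
  obtain ⟨a1, a2⟩ := torusPt_injective h1 h2 hu h le_rfl (by norm_num) hv
    (Or.inl (by norm_num)) e
  obtain ⟨b1, b2⟩ := torusPt_injective h1' h2' hu' h' (by norm_num) le_rfl hv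
    (Or.inl (by norm_num)) e'
  exact ⟨a1, b1, a2.trans b2.symm⟩

end Torus

/-! ### Identification with the standard one-holed torus -/

section TorusEmbedding

open Topology Set

/-- Two quotients of a compact space with the same fibres are homeomorphic. -/
theorem nonempty_homeomorph_range {X Y Z : Type*} [TopologicalSpace X] [CompactSpace X]
    [TopologicalSpace Y] [T2Space Y] [TopologicalSpace Z] [T2Space Z] {q : X → Z} {F : X → Y}
    (hq : Continuous q) (hq' : Function.Surjective q) (hF : Continuous F)
    (h : ∀ a b, q a = q b ↔ F a = F b) : Nonempty (range F ≃ₜ Z) := by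
  have hquot : IsQuotientMap q := hq.isClosedMap.isQuotientMap hq hq'
  let F' : C(X, Y) := ⟨F, hF⟩
  have hfac : ∀ a b, q a = q b → F' a = F' b := fun a b hab => (h a b).mp hab
  let q' : C(X, Z) := ⟨q, hq⟩
  have hquot' : IsQuotientMap q' := hquot
  let f : C(Z, Y) := hquot'.lift F' hfac
  have hf : ∀ a, f (q a) = F a := fun a => DFunLike.congr_fun (hquot'.lift_comp F' hfac) a
  have hZ : CompactSpace Z := hq'.compactSpace hq
  have hinj : Function.Injective f := by
    intro a b hab
    obtain ⟨a, rfl⟩ := hq' a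
    obtain ⟨b, rfl⟩ := hq' b
    rw [hf, hf] at hab
    exact (h a b).mpr hab
  have hr : range F = range f := by
    ext y
    constructor
    · rintro ⟨a, rfl⟩
      exact ⟨q a, hf a⟩
    · rintro ⟨a, rfl⟩
      obtain ⟨a, rfl⟩ := hq' a
      exact ⟨a, (hf a).symm⟩
  rw [hr]
  exact ⟨(f.continuous.isClosedEmbedding hinj).isEmbedding.toHomeomorph.symm⟩

variable {g n : ℕ}

theorem isCompact_torusParam : IsCompact TorusParam := by
  have : TorusParam = (Icc (-3) 3 ×ˢ univ) ∩ {p : ℝ × Circle | 1 ≤ |p.1| ∨ (p.2 : ℂ).re ≤ 1 / 2} := by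
    ext p
    simp [TorusParam]
  rw [this]
  refine (isCompact_Icc.prod isCompact_univ).inter_right ?_
  have h1 : Continuous fun p : ℝ × Circle => |p.1| := by fun_prop
  have h2 : Continuous fun p : ℝ × Circle => (p.2 : ℂ).re :=
    Complex.continuous_re.comp (continuous_subtype_val.comp continuous_snd)
  exact (isClosed_le continuous_const h1).union (isClosed_le h2 continuous_const)

/-- The condition on the second parameter is one on the image under `mob`. -/
theorem torusParam_mob {p : ℝ × Circle} (hp : p ∈ TorusParam) :
    1 ≤ |p.1| ∨ 1 / 2 ≤ (mob p.2).re :=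
  hp.2.imp_right fun h => half_le_mob_re (Circle.norm_coe _) h

theorem dist_one_lt_iff (w : Circle) : dist w 1 < 1 ↔ 1 / 2 < (w : ℂ).re := by
  have h1 : (w : ℂ).re * (w : ℂ).re + (w : ℂ).im * (w : ℂ).im = 1 := by
    rw [← Complex.normSq_apply, Circle.normSq_coe]
  change dist (w : ℂ) 1 < 1 ↔ _
  rw [dist_eq_norm, Complex.norm_def, Real.sqrt_lt' one_pos, Complex.normSq_apply]
  simp
  constructor <;> intro h <;> nlinarith

/-- The angle function of the first parameter. -/
def torusAngle (t : ℝ) : Circle := Circle.exp (Real.pi / 3 * t)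

theorem torusAngle_re (t : ℝ) : (torusAngle t : ℂ).re = Real.cos (Real.pi / 3 * t) := by
  rw [torusAngle, Circle.coe_exp, Complex.exp_ofReal_mul_I_re]

/-- The scale is chosen so that `|t| = 1` corresponds to the angle `π / 3`, whose cosine is `1 / 2`;
the points `t = ±3` correspond to the angle `π`. -/
theorem half_lt_torusAngle_re {t : ℝ} (h1 : -3 ≤ t) (h2 : t ≤ 3) :
    1 / 2 < (torusAngle t : ℂ).re ↔ |t| < 1 := by
  have hpi := Real.pi_pos
  have hle : |t| ≤ 3 := abs_le.mpr ⟨h1, h2⟩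
  rw [torusAngle_re, ← Real.cos_pi_div_three, ← Real.cos_abs (Real.pi / 3 * t), abs_mul,
    abs_of_pos (show 0 < Real.pi / 3 by positivity)]
  rw [Real.strictAntiOn_cos.lt_iff_gt ⟨by positivity, by linarith⟩
    ⟨by positivity, by nlinarith⟩]
  constructor <;> intro h <;> nlinarith

/-- The torus with a hole as a quotient of the parameter space. -/
def torusQuot (p : TorusParam) : OneHoledTorus :=
  ⟨(torusAngle p.1.1, p.1.2), by
    rw [OneHoledTorus, mem_compl_iff, Metric.mem_ball, Prod.dist_eq, max_lt_iff, dist_one_lt_iff,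
      dist_one_lt_iff, half_lt_torusAngle_re p.2.1.1 p.2.1.2, not_and_or, not_lt, not_lt]
    exact p.2.2⟩

theorem continuous_torusQuot : Continuous torusQuot := by
  refine Continuous.subtype_mk (Continuous.prodMk ?_ (by fun_prop)) _
  exact Circle.exp.continuous.comp (by fun_prop)

theorem exists_torusAngle (z : Circle) : ∃ t, (-3 ≤ t ∧ t ≤ 3) ∧ torusAngle t = z := by
  have hpi := Real.pi_pos
  refine ⟨3 / Real.pi * Complex.arg z, ⟨?_, ?_⟩, ?_⟩
  · have := (Complex.neg_pi_lt_arg z).le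
    rw [div_mul_eq_mul_div, le_div_iff₀ hpi]
    linarith
  · have := Complex.arg_le_pi z
    rw [div_mul_eq_mul_div, div_le_iff₀ hpi]
    linarith
  · rw [torusAngle, show Real.pi / 3 * (3 / Real.pi * Complex.arg z) = Complex.arg z by field_simp]
    exact Circle.exp_arg z

theorem torusQuot_surjective : Function.Surjective torusQuot := by
  rintro ⟨⟨z, w⟩, h⟩
  obtain ⟨t, ht, rfl⟩ := exists_torusAngle z
  refine ⟨⟨(t, w), ht, ?_⟩, rfl⟩
  rwa [OneHoledTorus, mem_compl_iff, Metric.mem_ball, Prod.dist_eq, max_lt_iff, dist_one_lt_iff,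
    dist_one_lt_iff, half_lt_torusAngle_re ht.1 ht.2, not_and_or, not_lt, not_lt] at h

theorem torusAngle_eq {t t' : ℝ} (h1 : -3 ≤ t) (h2 : t ≤ 3) (h1' : -3 ≤ t') (h2' : t' ≤ 3) :
    torusAngle t = torusAngle t' ↔ t = t' ∨ (t = -3 ∧ t' = 3) ∨ (t = 3 ∧ t' = -3) := by
  have hpi := Real.pi_pos
  constructor
  · intro h
    rw [torusAngle, torusAngle, Circle.exp_eq_exp] at h
    obtain ⟨m, hm⟩ := h
    have e : t - t' = 6 * m := by
      have : Real.pi * (t - t' - 6 * m) = 0 := by linear_combination 3 * hm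
      rcases mul_eq_zero.mp this with h | h <;> linarith
    have m1 : m < 2 := by
      have : (m : ℝ) < 2 := by linarith
      exact_mod_cast this
    have m2 : -2 < m := by
      have : (-2 : ℝ) < m := by linarith
      exact_mod_cast this
    obtain rfl | rfl | rfl : m = -1 ∨ m = 0 ∨ m = 1 := by omega
    · push_cast at e
      exact Or.inr (Or.inl ⟨by linarith, by linarith⟩)
    · push_cast at e
      exact Or.inl (by linarith)
    · push_cast at e
      exact Or.inr (Or.inr ⟨by linarith, by linarith⟩)
  · have h3 : torusAngle (-3) = torusAngle 3 := by
      rw [torusAngle, torusAngle, Circle.exp_eq_exp]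
      exact ⟨-1, by push_cast; ring⟩
    rintro (rfl | ⟨rfl, rfl⟩ | ⟨rfl, rfl⟩)
    · rfl
    · exact h3
    · exact h3.symm

/-- The torus with a hole in the standard surface. -/
def torusMap (p : TorusParam) : StdSurface g n := stdP (torusPt p.1.1 (mob p.1.2))

theorem torusMap_mem (p : TorusParam) : torusPt p.1.1 (mob p.1.2) ∈ Omega g n :=
  torusPt_mem p.2.1.1 p.2.1.2 (norm_mob (Circle.norm_coe _)) (torusParam_mob p.2)

theorem continuous_torusMap : Continuous (torusMap (g := g) (n := n)) := by
  refine continuousOn_stdP.comp_continuous (continuous_torusPt.comp (Continuous.prodMk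
    (by fun_prop) ?_)) torusMap_mem
  have h : Continuous fun p : TorusParam => ((p.1.2 : Circle) : ℂ) :=
    continuous_subtype_val.comp (by fun_prop)
  exact (by fun_prop : Continuous fun p : TorusParam => 1 - 2 * ((p.1.2 : Circle) : ℂ)).div
    (continuous_const.sub h) fun p => two_sub_ne (Circle.norm_coe _)

theorem mob_circle_injective {w w' : Circle} (h : mob w = mob w') : w = w' := by
  have := congrArg mob h
  rw [mob_mob (Circle.norm_coe _), mob_mob (Circle.norm_coe _)] at this
  exact Circle.coe_injective this

theorem torusMap_glue (hg : 0 < g) (w : Circle) (h : ((-3 : ℝ), w) ∈ TorusParam)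
    (h' : ((3 : ℝ), w) ∈ TorusParam) :
    (torusMap ⟨_, h⟩ : StdSurface g n) = torusMap ⟨_, h'⟩ := by
  have hm := torusMap_mem (g := g) (n := n) ⟨_, h⟩
  have hm' := torusMap_mem (g := g) (n := n) ⟨_, h'⟩
  refine stdP_congr hm hm' ?_
  have := proj_glue hg (norm_mob (Circle.norm_coe w))
  rw [Nat.cast_zero, mul_zero, zero_add, zero_add] at this
  simp only
  rw [torusPt_neg_three, torusPt_three, this]

/-- In both quotients the only identification is that of `t = -3` with `t = 3` for the same second
parameter. -/
theorem torusQuot_eq_iff (hg : 0 < g) (p p' : TorusParam) :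
    torusQuot p = torusQuot p' ↔ (torusMap p : StdSurface g n) = torusMap p' := by
  have key : torusQuot p = torusQuot p' ↔ torusAngle p.1.1 = torusAngle p'.1.1 ∧ p.1.2 = p'.1.2 := by
    rw [Subtype.ext_iff, Prod.ext_iff]
    rfl
  rw [key, torusAngle_eq p.2.1.1 p.2.1.2 p'.2.1.1 p'.2.1.2]
  constructor
  · obtain ⟨⟨t, w⟩, h⟩ := p
    obtain ⟨⟨t', w'⟩, h'⟩ := p'
    simp only
    rintro ⟨rfl | ⟨rfl, rfl⟩ | ⟨rfl, rfl⟩, rfl⟩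
    · rfl
    · exact torusMap_glue hg w h h'
    · exact (torusMap_glue hg w h' h).symm
  · intro h
    have hn := norm_mob (Circle.norm_coe p.1.2)
    have hn' := norm_mob (Circle.norm_coe p'.1.2)
    have h2 := congrArg Subtype.val h
    rw [torusMap, torusMap, stdP_coe (torusMap_mem p), stdP_coe (torusMap_mem p'), proj_eq_proj
      (torusMap_mem (n := n) p).1 (torusMap_mem (n := n) p').1] at h2
    rcases h2 with h2 | ⟨i, hi, u, hu, ⟨e1, e2⟩ | ⟨e1, e2⟩⟩
    · obtain ⟨a, b⟩ := torusPt_injective p.2.1.1 p.2.1.2 hn (torusParam_mob p.2) p'.2.1.1 p'.2.1.2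
        hn' (torusParam_mob p'.2) h2
      exact ⟨Or.inl a, mob_circle_injective b⟩
    · obtain ⟨a, b, c⟩ := torusPt_glue p.2.1.1 p.2.1.2 hn (torusParam_mob p.2) p'.2.1.1 p'.2.1.2
        hn' (torusParam_mob p'.2) hu e1 e2
      exact ⟨Or.inr (Or.inl ⟨a, b⟩), mob_circle_injective c⟩
    · obtain ⟨a, b, c⟩ := torusPt_glue p'.2.1.1 p'.2.1.2 hn' (torusParam_mob p'.2) p.2.1.1 p.2.1.2
        hn (torusParam_mob p.2) hu e1 e2
      exact ⟨Or.inr (Or.inr ⟨b, a⟩), (mob_circle_injective c).symm⟩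

variable (g n) in
theorem isOneHoledTorus_range (hg : 0 < g) :
    IsOneHoledTorus (range (torusMap (g := g) (n := n))) := by
  have := isCompact_iff_compactSpace.mp isCompact_torusParam
  exact nonempty_homeomorph_range continuous_torusQuot torusQuot_surjective continuous_torusMap
    (torusQuot_eq_iff hg)

theorem outer_mem {t : ℝ} (h : |t| = 3) (w : Circle) : (t, w) ∈ TorusParam :=
  ⟨abs_le.mp h.le, Or.inl (by simp only; rw [h]; norm_num)⟩

theorem band_mem {t : ℝ} (h : |t| ≤ 3) : (t, (-1 : Circle)) ∈ TorusParam :=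
  ⟨abs_le.mp h, Or.inr (by simp; norm_num)⟩

variable (τ : ∀ y : StdSurface g n, Path (stdBase g n) y)

theorem torusPt_one (t : ℝ) (h1 : -3 ≤ t) (h2 : t ≤ 3) :
    ∃ x : ℝ, torusPt t 1 = x ∧ 1 ≤ x ∧ x ≤ 2 := by
  have hO := torusPt_mem (g := 1) (n := 0) h1 h2 (u := 1) (by simp) (Or.inr (by norm_num))
  obtain ⟨r1, r2⟩ := bandRad_mem h1 h2
  refine ⟨(torusPt t 1).re, ?_, ?_⟩
  · apply Complex.ext
    · rw [Complex.ofReal_re]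
    · rw [torusPt_im, Complex.ofReal_im]; simp
  rw [torusPt_re]
  have hs : 0 ≤ bandPos t ∧ bandPos t ≤ 1 :=
    ⟨le_max_left _ _, max_le zero_le_one (min_le_left _ _)⟩
  simp only [Complex.one_re, mul_one]
  constructor <;> nlinarith

/-- The torus with a hole and the two curves on it that represent the first leaf and the first
handle curve. -/
theorem exists_oneHoledTorus (hg : 0 < g) : ∃ T : Set (StdSurface g n), IsOneHoledTorus T ∧
    ∃ (y : T) (p q : Path y y) (c : FundamentalGroup (StdSurface g n) (stdBase g n)),
      c * hol τ (p.map continuous_subtype_val) * c⁻¹ = leaf τ 0 ∧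
      c * hol τ (q.map continuous_subtype_val) * c⁻¹ = handleCurve τ 0 := by
  have habs : |(-3 : ℝ)| = 3 := by norm_num
  refine ⟨range torusMap, isOneHoledTorus_range g n hg,
    ⟨torusMap ⟨(-3, -1), outer_mem habs _⟩, mem_range_self _⟩, ?_⟩
  have hone : (1 : ℂ) ∈ Half g n := by
    have := pos_real_mem_half (g := g) (n := n) (x := 1) le_rfl (by norm_num)
    rwa [Complex.ofReal_one] at this
  have htwo : (2 : ℂ) ∈ Half g n := by
    have := pos_real_mem_half (g := g) (n := n) (x := 2) (by norm_num) le_rfl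
    rwa [Complex.ofReal_ofNat] at this
  have hneg : (-1 : ℂ) ∈ Half g n := by
    have := footL_mem_half (n := n) hg (u := -1) (by simp) (by simp)
    rwa [Nat.cast_zero, mul_zero, zero_add] at this
  -- The curve `p` is the boundary circle of the left end. The sign in `W` makes its image under
  -- `mob` start at `1` and run through the upper half first. The curve `q` runs along the middle of
  -- the band, where `mob (-1) = 1`, and closes up through the handle.
  let W : ℝ → Circle := fun θ => -Circle.exp θ
  have hWc : Continuous W := Circle.exp.continuous.neg
  have hW0 : W 0 = -1 := by simp [W]
  have hW1 : W (2 * Real.pi) = -1 := by simp [W]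
  let p : Path (⟨torusMap ⟨(-3, -1), outer_mem habs _⟩, mem_range_self _⟩ :
      range (torusMap (g := g) (n := n))) ⟨torusMap ⟨(-3, -1), outer_mem habs _⟩, mem_range_self _⟩ :=
    ⟨⟨fun t => ⟨torusMap ⟨(-3, W (2 * Real.pi * t)), outer_mem habs _⟩, mem_range_self _⟩,
      Continuous.subtype_mk (continuous_torusMap.comp (Continuous.subtype_mk
        (Continuous.prodMk continuous_const (hWc.comp (by fun_prop))) _)) _⟩,
      by simp [hW0], by simp [hW1]⟩
  have hm : ∀ t : unitInterval, |(-3 + 6 * t : ℝ)| ≤ 3 := fun t =>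
    abs_le.mpr ⟨by linarith [t.2.1], by linarith [t.2.2]⟩
  have h3 : (-3 + 6 * (1 : ℝ)) = 3 := by norm_num
  let q : Path (⟨torusMap ⟨(-3, -1), outer_mem habs _⟩, mem_range_self _⟩ :
      range (torusMap (g := g) (n := n))) ⟨torusMap ⟨(-3, -1), outer_mem habs _⟩, mem_range_self _⟩ :=
    ⟨⟨fun t => ⟨torusMap ⟨(-3 + 6 * t, -1), band_mem (hm t)⟩, mem_range_self _⟩,
      Continuous.subtype_mk (continuous_torusMap.comp (Continuous.subtype_mk
        (Continuous.prodMk (by fun_prop) continuous_const) _)) _⟩,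
      by simp, by
        refine Subtype.ext (Eq.trans ?_ (torusMap_glue hg (-1) (outer_mem habs _)
          (outer_mem (abs_of_pos (by norm_num)) _)).symm)
        simp only [Set.Icc.coe_one, h3]⟩
  refine ⟨p, q, hh τ false Complex.I 1, ?_, ?_⟩
  · let ψ : C(ℝ, StdSurface g n) := ⟨fun θ => torusMap ⟨(-3, W θ), outer_mem habs _⟩,
      continuous_torusMap.comp (Continuous.subtype_mk (Continuous.prodMk continuous_const hWc) _)⟩
    have hψ : ∀ θ, ψ θ = stdP (mob (W θ)) := fun θ => congrArg stdP (torusPt_neg_three _)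
    have e1 : hol τ (p.map continuous_subtype_val) = holMap τ ψ 0 (2 * Real.pi) := by
      refine hol_eq_holMap τ ψ (segPath 0 (2 * Real.pi)) _ fun t => ?_
      have : segPath 0 (2 * Real.pi) t = 2 * Real.pi * t := by
        change (1 - t : ℝ) * 0 + t * (2 * Real.pi) = _
        ring
      rw [this]
      rfl
    have hWn : ∀ θ, ‖((W θ : Circle) : ℂ)‖ = 1 := fun θ => Circle.norm_coe _
    have hWim : ∀ θ, ((W θ : Circle) : ℂ).im = - Real.sin θ := fun θ => by
      simp only [W, Circle.coe_neg, Circle.coe_exp, Complex.neg_im, Complex.exp_ofReal_mul_I_im]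
    have hmem : ∀ (s : Bool) θ, 0 ≤ (flip s (mob (W θ))).im → flip s (mob (W θ)) ∈ Half g n := by
      intro s θ h
      have := footL_mem_half (n := n) hg (u := flip s (mob (W θ))) (by rw [norm_flip, norm_mob (hWn θ)]) h
      rwa [Nat.cast_zero, mul_zero, zero_add] at this
    have hc : Continuous fun θ => mob (W θ) := by
      have h : Continuous fun θ => ((W θ : Circle) : ℂ) := continuous_subtype_val.comp hWc
      exact (by fun_prop : Continuous fun θ => 1 - 2 * ((W θ : Circle) : ℂ)).div
        (continuous_const.sub h) fun θ => two_sub_ne (hWn θ)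
    have hpi := Real.pi_pos
    have m0 : mob (W 0) = 1 := by rw [hW0]; exact mob_neg_one
    have m1 : mob (W Real.pi) = -1 := by simp [W, mob]; norm_num
    have m2 : mob (W (2 * Real.pi)) = 1 := by rw [hW1]; exact mob_neg_one
    have e2 : holMap τ ψ 0 Real.pi = hh τ false 1 (-1) := by
      have := holMap_eq_hh τ false ψ (f := fun θ => flip false (mob (W θ))) hpi.le hc.continuousOn
        (fun r hr => hmem false r ?_) (fun r _ => by rw [flip_flip]; exact hψ r)
      · simp only [flip_false] at this
        rwa [m0, m1] at this
      · rw [flip_false, (mob_re_im (hWn r)).2, hWim]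
        have := Real.sin_nonneg_of_nonneg_of_le_pi hr.1 hr.2
        exact div_nonneg (by linarith) (five_sub_pos (hWn r)).le
    have e3 : holMap τ ψ Real.pi (2 * Real.pi) = hh τ true (-1) 1 := by
      have := holMap_eq_hh τ true ψ (f := fun θ => flip true (mob (W θ)))
        (show Real.pi ≤ 2 * Real.pi by linarith) ((continuous_flip true).comp hc).continuousOn
        (fun r hr => hmem true r ?_) (fun r _ => by rw [flip_flip]; exact hψ r)
      · simp only [m1, m2, flip_true, map_neg, map_one] at this
        exact this
      · rw [flip_true, Complex.conj_im, (mob_re_im (hWn r)).2, hWim]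
        have h0 : Real.sin r ≤ 0 := by
          rw [← Real.sin_sub_two_pi]
          exact Real.sin_nonpos_of_nonpos_of_neg_pi_le (by linarith [hr.2]) (by linarith [hr.1])
        rw [neg_div, neg_neg]
        exact div_nonneg (by linarith) (five_sub_pos (hWn r)).le
    rw [e1, ← holMap_mul τ ψ 0 Real.pi, e2, e3, ← mul_assoc, hh_mul τ false I_mem_half hone hneg, hh_inv]
    change lasso τ Complex.I (-1) 1 = leaf τ 0
    have c1 : (-1 : ℂ) = ((-1 : ℝ) : ℂ) := by push_cast; rfl
    have c2 : (1 : ℂ) = ((1 : ℝ) : ℂ) := by push_cast; rfl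
    refine lasso_congr τ I_mem_half hneg hone (leafPt_mem 0) (mid_mem 0) ?_ ?_
    · rw [c1]
      refine hh_real τ _ _ fun r hr => ?_
      rw [uIcc_comm, uIcc_of_le (by linarith [one_le_rad (4 * 0 + 2)])] at hr
      refine real_mem_half (by rw [le_abs]; right; linarith [hr.2]) (by linarith [hr.2]) fun k _ hk => ?_
      have := rad_strictMono (show 4 * 0 + 2 < 4 * k + 3 by omega)
      linarith [hr.1]
    · rw [c2, mid_zero]
      refine hh_real τ _ _ fun r hr => ?_
      rw [uIcc_of_le (by norm_num)] at hr
      exact pos_real_mem_half hr.1 (by linarith [hr.2])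
  · have hseg : ∀ t : unitInterval, torusPt (-3 + 6 * t) 1 ∈ Half g n := fun t => by
      obtain ⟨x, hx, h1, h2⟩ := torusPt_one (-3 + 6 * t) (by linarith [t.2.1]) (by linarith [t.2.2])
      rw [hx]
      exact pos_real_mem_half h1 h2
    have f0 : torusPt (-3 + 6 * (0 : unitInterval)) 1 = 1 := by
      simp [torusPt_neg_three]
    have f1 : torusPt (-3 + 6 * (1 : unitInterval)) 1 = 2 := by
      rw [Set.Icc.coe_one, h3, torusPt_three, map_one]; norm_num
    let l : Path (⟨1, hone⟩ : Half g n) ⟨2, htwo⟩ :=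
      ⟨⟨fun t => ⟨torusPt (-3 + 6 * t) 1, hseg t⟩, Continuous.subtype_mk
        (continuous_torusPt.comp (Continuous.prodMk (by fun_prop) continuous_const)) _⟩,
        Subtype.ext f0, Subtype.ext f1⟩
    have e1 : hol τ (q.map continuous_subtype_val) = hh τ false 1 2 := by
      rw [hh_eq τ false hone htwo]
      refine hol_eq_holMap τ (halfMap false) l _ fun t => ?_
      rw [halfMap_eq_stdP]
      change stdP (torusPt (-3 + 6 * t) 1) = stdP (torusPt (-3 + 6 * t) (mob (-1 : Circle)))
      rw [Circle.coe_neg, Circle.coe_one, mob_neg_one]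
    -- The quarter circle from `i` to `1` at the left end is glued to the one from `topR 0` to `2`
    -- at the right end.
    have e2 : hh τ false Complex.I 1 = hh τ false (topR 0) 2 := by
      have := hh_glue τ false hg (u := Complex.I) (v := 1) (by simp) (by simp) (by simp) (by simp)
      rw [joinedTops_mem, map_one] at this
      convert this using 2
      · simp
      · simp
      · simp [topR]
      · simp; norm_num
    rw [e1, handleCurve_zero, hh_mul τ false I_mem_half hone htwo, e2, hh_inv,
      hh_mul τ false I_mem_half htwo (topR_mem hg)]

end TorusEmbedding

/-! ### Reducible representations -/

section Reducible

open Matrix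

variable {π : Type*} [Group π]

theorem finrank_eq_one_of_ne {W : Submodule ℂ (Fin 2 → ℂ)} (h1 : W ≠ ⊥) (h2 : W ≠ ⊤) :
    Module.finrank ℂ W = 1 := by
  have h3 : Module.finrank ℂ W < 2 := by
    have := Submodule.finrank_lt h2
    simpa using this
  have h4 : 0 < Module.finrank ℂ W := by
    rw [Module.finrank_pos_iff, Submodule.nontrivial_iff_ne_bot]
    exact h1
  omega

/-- A representation is reducible if and only if its image preserves a line. -/
theorem not_isIrreducible_iff (ρ : π →* SL2) :
    ¬ IsIrreducible ρ ↔ ∃ v : Fin 2 → ℂ, v ≠ 0 ∧ ∀ x, ρ x ∈ lineStab v := by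
  have hact : ∀ x v, (stdRep.comp ρ : Representation ℂ π (Fin 2 → ℂ)) x v = mat (ρ x) *ᵥ v :=
    fun _ _ => rfl
  constructor
  · intro h
    by_contra hno
    push Not at hno
    refine h ?_
    have hnt : Nontrivial (Subrepresentation (stdRep.comp ρ : Representation ℂ π (Fin 2 → ℂ))) := by
      refine ⟨⊥, ⊤, fun h => ?_⟩
      have h' : (⊥ : Submodule ℂ (Fin 2 → ℂ)) = ⊤ :=
        congrArg Subrepresentation.toSubmodule h
      exact bot_ne_top h'
    refine ⟨fun W => ?_⟩
    by_cases h1 : W.toSubmodule = ⊥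
    · left
      exact Subrepresentation.toSubmodule_injective h1
    by_cases h2 : W.toSubmodule = ⊤
    · right
      exact Subrepresentation.toSubmodule_injective h2
    exfalso
    obtain ⟨v, hv0, hv⟩ := finrank_eq_one_iff'.mp (finrank_eq_one_of_ne h1 h2)
    obtain ⟨x, hx⟩ := hno v (fun h => hv0 (Subtype.ext h))
    obtain ⟨c, hc⟩ := hv ⟨_, W.apply_mem_toSubmodule x v.2⟩
    exact hx ⟨c, (congrArg Subtype.val hc).symm⟩
  · rintro ⟨v, hv0, hv⟩ h
    let W : Subrepresentation (stdRep.comp ρ : Representation ℂ π (Fin 2 → ℂ)) :=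
      ⟨Submodule.span ℂ {v}, fun x w hw => by
        obtain ⟨c, rfl⟩ := Submodule.mem_span_singleton.mp hw
        obtain ⟨d, hd⟩ := hv x
        rw [hact, mulVec_smul, hd]
        exact Submodule.smul_mem _ _ (Submodule.smul_mem _ _ (Submodule.mem_span_singleton_self v))⟩
    have hW : W.toSubmodule = Submodule.span ℂ {v} := rfl
    rcases h.eq_bot_or_eq_top W with h | h
    · have := congrArg Subrepresentation.toSubmodule h
      rw [hW] at this
      exact hv0 (Submodule.span_singleton_eq_bot.mp this)
    · have := congrArg Subrepresentation.toSubmodule h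
      rw [hW] at this
      have h1 : Module.finrank ℂ (Submodule.span ℂ {v}) = Module.finrank ℂ (Fin 2 → ℂ) := by
        rw [this]
        exact finrank_top ℂ _
      rw [finrank_span_singleton hv0] at h1
      simp at h1

end Reducible

/-! ### Restrictions to subspaces in terms of paths -/

section Restrict

open CategoryTheory Topology

variable {S : Type*} [TopologicalSpace S] {x₀ : S} {G : Type*} [Group G]

theorem restrict_apply (ρ : FundamentalGroup S x₀ →* G) (A : Set S) (y : A) (γ : Path x₀ (y : S))
    (q : Path y y) : restrict ρ A y γ (pathClass q) =
      ρ (pathClass γ ≫ pathClass (q.map continuous_subtype_val) ≫ Groupoid.inv (pathClass γ)) := by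
  rfl

theorem isIrreducible_of_restrict {ρ : FundamentalGroup S x₀ →* SL2} {A : Set S} {y : A}
    {γ : Path x₀ (y : S)} (h : IsIrreducible (restrict ρ A y γ)) : IsIrreducible ρ := by
  by_contra hno
  obtain ⟨v, hv0, hv⟩ := (not_isIrreducible_iff ρ).mp hno
  exact (not_isIrreducible_iff (restrict ρ A y γ)).mpr ⟨v, hv0, fun x => hv _⟩ h

theorem restrict_hol (τ : ∀ y : S, Path x₀ y) (ρ : FundamentalGroup S x₀ →* G) (A : Set S) (y : A)
    (q : Path y y) : restrict ρ A y (τ y) (pathClass q.symm) =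
      ρ (hol τ (q.map continuous_subtype_val)) := rfl

end Restrict

/-! ### The standard surface -/

section Standard

open Topology Set

variable {g n : ℕ}

/-- The theorem for the standard surface. -/
theorem exists_isIrreducible_restrict (hg : 0 < g)
    {ρ : FundamentalGroup (StdSurface g n) (stdBase g n) →* SL2} (hρ : IsIrreducible ρ) :
    ∃ A : Set (StdSurface g n), IsOneHoledTorus A ∧
      ∃ (y : A) (γ : Path (stdBase g n) (y : StdSurface g n)), IsIrreducible (restrict ρ A y γ) := by
  obtain ⟨τ, hτ⟩ := exists_stdTether (g := g) (n := n)
  by_contra hno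
  push Not at hno
  obtain ⟨T, ⟨e⟩, y, p, q, c, hp, hq⟩ := exists_oneHoledTorus τ hg
  -- If `φ` is induced by `D`, a line for the restriction to `D '' T` becomes, after the change of
  -- base point by `φ c * μ y`, a line for the images of both curves of `T`.
  have hred : ∀ φ ∈ inducedAut τ, CommonLine (ρ (φ (leaf τ 0))) (ρ (φ (chainCurve τ 0))) := by
    rintro φ ⟨D, hD⟩
    obtain ⟨μ, -, hact⟩ := hD.exists_apply hτ
    have hline := hno (D '' T) ⟨(D.image T).symm.trans e⟩ (D.image T y) (τ _)
    obtain ⟨v, hv0, hv⟩ := (not_isIrreducible_iff _).mp hline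
    have key : ∀ r : Path y y, ρ (φ (c * hol τ (r.map continuous_subtype_val) * c⁻¹)) ∈
        lineStab ((mat (ρ (φ c * μ y))).mulVec v) := by
      intro r
      have h1 := hv (pathClass (r.map (D.image T).continuous).symm)
      rw [restrict_hol] at h1
      have h2 : hol τ ((r.map (D.image T).continuous).map continuous_subtype_val) =
          hol τ ((r.map continuous_subtype_val).map D.continuous) := hol_congr τ _ _ fun t => rfl
      rw [h2] at h1
      have h3 := mem_lineStab_conj (ρ (φ c * μ y)) _ h1
      rw [map_mul φ, map_mul φ, map_inv, hact]
      rw [← map_inv, ← map_mul, ← map_mul] at h3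
      convert h3 using 2
      group
    refine ⟨_, mat_mulVec_ne_zero (ρ (φ c * μ y)) hv0, ?_, ?_⟩
    · rw [← hp]
      exact key p
    · rw [show chainCurve τ 0 = handleCurve τ 0 from chainCurve_even τ 0, ← hq]
      exact key q
  obtain ⟨φ, -, v, hv0, h1, h2⟩ := (isTwistSystem τ hτ hg).exists_line ρ hred
  -- The elements that preserve the line under `ρ ∘ φ` form a subgroup that contains the generating
  -- curves, so they form the whole group. Surjectivity of `φ` then removes it.
  have hK : ContainsCurves τ ((lineStab v).comap (ρ.comp φ.toMonoidHom)) := by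
    refine ⟨h1, fun j hj => ?_, fun j hj => ?_⟩
    · have := h2 (2 * j) (by omega)
      rwa [chainCurve_even] at this
    · have := h2 (2 * j + 1) (by omega)
      rwa [chainCurve_odd] at this
  have htop := hK.eq_top hτ hg
  refine (not_isIrreducible_iff ρ).mpr ⟨v, hv0, fun x => ?_⟩ hρ
  obtain ⟨x, rfl⟩ := φ.surjective x
  have : x ∈ (lineStab v).comap (ρ.comp φ.toMonoidHom) := htop ▸ Subgroup.mem_top x
  exact this

end Standard

/-! ### Transport along a homeomorphism -/

section Transport

open CategoryTheory Topology

variable {S Y : Type*} [TopologicalSpace S] [TopologicalSpace Y] {x₀ : S} {y₀ : Y}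

/-- The pullback of a representation along a homeomorphism. -/
def transportRep (e : S ≃ₜ Y) (δ : Path x₀ (e.symm y₀)) (ρ : FundamentalGroup S x₀ →* SL2) :
    FundamentalGroup Y y₀ →* SL2 :=
  (ρ.comp (FundamentalGroup.fundamentalGroupMulEquivOfPath δ).symm.toMonoidHom).comp
    (FundamentalGroup.map (e.symm : C(Y, S)) y₀)

theorem transportRep_apply (e : S ≃ₜ Y) (δ : Path x₀ (e.symm y₀))
    (ρ : FundamentalGroup S x₀ →* SL2) (q : Path y₀ y₀) : transportRep e δ ρ (pathClass q) =
      ρ (pathClass δ ≫ pathClass (q.map e.symm.continuous) ≫ Groupoid.inv (pathClass δ)) :=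
  rfl

theorem exists_pathClass (x : FundamentalGroup S x₀) : ∃ p : Path x₀ x₀, pathClass p = x :=
  Path.Homotopic.Quotient.mk_surjective x

theorem isIrreducible_transportRep (e : S ≃ₜ Y) (δ : Path x₀ (e.symm y₀))
    {ρ : FundamentalGroup S x₀ →* SL2} (hρ : IsIrreducible ρ) :
    IsIrreducible (transportRep e δ ρ) := by
  by_contra hno
  obtain ⟨v, hv0, hv⟩ := (not_isIrreducible_iff _).mp hno
  refine (not_isIrreducible_iff ρ).mpr ⟨v, hv0, fun x => ?_⟩ hρ
  obtain ⟨p, rfl⟩ := exists_pathClass x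
  have he : e (e.symm y₀) = y₀ := e.apply_symm_apply y₀
  have := hv (pathClass (((δ.symm.trans (p.trans δ)).map e.continuous).cast he.symm he.symm))
  rw [transportRep_apply] at this
  have h1 : (((δ.symm.trans (p.trans δ)).map e.continuous).cast he.symm he.symm).map
      e.symm.continuous = δ.symm.trans (p.trans δ) := by
    ext t
    exact e.symm_apply_apply _
  rw [h1] at this
  convert this using 2
  simp [pathClass_trans, pathClass_symm]

theorem isIrreducible_restrict_transport (e : S ≃ₜ Y) (δ : Path x₀ (e.symm y₀))
    {ρ : FundamentalGroup S x₀ →* SL2} {A : Set Y} {y : A} {γ : Path y₀ (y : Y)}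
    (h : IsIrreducible (restrict (transportRep e δ ρ) A y γ)) :
    IsIrreducible (restrict ρ (e.symm '' A) (e.symm.image A y)
      (δ.trans (γ.map e.symm.continuous))) := by
  by_contra hno
  obtain ⟨v, hv0, hv⟩ := (not_isIrreducible_iff _).mp hno
  refine (not_isIrreducible_iff _).mpr ⟨v, hv0, fun x => ?_⟩ h
  obtain ⟨q, rfl⟩ := exists_pathClass x
  have := hv (pathClass (q.map (e.symm.image A).continuous))
  rw [restrict_apply] at this ⊢
  change ρ ((pathClass δ ≫ pathClass (γ.map e.symm.continuous)) ≫
    pathClass ((q.map continuous_subtype_val).map e.symm.continuous) ≫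
    Groupoid.inv (pathClass δ ≫ pathClass (γ.map e.symm.continuous))) ∈ lineStab v at this
  rw [← pathClass_symm, ← pathClass_trans, ← pathClass_trans, transportRep_apply, Path.map_trans,
    Path.map_trans, ← Path.map_symm]
  change ρ (pathClass δ ≫ (pathClass (γ.map e.symm.continuous) ≫
    pathClass ((q.map continuous_subtype_val).map e.symm.continuous) ≫
    Groupoid.inv (pathClass (γ.map e.symm.continuous))) ≫ Groupoid.inv (pathClass δ)) ∈ lineStab v
  convert this using 2
  simp

end Transport

end SurfaceRep

end

/-! ### The general case -/

theorem proposition5p2 (g n : ℕ) (hg : 1 ≤ g) {S : Type*} [TopologicalSpace S]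
    (hS : SurfaceRep.IsSurface g n S) (x₀ : S)
    (ρ : FundamentalGroup S x₀ →* Matrix.SpecialLinearGroup (Fin 2) ℂ) :
    SurfaceRep.IsIrreducible ρ ↔
      ∃ A : Set S, SurfaceRep.IsOneHoledTorus A ∧
        ∃ (y : A) (γ : Path x₀ (y : S)), SurfaceRep.IsIrreducible (SurfaceRep.restrict ρ A y γ) := by
  constructor
  · intro h
    obtain ⟨e⟩ := hS.nonempty_homeomorph
    have : PathConnectedSpace S := e.symm.surjective.pathConnectedSpace e.symm.continuous
    let δ : Path x₀ (e.symm (SurfaceRep.stdBase g n)) := PathConnectedSpace.somePath _ _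
    obtain ⟨A, ⟨f⟩, y, γ, hA⟩ := SurfaceRep.exists_isIrreducible_restrict hg
      (SurfaceRep.isIrreducible_transportRep e δ h)
    exact ⟨e.symm '' A, ⟨(e.symm.image A).symm.trans f⟩, e.symm.image A y, _,
      SurfaceRep.isIrreducible_restrict_transport e δ hA⟩
  · rintro ⟨A, -, y, γ, h⟩
    exact SurfaceRep.isIrreducible_of_restrict h
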